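/- **Setting.** Let $n,k\ge 1$, $g\ge k$, $0<\delta<1$, $\epsilon>0$, $I=[-1,1]$, $S^1=\mathbb R/\mathbb Z$. *Liouville domain.* $Y$ is a closed $(2n-1)$-manifold and $\alpha=\{\alpha_r\}$ a smooth family of 1-forms on $Y$ (so $\alpha(\partial_r)=0$) such that $d\alpha$ is symplectic on $Y\times I$ and $\alpha_r=e^{\pm r-1}\alpha_{\pm}$, $\alpha_\pm:=\alpha_{\pm1}$, for $\pm r>1-\delta$. Put $\xi_\pm=\ker\alpha_\pm$, and let $R_\pm$ be the Reeb field of $\alpha_\pm$. $J_0$ is a smooth $d\alpha$-compatible almost complex structure on $Y\times I$ which for $\pm r>1-\delta$ preserves $\xi_\pm$, restricts to an $r$-independent $J^\pm$ on $\xi_\pm$, and maps $\pm\partial_r$ to $R_\pm$ times a positive function of $r$. *Surface.* $S$ is the closed surface obtained from connected surfaces $\Sigma_+$ of genus $g-k+1$ and $\Sigma_-$ of genus $0$, each with $k$ boundary circles, by joining them along $k$ cylinders $I\times S^1$. Collars of $\partial\Sigma_\pm$ have coordinates $(t,\theta)\in(-\delta,0]\times S^1$; $\mathcal N(\partial\Sigma_\pm)$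 is their union. $\lambda$ is a Liouville form on $\Sigma_\pm$ with $\lambda=e^td\theta$ on the collars, and $j$ is a $d\lambda$-compatible complex structure on $\Sigma_\pm\setminus\mathcal N(\partial\Sigma_\pm)$. The $i$-th cylinder together with its two collars has coordinates $(\tau,\theta)\in(-1-\delta,1+\delta)\times S^1$. Fix smooth functions $r=F(\tau)$, $t=G(\tau)$ with $(F,G)=(\tau,0)$ for $|\tau|\le1-\delta/3$, $(F,G)=(\pm1,1\mp\tau)$ for $\pm\tau\ge1+\delta/3$, $F'>0$ for $|\tau|<1+\delta/3$, and $\pm G'<0$ for $\pm\tau>1-\delta/3$. On these cylinders put $\lambda=e^{G}d\theta$ (a global smooth 1-form on $S$), and on the rest of $\Sigma_\pm$ put $r=\pm1$. The spine is the region $|\tau|\le1-\delta$, and the corners are the regions $1-\delta<\pm\tau<1+\delta$. *Functions.* $\sigma:\mathbb R\to\mathbb R$ is smooth, equal to $\epsilon$ on $[-1+\delta,1-\delta]$ and to a constant $K$ for $|r|\ge1$, with $\pm\sigma'>0$ for $1-\delta<\pm r<1$. $\beta:\mathbb R\to[0,1]$ is smooth, nondecreasing, $0$ for $t\le-8\delta/9$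 and $1$ for $t\ge-7\delta/9$. $H:Y\times I\to[0,\infty)$ is smooth with $H=0$ at $r=\pm1$. In a neighbourhood of $\{1-\delta\le|r|\le1\}$ it depends only on $r$, with $\pm\partial_rH\le0$ for $\pm r>0$ there. Moreover, either $H$ is Morse on $Y\times(-1,1)$, or $H$ depends only on $r$ and is Morse as a function of $r\in(-1,1)$ (Morse–Bott case). $\mathrm{crit}(H)$ denotes the critical points with $|r|<1$. *Stable Hamiltonian structure.* On $M=Y\times S$ let $$\Lambda=e^{\epsilon H}\big(\sigma(r)\alpha_r+\beta(t)\lambda\big),\qquad \Omega=d\big(e^{\epsilon H}(\sigma(r)\alpha_r+\lambda)\big),$$ where $\beta(t)$ means $0$ on $\Sigma_\pm\setminus\mathcal N(\partial\Sigma_\pm)$, and let $R$ be the Reeb field: $\Lambda(R)=1$, $i_R\Omega=0$. Let $e_0>0$ be such that $\omega^\varphi=d(\varphi(a)\Lambda)+\Omega$ is symplectic on $W=\mathbb R\times M$ for every $\varphi\in\mathcal P=\{\varphi\in C^\infty(\mathbb R,(-e_0,e_0)):\varphi'>0\}$. *Almost complex structure.* Let $J$ be a smooth $\mathbb R$-invariant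 almost complex structure on $W$ with $J\partial_a=R$ and with the following form on $\ker\Lambda$. Over the spine it is the lift of $J_0$ to $\ker\Lambda$, which projects isomorphically to $T(Y\times I)$. Over the corners it is $J^\pm$ on $\xi_\pm$ and $J\partial_\tau=h(\tau)v_2$ with $h>0$, where $v_2\in\ker\Lambda\cap\langle R_\pm,\partial_\theta\rangle$ and $\Omega(\partial_\tau,v_2)=1$. Over $Y\times(\Sigma_\pm\setminus\mathcal N(\partial\Sigma_\pm))$ it is $J^\pm\oplus j$ on $\xi_\pm\oplus T\Sigma_\pm$. For $p\in\mathrm{crit}(H)$ and each of the $k$ components of the spine, $\gamma_p=\{p\}\times S^1$ is a closed orbit of $R$ of period $e^{\epsilon H(p)}$. A $J$-holomorphic curve is a holomorphic map to $(W,J)$ from a connected Riemann surface with finitely many punctures, each having a half-cylinder neighbourhood with coordinates $(s,t)\in(0,\infty)\times S^1$ (positive) or $(-\infty,0)\times S^1$ (negative), on which the map is $C^1$-asymptotic, up to a constant shift in $a$, to the cylinder $(Ts,\gamma(Tt))$ over a $T$-periodic orbit $\gamma$ of $R$. **Theorem.** $W$ admits a finite energy foliation: a partition into leaves of a smooth 2-dimensional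 foliation, invariant under translations in $\mathbb R$, such that each leaf is the image of an injectively immersed simple (not multiply covered) $J$-holomorphic curve $u$, with $\int u^*\Omega$ and $\sup_{\varphi\in\mathcal P}\int u^*\omega^\varphi$ bounded uniformly over all leaves. Its leaves are of the following three types, and all curves of these types occur. 1. *Trivial cylinders* $C_p$, for $p\in\mathrm{crit}(H)$ and each component of the spine: $C_p(s,t)=(e^{\epsilon H(p)}s,p,t)$, $(s,t)\in\mathbb R\times S^1$. 2. *Flow-line cylinders* $u_\gamma^{a_0}$, for each component of the spine, each $a_0\in\mathbb R$, and each non-constant gradient line $\gamma:\mathbb R\to Y\times[-1+\delta,1-\delta]$: $u(s,t)=(a(s),\gamma(s),\theta(s)+t)$, $(s,t)\in\mathbb R\times S^1$, where $a$ is proper and $$\dot\gamma=\nabla H(\gamma),\quad\dot a=e^{\epsilon H(\gamma)},\ a(0)=a_0,\quad\dot\theta=-\epsilon\,\alpha(\nabla H(\gamma)),\ \theta(0)=0,$$ the gradient being taken for the metric $d\alpha(\cdot,J_0\cdot)$. The limits $p_\pm=\lim_{s\to\pm\infty}\gamma(s)$ exist and lie in $\mathrm{crit}(H)$, and the positive/negative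 puncture is asymptotic to $\gamma_{p_\pm}$. 3. *Page-like curves* $u^\pm_{y,a}$, for each sign, $y\in Y$ and $a\in\mathbb R$. They have exactly $k$ punctures, all positive, exactly one in each component of the spine; the positive curves have genus $g-k+1$ and the negative ones genus $0$. Away from $k$ cylindrical ends the image of $u^\pm_{y,a}$ is $\{a\}\times\{y\}\times(\Sigma_\pm\setminus\mathcal N(\partial\Sigma_\pm))$. The $i$-th end is $(s,t)\mapsto(b(s),y(s),\tau(s),\theta(s)+t)$, $s>0$, in the $i$-th cylinder, with $b(s)\to a$ and $\tau(s)\to\pm(1+\delta)$ as $s\to0$. While $\pm\tau(s)>1-\delta$ one has $y(s)=y$, $\theta(s)=0$, $\dot b=\beta(G)e^{G+\epsilon H}$ and $\dot\tau=\partial_\tau(e^{G+\epsilon H})/h$, where $G=G(\tau)$, $H=H(y,F(\tau))$, $h=h(\tau)$. For large $s$ it lies in the spine, where $(b,(y,\tau),\theta)$ satisfies the differential equations of (2) for $(a,\gamma,\theta)$. As $s\to\infty$, $(y(s),\tau(s))$ converges to some $p_i\in\mathrm{crit}(H)$, and the puncture is asymptotic to $\gamma_{p_i}$ in the $i$-th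 component. -/

import Mathlib

open scoped Manifold ContDiff Topology ENNReal NNReal
open Set Filter

noncomputable section

namespace SpinalFoliation

/-! ## Forms, endomorphism fields

For a manifold `M` with model `I` on the vector space `E`, `TangentSpace I x` is by definition `E`
(through the preferred chart at `x`).  Hence 1-forms on `M` are functions `M → E →L[ℝ] ℝ`, and
fields of endomorphisms of `TM` are functions `M → E →L[ℝ] E`. -/

section General

variable {E : Type*} [NormedAddCommGroup E] [NormedSpace ℝ E]
  {H : Type*} [TopologicalSpace H] (I : ModelWithCorners ℝ E H)
  {M : Type*} [TopologicalSpace M] [ChartedSpace H M] [IsManifold I ∞ M]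

/-- The coordinate expression of a 1-form in the preferred chart at `x`. -/
def formInChart (α : M → E →L[ℝ] ℝ) (x : M) (z : E) : E →L[ℝ] ℝ :=
  (α ((extChartAt I x).symm z)).comp (mfderiv 𝓘(ℝ, E) I (extChartAt I x).symm z)

/-- The exterior derivative of a 1-form on a manifold without boundary, computed at `x` in the
preferred chart at `x`: `dα(v,w) = (D_v α)(w) - (D_w α)(v)`. -/
def dForm (α : M → E →L[ℝ] ℝ) (x : M) : E →L[ℝ] E →L[ℝ] ℝ :=
  fderiv ℝ (formInChart I α x) (extChartAt I x x)
    - (fderiv ℝ (formInChart I α x) (extChartAt I x x)).flip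

/-- A 1-form is smooth if it is smooth as a function on the tangent bundle. -/
def SmoothForm (α : M → E →L[ℝ] ℝ) : Prop :=
  ContMDiff I.tangent 𝓘(ℝ, ℝ) ∞ (fun p : TangentBundle I M => α p.1 p.2)

/-- A field of endomorphisms is smooth if it is smooth as a self-map of the tangent bundle. -/
def SmoothEnd (J : M → E →L[ℝ] E) : Prop :=
  ContMDiff I.tangent I.tangent ∞
    (fun p : TangentBundle I M => (⟨p.1, J p.1 p.2⟩ : TangentBundle I M))

/-- A bilinear form is non-degenerate. -/
def Nondeg (B : E →L[ℝ] E →L[ℝ] ℝ) : Prop := ∀ v, v ≠ 0 → ∃ w, B v w ≠ 0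

/-- `p` is a critical point of `F`. -/
def IsCrit (F : M → ℝ) (p : M) : Prop := ∀ v : E, mfderiv I 𝓘(ℝ, ℝ) F p v = (0 : ℝ)

/-- The Hessian of `F` in the preferred chart at `p` (intrinsic when `p` is a critical point). -/
def hessianInChart (F : M → ℝ) (p : M) : E →L[ℝ] E →L[ℝ] ℝ :=
  fderiv ℝ (fderiv ℝ (F ∘ (extChartAt I p).symm)) (extChartAt I p p)

/-! ## Topology of surfaces -/

/-- The path-connected surface `X` of finite type with `k ≥ 1` ends (punctures, or boundary
circles) has genus `h`: its first Betti number, the rank of the abelianised fundamental group, is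
`2 h + k - 1`. -/
def HasGenus (X : Type) [TopologicalSpace X] (k h : ℕ) : Prop :=
  PathConnectedSpace X ∧
    ∀ x : X, Module.rank ℤ (Additive (Abelianization (FundamentalGroup X x))) + 1
      = ((2 * h + k : ℕ) : Cardinal)

/-! ## Punctured holomorphic curves in `ℝ × M`

An `ℝ`-invariant almost complex structure on `ℝ × M` is given by `J : M → End (ℝ ⊕ TM)`.
Its Reeb vector field is `R = J ∂_a`. -/

/-- `γ : ℝ → M` is a `T`-periodic orbit (not necessarily of minimal period `T`) of the vector field
`R = J ∂_a`. -/
def IsPeriodicOrbit (J : M → (ℝ × E) →L[ℝ] (ℝ × E)) (T : ℝ) (γ : ℝ → M) : Prop :=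
  0 < T ∧ MDifferentiable 𝓘(ℝ, ℝ) I γ ∧
    (∀ x, mfderiv 𝓘(ℝ, ℝ) I γ x (1 : ℝ) = (J (γ x) (1, 0)).2) ∧ ∀ x, γ (x + T) = γ x

/-- The open half-cylinders `(r,∞) × S¹` (positive) and `(-∞,-r) × S¹` (negative), seen in the
universal cover `ℝ × ℝ`, with `S¹ = ℝ/ℤ`. -/
def halfCyl (pos : Bool) (r : ℝ) : Set (ℝ × ℝ) := {p | if pos then r < p.1 else p.1 < -r}

/-- The filter `s → +∞` or `s → -∞` . -/
def endFilter (pos : Bool) : Filter ℝ := if pos then atTop else atBot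

/-- A map `v = (a, m)` from a half-cylinder to `ℝ × M` (written on the universal cover) is
asymptotically cylindrical over the `T`-periodic orbit `γ`: as `s → ±∞`, uniformly in `t`,
`a(s,t) - T s` converges to a constant, `m(s,t) → γ(Tt)`, and the first derivatives converge to
those of `(T s, γ(T t))`. -/
def AsymptoticTo (J : M → (ℝ × E) →L[ℝ] (ℝ × E)) (pos : Bool) (v : ℝ × ℝ → ℝ × M)
    (T : ℝ) (γ : ℝ → M) : Prop :=
  (∃ c : ℝ, ∀ t₀ : ℝ,
    Tendsto (fun p : ℝ × ℝ => (v p).1 - T * p.1) (endFilter pos ×ˢ 𝓝 t₀) (𝓝 c)) ∧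
  (∀ t₀ : ℝ, Tendsto (fun p : ℝ × ℝ => fderiv ℝ (fun q => (v q).1) p (1, 0))
    (endFilter pos ×ˢ 𝓝 t₀) (𝓝 T)) ∧
  (∀ t₀ : ℝ, Tendsto (fun p : ℝ × ℝ => fderiv ℝ (fun q => (v q).1) p (0, 1))
    (endFilter pos ×ˢ 𝓝 t₀) (𝓝 0)) ∧
  (∀ t₀ : ℝ, Tendsto
    (fun p : ℝ × ℝ => (⟨(v p).2,
      mfderiv 𝓘(ℝ, ℝ × ℝ) I (fun q => (v q).2) p ((1, 0) : ℝ × ℝ)⟩ : TangentBundle I M))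
    (endFilter pos ×ˢ 𝓝 t₀) (𝓝 ⟨γ (T * t₀), (0 : E)⟩)) ∧
  (∀ t₀ : ℝ, Tendsto
    (fun p : ℝ × ℝ => (⟨(v p).2,
      mfderiv 𝓘(ℝ, ℝ × ℝ) I (fun q => (v q).2) p ((0, 1) : ℝ × ℝ)⟩ : TangentBundle I M))
    (endFilter pos ×ˢ 𝓝 t₀) (𝓝 ⟨γ (T * t₀), T • (J (γ (T * t₀)) (1, 0)).2⟩))

/-- A map `P : ℝ × ℝ → S`, 1-periodic in the second variable, which restricts on the invariant
open set `A` to a smooth embedding of the quotient `A / ℤ` as an open subset of the surface `S`. -/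
structure IsCylEmbedding {S : Type} [TopologicalSpace S]
    [ChartedSpace (EuclideanSpace ℝ (Fin 2)) S] (P : ℝ × ℝ → S) (A : Set (ℝ × ℝ)) : Prop where
  smooth : ContMDiffOn 𝓘(ℝ, ℝ × ℝ) (𝓡 2) ∞ P A
  periodic : ∀ s t, P (s, t + 1) = P (s, t)
  immersion : ∀ p ∈ A, Function.Injective (mfderiv 𝓘(ℝ, ℝ × ℝ) (𝓡 2) P p)
  inj : ∀ p ∈ A, ∀ q ∈ A, P p = P q → p.1 = q.1 ∧ ∃ m : ℤ, q.2 = p.2 + m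

/-- `P` is holomorphic on `A` for the standard structure `∂_s ↦ ∂_t` and the structure `j`. -/
def IsHolCyl {S : Type} [TopologicalSpace S] [ChartedSpace (EuclideanSpace ℝ (Fin 2)) S]
    (j : S → EuclideanSpace ℝ (Fin 2) →L[ℝ] EuclideanSpace ℝ (Fin 2))
    (P : ℝ × ℝ → S) (A : Set (ℝ × ℝ)) : Prop :=
  ∀ p ∈ A, j (P p) (mfderiv 𝓘(ℝ, ℝ × ℝ) (𝓡 2) P p ((1, 0) : ℝ × ℝ))
    = mfderiv 𝓘(ℝ, ℝ × ℝ) (𝓡 2) P p ((0, 1) : ℝ × ℝ)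

/-- A punctured, asymptotically cylindrical `J`-holomorphic curve in `ℝ × M`.  The domain is a
connected Riemann surface `(S, j)` which is the union of a compact set and finitely many disjoint
half-cylinders, biholomorphically embedded by the maps `φ i` (punctured neighbourhoods of the
punctures). -/
structure PuncturedCurve (J : M → (ℝ × E) →L[ℝ] (ℝ × E)) where
  S : Type
  [top : TopologicalSpace S]
  [charted : ChartedSpace (EuclideanSpace ℝ (Fin 2)) S]
  [mfd : IsManifold (𝓡 2) ∞ S]
  [t2 : T2Space S]
  [conn : ConnectedSpace S]
  j : S → EuclideanSpace ℝ (Fin 2) →L[ℝ] EuclideanSpace ℝ (Fin 2)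
  j_smooth : SmoothEnd (𝓡 2) j
  j_sq : ∀ z v, j z (j z v) = -v
  /-- the index set of the punctures, and their signs -/
  ι : Type
  fin : Finite ι
  pos : ι → Bool
  φ : ι → ℝ × ℝ → S
  φ_emb : ∀ i, IsCylEmbedding (φ i) (halfCyl (pos i) 0)
  φ_hol : ∀ i, IsHolCyl j (φ i) (halfCyl (pos i) 0)
  φ_disj : ∀ i i', i ≠ i' → Disjoint (φ i '' halfCyl (pos i) 0) (φ i' '' halfCyl (pos i') 0)
  compact : IsCompact (⋃ i, φ i '' halfCyl (pos i) 1)ᶜ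
  u : S → ℝ × M
  u_smooth : ContMDiff (𝓡 2) (𝓘(ℝ, ℝ).prod I) ∞ u
  u_hol : ∀ (z : S) (v : EuclideanSpace ℝ (Fin 2)),
    mfderiv (𝓡 2) (𝓘(ℝ, ℝ).prod I) u z (j z v)
      = J (u z).2 (mfderiv (𝓡 2) (𝓘(ℝ, ℝ).prod I) u z v)
  asymptotic : ∀ i, ∃ (T : ℝ) (γ : ℝ → M), IsPeriodicOrbit I J T γ ∧
    AsymptoticTo I J (pos i) (fun p => u (φ i p)) T γ

attribute [instance] PuncturedCurve.top PuncturedCurve.charted PuncturedCurve.mfd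
  PuncturedCurve.t2 PuncturedCurve.conn

variable {I} {J : M → (ℝ × E) →L[ℝ] (ℝ × E)}

/-- The curve is simple: it is not a multiple cover, i.e. whenever `u = u' ∘ f` for a holomorphic
map `f` of Riemann surfaces and a punctured `J`-holomorphic curve `u'`, the map `f` is injective. -/
def PuncturedCurve.IsSimple (C : PuncturedCurve I J) : Prop :=
  ∀ (C' : PuncturedCurve I J) (f : C.S → C'.S), ContMDiff (𝓡 2) (𝓡 2) ∞ f →
    (∀ (z : C.S) (v : EuclideanSpace ℝ (Fin 2)),
      mfderiv (𝓡 2) (𝓡 2) f z (C.j z v) = C'.j (f z) (mfderiv (𝓡 2) (𝓡 2) f z v)) →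
    (∀ z, C.u z = C'.u (f z)) → Function.Injective f

/-- The curve is a simple injective immersion with image `L`. -/
def PuncturedCurve.Parametrizes (C : PuncturedCurve I J) (L : Set (ℝ × M)) : Prop :=
  C.IsSimple ∧ Function.Injective C.u ∧
    (∀ z, Function.Injective (mfderiv (𝓡 2) (𝓘(ℝ, ℝ).prod I) C.u z)) ∧ range C.u = L

/-- The puncture `i` of the curve is asymptotic to the `T`-periodic orbit `γ`. -/
def PuncturedCurve.AsymptoticAt (C : PuncturedCurve I J) (i : C.ι) (T : ℝ) (γ : ℝ → M) : Prop :=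
  IsPeriodicOrbit I J T γ ∧ AsymptoticTo I J (C.pos i) (fun p => C.u (C.φ i p)) T γ

/-- The domain of the curve is (biholomorphic to) the cylinder `ℝ × S¹`, on which the curve is the
map `v` (written on the universal cover); the two punctures are the positive one at `s = +∞` and the
negative one at `s = -∞`, asymptotic to `(Tp, γp)` and `(Tm, γm)`. -/
def PuncturedCurve.IsCylinder (C : PuncturedCurve I J) (v : ℝ × ℝ → ℝ × M)
    (Tm : ℝ) (γm : ℝ → M) (Tp : ℝ) (γp : ℝ → M) : Prop :=
  ∃ (P : ℝ × ℝ → C.S) (ip im : C.ι),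
    IsCylEmbedding P univ ∧ IsHolCyl C.j P univ ∧ Function.Surjective P ∧
    (∀ p, C.u (P p) = v p) ∧
    (∀ i, i = ip ∨ i = im) ∧ C.pos ip = true ∧ C.pos im = false ∧
    (∀ p ∈ halfCyl true 0, C.φ ip p = P p) ∧ (∀ p ∈ halfCyl false 0, C.φ im p = P p) ∧
    C.AsymptoticAt ip Tp γp ∧ C.AsymptoticAt im Tm γm

variable (I)

/-- The set `𝒫` of smooth functions `ℝ → (-e, e)` with positive derivative. -/
def IsProfile (e : ℝ) (ph : ℝ → ℝ) : Prop :=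
  ContDiff ℝ ∞ ph ∧ (∀ a, ph a ∈ Ioo (-e) e) ∧ ∀ a, 0 < deriv ph a

/-- The 2-form `ω^φ = d(φ(a) Λ) + Ω = φ'(a) da ∧ Λ + φ(a) dΛ + Ω` on `ℝ × M`. -/
def sympForm (Λ : M → E →L[ℝ] ℝ) (Ω : M → E →L[ℝ] E →L[ℝ] ℝ) (ph : ℝ → ℝ)
    (w : ℝ × M) (v v' : ℝ × E) : ℝ :=
  deriv ph w.1 * (v.1 * Λ w.2 v'.2 - v'.1 * Λ w.2 v.2)
    + ph w.1 * dForm I Λ w.2 v.2 v'.2 + Ω w.2 v.2 v'.2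

/-- `ω^φ` is symplectic, i.e. non-degenerate (it is closed if `Ω` is), for all `φ ∈ 𝒫`. -/
def IsSymplectization (Λ : M → E →L[ℝ] ℝ) (Ω : M → E →L[ℝ] E →L[ℝ] ℝ) (e : ℝ) : Prop :=
  ∀ ph, IsProfile e ph → ∀ (w : ℝ × M) (v : ℝ × E), v ≠ 0 →
    ∃ v', sympForm I Λ Ω ph w v v' ≠ 0

variable {I}

/-- The integral `∫ |u^* om|` over the domain of a curve, as an outer measure: the infimum, over all
countable covers of the domain by images `ψ m (A m)` of measurable subsets `A m` of the plane under
`C¹` maps `ψ m`, of the sum of the integrals of `|om(∂₁(u ∘ ψ m), ∂₂(u ∘ ψ m))|`. For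
`J`-holomorphic `u` and `om` taming `J` the integrand `u^* om` is non-negative, and this is
`∫ u^* om`. -/
def PuncturedCurve.energy (C : PuncturedCurve I J) (om : ℝ × M → ℝ × E → ℝ × E → ℝ) : ℝ≥0∞ :=
  ⨅ (ψ : ℕ → ℝ × ℝ → C.S) (A : ℕ → Set (ℝ × ℝ))
    (_ : (∀ m, MeasurableSet (A m)) ∧
      (∀ m, ∃ O : Set (ℝ × ℝ), IsOpen O ∧ A m ⊆ O ∧
        ContMDiffOn 𝓘(ℝ, ℝ × ℝ) (𝓡 2) 1 (ψ m) O) ∧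
      (⋃ m, ψ m '' A m) = univ),
    ∑' m, ∫⁻ p in A m, ENNReal.ofReal
      |om (C.u (ψ m p))
        (mfderiv 𝓘(ℝ, ℝ × ℝ) (𝓘(ℝ, ℝ).prod I) (fun q => C.u (ψ m q)) p ((1, 0) : ℝ × ℝ))
        (mfderiv 𝓘(ℝ, ℝ × ℝ) (𝓘(ℝ, ℝ).prod I) (fun q => C.u (ψ m q)) p ((0, 1) : ℝ × ℝ))|

/-- A finite energy foliation of the symplectization `(ℝ × M, ω^φ)`, `φ ∈ 𝒫`: a partition of
`ℝ × M` into the images of simple, injectively immersed punctured `J`-holomorphic curves, which are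
the leaves of a smooth foliation (their tangent planes form a smooth plane field), which is
invariant under the `ℝ`-translations, and whose energies `∫ u^* Ω` and `sup_φ ∫ u^* ω^φ` have a common
finite bound. -/
structure IsFiniteEnergyFoliation (Λ : M → E →L[ℝ] ℝ) (Ω : M → E →L[ℝ] E →L[ℝ] ℝ) (e : ℝ)
    (J : M → (ℝ × E) →L[ℝ] (ℝ × E)) (leaves : Set (Set (ℝ × M))) : Prop where
  partition : Setoid.IsPartition leaves
  translation : ∀ L ∈ leaves, ∀ c : ℝ, (fun w : ℝ × M => (w.1 + c, w.2)) '' L ∈ leaves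
  curves : ∃ (D : ℝ × M → Submodule ℝ (ℝ × E)) (B : ℝ≥0),
    (∀ w : ℝ × M, ∃ (O : Set (ℝ × M)) (X : ℝ × M → ℝ × E), IsOpen O ∧ w ∈ O ∧
      ContMDiffOn (𝓘(ℝ, ℝ).prod I) (𝓘(ℝ, ℝ).prod I).tangent ∞
        (fun q => (⟨q, X q⟩ : TangentBundle (𝓘(ℝ, ℝ).prod I) (ℝ × M))) O ∧
      ∀ q ∈ O, X q ≠ 0 ∧ D q = Submodule.span ℝ {X q, J q.2 (X q)}) ∧
    ∀ L ∈ leaves, ∃ C : PuncturedCurve I J, C.Parametrizes L ∧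
      (∀ (z : C.S) (v : EuclideanSpace ℝ (Fin 2)),
        mfderiv (𝓡 2) (𝓘(ℝ, ℝ).prod I) C.u z v ∈ D (C.u z)) ∧
      C.energy (fun w v v' => Ω w.2 v.2 v'.2) ≤ B ∧
      ∀ ph, IsProfile e ph → C.energy (sympForm I Λ Ω ph) ≤ B

end General

/-! ## The model manifold `M = Y × S` and its stable Hamiltonian structure

The boolean `true` stands for the sign `+` and `false` for the sign `-`. -/

/-- The sign `±1`. -/
def sgn (e : Bool) : ℝ := if e then 1 else -1

/-- The model space of the closed `(2n-1)`-manifold `Y`. -/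
abbrev EY (n : ℕ) := EuclideanSpace ℝ (Fin (2 * n - 1))

/-- The model space of surfaces. -/
abbrev ES := EuclideanSpace ℝ (Fin 2)

/-- The model of `Y × ℝ`. -/
abbrev IYR (n : ℕ) := (𝓡 (2 * n - 1)).prod 𝓘(ℝ, ℝ)

/-- The model of `Y × S`. -/
abbrev IYS (n : ℕ) := (𝓡 (2 * n - 1)).prod (𝓡 2)

section Model

variable {n : ℕ} {Y S : Type}

/-- The 1-form `α = {α_r}` on `Y × ℝ`, with `α(∂_r) = 0`, of a family of 1-forms on `Y`. -/
def familyForm (al : ℝ → Y → EY n →L[ℝ] ℝ) (p : Y × ℝ) : (EY n × ℝ) →L[ℝ] ℝ :=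
  (al p.2 p.1).comp (ContinuousLinearMap.fst ℝ (EY n) ℝ)

/-- The cylinder `(-1-δ, 1+δ) × S¹`, in the universal cover. -/
def longCyl (δ : ℝ) : Set (ℝ × ℝ) := {p | |p.1| < 1 + δ}

variable [TopologicalSpace Y] [ChartedSpace (EY n) Y] [IsManifold (𝓡 (2 * n - 1)) ∞ Y]
  [TopologicalSpace S] [ChartedSpace ES S] [IsManifold (𝓡 2) ∞ S]

variable (n) in
/-- The function `F` on `Y × (-1,1)` is Morse. -/
def IsMorse (F : Y × ℝ → ℝ) : Prop :=
  ∀ p : Y × ℝ, |p.2| < 1 → IsCrit (IYR n) F p → Nondeg (hessianInChart (IYR n) F p)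

/-- The function `F` on `Y × [-1,1]` depends only on `r`, and is Morse as a function of
`r ∈ (-1,1)`. -/
def IsMorseBott (F : Y × ℝ → ℝ) : Prop :=
  ∃ f : ℝ → ℝ, ContDiff ℝ ∞ f ∧ (∀ y r, |r| ≤ 1 → F (y, r) = f r) ∧
    ∀ r, |r| < 1 → deriv f r = 0 → deriv (deriv f) r ≠ 0

variable (n Y S) in
/-- The data of the construction.

* `(Y × [-1,1], dα)` is a Liouville domain, `α = {α_r}` (extended to `Y × ℝ`), with cylindrical ends
  `α = e^{±r-1} α_{±1}`.
* `S` is the closed surface obtained from surfaces `S_±` with `k` boundary circles, of genera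
  `g - k + 1` and `0`, by attaching `k` cylinders `[-1,1] × S¹`. The map `c i` parametrizes the union
  of the `i`-th cylinder and the adjacent collars of `S_±`.  It has coordinates `(τ, θ)`.  The circles
  `τ = 0` cut `S` into the open sets `U ±`, which are `S_±` with open cylinders attached.
* `(F, G)` is the profile of the smoothened corners: in `(r, t)`-coordinates of the double completion
  of `Y × S` the hypersurface `M` is `r = F τ`, `t = G τ`.  Thus `r = τ`, `t = 0` for
  `|τ| ≤ 1 - δ/3`, and `r = ±1`, `t = 1 - |τ|` for `|τ| ≥ 1 + δ/3`.
* `lam` is the 1-form on `S` which is a Liouville form on `S_±`, equal to `e^t dθ` on the collars, and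
  `e^t dθ` on the rest of the cylinders. -/
structure ModelData (k g : ℕ) where
  δ : ℝ
  δ_pos : 0 < δ
  δ_lt : δ < 1
  -- the Liouville domain
  al : ℝ → Y → EY n →L[ℝ] ℝ
  al_smooth : SmoothForm (IYR n) (familyForm al)
  al_symp : ∀ p : Y × ℝ, |p.2| ≤ 1 → Nondeg (dForm (IYR n) (familyForm al) p)
  al_end : ∀ (e : Bool) (r : ℝ) (y : Y), 1 - δ < sgn e * r →
    al r y = Real.exp (sgn e * r - 1) • al (sgn e) y
  -- the compatible almost complex structure on the Liouville domain, cylindrical at the ends: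
  -- there it is `r`-invariant on `ker α_±` and maps the Liouville field `±∂_r` to a positive
  -- multiple (depending only on `r`) of the Reeb field of `α_±`
  J₀ : Y × ℝ → (EY n × ℝ) →L[ℝ] (EY n × ℝ)
  J₀_smooth : SmoothEnd (IYR n) J₀
  J₀_sq : ∀ p : Y × ℝ, |p.2| ≤ 1 → ∀ v, J₀ p (J₀ p v) = -v
  J₀_tame : ∀ p : Y × ℝ, |p.2| ≤ 1 → ∀ v, v ≠ 0 →
    0 < dForm (IYR n) (familyForm al) p v (J₀ p v)
  J₀_inv : ∀ p : Y × ℝ, |p.2| ≤ 1 → ∀ v w,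
    dForm (IYR n) (familyForm al) p (J₀ p v) (J₀ p w) = dForm (IYR n) (familyForm al) p v w
  J₀_end_xi : ∀ (e : Bool) (r : ℝ) (y : Y), 1 - δ < sgn e * r → |r| ≤ 1 →
    ∀ v, al (sgn e) y v = 0 →
      (J₀ (y, r) (v, 0)).2 = 0 ∧ al (sgn e) y (J₀ (y, r) (v, 0)).1 = 0 ∧
      J₀ (y, r) (v, 0) = J₀ (y, sgn e) (v, 0)
  scale : ℝ → ℝ
  scale_pos : ∀ r, 0 < scale r
  J₀_end_reeb : ∀ (e : Bool) (r : ℝ) (y : Y), 1 - δ < sgn e * r → |r| ≤ 1 →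
    (J₀ (y, r) (0, sgn e)).2 = 0 ∧ al (sgn e) y (J₀ (y, r) (0, sgn e)).1 = scale r ∧
      ∀ v, dForm (𝓡 (2 * n - 1)) (al (sgn e)) y (J₀ (y, r) (0, sgn e)).1 v = 0
  -- the functions `σ`, `β` and the profile of the corners
  ε : ℝ
  ε_pos : 0 < ε
  K : ℝ
  σ : ℝ → ℝ
  σ_smooth : ContDiff ℝ ∞ σ
  σ_out : ∀ r, 1 ≤ |r| → σ r = K
  σ_in : ∀ r, |r| ≤ 1 - δ → σ r = ε
  σ_mono : ∀ (e : Bool) (r : ℝ), 1 - δ < sgn e * r → sgn e * r < 1 → 0 < sgn e * deriv σ r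
  β : ℝ → ℝ
  β_smooth : ContDiff ℝ ∞ β
  β_zero : ∀ t, t ≤ -δ + δ / 9 → β t = 0
  β_one : ∀ t, -(2 * δ / 3) - δ / 9 ≤ t → β t = 1
  β_mono : ∀ t, 0 ≤ deriv β t
  F : ℝ → ℝ
  G : ℝ → ℝ
  F_smooth : ContDiff ℝ ∞ F
  G_smooth : ContDiff ℝ ∞ G
  FG_in : ∀ τ, |τ| ≤ 1 - δ / 3 → F τ = τ ∧ G τ = 0
  FG_out : ∀ (e : Bool) (τ : ℝ), 1 + δ / 3 ≤ sgn e * τ → F τ = sgn e ∧ G τ = 1 - sgn e * τ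
  F_mono : ∀ τ, |τ| < 1 + δ / 3 → 0 < deriv F τ
  G_mono : ∀ (e : Bool) (τ : ℝ), 1 - δ / 3 < sgn e * τ → sgn e * deriv G τ < 0
  -- the function `H` on `Y × [-1,1]`: it vanishes at `r = ±1`, depends only on `r` in a
  -- neighbourhood of `1 - δ ≤ |r| ≤ 1`, where it is non-increasing towards `r = ±1`
  H : Y × ℝ → ℝ
  H_smooth : ContMDiff (IYR n) 𝓘(ℝ, ℝ) ∞ H
  H_nonneg : ∀ y r, |r| ≤ 1 → 0 ≤ H (y, r)
  H_end : ∀ (e : Bool) (y : Y), H (y, sgn e) = 0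
  δ' : ℝ
  δ'_gt : δ < δ'
  δ'_le : δ' ≤ 1
  H_indep : ∀ y y' r, 1 - δ' < |r| → |r| ≤ 1 → H (y, r) = H (y', r)
  H_mono : ∀ (e : Bool) (y : Y) (r : ℝ), 1 - δ' < sgn e * r → sgn e * r < 1 →
    sgn e * deriv (fun x => H (y, x)) r ≤ 0
  H_morse : IsMorse n H ∨ IsMorseBott H
  -- the surface
  c : Fin k → ℝ × ℝ → S
  c_emb : ∀ i, IsCylEmbedding (c i) (longCyl δ)
  c_disj : ∀ i i', i ≠ i' → Disjoint (c i '' longCyl δ) (c i' '' longCyl δ)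
  U : Bool → TopologicalSpace.Opens S
  U_disj : Disjoint (U true : Set S) (U false)
  U_union : (U true : Set S) ∪ U false = (⋃ i, c i '' {p | p.1 = 0})ᶜ
  U_cyl : ∀ (e : Bool) i, ∀ p ∈ longCyl δ, 0 < sgn e * p.1 → c i p ∈ U e
  genus_pos : HasGenus (U true) k (g + 1 - k)
  genus_neg : HasGenus (U false) k 0
  lam : S → ES →L[ℝ] ℝ
  lam_smooth : SmoothForm (𝓡 2) lam
  lam_cyl : ∀ i, ∀ p ∈ longCyl δ,
    lam (c i p) (mfderiv 𝓘(ℝ, ℝ × ℝ) (𝓡 2) (c i) p ((1, 0) : ℝ × ℝ)) = 0 ∧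
    lam (c i p) (mfderiv 𝓘(ℝ, ℝ × ℝ) (𝓡 2) (c i) p ((0, 1) : ℝ × ℝ)) = Real.exp (G p.1)
  lam_symp : ∀ z, z ∉ ⋃ i, c i '' longCyl δ → Nondeg (dForm (𝓡 2) lam z)
  -- the `d lam`-compatible complex structure on the pages
  j : S → ES →L[ℝ] ES
  j_sq : ∀ z, z ∉ ⋃ i, c i '' longCyl δ → ∀ w, j z (j z w) = -w
  j_tame : ∀ z, z ∉ ⋃ i, c i '' longCyl δ → ∀ w, w ≠ 0 → 0 < dForm (𝓡 2) lam z w (j z w)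
  -- the function which interpolates the almost complex structure over the corners
  h : ℝ → ℝ
  h_pos : ∀ τ, 0 < h τ

namespace ModelData

variable {k g : ℕ} (D : ModelData n Y S k g)

/-- The page `S_±` minus its open collar, as a subset of `S`. -/
def core (e : Bool) : Set S := (D.U e : Set S) \ ⋃ i, D.c i '' longCyl D.δ

/-- The coordinate vector field `∂_τ` at the point `(τ,θ)` of the `i`-th cylinder. -/
def dtau (i : Fin k) (p : ℝ × ℝ) : ES := mfderiv 𝓘(ℝ, ℝ × ℝ) (𝓡 2) (D.c i) p ((1, 0) : ℝ × ℝ)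

/-- The coordinate vector field `∂_θ` at the point `(τ,θ)` of the `i`-th cylinder. -/
def dtheta (i : Fin k) (p : ℝ × ℝ) : ES := mfderiv 𝓘(ℝ, ℝ × ℝ) (𝓡 2) (D.c i) p ((0, 1) : ℝ × ℝ)

open Classical in
/-- The coordinate `τ` on `S`, extended from the cylinders by the constants `±(1+δ)`. -/
def tau (z : S) : ℝ :=
  if hz : ∃ τ : ℝ, |τ| < 1 + D.δ ∧ ∃ (i : Fin k) (θ : ℝ), D.c i (τ, θ) = z then hz.choose
  else if z ∈ D.U true then 1 + D.δ else -(1 + D.δ)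

/-- The global coordinate `r` on `S`. -/
def r (z : S) : ℝ := D.F (D.tau z)

/-- The 1-form `Λ = e^{ε H} (σ(r) α_r + β(t) lam)` on `M = Y × S`. -/
def Lam (p : Y × S) : (EY n × ES) →L[ℝ] ℝ :=
  Real.exp (D.ε * D.H (p.1, D.r p.2)) •
    (D.σ (D.r p.2) • (D.al (D.r p.2) p.1).comp (ContinuousLinearMap.fst ℝ (EY n) ES)
      + D.β (D.G (D.tau p.2)) • (D.lam p.2).comp (ContinuousLinearMap.snd ℝ (EY n) ES))

/-- The restriction to `M` (perturbed along the flow for time `ε H`) of the Liouville form of the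
double completion: `e^{ε H} (σ(r) α_r + lam)`. -/
def primitive (p : Y × S) : (EY n × ES) →L[ℝ] ℝ :=
  Real.exp (D.ε * D.H (p.1, D.r p.2)) •
    (D.σ (D.r p.2) • (D.al (D.r p.2) p.1).comp (ContinuousLinearMap.fst ℝ (EY n) ES)
      + (D.lam p.2).comp (ContinuousLinearMap.snd ℝ (EY n) ES))

/-- The 2-form `Ω` of the stable Hamiltonian structure. -/
def Om (p : Y × S) : (EY n × ES) →L[ℝ] (EY n × ES) →L[ℝ] ℝ := dForm (IYS n) D.primitive p

/-- The lift to `ker Λ`, over the point `(y, c i (τ, θ))` of the spine, of the tangent vector `x` of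
`Y × [-1,1]` at `(y, τ)`. -/
def lift (i : Fin k) (y : Y) (p : ℝ × ℝ) (x : EY n × ℝ) : EY n × ES :=
  (x.1, x.2 • D.dtau i p - (D.ε * D.al p.1 y x.1) • D.dtheta i p)

/-- `J` (given by its values along `{0} × M`) is the `ℝ`-invariant almost complex structure on
`ℝ × M` which maps `∂_a` to the Reeb field `R`, and is on `ker Λ`

* the lift of `J₀` over the spine `|τ| ≤ 1 - δ`,
* over the corners `1 - δ < ±τ < 1 + δ`: equal to `J₀` on `ker α_±`, and `J ∂_τ = h(τ) v₂`, where `v₂`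
  is the vector in the span of `R_±` and `∂_θ` with `Λ(v₂) = 0`, `Ω(∂_τ, v₂) = 1`,
* over the rest of the pages: equal to `J₀ ⊕ j` on `ker α_± ⊕ TS`. -/
structure IsModelJ (J : Y × S → (ℝ × (EY n × ES)) →L[ℝ] (ℝ × (EY n × ES))) : Prop where
  smooth : SmoothEnd (𝓘(ℝ, ℝ).prod (IYS n)) (fun w : ℝ × (Y × S) => J w.2)
  sq : ∀ p v, J p (J p v) = -v
  reeb : ∀ p, (J p (1, 0)).1 = 0 ∧ D.Lam p (J p (1, 0)).2 = 1 ∧ ∀ v, D.Om p (J p (1, 0)).2 v = 0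
  spine : ∀ (i : Fin k) (y : Y) (p : ℝ × ℝ), |p.1| ≤ 1 - D.δ → ∀ x : EY n × ℝ,
    J (y, D.c i p) (0, D.lift i y p x) = (0, D.lift i y p (D.J₀ (y, p.1) x))
  corner_xi : ∀ (e : Bool) (i : Fin k) (y : Y) (p : ℝ × ℝ),
    1 - D.δ < sgn e * p.1 → sgn e * p.1 < 1 + D.δ → ∀ v : EY n, D.al (sgn e) y v = 0 →
      J (y, D.c i p) (0, (v, 0)) = (0, ((D.J₀ (y, sgn e) (v, 0)).1, 0))
  corner : ∀ (e : Bool) (i : Fin k) (y : Y) (p : ℝ × ℝ),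
    1 - D.δ < sgn e * p.1 → sgn e * p.1 < 1 + D.δ →
      ∃ (w : EY n) (b : ℝ), (∀ v, dForm (𝓡 (2 * n - 1)) (D.al (sgn e)) y w v = 0) ∧
        D.Lam (y, D.c i p) (w, b • D.dtheta i p) = 0 ∧
        D.Om (y, D.c i p) (0, D.dtau i p) (w, b • D.dtheta i p) = 1 ∧
        J (y, D.c i p) (0, (0, D.dtau i p)) = D.h p.1 • (0, (w, b • D.dtheta i p))
  page_xi : ∀ (e : Bool) (y : Y), ∀ z ∈ D.core e, ∀ v : EY n, D.al (sgn e) y v = 0 →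
    J (y, z) (0, (v, 0)) = (0, ((D.J₀ (y, sgn e) (v, 0)).1, 0))
  page : ∀ (e : Bool) (y : Y), ∀ z ∈ D.core e, ∀ w : ES,
    J (y, z) (0, (0, w)) = (0, (0, D.j z w))

/-! ## The leaves -/

/-- The critical points of `H` in `Y × (-1,1)`. -/
def crit : Set (Y × ℝ) := {p | |p.2| < 1 ∧ IsCrit (IYR n) D.H p}

/-- The period `e^{ε H(p)}` of the orbit `γ_p`. -/
def period (p : Y × ℝ) : ℝ := Real.exp (D.ε * D.H p)

/-- The orbit `γ_p = {p} × S¹` in the `i`-th component of the spine, starting at the angle `θ₀`,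
parametrized as an orbit of the Reeb field. -/
def orbit (i : Fin k) (p : Y × ℝ) (θ₀ : ℝ) (x : ℝ) : Y × S :=
  (p.1, D.c i (p.2, x / D.period p + θ₀))

/-- `X` is the gradient of `H` at `p`, for the metric `dα(·, J₀ ·)`. -/
def IsGradient (p : Y × ℝ) (X : EY n × ℝ) : Prop :=
  ∀ v : EY n × ℝ, dForm (IYR n) (familyForm D.al) p X (D.J₀ p v)
    = mfderiv (IYR n) 𝓘(ℝ, ℝ) D.H p v

variable (n) in
/-- The velocity of a path in `Y × ℝ`. -/
def velocity (γ : ℝ → Y × ℝ) (s : ℝ) : EY n × ℝ := mfderiv 𝓘(ℝ, ℝ) (IYR n) γ s (1 : ℝ)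

/-- The path `(a, γ, θ)` satisfies at time `s` the equations
`γ' = ∇H(γ)`, `a' = e^{ε H(γ)}`, `θ' = - ε α(∇H(γ))`. -/
def FlowEqs (a : ℝ → ℝ) (γ : ℝ → Y × ℝ) (θ : ℝ → ℝ) (s : ℝ) : Prop :=
  MDifferentiableAt 𝓘(ℝ, ℝ) (IYR n) γ s ∧ D.IsGradient (γ s) (velocity n γ s) ∧
  HasDerivAt a (Real.exp (D.ε * D.H (γ s))) s ∧
  HasDerivAt θ (-(D.ε * familyForm D.al (γ s) (velocity n γ s))) s

/-- A non-constant gradient flow line of `H` defined for all times, which stays in the spine. -/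
def IsFlowLine (γ : ℝ → Y × ℝ) : Prop :=
  ∀ s, MDifferentiableAt 𝓘(ℝ, ℝ) (IYR n) γ s ∧ D.IsGradient (γ s) (velocity n γ s) ∧
    |(γ s).2| ≤ 1 - D.δ ∧ γ s ∉ D.crit

variable (J : Y × S → (ℝ × (EY n × ES)) →L[ℝ] (ℝ × (EY n × ES)))

/-- `L` is the trivial cylinder over `γ_p` in the `i`-th component of the spine. -/
def IsTrivialLeaf (i : Fin k) (p : Y × ℝ) (L : Set (ℝ × (Y × S))) : Prop :=
  ∃ C : PuncturedCurve (IYS n) J, C.Parametrizes L ∧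
    C.IsCylinder (fun q => (D.period p * q.1, (p.1, D.c i (p.2, q.2))))
      (D.period p) (D.orbit i p 0) (D.period p) (D.orbit i p 0)

/-- `L` is the flow-line cylinder `u_γ^{a₀}` in the `i`-th component of the spine: it is
parametrized by `(s,t) ↦ (a(s), γ(s), θ(s) + t)`, and asymptotic to the orbits `γ_{p_±}`,
`p_± = lim γ`. -/
def IsFlowLeaf (i : Fin k) (γ : ℝ → Y × ℝ) (a₀ : ℝ) (L : Set (ℝ × (Y × S))) : Prop :=
  ∃ (C : PuncturedCurve (IYS n) J) (a θ : ℝ → ℝ) (pm pp : Y × ℝ) (θm θp : ℝ),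
    C.Parametrizes L ∧
    (∀ s, D.FlowEqs a γ θ s) ∧ a 0 = a₀ ∧ θ 0 = 0 ∧
    Tendsto a atTop atTop ∧ Tendsto a atBot atBot ∧
    pm ∈ D.crit ∧ pp ∈ D.crit ∧ Tendsto γ atBot (𝓝 pm) ∧ Tendsto γ atTop (𝓝 pp) ∧
    C.IsCylinder (fun q => (a q.1, ((γ q.1).1, D.c i ((γ q.1).2, θ q.1 + q.2))))
      (D.period pm) (D.orbit i pm θm) (D.period pp) (D.orbit i pp θp)

/-- The `t`-coordinate of the perturbed hypersurface at the point `(y, τ)`. -/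
def Gε (y : Y) (τ : ℝ) : ℝ := D.G τ + D.ε * D.H (y, D.F τ)

/-- The restriction of the curve `C` to the end `i'` is, for `s > 0`, the cylinder
`(s,t) ↦ (b(s), γ(s), θ(s) + t)` in the `i`-th component of the spine with its adjacent collars.  It
starts at the page `{y} × core e` at level `a`; over the corner it is constant in `Y` and
satisfies `b' = β e^{Gε}`, `τ' = (e^{Gε})' / h`; then it enters the spine `|τ| ≤ 1 - δ`, where it is a
flow-line cylinder; and it is positively asymptotic to `γ_p` for a critical point `p` of `H`. -/
def IsPageEnd (C : PuncturedCurve (IYS n) J) (e : Bool) (y : Y) (a : ℝ) (i : Fin k) (i' : C.ι) :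
    Prop :=
  C.pos i' = true ∧
  ∃ (b θ : ℝ → ℝ) (γ : ℝ → Y × ℝ) (p : Y × ℝ) (θp : ℝ),
    (∀ s t, 0 < s → C.u (C.φ i' (s, t)) = (b s, ((γ s).1, D.c i ((γ s).2, θ s + t)))) ∧
    (∀ s, 0 < s → |(γ s).2| < 1 + D.δ) ∧
    Tendsto (fun s => (γ s).2) (𝓝[>] 0) (𝓝 (sgn e * (1 + D.δ))) ∧
    Tendsto b (𝓝[>] 0) (𝓝 a) ∧
    (∀ s, 0 < s → 1 - D.δ < sgn e * (γ s).2 →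
      (γ s).1 = y ∧ θ s = 0 ∧
      HasDerivAt b (D.β (D.G (γ s).2) * Real.exp (D.Gε y (γ s).2)) s ∧
      HasDerivAt (fun x => (γ x).2)
        (deriv (fun τ => Real.exp (D.Gε y τ)) (γ s).2 / D.h (γ s).2) s) ∧
    (∀ s, 0 < s → |(γ s).2| ≤ 1 - D.δ → D.FlowEqs b γ θ s) ∧
    (∀ᶠ s in atTop, |(γ s).2| < 1 - D.δ) ∧
    p ∈ D.crit ∧ Tendsto γ atTop (𝓝 p) ∧
    C.AsymptoticAt i' (D.period p) (D.orbit i p θp)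

/-- `L` is the page-like curve `u_{y,a}^±`: its punctures are all positive, and there is exactly one
in each of the `k` components of the spine; it has genus `g - k + 1` (sign `+`) or `0` (sign `-`);
away from its cylindrical ends it is the lift at level `a` of the page over `y`. -/
def IsPageLeaf (e : Bool) (y : Y) (a : ℝ) (L : Set (ℝ × (Y × S))) : Prop :=
  ∃ (C : PuncturedCurve (IYS n) J) (pt : Fin k ≃ C.ι), C.Parametrizes L ∧
    HasGenus C.S k (if e then g + 1 - k else 0) ∧
    C.u '' (⋃ i, C.φ i '' halfCyl (C.pos i) 0)ᶜ = {w | w.1 = a ∧ w.2.1 = y ∧ w.2.2 ∈ D.core e} ∧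
    ∀ i, D.IsPageEnd J C e y a i (pt i)

end ModelData

end Model

end SpinalFoliation

end

/-!
In the coordinates `((y, τ), θ)` on `Y` times a cylinder, `Λ = alphaForm + cutHeight dθ` and
`Ω = d(alphaForm + height dθ)` with `height = e^{G + ε H}` and `cutHeight = β(G) height`. Let
`flowField` be the gradient of `H` over the spine and `(∂_τ height / h) ∂_τ` over the corners. The
central computation, `IsModelJ.key`, is that `J` maps `(cutHeight, flowField, angle)` to `∂_θ`.
Hence, if `γ` is an orbit of `flowField`, `b' = cutHeight(γ)` and `θ' = angle(γ)`, then
`(s, t) ↦ (b(s), γ(s), θ(s) + t)` is a holomorphic cylinder. Near the pages `b` and `y` are constant,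
so that the cylinders which start at the boundary of a page fit together with the slice
`{a} × {y} × core`, which is holomorphic; `LeafModel` describes such glued curves.

It remains to understand the orbits.

* `height` increases along the flow, with derivative `ascent`, which vanishes only on `crit(H)`. As
  `H` is Morse or Morse-Bott, the differences of `height` and the squares of 1-forms evaluated on
  `flowField` are `O(ascent)` at the critical points (`isBigO_height`, `isBigO_form_sq`). By
  Lojasiewicz's argument (`tendsto_of_gradient_inequality`) the orbits converge, even in the Morse-Bott
  case, as do `θ` and `b - T s`, so the cylinders are asymptotic to periodic orbits
  (`IsLift.asymptoticTo`).
* `flowField` is not controlled at the boundary `±τ = 1 + δ` of the pages, where the coordinate `τ` ends.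
  But there `J` is tangent to the slices and tamed by `d lam`, which bounds the speed below
  (`exists_le_abs_flowField`), so that a unique orbit starts at each boundary point
  (`exists_isPageOrbit`). It moves into the spine and stays there.
* Followed backwards, an orbit in the spine stays there or is one of those which start at a page
  (`exists_flowLine_or_page`). Together with the uniqueness of orbits this gives the partition
  (`isPartition_leaves`).

The `Ω`-energy density of a swept out cylinder is `ascent`, and that of `d(φ Λ)` is the derivative of
`φ(b) cutHeight(γ)`. So the energies are bounded in terms of the maximum of `height`, and on the pages by
an area (`exists_energy_bound`). The leaves are tangent to the span of `∂_θ` and `J ∂_θ`, which extends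
smoothly over the pages (`exists_frame_planeField`).
-/

noncomputable section

namespace SpinalFoliation

set_option linter.unusedSectionVars false

local notation "𝓘₁" => 𝓘(ℝ, ℝ)
local notation "𝓘₂" => 𝓘(ℝ, ℝ × ℝ)
local notation "𝓘W" n:max => ModelWithCorners.prod 𝓘(ℝ, ℝ) (IYS n)
local notation "𝓘C" n:max => ModelWithCorners.prod (IYR n) 𝓘(ℝ, ℝ)

open Asymptotics
open Function (Bijective Injective Surjective LeftInverse RightInverse extend)
open ContinuousLinearMap (fst snd)
open Real (exp exp_pos)

/-! ### Differentials of maps of manifolds -/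

section Forms

variable {E : Type*} [NormedAddCommGroup E] [NormedSpace ℝ E]
  {H : Type*} [TopologicalSpace H] {I : ModelWithCorners ℝ E H}
  {M : Type*} [TopologicalSpace M] [ChartedSpace H M] [IsManifold I ∞ M]
  {E' : Type*} [NormedAddCommGroup E'] [NormedSpace ℝ E']
  {H' : Type*} [TopologicalSpace H'] {I' : ModelWithCorners ℝ E' H'}
  {M' : Type*} [TopologicalSpace M'] [ChartedSpace H' M'] [IsManifold I' ∞ M']

theorem contMDiffAt_tangentMap {f : M → M'} {p : TangentBundle I M}
    (hf : ContMDiffAt I I' ∞ f p.1) :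
    ContMDiffAt I.tangent I'.tangent ∞ (tangentMap I I' f) p := by
  have h1 := hf.mfderiv_const (m := ∞) (by simp)
  have h2 : ContMDiffAt I.tangent I ∞ (fun q : TangentBundle I M => q.1) p :=
    Bundle.contMDiffAt_proj _
  have h3 : ContMDiffAt I.tangent I.tangent ∞
      (fun q : TangentBundle I M => (⟨q.1, q.2⟩ : TangentBundle I M)) p := contMDiffAt_id
  have h4 : ContMDiffAt I.tangent I' ∞ (fun q : TangentBundle I M => f q.1) p := hf.comp p h2
  exact ContMDiffAt.clm_apply_of_inCoordinates (h1.comp p h2) h3 h4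

theorem TangentBundle.contMDiffAt_prodMk {E₀ H₀ M₀ : Type*} [NormedAddCommGroup E₀]
    [NormedSpace ℝ E₀] [TopologicalSpace H₀] {I₀ : ModelWithCorners ℝ E₀ H₀}
    [TopologicalSpace M₀] [ChartedSpace H₀ M₀]
    {f : M₀ → TangentBundle I M} {g : M₀ → TangentBundle I' M'} {x : M₀}
    (hf : ContMDiffAt I₀ I.tangent ∞ f x) (hg : ContMDiffAt I₀ I'.tangent ∞ g x) :
    ContMDiffAt I₀ (I.prod I').tangent ∞
      (fun y => (⟨((f y).1, (g y).1), ((f y).2, (g y).2)⟩ : TangentBundle (I.prod I') (M × M')))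
      x :=
  (contMDiff_equivTangentBundleProd_symm (n := ∞) (I := I) (M := M) (I' := I') (M' := M')
    (f x, g x)).comp x (hf.prodMk hg)

/-- The zero section composed with a map. -/
theorem contMDiffAt_zeroSection_comp {E₀ H₀ M₀ : Type*} [NormedAddCommGroup E₀]
    [NormedSpace ℝ E₀] [TopologicalSpace H₀] {I₀ : ModelWithCorners ℝ E₀ H₀}
    [TopologicalSpace M₀] [ChartedSpace H₀ M₀] {f : M₀ → M} {x : M₀}
    (hf : ContMDiffAt I₀ I ∞ f x) :
    ContMDiffAt I₀ I.tangent ∞ (fun y => (⟨f y, (0 : E)⟩ : TangentBundle I M)) x := by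
  have : ContMDiffAt I I.tangent ∞ (fun y => (⟨y, (0 : E)⟩ : TangentBundle I M)) (f x) :=
    Bundle.contMDiff_zeroSection ℝ (TangentSpace I) (f x)
  exact this.comp x hf

/-- The tangent bundle of a vector space is a product. -/
theorem contMDiffAt_tangentBundle_vectorSpace {E₀ H₀ M₀ : Type*} [NormedAddCommGroup E₀]
    [NormedSpace ℝ E₀] [TopologicalSpace H₀] {I₀ : ModelWithCorners ℝ E₀ H₀}
    [TopologicalSpace M₀] [ChartedSpace H₀ M₀] {f g : M₀ → E} {x : M₀}
    (hf : ContMDiffAt I₀ 𝓘(ℝ, E) ∞ f x) (hg : ContMDiffAt I₀ 𝓘(ℝ, E) ∞ g x) :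
    ContMDiffAt I₀ 𝓘(ℝ, E).tangent ∞ (fun y => (⟨f y, g y⟩ : TangentBundle 𝓘(ℝ, E) E)) x := by
  rw [Bundle.contMDiffAt_totalSpace]
  refine ⟨hf, ?_⟩
  simpa using hg


/-- The differential of a map of manifolds, as a map of the model vector spaces (which are, by
definition, the tangent spaces). -/
def md (I : ModelWithCorners ℝ E H) (I' : ModelWithCorners ℝ E' H') (f : M → M') (x : M) :
    E →L[ℝ] E' := mfderiv I I' f x

section md

variable {E₂ : Type*} [NormedAddCommGroup E₂] [NormedSpace ℝ E₂]
  {H₂ : Type*} [TopologicalSpace H₂] {I₂ : ModelWithCorners ℝ E₂ H₂}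
  {M₂ : Type*} [TopologicalSpace M₂] [ChartedSpace H₂ M₂]


theorem md_comp {g : M' → M₂} {f : M → M'} {x : M} (hg : MDifferentiableAt I' I₂ g (f x))
    (hf : MDifferentiableAt I I' f x) :
    md I I₂ (fun y => g (f y)) x = (md I' I₂ g (f x)).comp (md I I' f x) :=
  mfderiv_comp x hg hf

theorem md_congr {f g : M → M'} {x : M} (h : f =ᶠ[𝓝 x] g) : md I I' f x = md I I' g x :=
  h.mfderiv_eq

theorem md_id {x : M} : md I I (fun y : M => y) x = ContinuousLinearMap.id ℝ E := mfderiv_id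

theorem md_const {x : M} {c : M'} : md I I' (fun _ : M => c) x = 0 := mfderiv_const

theorem md_fst {p : M × M'} :
    md (I.prod I') I (fun q : M × M' => q.1) p = fst ℝ E E' := mfderiv_fst

theorem md_snd {p : M × M'} :
    md (I.prod I') I' (fun q : M × M' => q.2) p = snd ℝ E E' := mfderiv_snd

theorem md_prodMk {f : M₂ → M} {g : M₂ → M'} {x : M₂} (hf : MDifferentiableAt I₂ I f x)
    (hg : MDifferentiableAt I₂ I' g x) :
    md I₂ (I.prod I') (fun y => (f y, g y)) x = (md I₂ I f x).prod (md I₂ I' g x) :=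
  mfderiv_prodMk hf hg

theorem md_eq_fderiv {f : E → E'} {x : E} : md 𝓘(ℝ, E) 𝓘(ℝ, E') f x = fderiv ℝ f x :=
  mfderiv_eq_fderiv

theorem md_space_prodMk {f : M → E'} {g : M → E₂} {x : M} (hf : MDifferentiableAt I 𝓘(ℝ, E') f x)
    (hg : MDifferentiableAt I 𝓘(ℝ, E₂) g x) :
    md I 𝓘(ℝ, E' × E₂) (fun y => (f y, g y)) x
      = (md I 𝓘(ℝ, E') f x).prod (md I 𝓘(ℝ, E₂) g x) :=
  HasMFDerivAt.mfderiv (I := I) (I' := 𝓘(ℝ, E' × E₂)) (f' := (md I 𝓘(ℝ, E') f x).prod (md I 𝓘(ℝ, E₂) g x))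
    ⟨hf.hasMFDerivAt.1.prodMk hg.hasMFDerivAt.1,
      HasFDerivWithinAt.prodMk hf.hasMFDerivAt.2 hg.hasMFDerivAt.2⟩

end md

variable [I.Boundaryless] [I'.Boundaryless]

theorem md_extChartAt_self {x : M} :
    md I 𝓘(ℝ, E) (extChartAt I x) x = ContinuousLinearMap.id ℝ E :=
  have : IsManifold I 1 M := IsManifold.of_le (n := ∞) (by norm_cast)
  mfderiv_extChartAt_self

theorem mdifferentiableAt_extChartAt_symm {x : M} {z : E} (hz : z ∈ (extChartAt I x).target) :
    MDifferentiableAt 𝓘(ℝ, E) I (extChartAt I x).symm z := by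
  have : IsManifold I 1 M := IsManifold.of_le (n := ∞) (by norm_cast)
  have := mdifferentiableWithinAt_extChartAt_symm (I := I) (x := x) hz
  rwa [I.range_eq_univ, mdifferentiableWithinAt_univ] at this

theorem contMDiffAt_extChartAt_symm {x : M} {z : E} (hz : z ∈ (extChartAt I x).target) :
    ContMDiffAt 𝓘(ℝ, E) I ∞ (extChartAt I x).symm z :=
  (contMDiffOn_extChartAt_symm x).contMDiffAt ((isOpen_extChartAt_target x).mem_nhds hz)

theorem md_symm_comp_md_extChartAt {x q : M} (hq : q ∈ (chartAt H x).source) :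
    (md 𝓘(ℝ, E) I (extChartAt I x).symm (extChartAt I x q)).comp
      (md I 𝓘(ℝ, E) (extChartAt I x) q) = ContinuousLinearMap.id ℝ E := by
  have : IsManifold I 1 M := IsManifold.of_le (n := ∞) (by norm_cast)
  have h := mfderivWithin_extChartAt_symm_comp_mfderiv_extChartAt' (I := I) (x := x) (y := q)
    (by rwa [extChartAt_source])
  rw [I.range_eq_univ, mfderivWithin_univ] at h
  exact h

theorem md_extChartAt_comp_md_symm {x q : M} (hq : q ∈ (chartAt H x).source) :
    (md I 𝓘(ℝ, E) (extChartAt I x) q).comp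
      (md 𝓘(ℝ, E) I (extChartAt I x).symm (extChartAt I x q)) = ContinuousLinearMap.id ℝ E := by
  have : IsManifold I 1 M := IsManifold.of_le (n := ∞) (by norm_cast)
  have h := mfderiv_extChartAt_comp_mfderivWithin_extChartAt_symm' (I := I) (x := x) (y := q)
    (by rwa [extChartAt_source])
  rw [I.range_eq_univ, mfderivWithin_univ] at h
  exact h

theorem md_eq_fderiv_inChart {f : M → M'} {x : M} (hf : MDifferentiableAt I I' f x) :
    md I I' f x = fderiv ℝ (writtenInExtChartAt I I' x f) (extChartAt I x x) := by
  unfold md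
  rw [hf.mfderiv, I.range_eq_univ, fderivWithin_univ]

/-! ### The exterior derivative of 1-forms -/

/-- The form `f^* η`. -/
def pullForm (I : ModelWithCorners ℝ E H) (I' : ModelWithCorners ℝ E' H')
    (f : M → M') (η : M' → E' →L[ℝ] ℝ) (x : M) : E →L[ℝ] ℝ :=
  (η (f x)).comp (md I I' f x)

/-- A 1-form is differentiable at a point if its coordinate expression is. -/
def DiffFormAt (I : ModelWithCorners ℝ E H) (η : M → E →L[ℝ] ℝ) (x : M) : Prop :=
  DifferentiableAt ℝ (formInChart I η x) (extChartAt I x x)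

theorem formInChart_eq (η : M → E →L[ℝ] ℝ) (x : M) (z : E) : formInChart I η x z =
    (η ((extChartAt I x).symm z)).comp (md 𝓘(ℝ, E) I (extChartAt I x).symm z) := rfl

theorem dForm_apply (η : M → E →L[ℝ] ℝ) (x : M) (v w : E) : dForm I η x v w =
    fderiv ℝ (formInChart I η x) (extChartAt I x x) v w
      - fderiv ℝ (formInChart I η x) (extChartAt I x x) w v := rfl

theorem form_eq_formInChart_comp (η : M → E →L[ℝ] ℝ) {x q : M} (hq : q ∈ (chartAt H x).source) :
    η q = (formInChart I η x (extChartAt I x q)).comp (md I 𝓘(ℝ, E) (extChartAt I x) q) := by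
  have h2 : (extChartAt I x).symm (extChartAt I x q) = q :=
    (extChartAt I x).left_inv (by rwa [extChartAt_source])
  rw [formInChart_eq, ContinuousLinearMap.comp_assoc, md_symm_comp_md_extChartAt hq, h2,
    ContinuousLinearMap.comp_id]

theorem formInChart_pullForm {f : M → M'} {η : M' → E' →L[ℝ] ℝ} {x : M}
    (hf : ContMDiffAt I I' ∞ f x) :
    formInChart I (pullForm I I' f η) x =ᶠ[𝓝 (extChartAt I x x)] fun z =>
      (formInChart I' η (f x) (writtenInExtChartAt I I' x f z)).comp
        (fderiv ℝ (writtenInExtChartAt I I' x f) z) := by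
  have hI : IsManifold I 1 M := IsManifold.of_le (n := ∞) (by norm_cast)
  have hI' : IsManifold I' 1 M' := IsManifold.of_le (n := ∞) (by norm_cast)
  have hc : ContinuousAt (extChartAt I x).symm (extChartAt I x x) := continuousAt_extChartAt_symm x
  have h1 : ∀ᶠ q in 𝓝 x, MDifferentiableAt I I' f q := by
    have := (contMDiffAt_iff_contMDiffAt_nhds (n := 1) (by simp)).1
      (hf.of_le (m := 1) (by norm_cast))
    filter_upwards [this] with q hq
    exact hq.mdifferentiableAt (by simp)
  have h2 : ∀ᶠ q in 𝓝 x, f q ∈ (chartAt H' (f x)).source :=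
    hf.continuousAt ((chartAt H' (f x)).open_source.mem_nhds (mem_chart_source H' (f x)))
  have e1 : (extChartAt I x).symm (extChartAt I x x) = x := by simp
  rw [ContinuousAt, e1] at hc
  filter_upwards [hc.eventually h1, hc.eventually h2, extChartAt_target_mem_nhds (I := I) x]
    with z hz1 hz2 hz3
  have hsymm := mdifferentiableAt_extChartAt_symm (I := I) hz3
  have hch : MDifferentiableAt I' 𝓘(ℝ, E') (extChartAt I' (f x)) (f ((extChartAt I x).symm z)) :=
    mdifferentiableAt_extChartAt hz2
  have h3 : fderiv ℝ (writtenInExtChartAt I I' x f) z =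
      (md I' 𝓘(ℝ, E') (extChartAt I' (f x)) (f ((extChartAt I x).symm z))).comp
        ((md I I' f ((extChartAt I x).symm z)).comp
          (md 𝓘(ℝ, E) I (extChartAt I x).symm z)) := by
    rw [← md_comp hz1 hsymm, ← md_comp (f := fun z => f ((extChartAt I x).symm z)) hch
      (hz1.comp z hsymm), md_eq_fderiv]
    rfl
  rw [formInChart_eq, pullForm, form_eq_formInChart_comp (I := I') η hz2, h3]
  rfl

theorem contDiffAt_writtenInExtChartAt {f : M → M'} {x : M} (hf : ContMDiffAt I I' ∞ f x) :
    ContDiffAt ℝ ∞ (writtenInExtChartAt I I' x f) (extChartAt I x x) := by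
  have := (contMDiffAt_iff.1 hf).2
  rwa [I.range_eq_univ, contDiffWithinAt_univ] at this

theorem DiffFormAt.pullForm {f : M → M'} {η : M' → E' →L[ℝ] ℝ} {x : M}
    (hη : DiffFormAt I' η (f x)) (hf : ContMDiffAt I I' ∞ f x) :
    DiffFormAt I (pullForm I I' f η) x := by
  have hw := contDiffAt_writtenInExtChartAt hf
  have hd : DifferentiableAt ℝ (fderiv ℝ (writtenInExtChartAt I I' x f)) (extChartAt I x x) :=
    (hw.fderiv_right (m := 1) (by norm_cast)).differentiableAt (by simp)
  have e : writtenInExtChartAt I I' x f (extChartAt I x x) = extChartAt I' (f x) (f x) := by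
    simp [writtenInExtChartAt]
  unfold DiffFormAt at hη ⊢
  rw [(formInChart_pullForm hf).differentiableAt_iff]
  rw [← e] at hη
  exact (hη.comp (extChartAt I x x) (hw.differentiableAt (by simp))).clm_comp hd

/-- The exterior derivative commutes with pull-backs: the coordinate terms that involve second
derivatives of the map are symmetric. -/
theorem dForm_pullForm {f : M → M'} {η : M' → E' →L[ℝ] ℝ} {x : M}
    (hη : DiffFormAt I' η (f x)) (hf : ContMDiffAt I I' ∞ f x) (v w : E) :
    dForm I (SpinalFoliation.pullForm I I' f η) x v w
      = dForm I' η (f x) (md I I' f x v) (md I I' f x w) := by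
  have hw := contDiffAt_writtenInExtChartAt hf
  have hd : DifferentiableAt ℝ (fderiv ℝ (writtenInExtChartAt I I' x f)) (extChartAt I x x) :=
    (hw.fderiv_right (m := 1) (by norm_cast)).differentiableAt (by simp)
  have hsym : IsSymmSndFDerivAt ℝ (writtenInExtChartAt I I' x f) (extChartAt I x x) :=
    hw.isSymmSndFDerivAt (by simp; norm_cast)
  have e : writtenInExtChartAt I I' x f (extChartAt I x x) = extChartAt I' (f x) (f x) := by
    simp [writtenInExtChartAt]
  have hη' : DifferentiableAt ℝ (formInChart I' η (f x))
    (writtenInExtChartAt I I' x f (extChartAt I x x)) := by rw [e]; exact hη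
  have hcomp := (hη'.hasFDerivAt.comp (extChartAt I x x)
    (hw.differentiableAt (by simp)).hasFDerivAt).clm_comp hd.hasFDerivAt
  rw [dForm_apply, dForm_apply, md_eq_fderiv_inChart (hf.mdifferentiableAt (by simp)),
    (formInChart_pullForm hf).fderiv_eq, ← e]
  rw [show (fun z => (formInChart I' η (f x) (writtenInExtChartAt I I' x f z)).comp
        (fderiv ℝ (writtenInExtChartAt I I' x f) z)) = (fun z =>
      ((formInChart I' η (f x) ∘ writtenInExtChartAt I I' x f) z).comp
        (fderiv ℝ (writtenInExtChartAt I I' x f) z)) from rfl, hcomp.fderiv]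
  have hs := hsym v w
  simp only [add_apply, ContinuousLinearMap.comp_apply, ContinuousLinearMap.compL_apply,
    ContinuousLinearMap.flip_apply, hs]
  ring

theorem eventually_formInChart_congr {η η' : M → E →L[ℝ] ℝ} {x : M} (h : η =ᶠ[𝓝 x] η') :
    formInChart I η x =ᶠ[𝓝 (extChartAt I x x)] formInChart I η' x := by
  have hc : ContinuousAt (extChartAt I x).symm (extChartAt I x x) := continuousAt_extChartAt_symm x
  rw [ContinuousAt, show (extChartAt I x).symm (extChartAt I x x) = x by simp] at hc
  filter_upwards [hc.eventually h] with z hz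
  rw [formInChart_eq, formInChart_eq, hz]

theorem dForm_congr {η η' : M → E →L[ℝ] ℝ} {x : M} (h : η =ᶠ[𝓝 x] η') :
    dForm I η x = dForm I η' x := by
  unfold dForm
  rw [(eventually_formInChart_congr h).fderiv_eq]

theorem DiffFormAt.congr {η η' : M → E →L[ℝ] ℝ} {x : M} (hη : DiffFormAt I η x)
    (h : η =ᶠ[𝓝 x] η') : DiffFormAt I η' x := by
  unfold DiffFormAt at *
  rwa [← (eventually_formInChart_congr h).differentiableAt_iff]

theorem formInChart_add (η η' : M → E →L[ℝ] ℝ) (x : M) :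
    formInChart I (fun q => η q + η' q) x
      = fun z => formInChart I η x z + formInChart I η' x z := by
  ext z v; simp [formInChart_eq]

theorem formInChart_smul (f : M → ℝ) (η : M → E →L[ℝ] ℝ) (x : M) :
    formInChart I (fun q => f q • η q) x
      = fun z => f ((extChartAt I x).symm z) • formInChart I η x z := by
  ext z v; simp [formInChart_eq]

theorem DiffFormAt.add {η η' : M → E →L[ℝ] ℝ} {x : M} (hη : DiffFormAt I η x)
    (hη' : DiffFormAt I η' x) : DiffFormAt I (fun q => η q + η' q) x := by
  unfold DiffFormAt at *
  rw [formInChart_add]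
  exact hη.add hη'

theorem dForm_add {η η' : M → E →L[ℝ] ℝ} {x : M} (hη : DiffFormAt I η x)
    (hη' : DiffFormAt I η' x) (v w : E) :
    dForm I (fun q => η q + η' q) x v w = dForm I η x v w + dForm I η' x v w := by
  unfold DiffFormAt at *
  rw [dForm_apply, formInChart_add, fderiv_fun_add hη hη', dForm_apply, dForm_apply]
  simp only [add_apply]
  ring

theorem hasFDerivAt_comp_extChartAt_symm {f : M → E'} {x : M}
    (hf : MDifferentiableAt I 𝓘(ℝ, E') f x) :
    HasFDerivAt (fun z => f ((extChartAt I x).symm z)) (md I 𝓘(ℝ, E') f x) (extChartAt I x x) := by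
  have h := hf.differentiableWithinAt_writtenInExtChartAt
  rw [I.range_eq_univ, differentiableWithinAt_univ] at h
  rw [md_eq_fderiv_inChart hf]
  exact h.hasFDerivAt

theorem DiffFormAt.smul {f : M → ℝ} {η : M → E →L[ℝ] ℝ} {x : M} (hη : DiffFormAt I η x)
    (hf : MDifferentiableAt I 𝓘₁ f x) : DiffFormAt I (fun q => f q • η q) x := by
  unfold DiffFormAt at *
  rw [formInChart_smul]
  exact (hasFDerivAt_comp_extChartAt_symm hf).differentiableAt.smul hη

/-- The Leibniz rule `d(f η) = df ∧ η + f dη`. -/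
theorem dForm_smul {f : M → ℝ} {η : M → E →L[ℝ] ℝ} {x : M} (hη : DiffFormAt I η x)
    (hf : MDifferentiableAt I 𝓘₁ f x) (v w : E) :
    dForm I (fun q => f q • η q) x v w
      = md I 𝓘₁ f x v * η x w - md I 𝓘₁ f x w * η x v + f x * dForm I η x v w := by
  unfold DiffFormAt at *
  have h := hasFDerivAt_comp_extChartAt_symm hf
  have e : formInChart I η x (extChartAt I x x) = η x := by
    have := form_eq_formInChart_comp (I := I) η (mem_chart_source H x)
    rw [md_extChartAt_self, ContinuousLinearMap.comp_id] at this
    exact this.symm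
  have e1 : (extChartAt I x).symm (extChartAt I x x) = x := by simp
  rw [dForm_apply, formInChart_smul, (h.fun_smul hη.hasFDerivAt).fderiv, dForm_apply]
  simp only [add_apply, smul_apply, ContinuousLinearMap.smulRight_apply, smul_eq_mul, e, e1]
  ring

theorem SmoothForm.contDiffOn_formInChart [FiniteDimensional ℝ E] {η : M → E →L[ℝ] ℝ}
    (hη : SmoothForm I η) (x : M) :
    ContDiffOn ℝ ∞ (formInChart I η x) (extChartAt I x).target := by
  rw [contDiffOn_clm_apply]
  intro v z hz
  have h1 : ContMDiffAt 𝓘(ℝ, E) I.tangent ∞ (fun z => tangentMap 𝓘(ℝ, E) I (extChartAt I x).symm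
      (⟨z, v⟩ : TangentBundle 𝓘(ℝ, E) E)) z :=
    ContMDiffAt.comp z (contMDiffAt_tangentMap (p := (⟨z, v⟩ : TangentBundle 𝓘(ℝ, E) E))
      (contMDiffAt_extChartAt_symm hz))
      (contMDiffAt_tangentBundle_vectorSpace contMDiffAt_id contMDiffAt_const)
  exact (contMDiffAt_iff_contDiffAt.1 ((hη _).comp z h1)).contDiffWithinAt

theorem SmoothForm.contDiffAt_formInChart [FiniteDimensional ℝ E] {η : M → E →L[ℝ] ℝ}
    (hη : SmoothForm I η) (x : M) {z : E} (hz : z ∈ (extChartAt I x).target) :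
    ContDiffAt ℝ ∞ (formInChart I η x) z :=
  (hη.contDiffOn_formInChart x).contDiffAt ((isOpen_extChartAt_target x).mem_nhds hz)

theorem SmoothForm.diffFormAt [FiniteDimensional ℝ E] {η : M → E →L[ℝ] ℝ}
    (hη : SmoothForm I η) (x : M) : DiffFormAt I η x :=
  (hη.contDiffAt_formInChart x (mem_extChartAt_target x)).differentiableAt (by simp)

end Forms

section InverseFunction

variable {E : Type*} [NormedAddCommGroup E] [NormedSpace ℝ E]
  {H : Type*} [TopologicalSpace H] {I : ModelWithCorners ℝ E H}
  {M : Type*} [TopologicalSpace M] [ChartedSpace H M] [IsManifold I ∞ M]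
  {E' : Type*} [NormedAddCommGroup E'] [NormedSpace ℝ E']
  {H' : Type*} [TopologicalSpace H'] {I' : ModelWithCorners ℝ E' H'}
  {M' : Type*} [TopologicalSpace M'] [ChartedSpace H' M'] [IsManifold I' ∞ M']
  [I.Boundaryless] [I'.Boundaryless]

/-! ### The inverse function theorem on manifolds -/

/-- A smooth map with bijective differentials on an open set has smooth local inverses. -/
theorem exists_local_inverse [CompleteSpace E] [CompleteSpace E'] {f : M → M'} {A : Set M} (hA : IsOpen A)
    (hf : ContMDiffOn I I' ∞ f A) (hb : ∀ q ∈ A, Bijective (md I I' f q))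
    {x : M} (hx : x ∈ A) :
    ∃ (g : M' → M) (O : Set M'), IsOpen O ∧ f x ∈ O ∧ ContMDiffOn I' I ∞ g O ∧
      (∀ z ∈ O, g z ∈ A ∧ f (g z) = z) ∧ g (f x) = x ∧ ∀ᶠ q in 𝓝 x, g (f q) = q := by
  have hI : IsManifold I 1 M := IsManifold.of_le (n := ∞) (by norm_cast)
  have hI' : IsManifold I' 1 M' := IsManifold.of_le (n := ∞) (by norm_cast)
  set φ := extChartAt I x with hφ
  set φ' := extChartAt I' (f x) with hφ'
  set F : E → E' := writtenInExtChartAt I I' x f with hF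
  set A' : Set M := A ∩ f ⁻¹' φ'.source with hA'
  have hA'o : IsOpen A' :=
    hf.continuousOn.isOpen_inter_preimage hA (isOpen_extChartAt_source (f x))
  -- the part of the chart on which the coordinate expression `F` of `f` is defined
  set B : Set E := φ.target ∩ φ.symm ⁻¹' A' with hB
  have hBo : IsOpen B :=
    (continuousOn_extChartAt_symm (I := I) x).isOpen_inter_preimage
      (isOpen_extChartAt_target x) hA'o
  have hfa : ∀ q ∈ A, ContMDiffAt I I' ∞ f q := fun q hq => hf.contMDiffAt (hA.mem_nhds hq)
  have hFs : ∀ z ∈ B, ContDiffAt ℝ ∞ F z := by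
    intro z hz
    rw [← contMDiffAt_iff_contDiffAt]
    have h1 := contMDiffAt_extChartAt_symm (I := I) hz.1
    have h2 := hfa _ hz.2.1
    have h3 : ContMDiffAt I' 𝓘(ℝ, E') ∞ φ' (f (φ.symm z)) :=
      contMDiffAt_extChartAt' (by rw [← extChartAt_source (I := I')]; exact hz.2.2)
    exact h3.comp z (h2.comp z h1)
  have hFb : ∀ z ∈ B, Bijective (fderiv ℝ F z) := by
    intro z hz
    have hs : φ.symm z ∈ (chartAt H x).source := by
      rw [← extChartAt_source (I := I)]; exact φ.map_target hz.1
    have hs' : f (φ.symm z) ∈ (chartAt H' (f x)).source := by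
      rw [← extChartAt_source (I := I')]; exact hz.2.2
    have h1 := mdifferentiableAt_extChartAt_symm (I := I) hz.1
    have h2 := (hfa _ hz.2.1).mdifferentiableAt (by simp)
    have h3 : MDifferentiableAt I' 𝓘(ℝ, E') φ' (f (φ.symm z)) := mdifferentiableAt_extChartAt hs'
    have e : fderiv ℝ F z = (md I' 𝓘(ℝ, E') φ' (f (φ.symm z))).comp
        ((md I I' f (φ.symm z)).comp (md 𝓘(ℝ, E) I φ.symm z)) := by
      rw [← md_comp h2 h1, ← md_comp (f := fun z => f (φ.symm z)) h3 (h2.comp z h1), md_eq_fderiv]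
      rfl
    have b1 : Bijective (md I' 𝓘(ℝ, E') φ' (f (φ.symm z))) :=
      ⟨LeftInverse.injective (g := md 𝓘(ℝ, E') I' φ'.symm (φ' (f (φ.symm z))))
        fun v => DFunLike.congr_fun (md_symm_comp_md_extChartAt hs') v,
      RightInverse.surjective (g := md 𝓘(ℝ, E') I' φ'.symm (φ' (f (φ.symm z))))
        fun v => DFunLike.congr_fun (md_extChartAt_comp_md_symm hs') v⟩
    have b2 : Bijective (md 𝓘(ℝ, E) I φ.symm z) := by
      have ez : φ (φ.symm z) = z := φ.right_inv hz.1
      have c1 := md_symm_comp_md_extChartAt (I := I) hs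
      have c2 := md_extChartAt_comp_md_symm (I := I) hs
      rw [← hφ, ez] at c1 c2
      exact ⟨LeftInverse.injective (g := md I 𝓘(ℝ, E) φ (φ.symm z))
        fun v => DFunLike.congr_fun c2 v,
      RightInverse.surjective (g := md I 𝓘(ℝ, E) φ (φ.symm z))
        fun v => DFunLike.congr_fun c1 v⟩
    rw [e]
    exact b1.comp ((hb _ hz.2.1).comp b2)
  have hequiv : ∀ z ∈ B, ∃ L : E ≃L[ℝ] E', HasFDerivAt F (L : E →L[ℝ] E') z := by
    intro z hz
    refine ⟨ContinuousLinearEquiv.ofBijective (fderiv ℝ F z)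
      (LinearMap.ker_eq_bot.2 (hFb z hz).1) (LinearMap.range_eq_top.2 (hFb z hz).2), ?_⟩
    rw [ContinuousLinearEquiv.coe_ofBijective]
    exact ((hFs z hz).differentiableAt (by simp)).hasFDerivAt
  have hx0 : φ x ∈ B := by
    refine ⟨mem_extChartAt_target x, ?_⟩
    simp [hφ, hA', hx, hφ']
  obtain ⟨L, hL⟩ := hequiv _ hx0
  set e := (hFs _ hx0).toOpenPartialHomeomorph F hL (by simp) with he
  have hecoe : ∀ z, e z = F z := fun z => rfl
  have hxe : φ x ∈ e.source := (hFs _ hx0).mem_toOpenPartialHomeomorph_source hL (by simp)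
  have hFx : F (φ x) = φ' (f x) := by simp [hF, hφ, hφ', writtenInExtChartAt]
  set T : Set E' := e.target ∩ e.symm ⁻¹' B with hT
  have hTo : IsOpen T := e.continuousOn_symm.isOpen_inter_preimage e.open_target hBo
  refine ⟨fun z => φ.symm (e.symm (φ' z)), φ'.source ∩ φ' ⁻¹' T, ?_, ?_, ?_, ?_, ?_, ?_⟩
  · exact (continuousOn_extChartAt (I := I') (f x)).isOpen_inter_preimage
      (isOpen_extChartAt_source (f x)) hTo
  · refine ⟨mem_extChartAt_source (f x), ?_⟩
    rw [mem_preimage, ← hFx, hT]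
    refine ⟨e.map_source hxe, ?_⟩
    rw [mem_preimage, ← hecoe, e.left_inv hxe]
    exact hx0
  · intro z hz
    have h1 : ContMDiffAt I' 𝓘(ℝ, E') ∞ φ' z :=
      contMDiffAt_extChartAt' (by rw [← extChartAt_source (I := I')]; exact hz.1)
    obtain ⟨L', hL'⟩ := hequiv _ hz.2.2
    have h2 : ContDiffAt ℝ ∞ e.symm (φ' z) :=
      e.contDiffAt_symm hz.2.1 hL' (hFs _ hz.2.2)
    have h3 := contMDiffAt_extChartAt_symm (I := I) hz.2.2.1
    exact (h3.comp z (h2.contMDiffAt.comp z h1)).contMDiffWithinAt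
  · intro z hz
    refine ⟨hz.2.2.2.1, ?_⟩
    have h1 : F (e.symm (φ' z)) = φ' z := e.right_inv hz.2.1
    exact φ'.injOn hz.2.2.2.2 hz.1 h1
  · beta_reduce
    rw [← hFx, ← hecoe, e.left_inv hxe]
    simp [hφ]
  · have hc : ContinuousAt φ x := continuousAt_extChartAt x
    filter_upwards [hc (e.open_source.mem_nhds hxe), extChartAt_source_mem_nhds (I := I) x]
      with q hq hq'
    have h1 : φ' (f q) = F (φ q) := by
      simp only [hF, writtenInExtChartAt, Function.comp_apply]
      rw [φ.left_inv hq']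
    rw [h1, ← hecoe, e.left_inv hq, φ.left_inv hq']

/-- If `η₀ = g^* η` for the local inverse `g` of `f`, then `dη` is computed from `dη₀`. -/
theorem dForm_of_local_inverse {f : M → M'} {g : M' → M} {x : M} (hf : ContMDiffAt I I' ∞ f x)
    (hg : ContMDiffAt I' I ∞ g (f x)) (hgx : g (f x) = x) (hgf : ∀ᶠ q in 𝓝 x, g (f q) = q)
    {η : M' → E' →L[ℝ] ℝ} {η₀ : M → E →L[ℝ] ℝ} (hη₀ : DiffFormAt I η₀ x)
    (h : η =ᶠ[𝓝 (f x)] pullForm I' I g η₀) :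
    DiffFormAt I' η (f x) ∧ ∀ v w, dForm I' η (f x) (md I I' f x v) (md I I' f x w)
      = dForm I η₀ x v w := by
  have hη' : DiffFormAt I η₀ (g (f x)) := by rwa [hgx]
  refine ⟨(hη'.pullForm hg).congr h.symm, fun v w => ?_⟩
  have h1 : (md I' I g (f x)).comp (md I I' f x) = ContinuousLinearMap.id ℝ E := by
    rw [← md_comp (hg.mdifferentiableAt (by simp)) (hf.mdifferentiableAt (by simp)),
      md_congr (g := fun q => q) hgf, md_id]
  have h2 : ∀ v, md I' I g (f x) (md I I' f x v) = v := fun v => DFunLike.congr_fun h1 v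
  rw [dForm_congr h, dForm_pullForm hη' hg, h2, h2, hgx]

end InverseFunction

section Cylinder

variable {S : Type} [TopologicalSpace S] [ChartedSpace (EuclideanSpace ℝ (Fin 2)) S]
  [IsManifold (𝓡 2) ∞ S] {P : ℝ × ℝ → S} {A : Set (ℝ × ℝ)}

/-! ### Embedded cylinders -/

theorem IsCylEmbedding.bijective (hP : IsCylEmbedding P A) {p : ℝ × ℝ} (hp : p ∈ A) :
    Bijective (md 𝓘₂ (𝓡 2) P p) := by
  have hi : Injective (md 𝓘₂ (𝓡 2) P p) := hP.immersion p hp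
  refine ⟨hi, ?_⟩
  exact (LinearMap.injective_iff_surjective_of_finrank_eq_finrank
    (f := (md 𝓘₂ (𝓡 2) P p : (ℝ × ℝ) →ₗ[ℝ] EuclideanSpace ℝ (Fin 2)))
    (by simp)).1 hi

theorem IsCylEmbedding.exists_local_inverse (hP : IsCylEmbedding P A) (hA : IsOpen A)
    {p : ℝ × ℝ} (hp : p ∈ A) :
    ∃ (g : S → ℝ × ℝ) (O : Set S), IsOpen O ∧ P p ∈ O ∧ ContMDiffOn (𝓡 2) 𝓘₂ ∞ g O ∧
      (∀ z ∈ O, g z ∈ A ∧ P (g z) = z) ∧ g (P p) = p ∧ ∀ᶠ q in 𝓝 p, g (P q) = q :=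
  SpinalFoliation.exists_local_inverse hA hP.smooth (fun _ hq => hP.bijective hq) hp

theorem IsCylEmbedding.contMDiffAt (hP : IsCylEmbedding P A) (hA : IsOpen A)
    {p : ℝ × ℝ} (hp : p ∈ A) : ContMDiffAt 𝓘₂ (𝓡 2) ∞ P p :=
  hP.smooth.contMDiffAt (hA.mem_nhds hp)

theorem IsCylEmbedding.isOpen_image (hP : IsCylEmbedding P A) (hA : IsOpen A)
    {B : Set (ℝ × ℝ)} (hB : IsOpen B) (hBA : B ⊆ A) : IsOpen (P '' B) := by
  rw [isOpen_iff_mem_nhds]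
  rintro _ ⟨p, hp, rfl⟩
  obtain ⟨g, O, hO, hpO, hg, hgO, hgp, -⟩ := hP.exists_local_inverse hA (hBA hp)
  have : ContinuousAt g (P p) := hg.continuousOn.continuousAt (hO.mem_nhds hpO)
  filter_upwards [hO.mem_nhds hpO, this (by rw [hgp]; exact hB.mem_nhds hp)] with z hz hz'
  exact ⟨g z, hz', (hgO z hz).2⟩

theorem IsCylEmbedding.periodic_int (hP : IsCylEmbedding P A) (s t : ℝ) (m : ℤ) :
    P (s, t + m) = P (s, t) := by
  have : Function.Periodic (fun t => P (s, t)) 1 := fun t => hP.periodic s t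
  simpa using (this.int_mul m) t

theorem IsCylEmbedding.md_periodic (hP : IsCylEmbedding P A) (hA : IsOpen A)
    {s t : ℝ} (hp : (s, t) ∈ A) (m : ℤ) :
    md 𝓘₂ (𝓡 2) P (s, t + m) = md 𝓘₂ (𝓡 2) P (s, t) := by
  have h1 : P = fun q => P (q + (0, (-m : ℝ))) := by
    ext q
    have := hP.periodic_int q.1 q.2 (-m)
    push_cast at this
    exact ((congrArg P (by ext <;> simp)).trans this).symm
  have h2 : HasFDerivAt (fun q : ℝ × ℝ => q + (0, (-m : ℝ)))
      (ContinuousLinearMap.id ℝ (ℝ × ℝ)) (s, t + m) := (hasFDerivAt_id _).add_const _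
  have e : (s, t + (m : ℝ)) + (0, (-m : ℝ)) = (s, t) := by ext <;> simp
  have h3 : MDifferentiableAt 𝓘₂ (𝓡 2) P ((s, t + (m : ℝ)) + (0, (-m : ℝ))) := by
    rw [e]; exact (hP.contMDiffAt hA hp).mdifferentiableAt (by simp)
  have h4 := md_comp (I := 𝓘₂) (f := fun q : ℝ × ℝ => q + (0, (-m : ℝ))) h3
    h2.differentiableAt.mdifferentiableAt
  rw [← h1, md_eq_fderiv, h2.fderiv, ContinuousLinearMap.comp_id, e] at h4
  exact h4

end Cylinder

section CylForm

variable {E : Type*} [NormedAddCommGroup E] [NormedSpace ℝ E]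
  {H : Type*} [TopologicalSpace H] {I : ModelWithCorners ℝ E H}
  {M : Type*} [TopologicalSpace M] [ChartedSpace H M] [IsManifold I ∞ M]
  [I.Boundaryless]

theorem formInChart_vectorSpace (η : E → E →L[ℝ] ℝ) (x : E) : formInChart 𝓘(ℝ, E) η x = η := by
  ext z v
  have : md 𝓘(ℝ, E) 𝓘(ℝ, E) (fun y : E => y) z = ContinuousLinearMap.id ℝ E := md_id
  exact congrArg (η z) (DFunLike.congr_fun this v)

theorem diffFormAt_vectorSpace {η : E → E →L[ℝ] ℝ} {x : E} :
    DiffFormAt 𝓘(ℝ, E) η x ↔ DifferentiableAt ℝ η x := by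
  unfold DiffFormAt
  rw [formInChart_vectorSpace]; rfl

theorem dForm_vectorSpace (η : E → E →L[ℝ] ℝ) (x v w : E) :
    dForm 𝓘(ℝ, E) η x v w = fderiv ℝ η x v w - fderiv ℝ η x w v := by
  rw [dForm_apply, formInChart_vectorSpace]; rfl

/-- The `θ`-invariant form `A + b dθ` on `M × ℝ`. -/
def cylForm (A : M → E →L[ℝ] ℝ) (b : M → ℝ) (q : M × ℝ) : (E × ℝ) →L[ℝ] ℝ :=
  (A q.1).comp (fst ℝ E ℝ) + b q.1 • snd ℝ E ℝ

theorem cylForm_eq (A : M → E →L[ℝ] ℝ) (b : M → ℝ) : cylForm A b =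
    fun q : M × ℝ => pullForm (I.prod 𝓘₁) I (fun q : M × ℝ => q.1) A q
      + b q.1 • pullForm (I.prod 𝓘₁) 𝓘₁ (fun q : M × ℝ => q.2)
        (fun _ => ContinuousLinearMap.id ℝ ℝ) q := by
  ext q v
  · rw [pullForm, pullForm, md_fst, md_snd]; rfl
  · rw [pullForm, pullForm, md_fst, md_snd]; rfl

theorem dForm_pullForm_const {V : Type*} [NormedAddCommGroup V] [NormedSpace ℝ V] {f : M → V}
    {x : M} (hf : ContMDiffAt I 𝓘(ℝ, V) ∞ f x) (c : V →L[ℝ] ℝ) :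
    DiffFormAt I (pullForm I 𝓘(ℝ, V) f fun _ => c) x ∧
      ∀ v w, dForm I (pullForm I 𝓘(ℝ, V) f fun _ => c) x v w = 0 := by
  have h0 : DiffFormAt 𝓘(ℝ, V) (fun _ : V => c) (f x) :=
    diffFormAt_vectorSpace.2 (differentiableAt_const _)
  refine ⟨h0.pullForm hf, fun v w => ?_⟩
  rw [dForm_pullForm h0 hf, dForm_vectorSpace]
  simp

/-- The formula `d(A + b dθ) = dA + db ∧ dθ`. -/
theorem dForm_cylForm {A : M → E →L[ℝ] ℝ} {b : M → ℝ} {p : M} {θ : ℝ} (hA : DiffFormAt I A p)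
    (hb : MDifferentiableAt I 𝓘₁ b p) :
    DiffFormAt (I.prod 𝓘₁) (cylForm A b) (p, θ) ∧ ∀ v w : E × ℝ,
      dForm (I.prod 𝓘₁) (cylForm A b) (p, θ) v w
      = dForm I A p v.1 w.1 + (md I 𝓘₁ b p v.1 * w.2 - md I 𝓘₁ b p w.1 * v.2) := by
  have s1 : ContMDiffAt (I.prod 𝓘₁) I ∞ (fun q : M × ℝ => q.1) (p, θ) := contMDiffAt_fst
  have s2 : ContMDiffAt (I.prod 𝓘₁) 𝓘₁ ∞ (fun q : M × ℝ => q.2) (p, θ) :=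
    contMDiffAt_snd
  have h1 := DiffFormAt.pullForm (f := fun q : M × ℝ => q.1) (x := (p, θ)) hA s1
  obtain ⟨h2, h2'⟩ := dForm_pullForm_const s2 (ContinuousLinearMap.id ℝ ℝ)
  have hb1 : MDifferentiableAt (I.prod 𝓘₁) 𝓘₁ (fun q : M × ℝ => b q.1) (p, θ) :=
    MDifferentiableAt.comp (p, θ) hb (s1.mdifferentiableAt (by simp))
  have h3 := h2.smul hb1
  have hsum := h1.add h3
  have e := cylForm_eq (I := I) A b
  refine ⟨hsum.congr (Eventually.of_forall fun q => (congrFun e q).symm), fun v w => ?_⟩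
  have e1 := dForm_add h1 h3 v w
  have e2 := dForm_smul h2 hb1 v w
  have e3 : dForm (I.prod 𝓘₁) (pullForm (I.prod 𝓘₁) I (fun q : M × ℝ => q.1) A) (p, θ) v w
      = dForm I A p (md (I.prod 𝓘₁) I (fun q : M × ℝ => q.1) (p, θ) v)
        (md (I.prod 𝓘₁) I (fun q : M × ℝ => q.1) (p, θ) w) :=
    dForm_pullForm (f := fun q : M × ℝ => q.1) (η := A) (x := (p, θ)) hA s1 v w
  have e4 := h2' v w
  have e5 := md_comp (x := (p, θ)) (g := b) (f := fun q : M × ℝ => q.1) hb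
    (s1.mdifferentiableAt (by simp))
  rw [md_fst] at e3 e5
  rw [e3, e2, e4, e5, pullForm, md_snd] at e1
  refine (DFunLike.congr_fun (DFunLike.congr_fun (congrArg
    (fun f => dForm (I.prod 𝓘₁) f (p, θ)) e) v) w).trans (e1.trans ?_)
  simp

end CylForm

variable {n : ℕ} {Y S : Type}
  [TopologicalSpace Y] [ChartedSpace (EY n) Y] [IsManifold (𝓡 (2 * n - 1)) ∞ Y]
  [TopologicalSpace S] [ChartedSpace ES S] [IsManifold (𝓡 2) ∞ S]
  {k g : ℕ} {D : ModelData n Y S k g}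
  {J : Y × S → (ℝ × (EY n × ES)) →L[ℝ] (ℝ × (EY n × ES))}

namespace ModelData

variable (D)

/-! ### Cylindrical coordinates -/

theorem isOpen_longCyl (δ : ℝ) : IsOpen (longCyl δ) :=
  isOpen_lt (continuous_fst.abs) continuous_const

/-- The coordinates `((y, τ), θ)` on the part of `Y × S` over the `i`-th cylinder. -/
def coord (i : Fin k) (q : (Y × ℝ) × ℝ) : Y × S := (q.1.1, D.c i (q.1.2, q.2))

/-- The differential of `coord`. -/
def dcoord (i : Fin k) (p : ℝ × ℝ) (x : (EY n × ℝ) × ℝ) : EY n × ES :=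
  (x.1.1, x.1.2 • D.dtau i p + x.2 • D.dtheta i p)

theorem md_c (i : Fin k) (p : ℝ × ℝ) (a b : ℝ) :
    md 𝓘₂ (𝓡 2) (D.c i) p (a, b) = a • D.dtau i p + b • D.dtheta i p := by
  have : ((a, b) : ℝ × ℝ) = a • (1, 0) + b • (0, 1) := by ext <;> simp
  rw [this, map_add, map_smul, map_smul]
  rfl

theorem contMDiffAt_c (i : Fin k) {p : ℝ × ℝ} (hp : |p.1| < 1 + D.δ) :
    ContMDiffAt 𝓘₂ (𝓡 2) ∞ (D.c i) p :=
  (D.c_emb i).contMDiffAt (isOpen_longCyl _) hp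

theorem contMDiffAt_tauTheta (q : (Y × ℝ) × ℝ) : ContMDiffAt (𝓘C n) 𝓘₂ ∞
    (fun q : (Y × ℝ) × ℝ => (q.1.2, q.2)) q :=
  (contMDiffAt_snd.comp q contMDiffAt_fst).prodMk_space contMDiffAt_snd

theorem contMDiffAt_coord (i : Fin k) {q : (Y × ℝ) × ℝ} (hq : |q.1.2| < 1 + D.δ) :
    ContMDiffAt (𝓘C n) (IYS n) ∞ (D.coord i) q := by
  have h1 : ContMDiffAt (𝓘C n) (𝓡 (2 * n - 1)) ∞
      (fun q : (Y × ℝ) × ℝ => q.1.1) q := contMDiffAt_fst.comp q contMDiffAt_fst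
  have h2 : ContMDiffAt (𝓘C n) (𝓡 2) ∞
      (fun q : (Y × ℝ) × ℝ => D.c i (q.1.2, q.2)) q :=
    ContMDiffAt.comp q (D.contMDiffAt_c i (p := (q.1.2, q.2)) hq) (contMDiffAt_tauTheta (n := n) q)
  exact h1.prodMk h2

theorem md_coord (i : Fin k) {q : (Y × ℝ) × ℝ} (hq : |q.1.2| < 1 + D.δ) (x : (EY n × ℝ) × ℝ) :
    md (𝓘C n) (IYS n) (D.coord i) q x = D.dcoord i (q.1.2, q.2) x := by
  have f1 : ContMDiffAt (𝓘C n) (IYR n) ∞ (fun q : (Y × ℝ) × ℝ => q.1) q :=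
    contMDiffAt_fst
  have f2 : ContMDiffAt (𝓘C n) 𝓘₁ ∞ (fun q : (Y × ℝ) × ℝ => q.2) q :=
    contMDiffAt_snd
  have f3 : ContMDiffAt (IYR n) (𝓡 (2 * n - 1)) ∞ (fun q : Y × ℝ => q.1) q.1 :=
    contMDiffAt_fst
  have f4 : ContMDiffAt (IYR n) 𝓘₁ ∞ (fun q : Y × ℝ => q.2) q.1 :=
    contMDiffAt_snd
  have e1 := md_comp (f3.mdifferentiableAt (by simp)) (f1.mdifferentiableAt (by simp))
  have e2 := md_comp (f4.mdifferentiableAt (by simp)) (f1.mdifferentiableAt (by simp))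
  have f5 := f4.comp q f1
  have e3 := md_space_prodMk (f5.mdifferentiableAt (by simp)) (f2.mdifferentiableAt (by simp))
  have hc := D.contMDiffAt_c i (p := (q.1.2, q.2)) hq
  have e4 := md_comp (f := fun q : (Y × ℝ) × ℝ => (q.1.2, q.2)) (x := q)
    (hc.mdifferentiableAt (by simp)) ((contMDiffAt_tauTheta (n := n) q).mdifferentiableAt (by simp))
  have h2 := hc.comp q (contMDiffAt_tauTheta (n := n) (Y := Y) q)
  have e5 := md_prodMk ((f3.comp q f1).mdifferentiableAt (by simp))
    (h2.mdifferentiableAt (by simp))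
  refine (DFunLike.congr_fun e5 x).trans ?_
  refine Prod.ext ?_ ?_
  · refine (DFunLike.congr_fun e1 x).trans ?_
    rw [md_fst, md_fst]; rfl
  · refine (DFunLike.congr_fun e4 x).trans ?_
    rw [ContinuousLinearMap.comp_apply]
    have : md (𝓘C n) 𝓘₂ (fun q : (Y × ℝ) × ℝ => (q.1.2, q.2)) q x
        = (x.1.2, x.2) := by
      refine (DFunLike.congr_fun e3 x).trans (Prod.ext ?_ ?_)
      · refine (DFunLike.congr_fun e2 x).trans ?_
        rw [md_fst, md_snd]; rfl
      · exact DFunLike.congr_fun md_snd x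
    rw [this, md_c]; rfl

theorem dcoord_bijective (i : Fin k) {p : ℝ × ℝ} (hp : |p.1| < 1 + D.δ) :
    Bijective (D.dcoord i p) := by
  have hb := (D.c_emb i).bijective (p := p) hp
  constructor
  · intro x x' h
    have h1 := congrArg Prod.fst h
    have h2 := congrArg Prod.snd h
    simp only [dcoord] at h1 h2
    rw [← md_c, ← md_c] at h2
    have h3 := hb.1 h2
    rw [Prod.mk.injEq] at h3
    exact Prod.ext (Prod.ext h1 h3.1) h3.2
  · intro v
    obtain ⟨⟨a, b⟩, hab⟩ := hb.2 v.2
    rw [md_c] at hab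
    exact ⟨((v.1, a), b), Prod.ext rfl hab⟩

theorem exists_local_inverse_coord (i : Fin k) {q : (Y × ℝ) × ℝ} (hq : |q.1.2| < 1 + D.δ) :
    ∃ (G : Y × S → (Y × ℝ) × ℝ) (O : Set (Y × S)), IsOpen O ∧ D.coord i q ∈ O ∧
      ContMDiffOn (IYS n) (𝓘C n) ∞ G O ∧
      (∀ m ∈ O, |(G m).1.2| < 1 + D.δ ∧ D.coord i (G m) = m) ∧ G (D.coord i q) = q ∧
      ∀ᶠ q' in 𝓝 q, G (D.coord i q') = q' := by
  have ho : IsOpen {q : (Y × ℝ) × ℝ | |q.1.2| < 1 + D.δ} :=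
    isOpen_lt (by fun_prop) continuous_const
  refine SpinalFoliation.exists_local_inverse (I := (IYR n).prod 𝓘₁) (I' := IYS n)
    (f := D.coord i) ho
    (fun q hq => (D.contMDiffAt_coord i hq).contMDiffWithinAt) (fun q hq => ?_) hq
  have : ⇑(md (𝓘C n) (IYS n) (D.coord i) q) = D.dcoord i (q.1.2, q.2) :=
    funext fun x => D.md_coord i hq x
  rw [this]
  exact D.dcoord_bijective i hq

theorem tau_c (i : Fin k) {p : ℝ × ℝ} (hp : |p.1| < 1 + D.δ) : D.tau (D.c i p) = p.1 := by
  have hz : ∃ τ : ℝ, |τ| < 1 + D.δ ∧ ∃ (i' : Fin k) (θ : ℝ), D.c i' (τ, θ) = D.c i p :=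
    ⟨p.1, hp, i, p.2, rfl⟩
  unfold tau
  rw [dif_pos hz]
  obtain ⟨h1, i', θ, h2⟩ := hz.choose_spec
  have hi : i' = i := by
    by_contra hne
    refine Set.disjoint_left.1 (D.c_disj i' i hne)
      (mem_image_of_mem (D.c i') (show (hz.choose, θ) ∈ longCyl D.δ from h1)) ?_
    rw [h2]
    exact mem_image_of_mem _ hp
  subst hi
  exact ((D.c_emb i').inj _ h1 _ hp h2).1

theorem lam_dcoord (i : Fin k) {p : ℝ × ℝ} (hp : |p.1| < 1 + D.δ) (a b : ℝ) :
    D.lam (D.c i p) (a • D.dtau i p + b • D.dtheta i p) = b * exp (D.G p.1) := by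
  have h1 : D.lam (D.c i p) (D.dtau i p) = 0 := (D.lam_cyl i p hp).1
  have h2 : D.lam (D.c i p) (D.dtheta i p) = exp (D.G p.1) := (D.lam_cyl i p hp).2
  rw [map_add, map_smul, map_smul, h1, h2]
  simp

/-- The 1-form `e^{ε H} σ(F) α_{F}` on `Y × ℝ`. -/
def alphaForm (p : Y × ℝ) : (EY n × ℝ) →L[ℝ] ℝ :=
  (exp (D.ε * D.H (p.1, D.F p.2)) * D.σ (D.F p.2)) •
    (D.al (D.F p.2) p.1).comp (fst ℝ (EY n) ℝ)

/-- The function `e^{G + ε H}` on `Y × ℝ`. -/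
def height (p : Y × ℝ) : ℝ := exp (D.Gε p.1 p.2)

/-- The function `β(G) e^{G + ε H}`, the value of `Λ` on `∂_θ`. -/
def cutHeight (p : Y × ℝ) : ℝ := D.β (D.G p.2) * D.height p

theorem height_eq (p : Y × ℝ) :
    D.height p = exp (D.ε * D.H (p.1, D.F p.2)) * exp (D.G p.2) := by
  rw [height, Gε, ← Real.exp_add, add_comm]

theorem Lam_coord (i : Fin k) {q : (Y × ℝ) × ℝ} (hq : |q.1.2| < 1 + D.δ) (x : (EY n × ℝ) × ℝ) :
    D.Lam (D.coord i q) (D.dcoord i (q.1.2, q.2) x) = cylForm D.alphaForm D.cutHeight q x := by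
  have ht := D.tau_c i (p := (q.1.2, q.2)) hq
  have hl := D.lam_dcoord i (p := (q.1.2, q.2)) hq x.1.2 x.2
  simp only [Lam, r, coord, dcoord, cylForm, alphaForm, cutHeight, ht, height_eq, add_apply,
    smul_apply, ContinuousLinearMap.comp_apply, ContinuousLinearMap.coe_fst',
    ContinuousLinearMap.coe_snd', smul_eq_mul, hl]
  ring

theorem primitive_coord (i : Fin k) {q : (Y × ℝ) × ℝ} (hq : |q.1.2| < 1 + D.δ)
    (x : (EY n × ℝ) × ℝ) :
    D.primitive (D.coord i q) (D.dcoord i (q.1.2, q.2) x) = cylForm D.alphaForm D.height q x := by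
  have ht := D.tau_c i (p := (q.1.2, q.2)) hq
  have hl := D.lam_dcoord i (p := (q.1.2, q.2)) hq x.1.2 x.2
  simp only [primitive, r, coord, dcoord, cylForm, alphaForm, ht, height_eq, add_apply,
    smul_apply, ContinuousLinearMap.comp_apply, ContinuousLinearMap.coe_fst',
    ContinuousLinearMap.coe_snd', smul_eq_mul, hl]
  ring

/-- A 1-form that is `A + b dθ` in cylindrical coordinates has the expected exterior derivative. -/
theorem dForm_coord (i : Fin k) {q : (Y × ℝ) × ℝ} (hq : |q.1.2| < 1 + D.δ)
    {η : Y × S → (EY n × ES) →L[ℝ] ℝ} {A : Y × ℝ → (EY n × ℝ) →L[ℝ] ℝ} {b : Y × ℝ → ℝ}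
    (hη : ∀ q : (Y × ℝ) × ℝ, |q.1.2| < 1 + D.δ → ∀ x,
      η (D.coord i q) (D.dcoord i (q.1.2, q.2) x) = cylForm A b q x)
    (hA : DiffFormAt (IYR n) A q.1) (hb : MDifferentiableAt (IYR n) 𝓘₁ b q.1)
    (v w : (EY n × ℝ) × ℝ) :
    dForm (IYS n) η (D.coord i q) (D.dcoord i (q.1.2, q.2) v) (D.dcoord i (q.1.2, q.2) w)
      = dForm (IYR n) A q.1 v.1 w.1
        + (md (IYR n) 𝓘₁ b q.1 v.1 * w.2 - md (IYR n) 𝓘₁ b q.1 w.1 * v.2) := by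
  obtain ⟨G, O, hO, hqO, hG, hGO, hGq, hGe⟩ := D.exists_local_inverse_coord i hq
  obtain ⟨h1, h2⟩ := dForm_cylForm (I := IYR n) (θ := q.2) hA hb
  have hGs : ContMDiffAt (IYS n) (𝓘C n) ∞ G (D.coord i q) :=
    hG.contMDiffAt (hO.mem_nhds hqO)
  have hη' : η =ᶠ[𝓝 (D.coord i q)]
      pullForm (IYS n) (𝓘C n) G (cylForm A b) := by
    filter_upwards [hO.mem_nhds hqO] with m hm
    obtain ⟨h3, h4⟩ := hGO m hm
    have hGm : ContMDiffAt (IYS n) (𝓘C n) ∞ G m := hG.contMDiffAt (hO.mem_nhds hm)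
    have hcm := D.contMDiffAt_coord i h3
    have e : (md (𝓘C n) (IYS n) (D.coord i) (G m)).comp
        (md (IYS n) (𝓘C n) G m) = ContinuousLinearMap.id ℝ _ := by
      rw [← md_comp (hcm.mdifferentiableAt (by simp)) (hGm.mdifferentiableAt (by simp)),
        md_congr (g := fun m => m), md_id]
      filter_upwards [hO.mem_nhds hm] with m' hm'
      exact (hGO m' hm').2
    refine ContinuousLinearMap.ext fun u => ?_
    have e2 := DFunLike.congr_fun e u
    rw [ContinuousLinearMap.comp_apply, D.md_coord i h3] at e2
    rw [pullForm, ContinuousLinearMap.comp_apply, ← hη _ h3, h4, e2]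
    rfl
  have h5 := (dForm_of_local_inverse (x := q) (D.contMDiffAt_coord i hq) hGs hGq hGe h1 hη').2 v w
  rw [D.md_coord i hq, D.md_coord i hq] at h5
  rw [h5]
  exact h2 v w

/-! ### The profile functions -/

theorem sgn_mul_self (e : Bool) : sgn e * sgn e = 1 := by cases e <;> simp [sgn]

theorem abs_sgn (e : Bool) : |sgn e| = 1 := by cases e <;> simp [sgn]

theorem sgn_mul_le_abs (e : Bool) (x : ℝ) : sgn e * x ≤ |x| := by
  cases e <;> simp [sgn, le_abs_self, neg_le_abs]

theorem exists_sgn (x : ℝ) : ∃ e : Bool, sgn e * x = |x| := by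
  rcases le_total 0 x with h | h
  · exact ⟨true, by simp [sgn, abs_of_nonneg h]⟩
  · exact ⟨false, by simp [sgn, abs_of_nonpos h]⟩

theorem abs_eq_of_sgn_pos {e : Bool} {x : ℝ} (h : 0 ≤ sgn e * x) : |x| = sgn e * x := by
  rw [← abs_of_nonneg h, abs_mul, abs_sgn, one_mul]

theorem F_strictMonoOn : StrictMonoOn D.F (Icc (-(1 + D.δ / 3)) (1 + D.δ / 3)) := by
  refine strictMonoOn_of_deriv_pos (convex_Icc _ _) D.F_smooth.continuous.continuousOn ?_
  intro x hx
  rw [interior_Icc] at hx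
  exact D.F_mono x (abs_lt.2 hx)

theorem sgn_mul_F_lt {e : Bool} {τ τ' : ℝ} (h0 : 0 ≤ sgn e * τ) (h : sgn e * τ < sgn e * τ')
    (h' : sgn e * τ' ≤ 1 + D.δ / 3) : sgn e * D.F τ < sgn e * D.F τ' := by
  have hδ := D.δ_pos
  cases e
  · simp only [sgn] at *
    have := D.F_strictMonoOn (a := τ') (b := τ) ⟨by norm_num at *; linarith, by norm_num at *; linarith⟩
      ⟨by norm_num at *; linarith, by norm_num at *; linarith⟩ (by norm_num at *; linarith)
    norm_num; linarith
  · simp only [sgn] at *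
    have := D.F_strictMonoOn (a := τ) (b := τ') ⟨by norm_num at *; linarith, by norm_num at *; linarith⟩
      ⟨by norm_num at *; linarith, by norm_num at *; linarith⟩ (by norm_num at *; linarith)
    norm_num; linarith

theorem sgn_mul_F_outer {e : Bool} {τ : ℝ} (h : 1 + D.δ / 3 ≤ sgn e * τ) : sgn e * D.F τ = 1 := by
  rw [(D.FG_out e τ h).1, sgn_mul_self]

theorem sgn_mul_F_lt_one {e : Bool} {τ : ℝ} (h0 : 0 ≤ sgn e * τ) (h : sgn e * τ < 1 + D.δ / 3) :
    sgn e * D.F τ < 1 := by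
  have e1 : sgn e * (sgn e * (1 + D.δ / 3)) = 1 + D.δ / 3 := by
    rw [← mul_assoc, sgn_mul_self, one_mul]
  rw [← D.sgn_mul_F_outer (e := e) (τ := sgn e * (1 + D.δ / 3)) e1.ge]
  exact D.sgn_mul_F_lt h0 (by rw [e1]; exact h) e1.le

theorem F_inner {τ : ℝ} (h : |τ| ≤ 1 - D.δ / 3) : D.F τ = τ := (D.FG_in τ h).1

theorem G_inner {τ : ℝ} (h : |τ| ≤ 1 - D.δ / 3) : D.G τ = 0 := (D.FG_in τ h).2

/-- `F` maps the region `±τ > c` to the region `±r > c`, for `c ≤ 1 - δ`. -/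
theorem lt_sgn_mul_F {e : Bool} {τ c : ℝ} (hc0 : 0 ≤ c) (hc : c ≤ 1 - D.δ) (h : c < sgn e * τ) :
    c < sgn e * D.F τ := by
  have hδ := D.δ_pos
  have ha := abs_eq_of_sgn_pos (hc0.trans h.le)
  rcases le_or_gt (sgn e * τ) (1 - D.δ / 3) with h1 | h1
  · rwa [D.F_inner (by rwa [ha])]
  have e1 : sgn e * (sgn e * (1 - D.δ / 3)) = 1 - D.δ / 3 := by
    rw [← mul_assoc, sgn_mul_self, one_mul]
  rcases le_or_gt (sgn e * τ) (1 + D.δ / 3) with h2 | h2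
  · have h3 := D.sgn_mul_F_lt (e := e) (τ := sgn e * (1 - D.δ / 3)) (τ' := τ)
      (by rw [e1]; linarith [D.δ_lt]) (by rwa [e1]) h2
    rw [D.F_inner (τ := sgn e * (1 - D.δ / 3)), e1] at h3
    · linarith
    · rw [abs_mul, abs_sgn, one_mul, abs_of_nonneg (by linarith [D.δ_lt])]
  · rw [D.sgn_mul_F_outer h2.le]; linarith

theorem sgn_mul_F_nonneg {e : Bool} {τ : ℝ} (h : 0 ≤ sgn e * τ) : 0 ≤ sgn e * D.F τ := by
  rcases h.eq_or_lt with h | h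
  · have : τ = 0 := by
      rcases mul_eq_zero.1 h.symm with h | h
      · have := abs_sgn e; rw [h] at this; simp at this
      · exact h
    rw [this, D.F_inner (by simp; linarith [D.δ_lt, D.δ_pos])]
    simp
  · exact (D.lt_sgn_mul_F le_rfl (by linarith [D.δ_lt]) h).le

theorem abs_F_le_one (τ : ℝ) : |D.F τ| ≤ 1 := by
  obtain ⟨e, he⟩ := exists_sgn τ
  have h0 : 0 ≤ sgn e * τ := he ▸ abs_nonneg τ
  rw [abs_eq_of_sgn_pos (D.sgn_mul_F_nonneg h0)]
  rcases lt_or_ge (sgn e * τ) (1 + D.δ / 3) with h | h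
  · exact (D.sgn_mul_F_lt_one h0 h).le
  · exact (D.sgn_mul_F_outer h).le

theorem sgn_mul_deriv_G_nonpos {e : Bool} {τ : ℝ} (h : 0 < sgn e * τ) :
    sgn e * deriv D.G τ ≤ 0 := by
  have hc : Continuous (deriv D.G) := D.G_smooth.continuous_deriv (by norm_cast)
  rcases lt_or_ge (sgn e * τ) (1 - D.δ / 3) with h1 | h1
  · have ha := abs_eq_of_sgn_pos h.le
    have : D.G =ᶠ[𝓝 τ] fun _ => 0 := by
      have : ∀ᶠ x in 𝓝 τ, |x| < 1 - D.δ / 3 :=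
        (isOpen_lt continuous_abs continuous_const).mem_nhds (by rw [mem_ofPred_eq, ha]; exact h1)
      filter_upwards [this] with x hx
      exact D.G_inner hx.le
    rw [this.deriv_eq]; simp
  · have hcl : IsClosed {x : ℝ | sgn e * deriv D.G (sgn e * x) ≤ 0} :=
      isClosed_le (by fun_prop) continuous_const
    have hsub : Ioi (1 - D.δ / 3) ⊆ {x : ℝ | sgn e * deriv D.G (sgn e * x) ≤ 0} := by
      intro x hx
      refine (D.G_mono e (sgn e * x) ?_).le
      rwa [← mul_assoc, sgn_mul_self, one_mul]
    have h2 := closure_minimal hsub hcl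
    rw [closure_Ioi] at h2
    have h3 := h2 (mem_Ici.2 h1)
    rwa [mem_ofPred_eq, ← mul_assoc, sgn_mul_self, one_mul] at h3

theorem deriv_σ_inner {r : ℝ} (h : |r| ≤ 1 - D.δ) : deriv D.σ r = 0 := by
  have hc : Continuous (deriv D.σ) := D.σ_smooth.continuous_deriv (by norm_cast)
  have hcl : IsClosed {x : ℝ | deriv D.σ x = 0} := isClosed_eq hc continuous_const
  have hsub : Ioo (-(1 - D.δ)) (1 - D.δ) ⊆ {x : ℝ | deriv D.σ x = 0} := by
    intro x hx
    have : D.σ =ᶠ[𝓝 x] fun _ => D.ε := by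
      filter_upwards [isOpen_Ioo.mem_nhds hx] with z hz
      exact D.σ_in z (abs_lt.2 hz).le
    rw [mem_ofPred_eq, this.deriv_eq]; simp
  have h2 := closure_minimal hsub hcl
  rw [closure_Ioo (by linarith [D.δ_lt])] at h2
  exact h2 (abs_le.1 h)

theorem σ_pos {r : ℝ} (hr : |r| ≤ 1) : 0 < D.σ r := by
  have hδ := D.δ_lt
  have hδ0 := D.δ_pos
  have hε := D.ε_pos
  rcases le_or_gt |r| (1 - D.δ) with h | h
  · rw [D.σ_in r h]; exact hε
  obtain ⟨e, he⟩ := exists_sgn r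
  have hm : StrictMonoOn (fun x => D.σ (sgn e * x)) (Icc (1 - D.δ) 1) := by
    refine strictMonoOn_of_deriv_pos (convex_Icc _ _)
      (D.σ_smooth.continuous.comp (continuous_const.mul continuous_id)).continuousOn ?_
    intro x hx
    rw [interior_Icc] at hx
    have h1 : HasDerivAt (fun x => sgn e * x) (sgn e) x := by
      simpa using (hasDerivAt_id x).const_mul (sgn e)
    have h2 := ((D.σ_smooth.differentiable (by simp)) (sgn e * x)).hasDerivAt.comp x h1
    have h3 := D.σ_mono e (sgn e * x)
    rw [← mul_assoc, sgn_mul_self, one_mul] at h3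
    have h4 := h3 hx.1 hx.2
    rw [show (fun x => D.σ (sgn e * x)) = D.σ ∘ fun x => sgn e * x from rfl, h2.deriv]
    linarith
  have h5 := hm.monotoneOn (a := 1 - D.δ) (b := |r|) ⟨le_rfl, by linarith⟩ ⟨h.le, hr⟩ h.le
  simp only [← he] at h5
  rw [← mul_assoc, sgn_mul_self, one_mul, D.σ_in] at h5
  · linarith
  · rw [abs_mul, abs_sgn, one_mul, abs_of_nonneg (by linarith)]

theorem β_monotone : Monotone D.β :=
  monotone_of_deriv_nonneg (D.β_smooth.differentiable (by simp)) D.β_mono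

theorem β_nonneg (t : ℝ) : 0 ≤ D.β t := by
  rw [← D.β_zero (min t (-D.δ + D.δ / 9)) (min_le_right _ _)]
  exact D.β_monotone (min_le_left _ _)

theorem β_le_one (t : ℝ) : D.β t ≤ 1 := by
  rw [← D.β_one (max t (-(2 * D.δ / 3) - D.δ / 9)) (le_max_right _ _)]
  exact D.β_monotone (le_max_left _ _)

/-! ### The Hamiltonian near the boundary -/

theorem contDiff_H_line (y : Y) : ContDiff ℝ ∞ fun x => D.H (y, x) :=
  contMDiff_iff_contDiff.1 (D.H_smooth.comp (contMDiff_const.prodMk contMDiff_id))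

theorem hasDerivAt_H_line (y : Y) (r : ℝ) :
    HasDerivAt (fun x => D.H (y, x)) (deriv (fun x => D.H (y, x)) r) r :=
  (((D.contDiff_H_line y).differentiable (by simp)) r).hasDerivAt

theorem H_eventually_indep (y : Y) {r : ℝ} (h : 1 - D.δ' < |r|) (h' : |r| < 1) :
    D.H =ᶠ[𝓝 (y, r)] fun p => D.H (y, p.2) := by
  have h1 : ∀ᶠ p : Y × ℝ in 𝓝 (y, r), 1 - D.δ' < |p.2| ∧ |p.2| < 1 :=
    ((continuous_snd.abs.continuousAt (x := (y, r))).eventually_const_lt h).and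
      ((continuous_snd.abs.continuousAt (x := (y, r))).eventually_lt_const h')
  filter_upwards [h1] with p hp
  exact D.H_indep p.1 y p.2 hp.1 hp.2.le

theorem md_H_of_indep (y : Y) {r : ℝ} (h : 1 - D.δ' < |r|) (h' : |r| < 1) (v : EY n × ℝ) :
    md (IYR n) 𝓘₁ D.H (y, r) v = v.2 * deriv (fun x => D.H (y, x)) r := by
  have s2 : ContMDiffAt (IYR n) 𝓘₁ ∞ (fun p : Y × ℝ => p.2) (y, r) := contMDiffAt_snd
  have s3 : DifferentiableAt ℝ (fun x => D.H (y, x)) r := (D.hasDerivAt_H_line y r).differentiableAt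
  rw [md_congr (D.H_eventually_indep y h h'),
    md_comp (x := ((y, r) : Y × ℝ)) (g := fun x => D.H (y, x)) (f := fun p : Y × ℝ => p.2)
      s3.mdifferentiableAt (s2.mdifferentiableAt (by simp)), md_snd, md_eq_fderiv,
    ContinuousLinearMap.comp_apply]
  change fderiv ℝ (fun x => D.H (y, x)) r v.2 = _
  rw [fderiv_eq_smul_deriv, smul_eq_mul]

/-- There are no critical points of `H` in the region where it depends only on `r`: they would be
degenerate, in the directions of `Y` or, in the Morse-Bott case, since `±∂_r H ≤ 0`. -/
theorem deriv_H_neg (hn : 1 ≤ n) (e : Bool) (y : Y) {r : ℝ} (h : 1 - D.δ' < sgn e * r)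
    (h' : sgn e * r < 1) : sgn e * deriv (fun x => D.H (y, x)) r < 0 := by
  have hδ' := D.δ'_le
  have ha : |r| = sgn e * r := abs_eq_of_sgn_pos (by linarith)
  refine lt_of_le_of_ne (D.H_mono e y r h h') fun h0 => ?_
  have h0' : deriv (fun x => D.H (y, x)) r = 0 := by
    rcases mul_eq_zero.1 h0 with h1 | h1
    · have := abs_sgn e; rw [h1] at this; simp at this
    · exact h1
  rcases D.H_morse with hM | ⟨f, hf, hHf, hfne⟩
  · have hcrit : IsCrit (IYR n) D.H (y, r) := by
      intro v
      have := D.md_H_of_indep y (by rwa [ha]) (by rwa [ha]) v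
      rw [h0', mul_zero] at this
      exact this
    have hnd := hM (y, r) (by change |r| < 1; rwa [ha]) hcrit
    have : Nonempty (Fin (2 * n - 1)) := ⟨⟨0, by omega⟩⟩
    have : Nontrivial (EY n) := inferInstance
    obtain ⟨v, hv⟩ := exists_ne (0 : EY n)
    obtain ⟨w, hw⟩ := hnd (v, 0) (fun h => hv (congrArg Prod.fst h))
    apply hw
    set φ := extChartAt (IYR n) ((y, r) : Y × ℝ) with hφ
    have e1 : (D.H ∘ φ.symm) =ᶠ[𝓝 (φ (y, r))] fun z => D.H (y, z.2) := by
      have hc : ContinuousAt φ.symm (φ (y, r)) := continuousAt_extChartAt_symm _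
      rw [ContinuousAt, show φ.symm (φ (y, r)) = (y, r) from extChartAt_to_inv (I := IYR n) (y, r)] at hc
      filter_upwards [hc.eventually (D.H_eventually_indep y (by rwa [ha]) (by rwa [ha]))] with z hz
      have : (φ.symm z).2 = z.2 := by rw [hφ, extChartAt_prod]; rfl
      rw [Function.comp_apply, hz, this]
    have hd1 : ContDiff ℝ ∞ (deriv fun x => D.H (y, x)) :=
      ((contDiff_infty_iff_deriv).1 (D.contDiff_H_line y)).2
    have e2 : fderiv ℝ (fun z : EY n × ℝ => D.H (y, z.2))
        = fun z => (deriv (fun x => D.H (y, x)) z.2) • snd ℝ (EY n) ℝ := by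
      ext1 z
      have h2 : HasFDerivAt (fun z : EY n × ℝ => z.2) (snd ℝ (EY n) ℝ) z :=
        hasFDerivAt_snd
      exact (HasDerivAt.comp_hasFDerivAt z (D.hasDerivAt_H_line y z.2) h2).fderiv
    unfold hessianInChart
    rw [← hφ, (e1.fderiv).fderiv_eq, e2]
    have h2 : HasFDerivAt (fun z : EY n × ℝ => z.2) (snd ℝ (EY n) ℝ)
      (φ (y, r)) := hasFDerivAt_snd
    have h3 := ((HasDerivAt.comp_hasFDerivAt (φ (y, r))
      ((hd1.differentiable (by simp)) _).hasDerivAt h2).smul_const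
      (snd ℝ (EY n) ℝ)).fderiv
    rw [show (fun z : EY n × ℝ => (deriv (fun x => D.H (y, x)) z.2) •
      snd ℝ (EY n) ℝ) = fun z : EY n × ℝ =>
      ((deriv (fun x => D.H (y, x)) ∘ fun z : EY n × ℝ => z.2) z) •
      snd ℝ (EY n) ℝ from rfl, h3]
    simp
  · have hev : ∀ᶠ x in 𝓝 r, 1 - D.δ' < sgn e * x ∧ sgn e * x < 1 :=
      (((continuous_const_mul (sgn e)).continuousAt (x := r)).eventually_const_lt h).and
        (((continuous_const_mul (sgn e)).continuousAt (x := r)).eventually_lt_const h')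
    have hab : ∀ x, 1 - D.δ' < sgn e * x ∧ sgn e * x < 1 → |x| < 1 := by
      intro x hx
      rw [abs_eq_of_sgn_pos (by linarith [hx.1])]; exact hx.2
    have hde : ∀ x, |x| < 1 → deriv (fun x => D.H (y, x)) x = deriv f x := by
      intro x hx
      apply EventuallyEq.deriv_eq
      filter_upwards [(isOpen_lt continuous_abs continuous_const).mem_nhds hx] with z hz
      exact hHf y z (le_of_lt hz)
    have hr := hab r ⟨h, h'⟩
    have hf0 : deriv f r = 0 := by rw [← hde r hr]; exact h0'
    have hmax : IsLocalMax (fun x => sgn e * deriv f x) r := by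
      filter_upwards [hev] with x hx
      have := D.H_mono e y x hx.1 hx.2
      rw [hde x (hab x hx)] at this
      change sgn e * deriv f x ≤ sgn e * deriv f r
      rw [hf0, mul_zero]; exact this
    have h4 := hmax.deriv_eq_zero
    rw [deriv_const_mul_field] at h4
    rcases mul_eq_zero.1 h4 with h1 | h1
    · have := abs_sgn e; rw [h1] at this; simp at this
    · exact hfne r hr hf0 h1

theorem abs_crit_le (hn : 1 ≤ n) {p : Y × ℝ} (hp : p ∈ D.crit) : |p.2| ≤ 1 - D.δ' := by
  by_contra! h
  obtain ⟨e, he⟩ := exists_sgn p.2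
  have h1 := D.deriv_H_neg hn e p.1 (by rwa [he]) (by rw [he]; exact hp.1)
  have h2 : md (IYR n) 𝓘₁ D.H p (0, 1) = 0 := hp.2 (0, 1)
  have h3 := D.md_H_of_indep p.1 h hp.1 (0, 1)
  rw [Prod.mk.eta, h2] at h3
  simp at h3
  rw [← h3] at h1
  simp at h1

/-! ### The height function -/

theorem contMDiff_HF : ContMDiff (IYR n) 𝓘₁ ∞ fun p : Y × ℝ => D.H (p.1, D.F p.2) :=
  D.H_smooth.comp (contMDiff_fst.prodMk (D.F_smooth.contMDiff.comp contMDiff_snd))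

theorem contMDiff_height : ContMDiff (IYR n) 𝓘₁ ∞ D.height := by
  have h1 : ContMDiff (IYR n) 𝓘₁ ∞ fun p : Y × ℝ => D.G p.2 :=
    D.G_smooth.contMDiff.comp contMDiff_snd
  have h2 : ContDiff ℝ ∞ fun q : ℝ × ℝ => exp (q.1 + D.ε * q.2) := by fun_prop
  exact h2.contMDiff.comp (h1.prodMk_space D.contMDiff_HF)

theorem contMDiff_cutHeight : ContMDiff (IYR n) 𝓘₁ ∞ D.cutHeight := by
  have h1 : ContMDiff (IYR n) 𝓘₁ ∞ fun p : Y × ℝ => D.β (D.G p.2) :=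
    (D.β_smooth.comp D.G_smooth).contMDiff.comp contMDiff_snd
  exact h1.mul D.contMDiff_height

theorem height_pos (p : Y × ℝ) : 0 < D.height p := exp_pos _

theorem HF_indep (y y' : Y) {e : Bool} {τ : ℝ} (h : 1 - D.δ' < sgn e * τ) :
    D.H (y, D.F τ) = D.H (y', D.F τ) := by
  refine D.H_indep y y' _ ?_ (D.abs_F_le_one τ)
  exact (D.lt_sgn_mul_F (by linarith [D.δ'_le]) (by linarith [D.δ'_gt]) h).trans_le
    (sgn_mul_le_abs e _)

theorem height_indep (y y' : Y) {e : Bool} {τ : ℝ} (h : 1 - D.δ' < sgn e * τ) :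
    D.height (y, τ) = D.height (y', τ) := by
  simp only [height, Gε]
  rw [D.HF_indep y y' h]

theorem contDiff_height_line (y : Y) : ContDiff ℝ ∞ fun x => D.height (y, x) :=
  contMDiff_iff_contDiff.1 (D.contMDiff_height.comp (contMDiff_const.prodMk contMDiff_id))

theorem deriv_height_neg (hn : 1 ≤ n) (e : Bool) (y : Y) {τ : ℝ} (h : 1 - D.δ' < sgn e * τ) :
    sgn e * deriv (fun x => D.height (y, x)) τ < 0 := by
  have hδ' := D.δ'_le
  have h0 : 0 < sgn e * τ := by linarith
  have hF : HasDerivAt D.F (deriv D.F τ) τ := (D.F_smooth.differentiable (by simp) τ).hasDerivAt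
  have hG : HasDerivAt D.G (deriv D.G τ) τ := (D.G_smooth.differentiable (by simp) τ).hasDerivAt
  have hH := (D.hasDerivAt_H_line y (D.F τ)).comp τ hF
  have hE := (hG.add (hH.const_mul D.ε)).exp
  have e1 : (fun x => D.height (y, x)) = fun x => exp ((D.G + fun x => D.ε *
    ((fun x => D.H (y, x)) ∘ D.F) x) x) := rfl
  rw [e1, hE.deriv]
  have hG' := D.sgn_mul_deriv_G_nonpos h0
  have hexp := exp_pos ((D.G + fun x => D.ε * ((fun x => D.H (y, x)) ∘ D.F) x) τ)
  suffices sgn e * (deriv D.G τ + D.ε * (deriv (fun x => D.H (y, x)) (D.F τ) * deriv D.F τ)) < 0 by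
    have := mul_neg_of_pos_of_neg hexp this
    linarith
  rcases lt_or_ge (sgn e * τ) (1 + D.δ / 3) with h1 | h1
  · have hFp : 0 < deriv D.F τ := D.F_mono τ (by rwa [abs_eq_of_sgn_pos h0.le])
    have hHn := D.deriv_H_neg hn e y
      (D.lt_sgn_mul_F (by linarith) (by linarith [D.δ'_gt]) h) (D.sgn_mul_F_lt_one h0.le h1)
    have := mul_pos_of_neg_of_neg (mul_neg_of_neg_of_pos hHn hFp) (neg_neg_of_pos D.ε_pos)
    linarith
  · have hF0 : deriv D.F τ = 0 := by
      have hmax : IsLocalMax (fun x => sgn e * D.F x) τ := by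
        refine Eventually.of_forall fun x => ?_
        change sgn e * D.F x ≤ sgn e * D.F τ
        rw [D.sgn_mul_F_outer h1]
        exact (sgn_mul_le_abs e _).trans (D.abs_F_le_one x)
      have h4 := hmax.deriv_eq_zero
      rw [deriv_const_mul_field] at h4
      rcases mul_eq_zero.1 h4 with h1 | h1
      · have := abs_sgn e; rw [h1] at this; simp at this
      · exact h1
    have := D.G_mono e τ (by linarith [D.δ_pos])
    rw [hF0]; linarith

theorem height_spine {p : Y × ℝ} (h : |p.2| ≤ 1 - D.δ / 3) :
    D.height p = exp (D.ε * D.H p) := by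
  rw [height, Gε, D.F_inner h, D.G_inner h, zero_add]

theorem cutHeight_spine {p : Y × ℝ} (h : |p.2| ≤ 1 - D.δ / 3) :
    D.cutHeight p = exp (D.ε * D.H p) := by
  rw [cutHeight, D.height_spine h, D.G_inner h, D.β_one, one_mul]
  linarith [D.δ_pos]

/-! ### The exterior derivatives in cylindrical coordinates -/

theorem diffFormAt_al (r : ℝ) (y : Y) : DiffFormAt (𝓡 (2 * n - 1)) (D.al r) y := by
  have h1 : ContMDiffAt (𝓡 (2 * n - 1)) (IYR n) ∞ (fun y : Y => (y, r)) y :=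
    contMDiffAt_id.prodMk contMDiffAt_const
  have h2 := (D.al_smooth.diffFormAt ((y, r) : Y × ℝ)).pullForm (f := fun y : Y => (y, r)) h1
  refine h2.congr (Eventually.of_forall fun y' => ?_)
  have e : md (𝓡 (2 * n - 1)) (IYR n) (fun y : Y => (y, r)) y'
      = (md (𝓡 (2 * n - 1)) (𝓡 (2 * n - 1)) (fun y : Y => y) y').prod
        (md (𝓡 (2 * n - 1)) 𝓘₁ (fun _ : Y => r) y') :=
    md_prodMk (f := fun y : Y => y) (g := fun _ : Y => r) mdifferentiableAt_id
      mdifferentiableAt_const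
  rw [pullForm, e, md_id, md_const]
  rfl

/-- The formula `d(κ a) = κ' dτ ∧ a + κ da`, for a form `a` on `Y`. -/
theorem dForm_warped {κ : ℝ → ℝ} {a : Y → EY n →L[ℝ] ℝ} {p : Y × ℝ}
    (hκ : DifferentiableAt ℝ κ p.2) (ha : DiffFormAt (𝓡 (2 * n - 1)) a p.1) :
    DiffFormAt (IYR n)
      (fun p : Y × ℝ => κ p.2 • (a p.1).comp (fst ℝ (EY n) ℝ)) p ∧
    ∀ v w : EY n × ℝ, dForm (IYR n)
      (fun p : Y × ℝ => κ p.2 • (a p.1).comp (fst ℝ (EY n) ℝ)) p v w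
      = deriv κ p.2 * (v.2 * a p.1 w.1 - w.2 * a p.1 v.1)
        + κ p.2 * dForm (𝓡 (2 * n - 1)) a p.1 v.1 w.1 := by
  have s1 : ContMDiffAt (IYR n) (𝓡 (2 * n - 1)) ∞ (fun q : Y × ℝ => q.1) p := contMDiffAt_fst
  have s2 : ContMDiffAt (IYR n) 𝓘₁ ∞ (fun q : Y × ℝ => q.2) p := contMDiffAt_snd
  have h1 := DiffFormAt.pullForm (f := fun q : Y × ℝ => q.1) (x := p) ha s1
  have hk : MDifferentiableAt (IYR n) 𝓘₁ (fun q : Y × ℝ => κ q.2) p :=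
    MDifferentiableAt.comp p (g := κ) (f := fun q : Y × ℝ => q.2) hκ.mdifferentiableAt
      (s2.mdifferentiableAt (by simp))
  have e : pullForm (IYR n) (𝓡 (2 * n - 1)) (fun q : Y × ℝ => q.1) a
      = fun p : Y × ℝ => (a p.1).comp (fst ℝ (EY n) ℝ) := by
    funext q
    rw [pullForm, md_fst]
  have ek := md_comp (x := p) (g := κ) (f := fun q : Y × ℝ => q.2) hκ.mdifferentiableAt
    (s2.mdifferentiableAt (by simp))
  rw [md_snd, md_eq_fderiv] at ek
  have e3 : ∀ v w, dForm (IYR n) (pullForm (IYR n) (𝓡 (2 * n - 1)) (fun q : Y × ℝ => q.1) a) p v w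
      = dForm (𝓡 (2 * n - 1)) a p.1 (md (IYR n) (𝓡 (2 * n - 1)) (fun q : Y × ℝ => q.1) p v)
        (md (IYR n) (𝓡 (2 * n - 1)) (fun q : Y × ℝ => q.1) p w) :=
    fun v w => dForm_pullForm (f := fun q : Y × ℝ => q.1) (η := a) (x := p) ha s1 v w
  have h2 := h1.smul hk
  have h3 := dForm_smul h1 hk
  rw [e] at h2 h3
  simp only [e, md_fst] at e3
  refine ⟨h2, fun v w => ?_⟩
  have h4 := h3 v w
  rw [ek, e3] at h4
  refine h4.trans ?_
  simp only [ContinuousLinearMap.comp_apply, ContinuousLinearMap.coe_snd',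
    ContinuousLinearMap.coe_fst', fderiv_eq_smul_deriv, smul_eq_mul]
  ring

theorem alphaForm_spine {p : Y × ℝ} (h : |p.2| ≤ 1 - D.δ / 3) :
    D.alphaForm p = (exp (D.ε * D.H p) * D.σ p.2) • familyForm D.al p := by
  rw [alphaForm, D.F_inner h]; rfl

theorem eventually_spine {p : Y × ℝ} (h : |p.2| < 1 - D.δ / 3) :
    ∀ᶠ q : Y × ℝ in 𝓝 p, |q.2| ≤ 1 - D.δ / 3 :=
  ((continuous_snd.abs.continuousAt (x := p)).eventually_lt_const h).mono fun _ h => le_of_lt h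

theorem hasMD_expH (p : Y × ℝ) : MDifferentiableAt (IYR n) 𝓘₁
    (fun p : Y × ℝ => exp (D.ε * D.H p)) p ∧
    ∀ v, md (IYR n) 𝓘₁ (fun p : Y × ℝ => exp (D.ε * D.H p)) p v
      = exp (D.ε * D.H p) * (D.ε * md (IYR n) 𝓘₁ D.H p v) := by
  have h1 : HasDerivAt (fun x : ℝ => exp (D.ε * x))
      (exp (D.ε * D.H p) * D.ε) (D.H p) := by
    simpa using ((hasDerivAt_id (D.H p)).const_mul D.ε).exp
  have h2 : MDifferentiableAt (IYR n) 𝓘₁ D.H p := D.H_smooth.mdifferentiable (by simp) p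
  refine ⟨MDifferentiableAt.comp p (g := fun x : ℝ => exp (D.ε * x))
    h1.differentiableAt.mdifferentiableAt h2, fun v => ?_⟩
  have h3 := md_comp (x := p) (g := fun x : ℝ => exp (D.ε * x)) (f := D.H)
    h1.differentiableAt.mdifferentiableAt h2
  refine (DFunLike.congr_fun h3 v).trans ?_
  rw [ContinuousLinearMap.comp_apply, md_eq_fderiv, fderiv_eq_smul_deriv, h1.deriv, smul_eq_mul]
  ring

theorem md_height_spine {p : Y × ℝ} (h : |p.2| < 1 - D.δ / 3) (v : EY n × ℝ) :
    md (IYR n) 𝓘₁ D.height p v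
      = D.ε * exp (D.ε * D.H p) * md (IYR n) 𝓘₁ D.H p v := by
  have : D.height =ᶠ[𝓝 p] fun p => exp (D.ε * D.H p) := by
    filter_upwards [D.eventually_spine h] with q hq using D.height_spine hq
  rw [md_congr this, (D.hasMD_expH p).2]
  ring

theorem dForm_alphaForm_spine {p : Y × ℝ} (h : |p.2| ≤ 1 - D.δ) :
    DiffFormAt (IYR n) D.alphaForm p ∧ ∀ v w, dForm (IYR n) D.alphaForm p v w
      = D.ε * exp (D.ε * D.H p) * (dForm (IYR n) (familyForm D.al) p v w
        + D.ε * (md (IYR n) 𝓘₁ D.H p v * familyForm D.al p w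
          - md (IYR n) 𝓘₁ D.H p w * familyForm D.al p v)) := by
  have hδ := D.δ_pos
  have h' : |p.2| < 1 - D.δ / 3 := by linarith
  have hσ : HasDerivAt D.σ 0 p.2 := by
    rw [← D.deriv_σ_inner h]; exact (D.σ_smooth.differentiable (by simp) _).hasDerivAt
  have s2 : ContMDiffAt (IYR n) 𝓘₁ ∞ (fun q : Y × ℝ => q.2) p := contMDiffAt_snd
  have hσ1 : MDifferentiableAt (IYR n) 𝓘₁ (fun q : Y × ℝ => D.σ q.2) p :=
    MDifferentiableAt.comp p (g := D.σ) (f := fun q : Y × ℝ => q.2)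
      hσ.differentiableAt.mdifferentiableAt (s2.mdifferentiableAt (by simp))
  have hσ2 : ∀ v, md (IYR n) 𝓘₁ (fun q : Y × ℝ => D.σ q.2) p v = 0 := by
    intro v
    refine (DFunLike.congr_fun (md_comp (x := p) (g := D.σ) (f := fun q : Y × ℝ => q.2)
      hσ.differentiableAt.mdifferentiableAt (s2.mdifferentiableAt (by simp))) v).trans ?_
    rw [ContinuousLinearMap.comp_apply, md_eq_fderiv, fderiv_eq_smul_deriv, hσ.deriv, smul_zero]
  obtain ⟨hE1, hE2⟩ := D.hasMD_expH p
  have ha := D.al_smooth.diffFormAt p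
  have h1 := ha.smul hσ1
  have h2 := h1.smul hE1
  have e : D.alphaForm =ᶠ[𝓝 p] fun q => exp (D.ε * D.H q) • (D.σ q.2 • familyForm D.al q) := by
    filter_upwards [D.eventually_spine h'] with q hq
    rw [D.alphaForm_spine hq, smul_smul]
  refine ⟨h2.congr e.symm, fun v w => ?_⟩
  rw [dForm_congr e]
  refine (dForm_smul h1 hE1 v w).trans ?_
  rw [dForm_smul ha hσ1, hσ2, hσ2, hE2, hE2, D.σ_in _ h]
  simp only [smul_apply, smul_eq_mul]
  ring

/-- The function `κ` such that `alphaForm = κ(τ) α_±` over the corner. -/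
def cornerFactor (e : Bool) (y : Y) (τ : ℝ) : ℝ :=
  exp (D.ε * D.H (y, D.F τ)) * D.σ (D.F τ) * exp (sgn e * D.F τ - 1)

theorem differentiable_cornerFactor (e : Bool) (y : Y) :
    Differentiable ℝ (D.cornerFactor e y) := by
  have h1 := (D.contDiff_H_line y).differentiable (by simp)
  have h2 := D.F_smooth.differentiable (by simp)
  have h3 := D.σ_smooth.differentiable (by simp)
  have h4 : Differentiable ℝ fun τ => D.H (y, D.F τ) := h1.comp h2
  have h5 : Differentiable ℝ fun τ => D.σ (D.F τ) := h3.comp h2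
  unfold cornerFactor
  fun_prop

theorem cornerFactor_pos (e : Bool) (y : Y) (τ : ℝ) : 0 < D.cornerFactor e y τ :=
  mul_pos (mul_pos (exp_pos _) (D.σ_pos (D.abs_F_le_one τ))) (exp_pos _)

theorem eventually_corner {e : Bool} {c : ℝ} {p : Y × ℝ} (h : c < sgn e * p.2) :
    ∀ᶠ q : Y × ℝ in 𝓝 p, c < sgn e * q.2 :=
  ((continuous_const.mul continuous_snd).continuousAt (x := p)).eventually_const_lt h

theorem alphaForm_corner {e : Bool} {p : Y × ℝ} (y : Y) (h : 1 - D.δ < sgn e * p.2) :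
    D.alphaForm p = D.cornerFactor e y p.2 •
      (D.al (sgn e) p.1).comp (fst ℝ (EY n) ℝ) := by
  rw [alphaForm, cornerFactor, D.HF_indep p.1 y (e := e) (by linarith [D.δ'_gt]),
    D.al_end e (D.F p.2) p.1 (D.lt_sgn_mul_F (by linarith [D.δ_lt]) le_rfl h),
    ContinuousLinearMap.smul_comp, smul_smul]

theorem dForm_alphaForm_corner {e : Bool} {p : Y × ℝ} (h : 1 - D.δ < sgn e * p.2) :
    DiffFormAt (IYR n) D.alphaForm p ∧ ∀ v w, dForm (IYR n) D.alphaForm p v w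
      = deriv (D.cornerFactor e p.1) p.2 *
          (v.2 * D.al (sgn e) p.1 w.1 - w.2 * D.al (sgn e) p.1 v.1)
        + D.cornerFactor e p.1 p.2 * dForm (𝓡 (2 * n - 1)) (D.al (sgn e)) p.1 v.1 w.1 := by
  have e1 : D.alphaForm =ᶠ[𝓝 p] fun q => D.cornerFactor e p.1 q.2 •
      (D.al (sgn e) q.1).comp (fst ℝ (EY n) ℝ) := by
    filter_upwards [eventually_corner h] with q hq
    exact D.alphaForm_corner p.1 hq
  obtain ⟨h1, h2⟩ := dForm_warped (p := p) (D.differentiable_cornerFactor e p.1 p.2)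
    (D.diffFormAt_al (sgn e) p.1)
  refine ⟨h1.congr e1.symm, fun v w => ?_⟩
  rw [dForm_congr e1]
  exact h2 v w

theorem md_height_corner {e : Bool} {p : Y × ℝ} (h : 1 - D.δ' < sgn e * p.2) (v : EY n × ℝ) :
    md (IYR n) 𝓘₁ D.height p v = v.2 * deriv (fun x => D.height (p.1, x)) p.2 := by
  have s2 : ContMDiffAt (IYR n) 𝓘₁ ∞ (fun p : Y × ℝ => p.2) p := contMDiffAt_snd
  have s3 : DifferentiableAt ℝ (fun x => D.height (p.1, x)) p.2 :=
    (D.contDiff_height_line p.1).differentiable (by simp) _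
  have e1 : D.height =ᶠ[𝓝 p] fun q => D.height (p.1, q.2) := by
    filter_upwards [eventually_corner h] with q hq
    exact D.height_indep q.1 p.1 hq
  rw [md_congr e1,
    md_comp (x := p) (g := fun x => D.height (p.1, x)) (f := fun p : Y × ℝ => p.2)
      s3.mdifferentiableAt (s2.mdifferentiableAt (by simp)), md_snd, md_eq_fderiv,
    ContinuousLinearMap.comp_apply]
  change fderiv ℝ (fun x => D.height (p.1, x)) p.2 v.2 = _
  rw [fderiv_eq_smul_deriv, smul_eq_mul]

/-- The point lies over the spine or over one of the corners. -/
theorem spine_or_corner (τ : ℝ) : |τ| ≤ 1 - D.δ ∨ ∃ e : Bool, 1 - D.δ < sgn e * τ := by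
  rcases le_or_gt |τ| (1 - D.δ) with h | h
  · exact .inl h
  · obtain ⟨e, he⟩ := exists_sgn τ
    exact .inr ⟨e, by rwa [he]⟩

theorem diffFormAt_alphaForm (p : Y × ℝ) : DiffFormAt (IYR n) D.alphaForm p := by
  rcases D.spine_or_corner p.2 with h | ⟨e, h⟩
  · exact (D.dForm_alphaForm_spine h).1
  · exact (D.dForm_alphaForm_corner h).1

theorem mdifferentiableAt_height (p : Y × ℝ) : MDifferentiableAt (IYR n) 𝓘₁ D.height p :=
  D.contMDiff_height.mdifferentiable (by simp) p

theorem mdifferentiableAt_cutHeight (p : Y × ℝ) :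
    MDifferentiableAt (IYR n) 𝓘₁ D.cutHeight p :=
  D.contMDiff_cutHeight.mdifferentiable (by simp) p

theorem Om_coord (i : Fin k) {q : (Y × ℝ) × ℝ} (hq : |q.1.2| < 1 + D.δ)
    (v w : (EY n × ℝ) × ℝ) :
    D.Om (D.coord i q) (D.dcoord i (q.1.2, q.2) v) (D.dcoord i (q.1.2, q.2) w)
      = dForm (IYR n) D.alphaForm q.1 v.1 w.1
        + (md (IYR n) 𝓘₁ D.height q.1 v.1 * w.2
          - md (IYR n) 𝓘₁ D.height q.1 w.1 * v.2) :=
  D.dForm_coord i hq (fun _ hq x => D.primitive_coord i hq x) (D.diffFormAt_alphaForm q.1)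
    (D.mdifferentiableAt_height q.1) v w

theorem dLam_coord (i : Fin k) {q : (Y × ℝ) × ℝ} (hq : |q.1.2| < 1 + D.δ)
    (v w : (EY n × ℝ) × ℝ) :
    dForm (IYS n) D.Lam (D.coord i q) (D.dcoord i (q.1.2, q.2) v) (D.dcoord i (q.1.2, q.2) w)
      = dForm (IYR n) D.alphaForm q.1 v.1 w.1
        + (md (IYR n) 𝓘₁ D.cutHeight q.1 v.1 * w.2
          - md (IYR n) 𝓘₁ D.cutHeight q.1 w.1 * v.2) :=
  D.dForm_coord i hq (fun _ hq x => D.Lam_coord i hq x) (D.diffFormAt_alphaForm q.1)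
    (D.mdifferentiableAt_cutHeight q.1) v w

/-! ### The gradient -/

theorem exists_isGradient {p : Y × ℝ} (hp : |p.2| ≤ 1) : ∃ X, D.IsGradient p X := by
  let T : (EY n × ℝ) →ₗ[ℝ] Module.Dual ℝ (EY n × ℝ) :=
    { toFun := fun X => ((dForm (IYR n) (familyForm D.al) p X).comp (D.J₀ p)).toLinearMap
      map_add' := fun X X' => by ext <;> simp
      map_smul' := fun c X => by ext <;> simp }
  have hinj : Injective T := by
    rw [injective_iff_map_eq_zero]
    intro X hX
    by_contra hne
    have h1 := D.J₀_tame p hp X hne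
    have h2 : T X X = 0 := by rw [hX]; rfl
    exact h1.ne' h2
  have hsurj := (LinearMap.injective_iff_surjective_of_finrank_eq_finrank
    (Subspace.dual_finrank_eq (K := ℝ) (V := EY n × ℝ)).symm).1 hinj
  obtain ⟨X, hX⟩ := hsurj (md (IYR n) 𝓘₁ D.H p).toLinearMap
  exact ⟨X, fun v => DFunLike.congr_fun hX v⟩

theorem IsGradient.apply {D : ModelData n Y S k g} {p : Y × ℝ} {X : EY n × ℝ}
    (h : D.IsGradient p X) (v : EY n × ℝ) :
    dForm (IYR n) (familyForm D.al) p X (D.J₀ p v) = md (IYR n) 𝓘₁ D.H p v := h v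

theorem IsGradient.unique {D : ModelData n Y S k g} {p : Y × ℝ} (hp : |p.2| ≤ 1) {X X' : EY n × ℝ}
    (h : D.IsGradient p X) (h' : D.IsGradient p X') : X = X' := by
  by_contra hne
  have h1 := D.J₀_tame p hp (X - X') (sub_ne_zero.2 hne)
  rw [map_sub, sub_apply, h.apply, h'.apply, sub_self] at h1
  exact lt_irrefl _ h1

theorem dForm_self {E H M : Type*} [NormedAddCommGroup E] [NormedSpace ℝ E] [TopologicalSpace H]
    {I : ModelWithCorners ℝ E H} [TopologicalSpace M] [ChartedSpace H M] [IsManifold I ∞ M]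
    (η : M → E →L[ℝ] ℝ) (x : M) (v : E) : dForm I η x v v = 0 := by
  rw [dForm]; simp

theorem dForm_swap {E H M : Type*} [NormedAddCommGroup E] [NormedSpace ℝ E] [TopologicalSpace H]
    {I : ModelWithCorners ℝ E H} [TopologicalSpace M] [ChartedSpace H M] [IsManifold I ∞ M]
    (η : M → E →L[ℝ] ℝ) (x : M) (v w : E) : dForm I η x v w = -dForm I η x w v := by
  rw [dForm]; simp

/-- The vector field on `Y × (-1-δ, 1+δ)` to which the non-trivial leaves project: the gradient of
`H` over the spine, and a multiple of `∂_τ` over the corners. -/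
def flowField (p : Y × ℝ) : EY n × ℝ :=
  open Classical in
  if h : |p.2| ≤ 1 - D.δ then (D.exists_isGradient (h.trans (by linarith [D.δ_pos]))).choose
  else (0, deriv (fun x => D.height (p.1, x)) p.2 / D.h p.2)

theorem flowField_spine {p : Y × ℝ} (h : |p.2| ≤ 1 - D.δ) : D.IsGradient p (D.flowField p) := by
  rw [flowField, dif_pos h]
  exact (D.exists_isGradient (h.trans (by linarith [D.δ_pos]))).choose_spec

theorem flowField_corner {e : Bool} {p : Y × ℝ} (h : 1 - D.δ < sgn e * p.2) :
    D.flowField p = (0, deriv (fun x => D.height (p.1, x)) p.2 / D.h p.2) := by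
  rw [flowField, dif_neg]
  exact not_le.2 (h.trans_le (sgn_mul_le_abs e _))

/-- The velocity in the `θ`-direction which accompanies `flowField`. -/
def angle (p : Y × ℝ) : ℝ := -(D.ε * familyForm D.al p (D.flowField p))

theorem angle_corner {e : Bool} {p : Y × ℝ} (h : 1 - D.δ < sgn e * p.2) : D.angle p = 0 := by
  rw [angle, D.flowField_corner h]; simp [familyForm]

/-! ### The leaves are holomorphic -/

variable {D}

theorem IsModelJ.apply_eq (hJ : D.IsModelJ J) (m : Y × S) (b : ℝ) (v : EY n × ES) :
    J m (b, v) = (0, b • (J m (1, 0)).2) + J m (0, v) := by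
  have e : ((b, v) : ℝ × (EY n × ES)) = b • (1, 0) + (0, v) := by ext <;> simp
  rw [e, map_add, map_smul]
  congr 1
  refine Prod.ext ?_ rfl
  change b • (J m (1, 0)).1 = 0
  rw [(hJ.reeb m).1, smul_zero]

theorem IsModelJ.key_spine (hJ : D.IsModelJ J) (i : Fin k) {q : (Y × ℝ) × ℝ}
    (h : |q.1.2| ≤ 1 - D.δ) :
    J (D.coord i q) (D.cutHeight q.1, D.dcoord i (q.1.2, q.2) (D.flowField q.1, D.angle q.1))
      = (0, D.dcoord i (q.1.2, q.2) (0, 1)) := by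
  have hδ := D.δ_pos
  have hq : |q.1.2| < 1 + D.δ := by linarith
  have h1 : |q.1.2| ≤ 1 := by linarith
  have h3 : |q.1.2| < 1 - D.δ / 3 := by linarith
  have hgr := D.flowField_spine h
  set X := D.flowField q.1 with hX
  set E := exp (D.ε * D.H q.1) with hE
  have hE0 : 0 < E := exp_pos _
  obtain ⟨hR0, hR1, hR2⟩ := hJ.reeb (D.coord i q)
  have hlift : ∀ x : EY n × ℝ, D.lift i q.1.1 (q.1.2, q.2) x
      = D.dcoord i (q.1.2, q.2) (x, -(D.ε * familyForm D.al q.1 x)) := by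
    intro x
    rw [lift, dcoord, sub_eq_add_neg, ← neg_smul]; rfl
  have hsp := hJ.spine i q.1.1 (q.1.2, q.2) h X
  rw [hlift, hlift] at hsp
  rw [show D.angle q.1 = -(D.ε * familyForm D.al q.1 X) from rfl, hJ.apply_eq]
  rw [show J (D.coord i q) (0, D.dcoord i (q.1.2, q.2) (X, -(D.ε * familyForm D.al q.1 X))) = _
    from hsp, D.cutHeight_spine h3.le, Prod.mk_add_mk, add_zero]
  refine Prod.ext rfl ?_
  change E • (J (D.coord i q) (1, 0)).2 + D.dcoord i (q.1.2, q.2) _ = D.dcoord i (q.1.2, q.2) (0, 1)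
  -- the difference of the two sides lies in the kernels of `Λ` and `Ω`
  have hOm : ∀ v w : (EY n × ℝ) × ℝ,
      D.Om (D.coord i q) (D.dcoord i (q.1.2, q.2) v) (D.dcoord i (q.1.2, q.2) w)
        = D.ε * E * (dForm (IYR n) (familyForm D.al) q.1 v.1 w.1
        + D.ε * (md (IYR n) 𝓘₁ D.H q.1 v.1 * familyForm D.al q.1 w.1
          - md (IYR n) 𝓘₁ D.H q.1 w.1 * familyForm D.al q.1 v.1)
        + (md (IYR n) 𝓘₁ D.H q.1 v.1 * w.2 - md (IYR n) 𝓘₁ D.H q.1 w.1 * v.2)) := by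
    intro v w
    rw [D.Om_coord i hq, (D.dForm_alphaForm_spine h).2, D.md_height_spine h3, D.md_height_spine h3]
    ring
  have hLam : ∀ v : (EY n × ℝ) × ℝ, D.Lam (D.coord i q) (D.dcoord i (q.1.2, q.2) v)
      = E * (D.ε * familyForm D.al q.1 v.1 + v.2) := by
    intro v
    rw [D.Lam_coord i hq]
    simp only [cylForm, D.alphaForm_spine h3.le, D.cutHeight_spine h3.le, D.σ_in _ h, add_apply,
      smul_apply, ContinuousLinearMap.comp_apply, ContinuousLinearMap.coe_fst',
      ContinuousLinearMap.coe_snd', smul_eq_mul]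
    ring
  have hHJ : md (IYR n) 𝓘₁ D.H q.1 (D.J₀ q.1 X) = 0 := by
    rw [← hgr.apply, D.J₀_sq q.1 h1, map_neg, dForm_self, neg_zero]
  have hdJ : ∀ x, dForm (IYR n) (familyForm D.al) q.1 (D.J₀ q.1 X) x
      = -md (IYR n) 𝓘₁ D.H q.1 x := by
    intro x
    rw [← D.J₀_inv q.1 h1, D.J₀_sq q.1 h1, map_neg, neg_apply, hgr.apply]
  set W := E • (J (D.coord i q) (1, 0)).2 + D.dcoord i (q.1.2, q.2)
    (D.J₀ q.1 X, -(D.ε * familyForm D.al q.1 (D.J₀ q.1 X)))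
    - D.dcoord i (q.1.2, q.2) (0, 1) with hW
  suffices W = 0 from sub_eq_zero.1 this
  have hWL : D.Lam (D.coord i q) W = 0 := by
    rw [hW, map_sub, map_add, map_smul, hR1, hLam, hLam]
    simp
  have hWO : ∀ v, D.Om (D.coord i q) W (D.dcoord i (q.1.2, q.2) v) = 0 := by
    intro v
    rw [hW, map_sub, map_add, map_smul, sub_apply, add_apply, smul_apply, hR2, hOm, hOm, hHJ, hdJ]
    simp
    ring
  obtain ⟨⟨x, c⟩, hx⟩ := (D.dcoord_bijective i (p := (q.1.2, q.2)) hq).2 W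
  have hc : c = -(D.ε * familyForm D.al q.1 x) := by
    rw [← hx, hLam] at hWL
    have := (mul_eq_zero.1 hWL).resolve_left hE0.ne'
    simp only at this
    linarith
  have hx0 : x = 0 := by
    by_contra hne
    obtain ⟨x', hx'⟩ := D.al_symp q.1 h1 x hne
    have h5 := hWO (x', -(D.ε * familyForm D.al q.1 x'))
    rw [← hx, hOm, hc] at h5
    have h6 := (mul_eq_zero.1 h5).resolve_left (mul_pos D.ε_pos hE0).ne'
    simp only at h6
    exact hx' (by linarith)
  rw [← hx, hc, hx0]
  ext <;> simp [dcoord]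

/-- `α_±` is a contact form: only `0` is in the kernels of `α_±` and `dα_±`. -/
theorem al_kernel (e : Bool) (y : Y) {v : EY n} (h1 : D.al (sgn e) y v = 0)
    (h2 : ∀ w, dForm (𝓡 (2 * n - 1)) (D.al (sgn e)) y v w = 0) : v = 0 := by
  by_contra hne
  have hs : |(((y, sgn e) : Y × ℝ)).2| ≤ 1 := (abs_sgn e).le
  obtain ⟨w, hw⟩ := D.al_symp (y, sgn e) hs (v, 0) (fun h => hne (congrArg Prod.fst h))
  apply hw
  have hev : familyForm D.al =ᶠ[𝓝 ((y, sgn e) : Y × ℝ)]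
      fun p : Y × ℝ => exp (sgn e * p.2 - 1) •
        (D.al (sgn e) p.1).comp (fst ℝ (EY n) ℝ) := by
    filter_upwards [eventually_corner (e := e) (c := 1 - D.δ) (p := ((y, sgn e) : Y × ℝ))
      (by simp only [sgn_mul_self]; linarith [D.δ_pos])] with p hp
    rw [familyForm, D.al_end e p.2 p.1 hp, ContinuousLinearMap.smul_comp]
  rw [dForm_congr hev]
  refine ((dForm_warped (p := ((y, sgn e) : Y × ℝ)) (κ := fun τ => exp (sgn e * τ - 1))
    (by fun_prop) (D.diffFormAt_al (sgn e) y)).2 (v, 0) w).trans ?_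
  simp only [h1, h2]
  ring

theorem IsModelJ.key_corner (hJ : D.IsModelJ J) (hn : 1 ≤ n) (i : Fin k) {q : (Y × ℝ) × ℝ} {e : Bool}
    (h : 1 - D.δ < sgn e * q.1.2) (h' : sgn e * q.1.2 < 1 + D.δ) :
    J (D.coord i q) (D.cutHeight q.1, D.dcoord i (q.1.2, q.2) (D.flowField q.1, D.angle q.1))
      = (0, D.dcoord i (q.1.2, q.2) (0, 1)) := by
  have hδ := D.δ_pos
  have hδ1 := D.δ_lt
  have hq : |q.1.2| < 1 + D.δ := by rwa [abs_eq_of_sgn_pos (by linarith)]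
  have hc' : 1 - D.δ' < sgn e * q.1.2 := by linarith [D.δ'_gt]
  obtain ⟨hR0, hR1, hR2⟩ := hJ.reeb (D.coord i q)
  obtain ⟨w, b, hw1, hw2, hw3, hw4⟩ := hJ.corner e i q.1.1 (q.1.2, q.2) h h'
  have ew : ((w, b • D.dtheta i (q.1.2, q.2)) : EY n × ES) = D.dcoord i (q.1.2, q.2) ((w, 0), b) := by
    simp [dcoord]
  have et : ((0, D.dtau i (q.1.2, q.2)) : EY n × ES) = D.dcoord i (q.1.2, q.2) ((0, 1), 0) := by
    simp [dcoord]
  set κ := D.cornerFactor e q.1.1 q.1.2 with hκ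
  set κ' := deriv (D.cornerFactor e q.1.1) q.1.2 with hκ'
  set g' := deriv (fun x => D.height (q.1.1, x)) q.1.2 with hg'
  set B := D.cutHeight q.1 with hB
  have hκ0 : 0 < κ := D.cornerFactor_pos _ _ _
  have hg0 : g' ≠ 0 := by
    intro h0
    have := D.deriv_height_neg hn e q.1.1 hc'
    rw [← hg', h0, mul_zero] at this
    exact lt_irrefl _ this
  have hOm : ∀ v w : (EY n × ℝ) × ℝ,
      D.Om (D.coord i q) (D.dcoord i (q.1.2, q.2) v) (D.dcoord i (q.1.2, q.2) w)
        = κ' * (v.1.2 * D.al (sgn e) q.1.1 w.1.1 - w.1.2 * D.al (sgn e) q.1.1 v.1.1)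
        + κ * dForm (𝓡 (2 * n - 1)) (D.al (sgn e)) q.1.1 v.1.1 w.1.1
        + g' * (v.1.2 * w.2 - w.1.2 * v.2) := by
    intro v w
    rw [D.Om_coord i hq, (D.dForm_alphaForm_corner h).2, D.md_height_corner hc',
      D.md_height_corner hc']
    ring
  have hLam : ∀ v : (EY n × ℝ) × ℝ, D.Lam (D.coord i q) (D.dcoord i (q.1.2, q.2) v)
      = κ * D.al (sgn e) q.1.1 v.1.1 + B * v.2 := by
    intro v
    rw [D.Lam_coord i hq]
    simp only [cylForm, D.alphaForm_corner q.1.1 h, add_apply,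
      smul_apply, ContinuousLinearMap.comp_apply, ContinuousLinearMap.coe_fst',
      ContinuousLinearMap.coe_snd', smul_eq_mul]
    rfl
  obtain ⟨⟨⟨r1, r2⟩, r3⟩, hr⟩ :=
    (D.dcoord_bijective i (p := (q.1.2, q.2)) hq).2 (J (D.coord i q) (1, 0)).2
  rw [ew] at hw2 hw4
  rw [et] at hw4
  rw [ew, et] at hw3
  have k1 := (hLam ((w, 0), b)).symm.trans hw2
  have k2 := (hOm ((0, 1), 0) ((w, 0), b)).symm.trans hw3
  rw [← hr] at hR1 hR2
  have k3 := (hLam _).symm.trans hR1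
  have k4 := (hOm _ ((0, 0), 1)).symm.trans (hR2 _)
  have k5 := (hOm _ ((0, 1), 0)).symm.trans (hR2 _)
  have k6 : ∀ v, dForm (𝓡 (2 * n - 1)) (D.al (sgn e)) q.1.1 r1 v = 0 := by
    intro v
    have k7 := (hOm _ ((v, 0), 0)).symm.trans (hR2 _)
    simp only [map_zero] at k4 k7
    have hr2 : r2 = 0 := by
      have : g' * r2 = 0 := by linarith
      exact (mul_eq_zero.1 this).resolve_left hg0
    rw [hr2] at k7
    have : κ * dForm (𝓡 (2 * n - 1)) (D.al (sgn e)) q.1.1 r1 v = 0 := by linarith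
    exact (mul_eq_zero.1 this).resolve_left hκ0.ne'
  simp only [map_zero] at k1 k2 k3 k4 k5
  have hr2 : r2 = 0 := by
    have : g' * r2 = 0 := by linarith
    exact (mul_eq_zero.1 this).resolve_left hg0
  set x := D.al (sgn e) q.1.1 r1 with hx
  set z := D.al (sgn e) q.1.1 w with hz
  rw [zero_apply] at k2
  have m1 : κ * x + B * r3 = 1 := k3
  have m2 : κ' * x + g' * r3 = 0 := by linarith
  have m3 : κ * z + B * b = 0 := k1
  have m4 : κ' * z + g' * b = 1 := by linarith
  -- `m1`, ..., `m4` is a linear system for the components of `R` and `v₂`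
  have hdet : (κ * g' - B * κ') * (x * b - z * r3) = 1 := by
    linear_combination (κ' * z + g' * b) * m1 + m4 - (κ' * x + g' * r3) * m3
  have hdet0 : κ * g' - B * κ' ≠ 0 := fun h0 => by rw [h0, zero_mul] at hdet; exact zero_ne_one hdet
  have hP : B * x + g' * z = 0 := by
    have : (κ * g' - B * κ') * (B * x + g' * z) = 0 := by
      linear_combination (g' * B) * m1 + g' ^ 2 * m3 - B ^ 2 * m2 - (B * g') * m4
    exact (mul_eq_zero.1 this).resolve_left hdet0
  have hQ : B * r3 + g' * b = 1 := by
    have : (κ * g' - B * κ') * (B * r3 + g' * b - 1) = 0 := by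
      linear_combination (κ * B) * m2 + (κ * g') * m4 - (κ' * B) * m1 - κ' * g' * m3
    linarith [(mul_eq_zero.1 this).resolve_left hdet0]
  have hv : B • r1 + g' • w = 0 := by
    refine al_kernel (D := D) e q.1.1 ?_ fun v => ?_
    · rw [map_add, map_smul, map_smul, smul_eq_mul, smul_eq_mul]; exact hP
    · rw [map_add, map_smul, map_smul, add_apply, smul_apply, smul_apply, k6, hw1]; simp
  rw [hJ.apply_eq, ← hr, D.flowField_corner h, D.angle_corner h, ← hg']
  have e2 : D.dcoord i (q.1.2, q.2) ((0, g' / D.h q.1.2), 0)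
      = (g' / D.h q.1.2) • D.dcoord i (q.1.2, q.2) ((0, 1), 0) := by
    ext <;> simp [dcoord]
  have e3 : ((0, D.dcoord i (q.1.2, q.2) ((0, g' / D.h q.1.2), 0)) : ℝ × (EY n × ES))
      = (g' / D.h q.1.2) • (0, D.dcoord i (q.1.2, q.2) ((0, 1), 0)) := by
    rw [e2]; ext <;> simp
  have hh := (D.h_pos q.1.2).ne'
  rw [e3, map_smul]
  rw [show J (D.coord i q) (0, D.dcoord i (q.1.2, q.2) ((0, 1), 0)) = _ from hw4, smul_smul,
    div_mul_cancel₀ _ hh, hr2]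
  refine Prod.ext (by simp) ?_
  change B • D.dcoord i (q.1.2, q.2) ((r1, 0), r3)
    + g' • D.dcoord i (q.1.2, q.2) ((w, 0), b) = D.dcoord i (q.1.2, q.2) (0, 1)
  have e4 : B • D.dcoord i (q.1.2, q.2) ((r1, 0), r3)
    + g' • D.dcoord i (q.1.2, q.2) ((w, 0), b)
    = (B • r1 + g' • w, (B * r3 + g' * b) • D.dtheta i (q.1.2, q.2)) := by
    simp only [dcoord, Prod.smul_mk, Prod.mk_add_mk, zero_smul, zero_add, smul_smul, add_smul]
  rw [e4, hv, hQ]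
  simp [dcoord]

/-- `J` maps the velocity of a path `(b, γ, θ)` with `b' = cutHeight(γ)`, `γ' = flowField(γ)` and
`θ' = angle(γ)` to `∂_θ`, so that the rotations of this path sweep out a holomorphic cylinder. -/
theorem IsModelJ.key (hJ : D.IsModelJ J) (hn : 1 ≤ n) (i : Fin k) {q : (Y × ℝ) × ℝ}
    (h : |q.1.2| < 1 + D.δ) :
    J (D.coord i q) (D.cutHeight q.1, D.dcoord i (q.1.2, q.2) (D.flowField q.1, D.angle q.1))
      = (0, D.dcoord i (q.1.2, q.2) (0, 1)) := by
  rcases D.spine_or_corner q.1.2 with h1 | ⟨e, h1⟩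
  · exact hJ.key_spine i h1
  · exact hJ.key_corner hn i h1 ((sgn_mul_le_abs e _).trans_lt h)

end ModelData

/-! ### Integral curves -/

section Curves

variable {E : Type*} [NormedAddCommGroup E] [NormedSpace ℝ E]
  {H : Type*} [TopologicalSpace H] {I : ModelWithCorners ℝ E H}
  {M : Type*} [TopologicalSpace M] [ChartedSpace H M] [IsManifold I ∞ M]
  {E' : Type*} [NormedAddCommGroup E'] [NormedSpace ℝ E']
  {H' : Type*} [TopologicalSpace H'] {I' : ModelWithCorners ℝ E' H'}
  {M' : Type*} [TopologicalSpace M'] [ChartedSpace H' M'] [IsManifold I' ∞ M']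

/-- The curve `γ` has velocity `v` at time `t`. -/
def HasVel (I : ModelWithCorners ℝ E H) (γ : ℝ → M) (t : ℝ) (v : E) : Prop :=
  HasMFDerivAt 𝓘₁ I γ t ((1 : ℝ →L[ℝ] ℝ).smulRight v)

theorem HasVel.of_hasMFDerivAt {γ : ℝ → M} {t : ℝ} {v : E} {L : ℝ →L[ℝ] E}
    (h : HasMFDerivAt 𝓘₁ I γ t L) (e : L 1 = v) : HasVel I γ t v := by
  have e' : L = (1 : ℝ →L[ℝ] ℝ).smulRight v := by ext; simp [e]
  subst e'
  exact h

theorem HasVel.mdifferentiableAt {γ : ℝ → M} {t : ℝ} {v : E} (h : HasVel I γ t v) :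
    MDifferentiableAt 𝓘₁ I γ t :=
  HasMFDerivAt.mdifferentiableAt h

theorem HasVel.continuousAt {γ : ℝ → M} {t : ℝ} {v : E} (h : HasVel I γ t v) :
    ContinuousAt γ t :=
  h.mdifferentiableAt.continuousAt

theorem HasVel.md_eq {γ : ℝ → M} {t : ℝ} {v : E} (h : HasVel I γ t v) :
    md 𝓘₁ I γ t = (1 : ℝ →L[ℝ] ℝ).smulRight v :=
  HasMFDerivAt.mfderiv h

theorem HasVel.md_one {γ : ℝ → M} {t : ℝ} {v : E} (h : HasVel I γ t v) :
    md 𝓘₁ I γ t 1 = v := by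
  rw [h.md_eq]; simp

theorem MDifferentiableAt.hasVel {γ : ℝ → M} {t : ℝ} (h : MDifferentiableAt 𝓘₁ I γ t) :
    HasVel I γ t (md 𝓘₁ I γ t 1) :=
  HasVel.of_hasMFDerivAt (L := md 𝓘₁ I γ t) h.hasMFDerivAt rfl

theorem hasVel_iff_hasDerivAt {γ : ℝ → E} {t : ℝ} {v : E} :
    HasVel 𝓘(ℝ, E) γ t v ↔ HasDerivAt γ v t := by
  unfold HasVel
  rw [hasDerivAt_iff_hasFDerivAt]
  exact hasMFDerivAt_iff_hasFDerivAt

theorem HasVel.comp {γ : ℝ → M} {t : ℝ} {v : E} {f : M → M'}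
    (hf : MDifferentiableAt I I' f (γ t)) (h : HasVel I γ t v) :
    HasVel I' (fun s => f (γ s)) t (md I I' f (γ t) v) := by
  have h1 := HasMFDerivAt.comp (I' := I) (I'' := I') t hf.hasMFDerivAt h
  exact HasVel.of_hasMFDerivAt
    (L := (md I I' f (γ t)).comp ((1 : ℝ →L[ℝ] ℝ).smulRight v)) h1 (by simp)

theorem HasVel.prodMk {γ : ℝ → M} {γ' : ℝ → M'} {t : ℝ} {v : E} {v' : E'}
    (h : HasVel I γ t v) (h' : HasVel I' γ' t v') :
    HasVel (I.prod I') (fun s => (γ s, γ' s)) t (v, v') := by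
  have h1 := HasMFDerivAt.prodMk h h'
  exact HasVel.of_hasMFDerivAt
    (L := ((1 : ℝ →L[ℝ] ℝ).smulRight v).prod ((1 : ℝ →L[ℝ] ℝ).smulRight v')) h1 (by simp)

theorem HasVel.fst {γ : ℝ → M × M'} {t : ℝ} {v : E × E'} (h : HasVel (I.prod I') γ t v) :
    HasVel I (fun s => (γ s).1) t v.1 := by
  have h1 := h.comp (f := fun q : M × M' => q.1) (I' := I) mdifferentiableAt_fst
  rwa [md_fst] at h1

theorem HasVel.snd {γ : ℝ → M × M'} {t : ℝ} {v : E × E'} (h : HasVel (I.prod I') γ t v) :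
    HasVel I' (fun s => (γ s).2) t v.2 := by
  have h1 := h.comp (f := fun q : M × M' => q.2) (I' := I') mdifferentiableAt_snd
  rwa [md_snd] at h1

theorem HasVel.scomp {γ : ℝ → M} {ψ : ℝ → ℝ} {t c : ℝ} {v : E} (h : HasVel I γ (ψ t) v)
    (hψ : HasDerivAt ψ c t) : HasVel I (fun s => γ (ψ s)) t (c • v) := by
  have h1 := HasVel.comp (I := 𝓘₁) (I' := I) (f := γ) h.mdifferentiableAt
    (hasVel_iff_hasDerivAt.2 hψ)
  rw [h.md_eq] at h1
  simpa using h1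

theorem HasVel.congr {γ γ' : ℝ → M} {t : ℝ} {v : E} (h : HasVel I γ t v) (e : γ' =ᶠ[𝓝 t] γ) :
    HasVel I γ' t v :=
  HasMFDerivAt.congr_of_eventuallyEq (f := γ) h e

theorem hasVel_const (x : M) (t : ℝ) : HasVel I (fun _ => x) t 0 :=
  HasVel.of_hasMFDerivAt (L := 0) (hasMFDerivAt_const (I := 𝓘₁) (I' := I) x t) rfl

variable [I.Boundaryless]

/-- The coordinate expression of a vector field in the preferred chart at `x`. -/
def fieldInChart (I : ModelWithCorners ℝ E H) (v : M → E) (x : M) (z : E) : E :=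
  md I 𝓘(ℝ, E) (extChartAt I x) ((extChartAt I x).symm z) (v ((extChartAt I x).symm z))

theorem contDiffAt_fieldInChart {v : M → E} {x : M} {z : E} (hz : z ∈ (extChartAt I x).target)
    (hv : ContMDiffAt I I.tangent ∞ (fun y => (⟨y, v y⟩ : TangentBundle I M))
      ((extChartAt I x).symm z)) : ContDiffAt ℝ ∞ (fieldInChart I v x) z := by
  have h1 : ContMDiffAt 𝓘(ℝ, E) I ∞ (extChartAt I x).symm z := contMDiffAt_extChartAt_symm hz
  have h2 := hv.comp z h1
  have h3 : ContMDiffAt I 𝓘(ℝ, E) ∞ (extChartAt I x) ((extChartAt I x).symm z) :=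
    contMDiffAt_extChartAt' (by
      have := (extChartAt I x).map_target hz
      rwa [extChartAt_source] at this)
  have h4 := (contMDiffAt_tangentMap (p := (⟨(extChartAt I x).symm z,
    v ((extChartAt I x).symm z)⟩ : TangentBundle I M)) h3).comp z h2
  exact contMDiffAt_iff_contDiffAt.1
    (((contMDiff_snd_tangentBundle_modelSpace E 𝓘(ℝ, E)).contMDiffAt).comp z h4)

theorem HasVel.chart {γ : ℝ → M} {t : ℝ} {v : M → E} {x : M} (h : HasVel I γ t (v (γ t)))
    (hx : γ t ∈ (extChartAt I x).source) :
    HasDerivAt (fun s => extChartAt I x (γ s)) (fieldInChart I v x (extChartAt I x (γ t))) t := by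
  have hc : MDifferentiableAt I 𝓘(ℝ, E) (extChartAt I x) (γ t) :=
    (contMDiffAt_extChartAt' (n := ∞) (by rwa [extChartAt_source] at hx)).mdifferentiableAt
      (by simp)
  rw [← hasVel_iff_hasDerivAt, fieldInChart, (extChartAt I x).left_inv hx]
  exact h.comp hc

theorem hasVel_of_chart {α : ℝ → E} {t : ℝ} {v : M → E} {x : M}
    (h : HasDerivAt α (fieldInChart I v x (α t)) t) (hx : α t ∈ (extChartAt I x).target) :
    HasVel I (fun s => (extChartAt I x).symm (α s)) t (v ((extChartAt I x).symm (α t))) := by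
  have h1 := (hasVel_iff_hasDerivAt.2 h).comp (I' := I) (mdifferentiableAt_extChartAt_symm hx)
  have h2 := (extChartAt I x).map_target hx
  have h3 := DFunLike.congr_fun (md_symm_comp_md_extChartAt (I := I) (x := x)
    (q := (extChartAt I x).symm (α t)) (by rwa [extChartAt_source] at h2))
    (v ((extChartAt I x).symm (α t)))
  rw [(extChartAt I x).right_inv hx] at h3
  rwa [show md 𝓘(ℝ, E) I (extChartAt I x).symm (α t) (fieldInChart I v x (α t)) = _ from h3] at h1

/-- Near a given point, integral curves exist for a uniform time. -/
theorem exists_uniform_time [CompleteSpace E] {v : M → E} {x : M}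
    (hv : ContMDiffAt I I.tangent ∞ (fun y => (⟨y, v y⟩ : TangentBundle I M)) x) :
    ∃ ε > (0 : ℝ), ∀ᶠ y in 𝓝 x, ∃ γ : ℝ → M, γ 0 = y ∧
      ∀ t ∈ Ioo (-ε) ε, HasVel I γ t (v (γ t)) := by
  have hx0 := mem_extChartAt_target (I := I) x
  have hf : ContDiffAt ℝ ∞ (fieldInChart I v x) (extChartAt I x x) :=
    contDiffAt_fieldInChart hx0 (by rwa [extChartAt_to_inv])
  obtain ⟨ε, hε, a, r, L, K, hr, hpl⟩ := IsPicardLindelof.of_contDiffAt_one (hf.of_le (by simp))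
  obtain ⟨α, hα, hαc⟩ := (hpl 0).exists_forall_mem_closedBall_eq_hasDerivWithinAt_continuousOn
  have hnhd : Metric.closedBall (extChartAt I x x) r ×ˢ Icc (0 - ε) (0 + ε)
      ∈ 𝓝 (extChartAt I x x, (0 : ℝ)) :=
    prod_mem_nhds (Metric.closedBall_mem_nhds _ hr) (Icc_mem_nhds (by linarith) (by linarith))
  have hca : ContinuousAt α (extChartAt I x x, 0) := hαc.continuousAt hnhd
  have hα0 : α (extChartAt I x x, 0) = extChartAt I x x :=
    (hα _ (Metric.mem_closedBall_self hr.le)).1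
  have hev : ∀ᶠ q in 𝓝 (extChartAt I x x, (0 : ℝ)), α q ∈ (extChartAt I x).target := by
    refine hca ?_
    rw [hα0]
    exact (isOpen_extChartAt_target x).mem_nhds hx0
  rw [nhds_prod_eq, eventually_prod_iff] at hev
  obtain ⟨pa, ha, pb, hb, hab⟩ := hev
  obtain ⟨ε', hε', hb'⟩ := Metric.eventually_nhds_iff_ball.1 hb
  refine ⟨min ε ε', lt_min hε hε', ?_⟩
  have hcx : ContinuousAt (extChartAt I x) x := continuousAt_extChartAt x
  filter_upwards [hcx.eventually ha, hcx (Metric.closedBall_mem_nhds _ hr),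
    extChartAt_source_mem_nhds (I := I) x] with y hy1 hy2 hy3
  refine ⟨fun t => (extChartAt I x).symm (α (extChartAt I x y, t)), ?_, fun t ht => ?_⟩
  · change (extChartAt I x).symm (α (extChartAt I x y, 0)) = y
    rw [(hα _ hy2).1, (extChartAt I x).left_inv hy3]
  · have ht1 : |t| < min ε ε' := abs_lt.2 ht
    have ht2 := abs_lt.1 (ht1.trans_le (min_le_left _ _))
    refine hasVel_of_chart (α := fun t => α (extChartAt I x y, t)) ?_ ?_
    · exact ((hα _ hy2).2 t ⟨by linarith, by linarith⟩).hasDerivAt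
        (Icc_mem_nhds (by linarith) (by linarith))
    · refine hab hy1 (hb' t ?_)
      rw [Metric.mem_ball, Real.dist_eq, sub_zero]
      exact ht1.trans_le (min_le_right _ _)

/-- Smooth vector fields with compact support are complete. -/
theorem exists_integralCurve_of_compactSupport [CompleteSpace E] [T2Space M] {v : M → E}
    (hv : ContMDiff I I.tangent ∞ (fun y => (⟨y, v y⟩ : TangentBundle I M)))
    {K : Set M} (hK : IsCompact K) (hvK : ∀ x ∉ K, v x = 0) (x : M) :
    ∃ γ : ℝ → M, γ 0 = x ∧ ∀ t, HasVel I γ t (v (γ t)) := by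
  have hI1 : IsManifold I 1 M := IsManifold.of_le (n := ∞) (by norm_cast)
  choose ε hε hU using fun x => exists_uniform_time (I := I) (v := v) (hv x)
  obtain ⟨T, hT⟩ := hK.elim_nhds_subcover _ fun x _ => hU x
  obtain ⟨ε₀, hε₀, hε₀'⟩ : ∃ ε₀ > (0 : ℝ), ∀ x ∈ T, ε₀ ≤ ε x := by
    rcases T.eq_empty_or_nonempty with rfl | hne
    · exact ⟨1, one_pos, by simp⟩
    · refine ⟨T.inf' hne ε, ?_, fun x hx => Finset.inf'_le _ hx⟩
      rw [gt_iff_lt, Finset.lt_inf'_iff]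
      exact fun x _ => hε x
  have hloc : ∀ x : M, ∃ γ : ℝ → M, γ 0 = x ∧
      IsMIntegralCurveOn (I := I) γ (v : (x : M) → TangentSpace I x) (Ioo (-ε₀) ε₀) := by
    intro y
    by_cases hy : y ∈ K
    · obtain ⟨z, hz, hyz⟩ := mem_iUnion₂.1 (hT.2 hy)
      obtain ⟨γ, h0, hγ⟩ := hyz
      refine ⟨γ, h0, fun t ht => HasMFDerivAt.hasMFDerivWithinAt (hγ t ?_)⟩
      exact Ioo_subset_Ioo (neg_le_neg (hε₀' z hz)) (hε₀' z hz) ht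
    · refine ⟨fun _ => y, rfl, fun t _ => HasMFDerivAt.hasMFDerivWithinAt ?_⟩
      have := hasVel_const (I := I) y t
      rwa [← hvK y hy] at this
  obtain ⟨γ, h0, hγ⟩ := exists_isMIntegralCurve_of_isMIntegralCurveOn
    (v := (v : (x : M) → TangentSpace I x)) (hv.of_le (by norm_cast)) hε₀ hloc x
  exact ⟨γ, h0, fun t => hγ t⟩

theorem integralCurve_unique [T2Space M] {v : M → E}
    (hv : ContMDiff I I.tangent ∞ (fun y => (⟨y, v y⟩ : TangentBundle I M)))
    {γ γ' : ℝ → M} {a b t₀ : ℝ} (ht₀ : t₀ ∈ Ioo a b)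
    (h : ∀ t ∈ Ioo a b, HasVel I γ t (v (γ t))) (h' : ∀ t ∈ Ioo a b, HasVel I γ' t (v (γ' t)))
    (h0 : γ t₀ = γ' t₀) : EqOn γ γ' (Ioo a b) := by
  have hI1 : IsManifold I 1 M := IsManifold.of_le (n := ∞) (by norm_cast)
  exact isMIntegralCurveOn_Ioo_eqOn_of_contMDiff_boundaryless
    (v := (v : (x : M) → TangentSpace I x)) ht₀ (hv.of_le (by norm_cast))
    (fun t ht => HasMFDerivAt.hasMFDerivWithinAt (h t ht))
    (fun t ht => HasMFDerivAt.hasMFDerivWithinAt (h' t ht)) h0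

/-- Integral curves of smooth vector fields are smooth. -/
theorem HasVel.contMDiffAt [CompleteSpace E] {v : M → E} {γ : ℝ → M} {t₀ : ℝ}
    (hv : ∀ᶠ y in 𝓝 (γ t₀), ContMDiffAt I I.tangent ∞ (fun y => (⟨y, v y⟩ : TangentBundle I M)) y)
    (h : ∀ᶠ t in 𝓝 t₀, HasVel I γ t (v (γ t))) : ContMDiffAt 𝓘₁ I ∞ γ t₀ := by
  set x := γ t₀ with hx
  set φ := extChartAt I x with hφ
  have hcont : ContinuousAt γ t₀ := h.self_of_nhds.continuousAt
  have hs : ∀ᶠ t in 𝓝 t₀, γ t ∈ φ.source := hcont (extChartAt_source_mem_nhds (I := I) x)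
  have hsymm : ContinuousAt φ.symm (φ x) := continuousAt_extChartAt_symm x
  have hu : ∀ᶠ z in 𝓝 (φ x), z ∈ φ.target ∧
      ContMDiffAt I I.tangent ∞ (fun y => (⟨y, v y⟩ : TangentBundle I M)) (φ.symm z) := by
    refine Eventually.and
      ((isOpen_extChartAt_target (I := I) x).mem_nhds (mem_extChartAt_target x)) ?_
    have : Tendsto φ.symm (𝓝 (φ x)) (𝓝 x) := by
      have h1 := hsymm
      rwa [ContinuousAt, extChartAt_to_inv] at h1
    exact this.eventually hv
  obtain ⟨u, hu1, hu2, hu3⟩ := eventually_nhds_iff.1 hu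
  have hβc : ContinuousAt (fun t => φ (γ t)) t₀ :=
    (continuousAt_extChartAt x : ContinuousAt φ (γ t₀)).comp hcont
  have hβu : ∀ᶠ t in 𝓝 t₀, φ (γ t) ∈ u := hβc (hu2.mem_nhds hu3)
  obtain ⟨η, hη, hη'⟩ := Metric.nhds_basis_closedBall.eventually_iff.1 ((h.and hs).and hβu)
  rw [Real.closedBall_eq_Icc] at hη'
  have h1 : ContDiffOn ℝ ((⊤ : ℕ∞) : WithTop ℕ∞) (fun t => φ (γ t)) (Icc (t₀ - η) (t₀ + η)) := by
    refine ODE.contDiffOn_enat_Icc_of_hasDerivWithinAt (f := fun _ z => fieldInChart I v x z)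
      (u := u) ?_ (fun t ht => ?_) (fun t ht => (hη' ht).2)
    · rintro ⟨t, z⟩ ⟨-, hz⟩
      have h2 := contDiffAt_fieldInChart (v := v) (hu1 z hz).1 (hu1 z hz).2
      exact (h2.comp (t, z) contDiffAt_snd).contDiffWithinAt
    · exact ((hη' ht).1.1.chart (hη' ht).1.2).hasDerivWithinAt
  have h2 : ContMDiffAt 𝓘₁ 𝓘(ℝ, E) ∞ (fun t => φ (γ t)) t₀ :=
    (h1.contDiffAt (Icc_mem_nhds (by linarith) (by linarith))).contMDiffAt
  have h3 : ContMDiffAt 𝓘(ℝ, E) I ∞ φ.symm (φ (γ t₀)) :=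
    contMDiffAt_extChartAt_symm (mem_extChartAt_target x)
  refine (h3.comp t₀ h2).congr_of_eventuallyEq ?_
  filter_upwards [hs] with t ht
  exact (φ.left_inv ht).symm

end Curves

namespace ModelData

/-- The angular coordinate field `∂_θ`, as a smooth section of the tangent bundle of
`(Y × ℝ) × ℝ`. -/
theorem contMDiffAt_section_theta (c : ℝ) (q : (Y × ℝ) × ℝ) :
    ContMDiffAt (𝓘C n) (𝓘C n).tangent ∞
      (fun q : (Y × ℝ) × ℝ => (⟨q, ((0, c) : (EY n × ℝ) × ℝ)⟩ :
        TangentBundle (𝓘C n) ((Y × ℝ) × ℝ))) q := by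
  have h1 : ContMDiffAt (𝓘C n) (IYR n) ∞ (fun q : (Y × ℝ) × ℝ => q.1) q :=
    contMDiffAt_fst
  have h2 : ContMDiffAt (𝓘C n) 𝓘₁ ∞ (fun q : (Y × ℝ) × ℝ => q.2) q :=
    contMDiffAt_snd
  exact TangentBundle.contMDiffAt_prodMk (contMDiffAt_zeroSection_comp h1)
    (contMDiffAt_tangentBundle_vectorSpace (g := fun _ => c) h2 contMDiffAt_const)

/-- The vector field `c ∂_θ` on `Y × S`, along the `i`-th cylinder. -/
theorem contMDiffAt_section_coord_theta (D : ModelData n Y S k g) (i : Fin k) (c : ℝ)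
    {q : (Y × ℝ) × ℝ} (hq : |q.1.2| < 1 + D.δ) :
    ContMDiffAt (𝓘C n) (IYS n).tangent ∞
      (fun q : (Y × ℝ) × ℝ => (⟨D.coord i q, D.dcoord i (q.1.2, q.2) (0, c)⟩ :
        TangentBundle (IYS n) (Y × S))) q := by
  have h1 := contMDiffAt_section_theta (n := n) c q
  have h2 := (contMDiffAt_tangentMap (p := (⟨q, ((0, c) : (EY n × ℝ) × ℝ)⟩ :
        TangentBundle (𝓘C n) ((Y × ℝ) × ℝ))) (D.contMDiffAt_coord i hq)).comp q h1
  refine h2.congr_of_eventuallyEq ?_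
  have hev : ∀ᶠ q' : (Y × ℝ) × ℝ in 𝓝 q, |q'.1.2| < 1 + D.δ :=
    ((continuous_snd.comp continuous_fst).abs.continuousAt (x := q)).eventually_lt_const hq
  filter_upwards [hev] with q' hq'
  have h3 := D.md_coord i hq' (0, c)
  change (⟨D.coord i q', D.dcoord i (q'.1.2, q'.2) (0, c)⟩ : TangentBundle (IYS n) (Y × S))
    = ⟨D.coord i q', md (𝓘C n) (IYS n) (D.coord i) q' (0, c)⟩
  rw [h3]

/-- `J` maps smooth sections tangent to `Y × S` to sections with smooth `Y × S`-part. -/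
theorem IsModelJ.contMDiffAt_apply (hJ : D.IsModelJ J) {E₀ H₀ M₀ : Type*} [NormedAddCommGroup E₀]
    [NormedSpace ℝ E₀] [TopologicalSpace H₀] {I₀ : ModelWithCorners ℝ E₀ H₀}
    [TopologicalSpace M₀] [ChartedSpace H₀ M₀] {f : M₀ → Y × S} {v : M₀ → EY n × ES} {x : M₀}
    (hf : ContMDiffAt I₀ (IYS n).tangent ∞
      (fun y => (⟨f y, v y⟩ : TangentBundle (IYS n) (Y × S))) x) :
    ContMDiffAt I₀ (IYS n).tangent ∞
      (fun y => (⟨f y, (J (f y) (0, v y)).2⟩ : TangentBundle (IYS n) (Y × S))) x := by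
  have h0 : ContMDiffAt I₀ (𝓘₁).tangent ∞
      (fun _ => (⟨0, (0 : ℝ)⟩ : TangentBundle 𝓘₁ ℝ)) x :=
    contMDiffAt_const
  have h1 := TangentBundle.contMDiffAt_prodMk h0 hf
  have h2 := (hJ.smooth _).comp x h1
  have h3 : ContMDiffAt (𝓘W n) (IYS n) ∞ (fun w : ℝ × (Y × S) => w.2)
      ((0 : ℝ), f x) := contMDiffAt_snd
  have h4 := (contMDiffAt_tangentMap (p := (⟨((0 : ℝ), f x), J (f x) (0, v x)⟩ :
    TangentBundle (𝓘W n) (ℝ × (Y × S)))) h3).comp x h2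
  refine h4.congr_of_eventuallyEq (Eventually.of_forall fun y => ?_)
  change (⟨f y, (J (f y) (0, v y)).2⟩ : TangentBundle (IYS n) (Y × S))
    = ⟨f y, md (𝓘W n) (IYS n) (fun w : ℝ × (Y × S) => w.2) (0, f y)
      (J (f y) (0, v y))⟩
  rw [md_snd]; rfl

theorem IsModelJ.key' (hJ : D.IsModelJ J) (hn : 1 ≤ n) (i : Fin k) {q : (Y × ℝ) × ℝ}
    (h : |q.1.2| < 1 + D.δ) :
    J (D.coord i q) (0, D.dcoord i (q.1.2, q.2) (0, 1))
      = -(D.cutHeight q.1, D.dcoord i (q.1.2, q.2) (D.flowField q.1, D.angle q.1)) := by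
  rw [← hJ.key hn i h, hJ.sq]

theorem contMDiffAt_flowField (hJ : D.IsModelJ J) (hn : 1 ≤ n) (i : Fin k) {p : Y × ℝ}
    (hp : |p.2| < 1 + D.δ) :
    ContMDiffAt (IYR n) (IYR n).tangent ∞
      (fun p : Y × ℝ => (⟨p, D.flowField p⟩ : TangentBundle (IYR n) (Y × ℝ))) p := by
  have h0 : ContMDiffAt (IYR n) (𝓘C n) ∞ (fun p : Y × ℝ => (p, (0 : ℝ))) p :=
    contMDiffAt_id.prodMk contMDiffAt_const
  have h1 := hJ.contMDiffAt_apply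
    (ContMDiffAt.comp p (f := fun p : Y × ℝ => (p, (0 : ℝ)))
      (D.contMDiffAt_section_coord_theta i (-1) (q := (p, 0)) hp) h0)
  obtain ⟨G, O, hO, hqO, hG, hGO, hGq, hGe⟩ := D.exists_local_inverse_coord i (q := (p, 0)) hp
  have hG1 : ContMDiffAt (IYS n) (IYR n) ∞ (fun m => (G m).1) (D.coord i (p, 0)) :=
    (contMDiffAt_fst).comp (D.coord i (p, 0)) (hG.contMDiffAt (hO.mem_nhds hqO))
  have h2 := (contMDiffAt_tangentMap (p := (⟨D.coord i (p, 0), _⟩ :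
    TangentBundle (IYS n) (Y × S))) hG1).comp p h1
  refine h2.congr_of_eventuallyEq ?_
  have hev : ∀ᶠ q' : Y × ℝ in 𝓝 p, |q'.2| < 1 + D.δ :=
    (continuous_snd.abs.continuousAt (x := p)).eventually_lt_const hp
  have hcO : ∀ᶠ q' : Y × ℝ in 𝓝 p, D.coord i (q', 0) ∈ O := by
    have : ContinuousAt (fun q' : Y × ℝ => D.coord i (q', 0)) p :=
      (ContMDiffAt.comp p (f := fun p : Y × ℝ => (p, (0 : ℝ)))
        (D.contMDiffAt_coord i (q := (p, 0)) hp) h0).continuousAt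
    exact this (hO.mem_nhds hqO)
  have hGe' : ∀ᶠ q' : Y × ℝ in 𝓝 p, ∀ᶠ q in 𝓝 (q', (0 : ℝ)), G (D.coord i q) = q :=
    h0.continuousAt.eventually hGe.eventually_nhds
  filter_upwards [hev, hcO, hGe'] with q hq hqO hqe
  have e1 : D.dcoord i (q.2, 0) (0, -1) = -D.dcoord i (q.2, 0) (0, 1) := by
    ext <;> simp [dcoord]
  have e2 : (J (D.coord i (q, 0)) (0, D.dcoord i (q.2, 0) (0, -1))).2
      = D.dcoord i (q.2, 0) (D.flowField q, D.angle q) := by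
    have e3 : ((0, D.dcoord i (q.2, 0) (0, -1)) : ℝ × (EY n × ES))
        = -(0, D.dcoord i (q.2, 0) (0, 1)) := by rw [e1]; simp
    rw [e3, map_neg, hJ.key' hn i (q := (q, 0)) hq]
    simp
  have hGm : MDifferentiableAt (IYS n) (𝓘C n) G (D.coord i (q, 0)) :=
    (hG.contMDiffAt (hO.mem_nhds hqO)).mdifferentiableAt (by simp)
  have hfm : MDifferentiableAt (𝓘C n) (IYR n)
      (fun q : (Y × ℝ) × ℝ => q.1) (G (D.coord i (q, 0))) := mdifferentiableAt_fst
  have e4 := md_comp (x := D.coord i (q, 0)) hfm hGm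
  have e5 := md_comp (x := ((q, 0) : (Y × ℝ) × ℝ)) hGm
    ((D.contMDiffAt_coord i (q := (q, 0)) hq).mdifferentiableAt (by simp))
  rw [md_congr (g := fun q => q) hqe, md_id] at e5
  have e6 := DFunLike.congr_fun e5 (D.flowField q, D.angle q)
  rw [ContinuousLinearMap.comp_apply, D.md_coord i (q := (q, 0)) hq] at e6
  rw [md_fst] at e4
  have e7 := DFunLike.congr_fun e4 (D.dcoord i (q.2, 0) (D.flowField q, D.angle q))
  rw [ContinuousLinearMap.comp_apply] at e7
  have e8 : (G (D.coord i (q, 0))).1 = q := by rw [hqe.self_of_nhds]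
  change (⟨q, D.flowField q⟩ : TangentBundle (IYR n) (Y × ℝ))
    = ⟨(G (D.coord i (q, 0))).1, md (IYS n) (IYR n) (fun m => (G m).1) (D.coord i (q, 0))
        (J (D.coord i (q, 0)) (0, D.dcoord i (q.2, 0) (0, -1))).2⟩
  rw [e2, e7, ← e6, e8]
  rfl

theorem contMDiffAt_angle (hJ : D.IsModelJ J) (hn : 1 ≤ n) (i : Fin k) {p : Y × ℝ}
    (hp : |p.2| < 1 + D.δ) : ContMDiffAt (IYR n) 𝓘₁ ∞ D.angle p := by
  have h1 := (D.al_smooth _).comp p (contMDiffAt_flowField hJ hn i hp)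
  have h2 : ContDiff ℝ ∞ fun x : ℝ => -(D.ε * x) := by fun_prop
  exact h2.contMDiff.contMDiffAt.comp p h1

end ModelData

/-! ### Local estimates in charts -/

section Estimates

variable {E : Type*} [NormedAddCommGroup E] [NormedSpace ℝ E] [FiniteDimensional ℝ E]
  {H : Type*} [TopologicalSpace H] {I : ModelWithCorners ℝ E H} [I.Boundaryless]
  {M : Type*} [TopologicalSpace M] [ChartedSpace H M] [IsManifold I ∞ M]

/-- A continuous family of functions that are homogeneous of degree two is bounded below by a
multiple of the square of the norm, near a positive member of the family. -/
theorem exists_mul_sq_le_of_homogeneous {X : Type*} [TopologicalSpace X] {f : X → E → ℝ} {x₀ : X}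
    (hf : ∀ v, ContinuousAt (fun q : X × E => f q.1 q.2) (x₀, v))
    (hh : ∀ x (c : ℝ) v, f x (c • v) = c ^ 2 * f x v) (hpos : ∀ v, v ≠ 0 → 0 < f x₀ v) :
    ∃ c > 0, ∀ᶠ x in 𝓝 x₀, ∀ v, c * ‖v‖ ^ 2 ≤ f x v := by
  have hK : IsCompact (Metric.sphere (0 : E) 1) := isCompact_sphere 0 1
  obtain ⟨c, hc, hcK⟩ : ∃ c > 0, ∀ v ∈ Metric.sphere (0 : E) 1, c < f x₀ v := by
    rcases (Metric.sphere (0 : E) 1).eq_empty_or_nonempty with he | hne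
    · exact ⟨1, one_pos, by simp [he]⟩
    · have hc : ContinuousOn (f x₀) (Metric.sphere (0 : E) 1) := fun v _ =>
        (ContinuousAt.comp (f := fun v : E => (x₀, v)) (x := v) (hf v)
          (by fun_prop)).continuousWithinAt
      obtain ⟨v, hv, hmin⟩ := hK.exists_isMinOn hne hc
      have hv0 : v ≠ 0 := by
        rintro rfl; simp at hv
      exact ⟨f x₀ v / 2, half_pos (hpos v hv0), fun w hw =>
        (half_lt_self (hpos v hv0)).trans_le (hmin hw)⟩
  refine ⟨c, hc, ?_⟩
  have hev : ∀ᶠ x in 𝓝 x₀, ∀ v ∈ Metric.sphere (0 : E) 1, c < f x v :=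
    hK.eventually_forall_of_forall_eventually fun v hv => (hf v).eventually_const_lt (hcK v hv)
  filter_upwards [hev] with x hx v
  rcases eq_or_ne v 0 with rfl | hv
  · have := hh x 0 0
    rw [zero_smul] at this
    rw [this]; simp
  · have hn := norm_pos_iff.2 hv
    have h1 := hx (‖v‖⁻¹ • v) (by simp [norm_smul, hn.ne'])
    rw [hh] at h1
    have h2 := mul_le_mul_of_nonneg_right h1.le (sq_nonneg ‖v‖)
    calc c * ‖v‖ ^ 2 ≤ ‖v‖⁻¹ ^ 2 * f x v * ‖v‖ ^ 2 := h2
      _ = f x v := by field_simp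

/-- The gradient inequality at a non-degenerate critical point. -/
theorem isBigO_of_nondeg {f : E → ℝ} {z₀ : E} (hf : ContDiffAt ℝ ∞ f z₀)
    (h0 : fderiv ℝ f z₀ = 0)
    (hnd : ∀ v, v ≠ 0 → ∃ w, fderiv ℝ (fderiv ℝ f) z₀ v w ≠ 0) :
    (fun z => f z - f z₀) =O[𝓝 z₀] fun z => ‖fderiv ℝ f z‖ ^ 2 := by
  have hd1 : ContDiffAt ℝ ∞ (fderiv ℝ f) z₀ := hf.fderiv_right (by simp)
  have hd2 : HasFDerivAt (fderiv ℝ f) (fderiv ℝ (fderiv ℝ f) z₀) z₀ :=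
    (hd1.differentiableAt (by simp)).hasFDerivAt
  set A := fderiv ℝ (fderiv ℝ f) z₀ with hA
  have hinj : Injective A := by
    rw [injective_iff_map_eq_zero]
    intro v hv
    by_contra hne
    obtain ⟨w, hw⟩ := hnd v hne
    rw [hv] at hw
    exact hw rfl
  obtain ⟨K, hK, hAK⟩ := (A : E →ₗ[ℝ] (E →L[ℝ] ℝ)).exists_antilipschitzWith
    (LinearMap.ker_eq_bot.2 hinj)
  -- `‖z - z₀‖ ≤ C ‖f'(z)‖`
  have h1 : (fun z => z - z₀) =O[𝓝 z₀] fun z => fderiv ℝ f z := by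
    have h2 : (fun z => z - z₀) =O[𝓝 z₀] fun z => A (z - z₀) := by
      refine IsBigO.of_bound K (Eventually.of_forall fun z => ?_)
      have := hAK.le_mul_dist (z - z₀) 0
      simpa [dist_eq_norm] using this
    have h3 := hd2.isLittleO
    rw [h0] at h3
    simp only [sub_zero] at h3
    have h4 : (fun z => A (z - z₀)) =O[𝓝 z₀] fun z => fderiv ℝ f z := by
      have h5 := (h3.trans_isBigO h2)
      have h6 : (fun z => A (z - z₀) - fderiv ℝ f z) =o[𝓝 z₀] fun z => A (z - z₀) := by
        refine h5.neg_left.congr_left fun z => ?_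
        simp
      have h7 := h6.right_isBigO_sub
      simpa using h7
    exact h2.trans h4
  -- `|f(z) - f(z₀)| ≤ C ‖z - z₀‖²`
  have h2 : (fun z => f z - f z₀) =O[𝓝 z₀] fun z => ‖z - z₀‖ ^ 2 := by
    have hO := hd2.isBigO_sub
    rw [h0] at hO
    simp only [sub_zero] at hO
    obtain ⟨C, hC⟩ := hO.bound
    have hdiff : ∀ᶠ z in 𝓝 z₀, DifferentiableAt ℝ f z :=
      (hf.of_le (m := 1) (by simp)).eventually (by simp) |>.mono fun z hz =>
        hz.differentiableAt (by simp)
    obtain ⟨r, hr, hr'⟩ := Metric.eventually_nhds_iff_ball.1 (hC.and hdiff)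
    refine IsBigO.of_bound |C| ?_
    filter_upwards [Metric.ball_mem_nhds z₀ hr] with z hz
    have hsub : Metric.closedBall z₀ ‖z - z₀‖ ⊆ Metric.ball z₀ r :=
      Metric.closedBall_subset_ball (by rwa [Metric.mem_ball, dist_eq_norm] at hz)
    have h3 := (convex_closedBall z₀ ‖z - z₀‖).norm_image_sub_le_of_norm_fderiv_le (𝕜 := ℝ)
      (f := f) (C := |C| * ‖z - z₀‖) (fun w hw => (hr' w (hsub hw)).2) (fun w hw => ?_)
      (Metric.mem_closedBall_self (norm_nonneg _))
      (show z ∈ Metric.closedBall z₀ ‖z - z₀‖ by simp [dist_eq_norm])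
    · rw [norm_pow, norm_norm, pow_two, ← mul_assoc]
      exact h3
    · rw [Metric.mem_closedBall, dist_eq_norm] at hw
      exact ((hr' w (hsub (by rwa [Metric.mem_closedBall, dist_eq_norm]))).1).trans
        (mul_le_mul (le_abs_self C) hw (norm_nonneg _) (abs_nonneg C))
  refine h2.trans ?_
  exact (h1.norm_norm).pow 2

/-- The exterior derivative at points near `x`, in the preferred chart at `x`. -/
theorem dForm_inChart {η : M → E →L[ℝ] ℝ} (hη : SmoothForm I η) {x q : M}
    (hq : q ∈ (chartAt H x).source) (v w : E) :
    dForm I η q v w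
      = fderiv ℝ (formInChart I η x) (extChartAt I x q)
          (md I 𝓘(ℝ, E) (extChartAt I x) q v) (md I 𝓘(ℝ, E) (extChartAt I x) q w)
        - fderiv ℝ (formInChart I η x) (extChartAt I x q)
          (md I 𝓘(ℝ, E) (extChartAt I x) q w) (md I 𝓘(ℝ, E) (extChartAt I x) q v) := by
  have hq' : q ∈ (extChartAt I x).source := by rwa [extChartAt_source]
  have e : η =ᶠ[𝓝 q] pullForm I 𝓘(ℝ, E) (extChartAt I x) (formInChart I η x) := by
    filter_upwards [(chartAt H x).open_source.mem_nhds hq] with y hy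
    exact form_eq_formInChart_comp η hy
  have h1 : DiffFormAt 𝓘(ℝ, E) (formInChart I η x) (extChartAt I x q) :=
    diffFormAt_vectorSpace.2 ((hη.contDiffAt_formInChart x
      ((extChartAt I x).map_source hq')).differentiableAt (by simp))
  rw [dForm_congr e, dForm_pullForm h1 (contMDiffAt_extChartAt' hq), dForm_vectorSpace]

set_option maxSynthPendingDepth 3 in
theorem continuousAt_sub_flip {X : Type*} [TopologicalSpace X] {F : X → E →L[ℝ] E →L[ℝ] ℝ} {x : X}
    (hF : ContinuousAt F x) : ContinuousAt (fun z => F z - (F z).flip) x :=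
  hF.sub ((ContinuousLinearMap.flipₗᵢ ℝ E E ℝ).continuous.continuousAt.comp hF)

/-- The coordinate expression of a field of endomorphisms in the preferred chart at `x`. -/
def endInChart (I : ModelWithCorners ℝ E H) (J : M → E →L[ℝ] E) (x : M) (z : E) : E →L[ℝ] E :=
  ((md I 𝓘(ℝ, E) (extChartAt I x) ((extChartAt I x).symm z)).comp
    (J ((extChartAt I x).symm z))).comp (md 𝓘(ℝ, E) I (extChartAt I x).symm z)

theorem contDiffAt_endInChart {J : M → E →L[ℝ] E} (hJ : SmoothEnd I J) {x : M} {z : E}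
    (hz : z ∈ (extChartAt I x).target) : ContDiffAt ℝ ∞ (endInChart I J x) z := by
  suffices ContDiffOn ℝ ∞ (endInChart I J x) (extChartAt I x).target from
    this.contDiffAt ((isOpen_extChartAt_target x).mem_nhds hz)
  rw [contDiffOn_clm_apply]
  intro v z hz
  have h1 : ContMDiffAt 𝓘(ℝ, E) I.tangent ∞ (fun z => tangentMap 𝓘(ℝ, E) I (extChartAt I x).symm
      (⟨z, v⟩ : TangentBundle 𝓘(ℝ, E) E)) z :=
    ContMDiffAt.comp z (contMDiffAt_tangentMap (p := (⟨z, v⟩ : TangentBundle 𝓘(ℝ, E) E))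
      (contMDiffAt_extChartAt_symm hz))
      (contMDiffAt_tangentBundle_vectorSpace contMDiffAt_id contMDiffAt_const)
  have h2 := (hJ _).comp z h1
  have hs := (extChartAt I x).map_target hz
  rw [extChartAt_source] at hs
  have h3 : ContMDiffAt I 𝓘(ℝ, E) ∞ (extChartAt I x) ((extChartAt I x).symm z) :=
    contMDiffAt_extChartAt' hs
  have h4 := (contMDiffAt_tangentMap (p := (⟨(extChartAt I x).symm z,
    J ((extChartAt I x).symm z) (md 𝓘(ℝ, E) I (extChartAt I x).symm z v)⟩ : TangentBundle I M))
    h3).comp z h2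
  exact (contMDiffAt_iff_contDiffAt.1
    (((contMDiff_snd_tangentBundle_modelSpace E 𝓘(ℝ, E)).contMDiffAt).comp z
      h4)).contDiffWithinAt

theorem endInChart_apply {J : M → E →L[ℝ] E} {x q : M} (hq : q ∈ (chartAt H x).source) (v : E) :
    endInChart I J x (extChartAt I x q) (md I 𝓘(ℝ, E) (extChartAt I x) q v)
      = md I 𝓘(ℝ, E) (extChartAt I x) q (J q v) := by
  have hq' : q ∈ (extChartAt I x).source := by rwa [extChartAt_source]
  have h := DFunLike.congr_fun (md_symm_comp_md_extChartAt (I := I) hq) v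
  rw [ContinuousLinearMap.comp_apply] at h
  simp only [endInChart, ContinuousLinearMap.comp_apply, (extChartAt I x).left_inv hq', h]
  rfl

theorem md_chart_surj {x q : M} (hq : q ∈ (chartAt H x).source) (u : E) :
    md I 𝓘(ℝ, E) (extChartAt I x) q (md 𝓘(ℝ, E) I (extChartAt I x).symm (extChartAt I x q) u) = u :=
  DFunLike.congr_fun (md_extChartAt_comp_md_symm (I := I) hq) u

theorem smoothForm_md {g : M → ℝ} (hg : ContMDiff I 𝓘₁ ∞ g) :
    SmoothForm I (md I 𝓘₁ g) := fun p =>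
  ((contMDiff_snd_tangentBundle_modelSpace ℝ 𝓘₁).contMDiffAt).comp p
    (contMDiffAt_tangentMap (hg p.1))

end Estimates

namespace ModelData

variable (D)

/-! ### The height increases along the flow -/

/-- The derivative of the height in the direction of `flowField`. -/
def ascent (p : Y × ℝ) : ℝ := md (IYR n) 𝓘₁ D.height p (D.flowField p)

theorem ascent_spine {p : Y × ℝ} (h : |p.2| ≤ 1 - D.δ) :
    D.ascent p = D.ε * exp (D.ε * D.H p) *
      dForm (IYR n) (familyForm D.al) p (D.flowField p) (D.J₀ p (D.flowField p)) := by
  rw [ascent, D.md_height_spine (by linarith [D.δ_pos]), (D.flowField_spine h).apply]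

theorem ascent_corner {e : Bool} {p : Y × ℝ} (h : 1 - D.δ < sgn e * p.2) :
    D.ascent p = deriv (fun x => D.height (p.1, x)) p.2 ^ 2 / D.h p.2 := by
  rw [ascent, D.md_height_corner (e := e) (by linarith [D.δ'_gt]), D.flowField_corner h]
  ring

theorem isCrit_iff_flowField_eq_zero {p : Y × ℝ} (h : |p.2| ≤ 1 - D.δ) :
    IsCrit (IYR n) D.H p ↔ D.flowField p = 0 := by
  have h1 : |p.2| ≤ 1 := by linarith [D.δ_pos]
  have hgr := D.flowField_spine h
  constructor
  · intro hc
    refine hgr.unique h1 fun v => ?_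
    have : md (IYR n) 𝓘₁ D.H p v = 0 := hc v
    rw [map_zero, zero_apply]
    exact this.symm
  · intro h0 v
    have h2 := hgr.apply v
    rw [h0, map_zero, zero_apply] at h2
    exact h2.symm

/-- The critical points are the zeros of `ascent`; over the corners there are none. -/
theorem mem_crit_iff (hn : 1 ≤ n) {p : Y × ℝ} :
    p ∈ D.crit ↔ D.ascent p = 0 := by
  have hδ := D.δ_pos
  rcases D.spine_or_corner p.2 with h1 | ⟨e, h1⟩
  · have h2 : |p.2| < 1 := by linarith
    have h3 : p ∈ D.crit ↔ IsCrit (IYR n) D.H p := ⟨fun hc => hc.2, fun h' => ⟨h2, h'⟩⟩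
    rw [h3, D.isCrit_iff_flowField_eq_zero h1, D.ascent_spine h1]
    constructor
    · intro h0; rw [h0]; simp
    · intro h0
      by_contra hne
      have h4 := D.J₀_tame p h2.le _ hne
      have h5 := mul_pos D.ε_pos (exp_pos (D.ε * D.H p))
      exact (mul_pos h5 h4).ne' h0
  · constructor
    · intro hc
      have h2 := D.abs_crit_le hn hc
      have h3 := sgn_mul_le_abs e p.2
      linarith [D.δ'_gt]
    · intro h0
      have h2 := D.deriv_height_neg hn e p.1 (τ := p.2) (by linarith [D.δ'_gt])
      rw [D.ascent_corner h1, div_eq_zero_iff] at h0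
      rcases h0 with h0 | h0
      · rw [pow_eq_zero_iff two_ne_zero] at h0
        rw [h0, mul_zero] at h2
        exact absurd h2 (lt_irrefl _)
      · exact absurd h0 (D.h_pos p.2).ne'

theorem ascent_nonneg (p : Y × ℝ) : 0 ≤ D.ascent p := by
  rcases D.spine_or_corner p.2 with h | ⟨e, h⟩
  · rw [D.ascent_spine h]
    have h1 := mul_pos D.ε_pos (exp_pos (D.ε * D.H p))
    rcases eq_or_ne (D.flowField p) 0 with h0 | h0
    · rw [h0]; simp
    · exact (mul_pos h1 (D.J₀_tame p (by linarith [D.δ_pos]) _ h0)).le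
  · rw [D.ascent_corner h]
    exact div_nonneg (sq_nonneg _) (D.h_pos _).le

/-- The flow points into the interior of the spine, where the height is a function of `τ`. -/
theorem sgn_mul_flowField_neg (hn : 1 ≤ n) {e : Bool} {p : Y × ℝ} (h : 1 - D.δ' < sgn e * p.2) :
    sgn e * (D.flowField p).2 < 0 := by
  have h1 : p ∉ D.crit := fun hc => by
    have := D.abs_crit_le hn hc
    linarith [sgn_mul_le_abs e p.2]
  have h2 : D.ascent p ≠ 0 := fun h0 => h1 ((D.mem_crit_iff hn).2 h0)
  have h3 : 0 < D.ascent p := lt_of_le_of_ne (D.ascent_nonneg p) h2.symm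
  rw [ascent, D.md_height_corner h] at h3
  have h4 := D.deriv_height_neg hn e p.1 h
  have h5 : (sgn e * (D.flowField p).2) * (sgn e * deriv (fun x => D.height (p.1, x)) p.2)
      = (D.flowField p).2 * deriv (fun x => D.height (p.1, x)) p.2 := by
    rw [mul_mul_mul_comm, sgn_mul_self, one_mul]
  rw [← h5] at h3
  by_contra! h6
  exact absurd h3 (not_lt.2 (mul_nonpos_of_nonneg_of_nonpos h6 h4.le))

variable {D}

theorem continuousAt_form_flowField (hJ : D.IsModelJ J) (hn : 1 ≤ n) (i : Fin k)
    {η : Y × ℝ → (EY n × ℝ) →L[ℝ] ℝ} (hη : SmoothForm (IYR n) η) {p : Y × ℝ}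
    (hp : |p.2| < 1 + D.δ) : ContinuousAt (fun p => η p (D.flowField p)) p :=
  ((hη _).comp p (contMDiffAt_flowField hJ hn i hp)).continuousAt

theorem continuousAt_ascent (hJ : D.IsModelJ J) (hn : 1 ≤ n) (i : Fin k) {p : Y × ℝ}
    (hp : |p.2| < 1 + D.δ) : ContinuousAt D.ascent p :=
  continuousAt_form_flowField hJ hn i (smoothForm_md D.contMDiff_height) hp

theorem isBigO_of_ne_zero {X : Type*} [TopologicalSpace X] {f q : X → ℝ} {x : X}
    (hf : ContinuousAt f x) (hq : ContinuousAt q x) (h : q x ≠ 0) : f =O[𝓝 x] q := by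
  refine isBigO_of_div_tendsto_nhds ?_ (f x / q x) (hf.div hq h)
  filter_upwards [hq.eventually_ne h] with y hy h0
  exact absurd h0 hy

set_option maxSynthPendingDepth 3 in
set_option maxHeartbeats 800000 in
/-- The square of the norm of the vector field, in a chart at a critical point, is controlled by
`ascent`. -/
theorem isBigO_norm_sq (hn : 1 ≤ n) {p₀ : Y × ℝ} (hp : p₀ ∈ D.crit) :
    (fun p => ‖md (IYR n) 𝓘(ℝ, EY n × ℝ) (extChartAt (IYR n) p₀) p (D.flowField p)‖ ^ 2)
      =O[𝓝 p₀] D.ascent ∧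
    (fun p => ‖fderiv ℝ (D.H ∘ (extChartAt (IYR n) p₀).symm) (extChartAt (IYR n) p₀ p)‖ ^ 2)
      =O[𝓝 p₀] D.ascent := by
  have hδ := D.δ_pos
  have hp1 : |p₀.2| < 1 - D.δ := (D.abs_crit_le hn hp).trans_lt (by linarith [D.δ'_gt])
  have hz₀ := mem_extChartAt_target (I := IYR n) p₀
  set φ := extChartAt (IYR n) p₀ with hφ
  set Fm := formInChart (IYR n) (familyForm D.al) p₀ with hFm
  have hF : ContDiffAt ℝ ∞ (fderiv ℝ Fm) (φ p₀) :=
    (D.al_smooth.contDiffAt_formInChart p₀ hz₀).fderiv_right (by simp)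
  have hJ0 := (contDiffAt_endInChart D.J₀_smooth hz₀).continuousAt
  set Jc := endInChart (IYR n) D.J₀ p₀ with hJc
  set A : EY n × ℝ → (EY n × ℝ) →L[ℝ] (EY n × ℝ) →L[ℝ] ℝ :=
    fun z => fderiv ℝ Fm z - (fderiv ℝ Fm z).flip with hA
  have hAc : ContinuousAt A (φ p₀) := continuousAt_sub_flip hF.continuousAt
  have hφc : ContinuousAt φ p₀ := continuousAt_extChartAt p₀
  have hsrc : ∀ᶠ p in 𝓝 p₀, p ∈ (chartAt (ModelProd (EY n) ℝ) p₀).source :=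
    chart_source_mem_nhds (ModelProd (EY n) ℝ) p₀
  have hev : ∀ᶠ q : Y × ℝ in 𝓝 p₀, |q.2| ≤ 1 - D.δ :=
    ((continuous_snd.abs.continuousAt (x := p₀)).eventually_lt_const hp1).mono fun _ h => le_of_lt h
  have hdA : ∀ p ∈ (chartAt (ModelProd (EY n) ℝ) p₀).source, ∀ v w,
      dForm (IYR n) (familyForm D.al) p v w
      = A (φ p) (md (IYR n) 𝓘(ℝ, EY n × ℝ) φ p v) (md (IYR n) 𝓘(ℝ, EY n × ℝ) φ p w) := by
    intro p hp v w
    rw [dForm_inChart D.al_smooth hp]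
    rfl
  -- the quadratic form `dα(v, J₀ v)` is bounded below
  obtain ⟨c, hc, hlow⟩ := exists_mul_sq_le_of_homogeneous (E := EY n × ℝ) (x₀ := φ p₀)
    (f := fun z v => A z v (Jc z v))
    (fun v => by
      have h1 : ContinuousAt (fun q : (EY n × ℝ) × (EY n × ℝ) => A q.1) (φ p₀, v) :=
        ContinuousAt.comp (f := Prod.fst) (x := (φ p₀, v)) hAc continuousAt_fst
      have h2 : ContinuousAt (fun q : (EY n × ℝ) × (EY n × ℝ) => Jc q.1) (φ p₀, v) :=
        ContinuousAt.comp (f := Prod.fst) (x := (φ p₀, v)) hJ0 continuousAt_fst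
      exact (h1.clm_apply continuousAt_snd).clm_apply (h2.clm_apply continuousAt_snd))
    (fun z c v => by simp only [map_smul, smul_apply, smul_eq_mul]; ring)
    (fun v hv => by
      have h1 := D.J₀_tame p₀ (by linarith) (md 𝓘(ℝ, EY n × ℝ) (IYR n) φ.symm (φ p₀) v) (by
        intro h0
        have h2 := md_chart_surj (I := IYR n) (mem_chart_source _ p₀) v
        rw [← hφ, h0, map_zero] at h2
        exact hv h2.symm)
      rw [hdA p₀ (mem_chart_source _ p₀), ← endInChart_apply (mem_chart_source _ p₀), ← hφ,
        md_chart_surj (I := IYR n) (mem_chart_source _ p₀) v] at h1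
      exact h1)
  have key : ∀ᶠ p in 𝓝 p₀, c * (D.ε * ‖md (IYR n) 𝓘(ℝ, EY n × ℝ) φ p (D.flowField p)‖ ^ 2)
      ≤ exp (-(D.ε * D.H p)) * D.ascent p := by
    filter_upwards [hφc.eventually hlow, hsrc, hev] with p h1 h2 h3
    have h4 := h1 (md (IYR n) 𝓘(ℝ, EY n × ℝ) φ p (D.flowField p))
    rw [endInChart_apply h2, ← hφ, ← hdA p h2] at h4
    rw [D.ascent_spine h3]
    have h5 := mul_le_mul_of_nonneg_left h4 D.ε_pos.le
    have h6 : exp (-(D.ε * D.H p)) * (D.ε * exp (D.ε * D.H p) *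
      dForm (IYR n) (familyForm D.al) p (D.flowField p) (D.J₀ p (D.flowField p)))
      = D.ε * dForm (IYR n) (familyForm D.al) p (D.flowField p) (D.J₀ p (D.flowField p)) := by
      rw [Real.exp_neg]; field_simp
    rw [h6]
    linarith
  have hO1 : (fun p => ‖md (IYR n) 𝓘(ℝ, EY n × ℝ) φ p (D.flowField p)‖ ^ 2) =O[𝓝 p₀] D.ascent := by
    have h1 : (fun p => exp (-(D.ε * D.H p)) * D.ascent p) =O[𝓝 p₀]
        fun p => 1 * D.ascent p := by
      refine IsBigO.mul ?_ (isBigO_refl _ _)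
      have h2 : ContinuousAt (fun p => exp (-(D.ε * D.H p))) p₀ := by
        have := D.H_smooth.continuous
        fun_prop
      exact h2.tendsto.isBigO_one ℝ
    simp only [one_mul] at h1
    refine IsBigO.trans ?_ h1
    refine IsBigO.of_bound (c * D.ε)⁻¹ ?_
    filter_upwards [key] with p hk
    have hcε : 0 < c * D.ε := mul_pos hc D.ε_pos
    rw [Real.norm_of_nonneg (sq_nonneg _), Real.norm_of_nonneg
      (mul_nonneg (exp_pos _).le (D.ascent_nonneg p)), le_inv_mul_iff₀ hcε]
    linarith
  refine ⟨hO1, ?_⟩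
  -- `dH` is the contraction of `dα` with `flowField`, composed with `J₀`
  have hfd : ∀ᶠ p in 𝓝 p₀, ‖fderiv ℝ (D.H ∘ φ.symm) (φ p)‖
      ≤ ‖A (φ p)‖ * ‖Jc (φ p)‖ * ‖md (IYR n) 𝓘(ℝ, EY n × ℝ) φ p (D.flowField p)‖ := by
    filter_upwards [hsrc, hev] with p h2 h3
    have h2' : p ∈ φ.source := by rwa [hφ, extChartAt_source]
    refine ContinuousLinearMap.opNorm_le_bound _ (by positivity) fun u => ?_
    have e1 := md_comp (x := φ p) (g := D.H) (f := φ.symm)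
      (D.H_smooth.mdifferentiable (by simp) _)
      (mdifferentiableAt_extChartAt_symm (φ.map_source h2'))
    rw [md_eq_fderiv, φ.left_inv h2'] at e1
    rw [show fderiv ℝ (D.H ∘ φ.symm) (φ p) = _ from e1, ContinuousLinearMap.comp_apply,
      ← (D.flowField_spine h3).apply, hdA p h2, ← endInChart_apply h2, ← hφ,
      md_chart_surj (I := IYR n) h2]
    calc ‖A (φ p) (md (IYR n) 𝓘(ℝ, EY n × ℝ) φ p (D.flowField p)) (Jc (φ p) u)‖
        ≤ ‖A (φ p)‖ * ‖md (IYR n) 𝓘(ℝ, EY n × ℝ) φ p (D.flowField p)‖ * ‖Jc (φ p) u‖ :=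
          (A (φ p)).le_opNorm₂ _ _
      _ ≤ ‖A (φ p)‖ * ‖md (IYR n) 𝓘(ℝ, EY n × ℝ) φ p (D.flowField p)‖ * (‖Jc (φ p)‖ * ‖u‖) := by
          gcongr
          exact (Jc (φ p)).le_opNorm u
      _ = _ := by ring
  have h1 : (fun p => ‖fderiv ℝ (D.H ∘ φ.symm) (φ p)‖) =O[𝓝 p₀]
      fun p => ‖md (IYR n) 𝓘(ℝ, EY n × ℝ) φ p (D.flowField p)‖ := by
    have h2 : (fun p => ‖A (φ p)‖ * ‖Jc (φ p)‖ *
        ‖md (IYR n) 𝓘(ℝ, EY n × ℝ) φ p (D.flowField p)‖) =O[𝓝 p₀]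
        fun p => 1 * ‖md (IYR n) 𝓘(ℝ, EY n × ℝ) φ p (D.flowField p)‖ := by
      refine IsBigO.mul ?_ (isBigO_refl _ _)
      have hA1 : ContinuousAt (fun p => A (φ p)) p₀ :=
        ContinuousAt.comp (g := A) (f := φ) (x := p₀) hAc hφc
      have hJ1 : ContinuousAt (fun p => Jc (φ p)) p₀ :=
        ContinuousAt.comp (g := Jc) (f := φ) (x := p₀) hJ0 hφc
      have h3 : ContinuousAt (fun p => ‖A (φ p)‖ * ‖Jc (φ p)‖) p₀ := hA1.norm.mul hJ1.norm
      exact h3.tendsto.isBigO_one ℝ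
    simp only [one_mul] at h2
    refine IsBigO.trans ?_ h2
    refine IsBigO.of_bound 1 ?_
    filter_upwards [hfd] with p hp
    rw [norm_norm, one_mul]
    exact hp.trans (le_abs_self _)
  exact (h1.pow 2).trans hO1

theorem isBigO_form_sq (hJ : D.IsModelJ J) (hn : 1 ≤ n) (i : Fin k)
    {η : Y × ℝ → (EY n × ℝ) →L[ℝ] ℝ} (hη : SmoothForm (IYR n) η) {p₀ : Y × ℝ}
    (hp : |p₀.2| < 1 + D.δ) : (fun p => (η p (D.flowField p)) ^ 2) =O[𝓝 p₀] D.ascent := by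
  by_cases h0 : D.ascent p₀ = 0
  · have hc := (D.mem_crit_iff hn).2 h0
    refine IsBigO.trans ?_ (isBigO_norm_sq hn hc).1
    refine IsBigO.pow ?_ 2
    set φ := extChartAt (IYR n) p₀ with hφ
    have hsrc : ∀ᶠ p in 𝓝 p₀, p ∈ (chartAt (ModelProd (EY n) ℝ) p₀).source :=
      chart_source_mem_nhds (ModelProd (EY n) ℝ) p₀
    have h1 : (fun p => ‖formInChart (IYR n) η p₀ (φ p)‖ *
        ‖md (IYR n) 𝓘(ℝ, EY n × ℝ) φ p (D.flowField p)‖) =O[𝓝 p₀]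
        fun p => 1 * ‖md (IYR n) 𝓘(ℝ, EY n × ℝ) φ p (D.flowField p)‖ := by
      refine IsBigO.mul ?_ (isBigO_refl _ _)
      have h3 : ContinuousAt (fun p => ‖formInChart (IYR n) η p₀ (φ p)‖) p₀ :=
        (ContinuousAt.comp (x := p₀) (f := φ)
          (hη.contDiffAt_formInChart p₀ (mem_extChartAt_target p₀)).continuousAt
          (continuousAt_extChartAt p₀)).norm
      exact h3.tendsto.isBigO_one ℝ
    simp only [one_mul] at h1
    refine IsBigO.trans ?_ h1
    refine IsBigO.of_bound 1 ?_
    filter_upwards [hsrc] with p hp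
    rw [form_eq_formInChart_comp (I := IYR n) η hp, one_mul, ← hφ]
    exact ((formInChart (IYR n) η p₀ (φ p)).le_opNorm _).trans (le_abs_self _)
  · exact isBigO_of_ne_zero ((continuousAt_form_flowField hJ hn i hη hp).pow 2)
      (continuousAt_ascent hJ hn i hp) h0

/-- The gradient inequality for `H`. In the Morse-Bott case it is the inequality for a function of `r`
with non-degenerate critical points. -/
theorem isBigO_H (hn : 1 ≤ n) {p₀ : Y × ℝ} (hp : p₀ ∈ D.crit) :
    (fun p => D.H p - D.H p₀) =O[𝓝 p₀] D.ascent := by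
  refine IsBigO.trans ?_ (isBigO_norm_sq hn hp).2
  set φ := extChartAt (IYR n) p₀ with hφ
  have hφc : ContinuousAt φ p₀ := continuousAt_extChartAt p₀
  have hz₀ := mem_extChartAt_target (I := IYR n) p₀
  have hsrc : ∀ᶠ p in 𝓝 p₀, p ∈ φ.source := extChartAt_source_mem_nhds (I := IYR n) p₀
  have hsm : ContDiffAt ℝ ∞ (D.H ∘ φ.symm) (φ p₀) :=
    contMDiffAt_iff_contDiffAt.1 ((D.H_smooth _).comp (φ p₀) (contMDiffAt_extChartAt_symm hz₀))
  rcases D.H_morse with hM | ⟨f, hf, hHf, hfne⟩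
  · have h0 : fderiv ℝ (D.H ∘ φ.symm) (φ p₀) = 0 := by
      have h1 := hasFDerivAt_comp_extChartAt_symm (I := IYR n) (x := p₀)
        (D.H_smooth.mdifferentiable (by simp) p₀)
      refine h1.fderiv.trans (ContinuousLinearMap.ext fun v => hp.2 v)
    have h2 := (isBigO_of_nondeg hsm h0 (hM p₀ hp.1 hp.2)).comp_tendsto hφc
    refine h2.congr' ?_ (Eventually.of_forall fun p => rfl)
    filter_upwards [hsrc] with p hp
    change D.H (φ.symm (φ p)) - D.H (φ.symm (φ p₀)) = _
    rw [φ.left_inv hp, hφ, extChartAt_to_inv]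
  · have hr : |p₀.2| < 1 := hp.1
    have hsymm : ContinuousAt φ.symm (φ p₀) := continuousAt_extChartAt_symm p₀
    have hlt : ∀ᶠ q : Y × ℝ in 𝓝 p₀, |q.2| < 1 :=
      (continuous_snd.abs.continuousAt (x := p₀)).eventually_lt_const hr
    have hsnd : ∀ z : EY n × ℝ, (φ.symm z).2 = z.2 := fun z => by
      rw [hφ, extChartAt_prod]; rfl
    have hsnd' : ∀ p : Y × ℝ, (φ p).2 = p.2 := fun z => by
      rw [hφ, extChartAt_prod]; rfl
    have e1 : D.H ∘ φ.symm =ᶠ[𝓝 (φ p₀)] fun z => f z.2 := by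
      have h1 : Tendsto φ.symm (𝓝 (φ p₀)) (𝓝 p₀) := by
        have h1 := hsymm
        rwa [ContinuousAt, extChartAt_to_inv] at h1
      filter_upwards [h1.eventually hlt] with z hz
      have := hHf (φ.symm z).1 (φ.symm z).2 hz.le
      rw [Prod.mk.eta, hsnd] at this
      exact this
    have hdf : ∀ r, HasDerivAt f (deriv f r) r := fun r =>
      (hf.differentiable (by simp) r).hasDerivAt
    have e2 : ∀ᶠ p in 𝓝 p₀, ‖deriv f p.2‖ ≤ ‖fderiv ℝ (D.H ∘ φ.symm) (φ p)‖ := by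
      filter_upwards [hφc.eventually e1.eventuallyEq_nhds] with p hp
      have h2 : HasFDerivAt (fun z : EY n × ℝ => z.2) (snd ℝ (EY n) ℝ) (φ p) :=
        hasFDerivAt_snd
      have h3 : fderiv ℝ (fun z : EY n × ℝ => f z.2) (φ p)
          = deriv f (φ p).2 • snd ℝ (EY n) ℝ :=
        (HasDerivAt.comp_hasFDerivAt (φ p) (hdf (φ p).2) h2).fderiv
      rw [hp.fderiv_eq, h3, hsnd']
      have h4 := (deriv f p.2 • snd ℝ (EY n) ℝ).le_opNorm (0, 1)
      simpa [Prod.norm_def] using h4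
    have hf0 : deriv f p₀.2 = 0 := by
      have h1 := e2.self_of_nhds
      have h2 := hasFDerivAt_comp_extChartAt_symm (I := IYR n) (x := p₀)
        (D.H_smooth.mdifferentiable (by simp) p₀)
      have h3 : fderiv ℝ (D.H ∘ φ.symm) (φ p₀) = 0 :=
        h2.fderiv.trans (ContinuousLinearMap.ext fun v => hp.2 v)
      rw [h3, norm_zero] at h1
      exact norm_le_zero_iff.1 h1
    have hfd : fderiv ℝ f = fun r => deriv f r • (1 : ℝ →L[ℝ] ℝ) := by
      ext r; simp
    have hf2 := (contDiff_infty_iff_deriv.1 hf).2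
    have h5 : (fun r => f r - f p₀.2) =O[𝓝 p₀.2] fun r => ‖fderiv ℝ f r‖ ^ 2 := by
      refine isBigO_of_nondeg hf.contDiffAt (by
        rw [hfd]; change deriv f p₀.2 • (1 : ℝ →L[ℝ] ℝ) = 0; rw [hf0, zero_smul]) fun v hv => ⟨1, ?_⟩
      rw [hfd, ((hf2.differentiable (by simp) p₀.2).hasFDerivAt.smul_const
        (1 : ℝ →L[ℝ] ℝ)).fderiv]
      simpa [hv] using hfne _ hr hf0
    have h6 := h5.comp_tendsto (continuousAt_snd (p := p₀))
    have h7 : (fun p : Y × ℝ => ‖fderiv ℝ f p.2‖ ^ 2) =O[𝓝 p₀]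
        fun p => ‖fderiv ℝ (D.H ∘ φ.symm) (φ p)‖ ^ 2 := by
      refine IsBigO.pow (IsBigO.of_bound 1 ?_) 2
      filter_upwards [e2] with p hp
      rw [norm_norm, norm_norm, one_mul, ← norm_deriv_eq_norm_fderiv]
      exact hp
    refine (h6.trans h7).congr' ?_ (Eventually.of_forall fun p => rfl)
    filter_upwards [hlt] with p hp
    have e3 := hHf p.1 p.2 hp.le
    have e4 := hHf p₀.1 p₀.2 hr.le
    rw [Prod.mk.eta] at e3 e4
    rw [e3, e4]; rfl

theorem isBigO_height (hn : 1 ≤ n) {p₀ : Y × ℝ} (hp : p₀ ∈ D.crit) :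
    (fun p => D.height p - D.height p₀) =O[𝓝 p₀] D.ascent := by
  refine IsBigO.trans ?_ (isBigO_H hn hp)
  have hδ := D.δ_pos
  have hp1 : |p₀.2| < 1 - D.δ / 3 := (D.abs_crit_le hn hp).trans_lt (by linarith [D.δ'_gt])
  have h1 : HasDerivAt (fun x : ℝ => exp (D.ε * x))
      (exp (D.ε * D.H p₀) * D.ε) (D.H p₀) := by
    simpa using ((hasDerivAt_id (D.H p₀)).const_mul D.ε).exp
  have h2 := h1.hasFDerivAt.isBigO_sub.comp_tendsto (D.H_smooth.continuous.continuousAt (x := p₀))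
  refine h2.congr' ?_ (Eventually.of_forall fun p => rfl)
  filter_upwards [D.eventually_spine hp1] with p hp
  rw [D.height_spine hp, D.height_spine hp1.le]
  rfl

end ModelData

/-! ### Convergence of gradient trajectories -/

theorem antitoneOn_of_hasDerivAt_nonpos {f f' : ℝ → ℝ} {t₁ : ℝ}
    (h : ∀ t ≥ t₁, HasDerivAt f (f' t) t) (h' : ∀ t ≥ t₁, f' t ≤ 0) : AntitoneOn f (Ici t₁) := by
  refine antitoneOn_of_deriv_nonpos (convex_Ici t₁)
    (fun t ht => (h t ht).continuousAt.continuousWithinAt)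
    (fun t ht => (h t (interior_subset ht)).differentiableAt.differentiableWithinAt) fun t ht => ?_
  rw [(h t (interior_subset ht)).deriv]
  exact h' t (interior_subset ht)

theorem monotoneOn_of_hasDerivAt_nonneg {f f' : ℝ → ℝ} {t₁ : ℝ}
    (h : ∀ t ≥ t₁, HasDerivAt f (f' t) t) (h' : ∀ t ≥ t₁, 0 ≤ f' t) : MonotoneOn f (Ici t₁) := by
  have := antitoneOn_of_hasDerivAt_nonpos (f := fun t => -f t) (f' := fun t => -f' t)
    (fun t ht => (h t ht).neg) fun t ht => neg_nonpos.2 (h' t ht)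
  exact fun a ha b hb hab => neg_le_neg_iff.1 (this ha hb hab)

theorem tendsto_of_antitoneOn {f : ℝ → ℝ} {t₁ B : ℝ} (h : AntitoneOn f (Ici t₁))
    (hB : ∀ t ≥ t₁, B ≤ f t) : ∃ l, Tendsto f atTop (𝓝 l) := by
  have hanti : Antitone fun t => f (max t t₁) := fun a b hab =>
    h (mem_Ici.2 (le_max_right _ _)) (mem_Ici.2 (le_max_right _ _)) (max_le_max_right _ hab)
  refine ⟨_, (tendsto_atTop_ciInf hanti ⟨B, ?_⟩).congr' ?_⟩
  · rintro _ ⟨t, rfl⟩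
    exact hB _ (le_max_right _ _)
  · filter_upwards [eventually_ge_atTop t₁] with t ht
    simp [max_eq_left ht]

theorem tendsto_of_monotoneOn {f : ℝ → ℝ} {t₁ B : ℝ} (h : MonotoneOn f (Ici t₁))
    (hB : ∀ t ≥ t₁, f t ≤ B) : ∃ l, Tendsto f atTop (𝓝 l) ∧ ∀ t ≥ t₁, f t ≤ l := by
  obtain ⟨l, hl⟩ := tendsto_of_antitoneOn (f := fun t => -f t) (B := -B) h.neg
    fun t ht => neg_le_neg (hB t ht)
  have hl' : Tendsto f atTop (𝓝 (-l)) := by simpa using hl.neg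
  refine ⟨-l, hl', fun t ht => ge_of_tendsto hl' ?_⟩
  filter_upwards [eventually_ge_atTop t] with t' ht'
  exact h ht (ht.trans ht') ht'

/-- Lojasiewicz's argument: if `m` decreases to `0` with speed `q`, and both `m` and the square of the
derivative of `f` are bounded by a multiple of `q`, then `f` converges, since `√m` decreases faster
than `f` can move. -/
theorem tendsto_of_gradient_inequality {m q f d : ℝ → ℝ} {C t₁ : ℝ} (hC : 0 < C)
    (hm0 : ∀ t ≥ t₁, 0 ≤ m t) (hm : ∀ t ≥ t₁, HasDerivAt m (-q t) t) (hq : ∀ t ≥ t₁, 0 ≤ q t)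
    (hf : ∀ t ≥ t₁, HasDerivAt f (d t) t) (hmq : ∀ t ≥ t₁, m t ≤ C * q t)
    (hdq : ∀ t ≥ t₁, d t ^ 2 ≤ C * q t) : ∃ l, Tendsto f atTop (𝓝 l) := by
  have hanti := antitoneOn_of_hasDerivAt_nonpos hm fun t ht => neg_nonpos.2 (hq t ht)
  -- if `m` reaches `0`, then `f` is eventually constant
  by_cases hz : ∃ t₀ ≥ t₁, m t₀ = 0
  · obtain ⟨t₀, ht₀, h0⟩ := hz
    have hmz : ∀ t ≥ t₀, m t = 0 := fun t ht =>
      le_antisymm (h0 ▸ hanti ht₀ (ht₀.le.trans ht) ht) (hm0 t (ht₀.le.trans ht))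
    have hdz : ∀ t ≥ t₀ + 1, d t = 0 := by
      intro t ht
      have ht' : t₁ ≤ t := by linarith
      have h1 : m =ᶠ[𝓝 t] fun _ => 0 := by
        filter_upwards [Ioi_mem_nhds (show t₀ < t by linarith)] with x hx
        exact hmz x hx.le
      have h2 : q t = 0 := by
        have := (hm t ht').unique ((hasDerivAt_const t (0 : ℝ)).congr_of_eventuallyEq h1)
        linarith
      have h3 := hdq t ht'
      rw [h2, mul_zero] at h3
      exact pow_eq_zero_iff two_ne_zero |>.1 (le_antisymm h3 (sq_nonneg _))
    have h4 := antitoneOn_of_hasDerivAt_nonpos (f := f) (t₁ := t₀ + 1)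
      (fun t ht => hf t (by linarith)) fun t ht => (hdz t ht).le
    have h5 := monotoneOn_of_hasDerivAt_nonneg (f := f) (t₁ := t₀ + 1)
      (fun t ht => hf t (by linarith)) fun t ht => (hdz t ht).ge
    exact tendsto_of_antitoneOn h4 fun t ht => h5 (le_refl (t₀ + 1)) ht ht
  · push Not at hz
    have hpos : ∀ t ≥ t₁, 0 < m t := fun t ht => lt_of_le_of_ne (hm0 t ht) (hz t ht).symm
    have hw : ∀ t ≥ t₁, HasDerivAt (fun t => 2 * C * √(m t)) (-(C * q t / √(m t))) t := by
      intro t ht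
      have h1 := ((hm t ht).sqrt (hpos t ht).ne').const_mul (2 * C)
      convert! h1 using 1
      have := (Real.sqrt_pos.2 (hpos t ht)).ne'
      field_simp
    have hbd : ∀ t ≥ t₁, |d t| ≤ C * q t / √(m t) := by
      intro t ht
      have h1 := Real.sqrt_pos.2 (hpos t ht)
      have h2 : 0 ≤ C * q t := mul_nonneg hC.le (hq t ht)
      rw [le_div_iff₀ h1]
      refine abs_le_of_sq_le_sq' ?_ h2 |>.2
      rw [mul_pow, sq_abs, Real.sq_sqrt (hm0 t ht), pow_two (C * q t)]
      exact mul_le_mul (hdq t ht) (hmq t ht) (hm0 t ht) h2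
    have h1 := antitoneOn_of_hasDerivAt_nonpos (fun t ht => (hf t ht).add (hw t ht))
      fun t ht => by linarith [le_abs_self (d t), hbd t ht]
    have h2 := monotoneOn_of_hasDerivAt_nonneg (fun t ht => (hf t ht).sub (hw t ht))
      fun t ht => by linarith [neg_abs_le (d t), hbd t ht]
    have hsq : ∀ t, 0 ≤ 2 * C * √(m t) := fun t => by positivity
    obtain ⟨l₁, hl₁⟩ := tendsto_of_antitoneOn (B := (f - fun t => 2 * C * √(m t)) t₁) h1
      fun t ht => (h2 (le_refl t₁) ht ht).trans (by
        simp only [Pi.sub_apply, Pi.add_apply]; linarith [hsq t])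
    obtain ⟨l₂, hl₂, -⟩ := tendsto_of_monotoneOn (B := (f + fun t => 2 * C * √(m t)) t₁) h2
      fun t ht => le_trans (by
        simp only [Pi.sub_apply, Pi.add_apply]; linarith [hsq t]) (h1 (le_refl t₁) ht ht)
    refine ⟨(l₁ + l₂) / 2, ((hl₁.add hl₂).div_const 2).congr fun t => ?_⟩
    simp only [Pi.sub_apply, Pi.add_apply]
    ring

theorem eq_zero_of_tendsto_of_tendsto_deriv {f f' : ℝ → ℝ} {l l' t₁ : ℝ}
    (h : ∀ t ≥ t₁, HasDerivAt f (f' t) t) (h0 : ∀ t ≥ t₁, 0 ≤ f' t) (hl : Tendsto f atTop (𝓝 l))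
    (hl' : Tendsto f' atTop (𝓝 l')) : l' = 0 := by
  by_contra hne
  have hpos : 0 < l' := lt_of_le_of_ne
    (ge_of_tendsto hl' ((eventually_ge_atTop t₁).mono fun t ht => h0 t ht)) (Ne.symm hne)
  obtain ⟨t₂, ht₂⟩ := eventually_atTop.1 (hl'.eventually_const_lt (half_lt_self hpos))
  have h1 := monotoneOn_of_hasDerivAt_nonneg (f := fun t => f t - l' / 2 * t)
    (f' := fun t => f' t - l' / 2) (t₁ := max t₁ t₂)
    (fun t ht => by
      have := (h t ((le_max_left _ _).trans ht)).sub ((hasDerivAt_id t).const_mul (l' / 2))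
      rw [mul_one] at this
      exact this)
    fun t ht => by linarith [ht₂ t ((le_max_right _ _).trans ht)]
  have h2 : Tendsto (fun t => l' / 2 * t) atTop atTop :=
    tendsto_id.const_mul_atTop (half_pos hpos)
  have h3 : Tendsto (fun t => f t - l' / 2 * t) atTop atBot := by
    simpa [sub_eq_add_neg] using hl.add_atBot (tendsto_neg_atTop_atBot.comp h2)
  obtain ⟨t, ht, ht'⟩ := ((h3.eventually_lt_atBot
    (f (max t₁ t₂) - l' / 2 * (max t₁ t₂))).and (eventually_ge_atTop (max t₁ t₂))).exists
  exact absurd (h1 (mem_Ici.2 le_rfl) (mem_Ici.2 ht') ht') (not_le.2 ht)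

namespace ModelData

theorem isCompact_strip [CompactSpace Y] (c : ℝ) : IsCompact {p : Y × ℝ | |p.2| ≤ c} := by
  have : {p : Y × ℝ | |p.2| ≤ c} = univ ×ˢ Icc (-c) c := by
    ext p; simp [abs_le]
  rw [this]
  exact isCompact_univ.prod isCompact_Icc

/-- `γ` follows the vector field `flowField` (for `s = 1`), respectively `-flowField` (for `s = -1`),
for positive times, and stays away from the pages. -/
structure IsTrajectory (D : ModelData n Y S k g) (s c : ℝ) (γ : ℝ → Y × ℝ) : Prop where
  sq : s ^ 2 = 1
  lt : c < 1 + D.δ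
  vel : ∀ t ≥ 0, HasVel (IYR n) γ t (s • D.flowField (γ t))
  mem : ∀ t ≥ 0, |(γ t).2| ≤ c

namespace IsTrajectory

variable {s c : ℝ} {γ : ℝ → Y × ℝ} (h : IsTrajectory D s c γ)
include h

theorem hasDerivAt_comp {f : Y × ℝ → ℝ} (hf : ContMDiff (IYR n) 𝓘₁ ∞ f) {t : ℝ} (ht : t ≥ 0) :
    HasDerivAt (fun t => f (γ t)) (s * md (IYR n) 𝓘₁ f (γ t) (D.flowField (γ t))) t := by
  have h1 := (h.vel t ht).comp (I' := 𝓘₁) (f := f) (hf.mdifferentiable (by simp) (γ t))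
  rw [map_smul, hasVel_iff_hasDerivAt] at h1
  exact h1

theorem hasDerivAt_height {t : ℝ} (ht : t ≥ 0) :
    HasDerivAt (fun t => s * D.height (γ t)) (D.ascent (γ t)) t := by
  have h1 := (h.hasDerivAt_comp D.contMDiff_height ht).const_mul s
  rwa [← mul_assoc, ← pow_two, h.sq, one_mul] at h1

theorem exists_limit_height [CompactSpace Y] : ∃ L, Tendsto (fun t => s * D.height (γ t)) atTop (𝓝 L) ∧
    ∀ t ≥ 0, s * D.height (γ t) ≤ L := by
  have hc : ContinuousOn (fun p : Y × ℝ => s * D.height p) {p : Y × ℝ | |p.2| ≤ c} :=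
    (continuous_const.mul D.contMDiff_height.continuous).continuousOn
  obtain ⟨B, hB⟩ := (isCompact_strip c).bddAbove_image hc
  exact tendsto_of_monotoneOn (monotoneOn_of_hasDerivAt_nonneg
    (fun t ht => h.hasDerivAt_height ht) fun t _ => D.ascent_nonneg _)
    (B := B) fun t ht => hB ⟨γ t, h.mem t ht, rfl⟩

/-- The gradient inequality along a trajectory. -/
theorem exists_bound [CompactSpace Y] (hJ : D.IsModelJ J) (hn : 1 ≤ n) (i : Fin k)
    {η : Y × ℝ → (EY n × ℝ) →L[ℝ] ℝ} (hη : SmoothForm (IYR n) η) {L : ℝ}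
    (hL : Tendsto (fun t => s * D.height (γ t)) atTop (𝓝 L)) :
    ∃ C > 0, ∀ᶠ t in atTop, L - s * D.height (γ t) ≤ C * D.ascent (γ t) ∧
      (η (γ t) (D.flowField (γ t))) ^ 2 ≤ C * D.ascent (γ t) := by
  have hcov : ∃ C > 0, ∀ᶠ t in atTop, γ t ∈ {p : Y × ℝ | |p.2| ≤ c} →
      L - s * D.height (γ t) ≤ C * D.ascent (γ t) ∧
      (η (γ t) (D.flowField (γ t))) ^ 2 ≤ C * D.ascent (γ t) := by
    refine (isCompact_strip (Y := Y) c).induction_on (p := fun U => ∃ C > 0, ∀ᶠ t in atTop, γ t ∈ U →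
      L - s * D.height (γ t) ≤ C * D.ascent (γ t) ∧
      (η (γ t) (D.flowField (γ t))) ^ 2 ≤ C * D.ascent (γ t)) ⟨1, one_pos, by simp⟩ ?_ ?_ ?_
    · rintro U U' hU ⟨C, hC, h1⟩
      exact ⟨C, hC, h1.mono fun t ht h2 => ht (hU h2)⟩
    · rintro U U' ⟨C, hC, h1⟩ ⟨C', hC', h1'⟩
      refine ⟨max C C', lt_max_of_lt_left hC, ?_⟩
      filter_upwards [h1, h1'] with t ht ht' h2
      have h3 := mul_le_mul_of_nonneg_right (le_max_left C C') (D.ascent_nonneg (γ t))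
      have h4 := mul_le_mul_of_nonneg_right (le_max_right C C') (D.ascent_nonneg (γ t))
      rcases h2 with h2 | h2
      · exact ⟨(ht h2).1.trans h3, (ht h2).2.trans h3⟩
      · exact ⟨(ht' h2).1.trans h4, (ht' h2).2.trans h4⟩
    · intro x hx
      have hx' : |x.2| < 1 + D.δ := lt_of_le_of_lt hx h.lt
      have hcont : ContinuousAt (fun p => L - s * D.height p) x :=
        (continuous_const.sub (continuous_const.mul D.contMDiff_height.continuous)).continuousAt
      -- zeros of `ascent` at which `s * height` is not its limit `L` have neighbourhoods left by `γ`
      by_cases hLx : D.ascent x = 0 ∧ L - s * D.height x ≠ 0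
      · refine ⟨{p | |L - s * D.height x| / 2 < |L - s * D.height p|},
          mem_nhdsWithin_of_mem_nhds (hcont.abs.eventually_const_lt
            (half_lt_self (abs_pos.2 hLx.2))), 1, one_pos, ?_⟩
        have h1 : Tendsto (fun t => |L - s * D.height (γ t)|) atTop (𝓝 0) := by
          simpa using (hL.const_sub L).abs
        filter_upwards [h1.eventually_lt_const (half_pos (abs_pos.2 hLx.2))] with t ht h2
        exact absurd h2 (not_lt.2 ht.le)
      · have hO : (fun p => L - s * D.height p) =O[𝓝 x] D.ascent := by
          by_cases h0 : D.ascent x = 0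
          · have h1 := isBigO_height hn ((D.mem_crit_iff hn).2 h0)
            have h2 : L = s * D.height x := by
              by_contra hne
              exact hLx ⟨h0, sub_ne_zero.2 hne⟩
            refine (h1.const_mul_left (-s)).congr_left fun p => ?_
            rw [h2]; ring
          · exact isBigO_of_ne_zero hcont (continuousAt_ascent hJ hn i hx') h0
        obtain ⟨C₁, hC₁, h1⟩ := hO.exists_pos
        obtain ⟨C₂, hC₂, h2⟩ := (isBigO_form_sq hJ hn i hη hx').exists_pos
        have h3 := h1.bound.and h2.bound
        refine ⟨_, mem_nhdsWithin_of_mem_nhds h3, max C₁ C₂, lt_max_of_lt_left hC₁,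
          Eventually.of_forall fun t ht => ?_⟩
        obtain ⟨h4, h5⟩ := ht
        rw [Real.norm_of_nonneg (D.ascent_nonneg (γ t))] at h4 h5
        exact ⟨((le_abs_self _).trans h4).trans (mul_le_mul_of_nonneg_right (le_max_left _ _)
          (D.ascent_nonneg _)), ((le_abs_self _).trans h5).trans
          (mul_le_mul_of_nonneg_right (le_max_right _ _) (D.ascent_nonneg _))⟩
  obtain ⟨C, hC, h1⟩ := hcov
  refine ⟨C, hC, ?_⟩
  filter_upwards [h1, eventually_ge_atTop 0] with t ht ht'
  exact ht (h.mem t ht')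

theorem exists_limit_of_hasDerivAt [CompactSpace Y] (hJ : D.IsModelJ J) (hn : 1 ≤ n) (i : Fin k)
    {η : Y × ℝ → (EY n × ℝ) →L[ℝ] ℝ} (hη : SmoothForm (IYR n) η) {f : ℝ → ℝ} {a : ℝ}
    (hf : ∀ᶠ t in atTop, HasDerivAt f (a * η (γ t) (D.flowField (γ t))) t) :
    ∃ l, Tendsto f atTop (𝓝 l) := by
  obtain ⟨L, hL, hL'⟩ := h.exists_limit_height
  obtain ⟨C, hC, hb⟩ := h.exists_bound hJ hn i hη hL
  obtain ⟨t₁, ht₁⟩ := eventually_atTop.1 ((hb.and hf).and (eventually_ge_atTop 0))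
  refine tendsto_of_gradient_inequality (m := fun t => L - s * D.height (γ t))
    (q := fun t => D.ascent (γ t)) (C := max C (a ^ 2 * C)) (t₁ := t₁) (lt_max_of_lt_left hC)
    (fun t ht => sub_nonneg.2 (hL' t (ht₁ t ht).2))
    (fun t ht => (h.hasDerivAt_height (ht₁ t ht).2).const_sub L)
    (fun t _ => D.ascent_nonneg _) (fun t ht => (ht₁ t ht).1.2)
    (fun t ht => (ht₁ t ht).1.1.1.trans
      (mul_le_mul_of_nonneg_right (le_max_left _ _) (D.ascent_nonneg _))) fun t ht => ?_
  rw [mul_pow]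
  refine le_trans (mul_le_mul_of_nonneg_left (ht₁ t ht).1.1.2 (sq_nonneg a)) ?_
  rw [← mul_assoc]
  exact mul_le_mul_of_nonneg_right (le_max_right _ _) (D.ascent_nonneg _)

/-- Trajectories converge to critical points. -/
theorem exists_limit [CompactSpace Y] [T2Space Y] (hJ : D.IsModelJ J) (hn : 1 ≤ n) (i : Fin k) :
    ∃ p ∈ D.crit, Tendsto γ atTop (𝓝 p) := by
  have hmem : ∀ᶠ t in atTop, γ t ∈ {p : Y × ℝ | |p.2| ≤ c} :=
    (eventually_ge_atTop 0).mono fun t ht => h.mem t ht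
  obtain ⟨p, hpK, hp⟩ := (isCompact_strip (Y := Y) c).exists_mapClusterPt_of_frequently
    hmem.frequently
  have hlim : Tendsto γ atTop (𝓝 p) := by
    refine (isCompact_strip (Y := Y) c).tendsto_nhds_of_unique_mapClusterPt hmem fun q _ hq => ?_
    by_contra hne
    -- a bump function which separates two limit points would converge along `γ`
    have hnhds : {q}ᶜ ∈ 𝓝 p := isOpen_compl_singleton.mem_nhds (Ne.symm hne)
    obtain ⟨f, hf, -⟩ := (SmoothBumpFunction.nhds_basis_support (I := IYR n) hnhds).mem_iff.1 hnhds
    have hfq : f q = 0 := by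
      by_contra h0
      exact hf (subset_tsupport _ h0) rfl
    obtain ⟨l, hl⟩ := h.exists_limit_of_hasDerivAt hJ hn i (smoothForm_md f.contMDiff) (a := s)
      (f := fun t => f (γ t))
      ((eventually_ge_atTop 0).mono fun t ht => h.hasDerivAt_comp f.contMDiff ht)
    have hfl : ∀ x, MapClusterPt x atTop γ → f x = l := by
      intro x hx
      have h1 : MapClusterPt (f x) atTop (fun t => f (γ t)) :=
        hx.continuousAt_comp f.continuous.continuousAt
      have h2 : ClusterPt (f x) (𝓝 l) := ClusterPt.mono h1 hl
      exact eq_of_nhds_neBot h2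
    have h1 := hfl p hp
    rw [f.eq_one] at h1
    have h2 := hfl q hq
    rw [hfq, ← h1] at h2
    exact zero_ne_one h2
  refine ⟨p, ?_, hlim⟩
  obtain ⟨L, hL, -⟩ := h.exists_limit_height
  rw [D.mem_crit_iff hn]
  exact eq_zero_of_tendsto_of_tendsto_deriv (t₁ := 0) (fun t ht => h.hasDerivAt_height ht)
    (fun t _ => D.ascent_nonneg _) hL
    ((continuousAt_ascent hJ hn i (lt_of_le_of_lt hpK h.lt)).tendsto.comp hlim)

theorem exists_limit_angle [CompactSpace Y] (hJ : D.IsModelJ J) (hn : 1 ≤ n) (i : Fin k)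
    {θ : ℝ → ℝ} (hθ : ∀ᶠ t in atTop, HasDerivAt θ (s * D.angle (γ t)) t) :
    ∃ l, Tendsto θ atTop (𝓝 l) := by
  refine h.exists_limit_of_hasDerivAt hJ hn i D.al_smooth (a := -(s * D.ε)) (hθ.mono fun t ht => ?_)
  convert! ht using 1
  rw [angle]; ring

/-- Over the spine `b' - T` is the difference of the height and its limit, hence `O(ascent)`, so that
`tendsto_of_gradient_inequality` applies. -/
theorem exists_limit_action [CompactSpace Y] (hJ : D.IsModelJ J) (hn : 1 ≤ n)
    (i : Fin k) {p : Y × ℝ} (hp : p ∈ D.crit) (hlim : Tendsto γ atTop (𝓝 p)) {b : ℝ → ℝ}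
    (hb : ∀ᶠ t in atTop, HasDerivAt b (s * D.cutHeight (γ t)) t) :
    ∃ l, Tendsto (fun t => b t - s * (D.period p * t)) atTop (𝓝 l) := by
  have hδ := D.δ_pos
  have hp1 : |p.2| < 1 - D.δ / 3 := (D.abs_crit_le hn hp).trans_lt (by linarith [D.δ'_gt])
  obtain ⟨L, hL, hL'⟩ := h.exists_limit_height
  obtain ⟨C, hC, hbd⟩ := h.exists_bound hJ hn i D.al_smooth hL
  have hLp : L = s * D.period p := by
    have h1 := tendsto_nhds_unique hL
      ((D.contMDiff_height.continuous.continuousAt.tendsto.comp hlim).const_mul s)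
    rw [h1, D.height_spine hp1.le, period]
  have hm1 : ∀ᶠ t in atTop, L - s * D.height (γ t) < 1 := by
    have h1 : Tendsto (fun t => L - s * D.height (γ t)) atTop (𝓝 0) := by
      simpa using hL.const_sub L
    exact h1.eventually_lt_const one_pos
  obtain ⟨t₁, ht₁⟩ := eventually_atTop.1 ((((hbd.and hb).and
    (hlim.eventually (D.eventually_spine hp1))).and hm1).and (eventually_ge_atTop 0))
  refine tendsto_of_gradient_inequality (m := fun t => L - s * D.height (γ t))
    (q := fun t => D.ascent (γ t)) (d := fun t => s * D.cutHeight (γ t) - s * D.period p)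
    (C := C) (t₁ := t₁) hC
    (fun t ht => sub_nonneg.2 (hL' t (ht₁ t ht).2))
    (fun t ht => (h.hasDerivAt_height (ht₁ t ht).2).const_sub L)
    (fun t _ => D.ascent_nonneg _) (fun t ht => ?_)
    (fun t ht => (ht₁ t ht).1.1.1.1.1) fun t ht => ?_
  · have h1 := ((hasDerivAt_id t).const_mul (D.period p)).const_mul s
    rw [mul_one] at h1
    exact (ht₁ t ht).1.1.1.2.sub h1
  · have h1 := (ht₁ t ht).1.1.2
    have h2 := (ht₁ t ht).1.1.1.1.1
    have h3 := sub_nonneg.2 (hL' t (ht₁ t ht).2)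
    have h4 := (ht₁ t ht).1.2
    refine le_trans ?_ h2
    rw [D.cutHeight_spine h1, ← D.height_spine h1, ← hLp]
    nlinarith

end IsTrajectory

end ModelData

/-! ### Orbits of the flow field -/

theorem eq_of_hasVel_zero {E H M : Type*} [NormedAddCommGroup E] [NormedSpace ℝ E]
    [TopologicalSpace H] {I : ModelWithCorners ℝ E H} [I.Boundaryless] [TopologicalSpace M]
    [ChartedSpace H M] [IsManifold I ∞ M] [CompleteSpace E] [T2Space M] {γ : ℝ → M} {a b : ℝ}
    (h : ∀ t ∈ Ioo a b, HasVel I γ t 0) {s t : ℝ} (hs : s ∈ Ioo a b) (ht : t ∈ Ioo a b) :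
    γ t = γ s :=
  integralCurve_unique (I := I) (v := fun _ => 0) (γ' := fun _ => γ s)
    (fun _ => contMDiffAt_zeroSection_comp contMDiffAt_id) hs h
    (fun t _ => hasVel_const _ t) rfl ht

theorem contMDiffAt_smul_section {E H M : Type*} [NormedAddCommGroup E] [NormedSpace ℝ E]
    [TopologicalSpace H] {I : ModelWithCorners ℝ E H} [TopologicalSpace M]
    [ChartedSpace H M] [IsManifold I ∞ M] {f : M → ℝ} {v : M → E} {x : M}
    (hf : ContMDiffAt I 𝓘₁ ∞ f x)
    (hv : ContMDiffAt I I.tangent ∞ (fun y => (⟨y, v y⟩ : TangentBundle I M)) x) :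
    ContMDiffAt I I.tangent ∞ (fun y => (⟨y, f y • v y⟩ : TangentBundle I M)) x :=
  ContMDiffAt.smul_section (V := TangentSpace I (M := M)) (s := fun y => v y) hf hv

namespace ModelData

/-- The flow field can be cut off near the pages. -/
theorem exists_cutoff [CompactSpace Y] (hJ : D.IsModelJ J) (hn : 1 ≤ n) (i : Fin k) {c : ℝ}
    (hc : c < 1 + D.δ) :
    ∃ (v : Y × ℝ → EY n × ℝ) (K : Set (Y × ℝ)),
      ContMDiff (IYR n) (IYR n).tangent ∞
        (fun p => (⟨p, v p⟩ : TangentBundle (IYR n) (Y × ℝ))) ∧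
      IsCompact K ∧ (∀ p ∉ K, v p = 0) ∧ ∀ p, |p.2| ≤ c → v p = D.flowField p := by
  obtain ⟨c₁, h1, h1'⟩ := exists_between hc
  obtain ⟨c₂, h2, h2'⟩ := exists_between h1'
  let f : ℝ → ℝ := fun x => Real.smoothTransition ((c₁ - x) / (c₁ - c))
  have hf : ContMDiff 𝓘₁ 𝓘₁ ∞ (fun x => f x * f (-x)) := by
    have : ContDiff ℝ ∞ f :=
      Real.smoothTransition.contDiff.comp ((contDiff_const.sub contDiff_id).div_const _)
    exact (this.mul (this.comp contDiff_neg)).contMDiff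
  have hpos : 0 < c₁ - c := sub_pos.2 h1
  have h0 : ∀ x, c₁ ≤ |x| → f x * f (-x) = 0 := by
    intro x hx
    rcases le_abs.1 hx with h | h
    · have : f x = 0 := Real.smoothTransition.zero_of_nonpos
        (div_nonpos_of_nonpos_of_nonneg (by linarith) hpos.le)
      rw [this, zero_mul]
    · have : f (-x) = 0 := Real.smoothTransition.zero_of_nonpos
        (div_nonpos_of_nonpos_of_nonneg (by linarith) hpos.le)
      rw [this, mul_zero]
  have hone : ∀ x, |x| ≤ c → f x * f (-x) = 1 := by
    intro x hx
    have h := abs_le.1 hx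
    have h3 : f x = 1 := Real.smoothTransition.one_of_one_le
      ((one_le_div hpos).2 (by linarith))
    have h4 : f (-x) = 1 := Real.smoothTransition.one_of_one_le
      ((one_le_div hpos).2 (by linarith))
    rw [h3, h4, one_mul]
  refine ⟨fun p => (f p.2 * f (-p.2)) • D.flowField p, {p | |p.2| ≤ c₁}, fun p => ?_,
    isCompact_strip c₁, fun p hp => ?_, fun p hp => ?_⟩
  · by_cases hp : |p.2| < 1 + D.δ
    · exact contMDiffAt_smul_section (f := fun p : Y × ℝ => f p.2 * f (-p.2))
        (v := D.flowField)
        ((hf.contMDiffAt (x := p.2)).comp p (g := fun x => f x * f (-x)) contMDiffAt_snd)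
        (contMDiffAt_flowField hJ hn i hp)
    · have : ∀ᶠ q : Y × ℝ in 𝓝 p, c₁ < |q.2| :=
        (continuous_snd.abs.continuousAt (x := p)).eventually_const_lt
          (lt_of_lt_of_le h1' (not_lt.1 hp))
      refine (contMDiffAt_zeroSection_comp contMDiffAt_id).congr_of_eventuallyEq ?_
      filter_upwards [this] with q hq
      simp [h0 _ hq.le]
  · simp [h0 _ (not_le.1 hp).le]
  · simp [hone _ hp]

/-- `γ` is, at the times in `I`, an integral curve of the flow field away from the pages. -/
structure IsOrbit (D : ModelData n Y S k g) (I : Set ℝ) (γ : ℝ → Y × ℝ) : Prop where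
  vel : ∀ s ∈ I, HasVel (IYR n) γ s (D.flowField (γ s))
  mem : ∀ s ∈ I, |(γ s).2| < 1 + D.δ

/-- The flow field points away from the pages, so its orbits are trapped by the level sets of
`τ` outside of the spine. -/
theorem sgn_mul_le_of_hasVel (hn : 1 ≤ n) {e : Bool} {γ : ℝ → Y × ℝ} {v : Y × ℝ → EY n × ℝ}
    {a b c : ℝ} (hc : 1 - D.δ' < c) (hv : ∀ p, |p.2| = c → v p = D.flowField p)
    (h : ∀ t ∈ Icc a b, HasVel (IYR n) γ t (v (γ t))) (h0 : sgn e * (γ a).2 ≤ c) :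
    ∀ t ∈ Icc a b, sgn e * (γ t).2 ≤ c := by
  intro t ht
  have hd : ∀ t ∈ Icc a b, HasDerivAt (fun s => sgn e * (γ s).2) (sgn e * (v (γ t)).2) t :=
    fun t ht => (hasVel_iff_hasDerivAt.1 (h t ht).snd).const_mul _
  have hc0 : 0 ≤ c := by linarith [D.δ'_le]
  refine image_le_of_deriv_right_lt_deriv_boundary (f := fun s => sgn e * (γ s).2)
    (f' := fun t => sgn e * (v (γ t)).2) (B := fun _ => c) (B' := fun _ => 0)
    (fun t ht => (hd t ht).continuousAt.continuousWithinAt)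
    (fun t ht => (hd t (Ico_subset_Icc_self ht)).hasDerivWithinAt)
    h0 (fun t => hasDerivAt_const t c) (fun t _ hc' => ?_) ht
  have h1 : sgn e * (γ t).2 = c := hc'
  have h2 := abs_eq_of_sgn_pos (hc0.trans h1.ge)
  rw [hv _ (h2.trans h1)]
  exact D.sgn_mul_flowField_neg hn (by rw [h1]; exact hc)

theorem abs_le_of_hasVel (hn : 1 ≤ n) {γ : ℝ → Y × ℝ} {v : Y × ℝ → EY n × ℝ} {a b c : ℝ}
    (hc : 1 - D.δ' < c) (hv : ∀ p, |p.2| = c → v p = D.flowField p)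
    (h : ∀ t ∈ Icc a b, HasVel (IYR n) γ t (v (γ t))) (h0 : |(γ a).2| ≤ c) :
    ∀ t ∈ Icc a b, |(γ t).2| ≤ c := by
  intro t ht
  obtain ⟨e, he⟩ := exists_sgn (γ t).2
  exact he ▸ sgn_mul_le_of_hasVel hn hc hv h ((sgn_mul_le_abs e _).trans h0) t ht

/-- A cut-off version of the flow of the flow field. -/
theorem exists_flow [CompactSpace Y] [T2Space Y] (hJ : D.IsModelJ J) (hn : 1 ≤ n) (i : Fin k) {c : ℝ}
    (hc : 1 - D.δ' < c) (hc' : c < 1 + D.δ) (p : Y × ℝ) :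
    ∃ γ : ℝ → Y × ℝ, γ 0 = p ∧ Continuous γ ∧ ∀ t, |(γ t).2| ≤ c →
      ∀ t' ≥ t, |(γ t').2| ≤ c ∧ HasVel (IYR n) γ t' (D.flowField (γ t')) := by
  obtain ⟨v, K, hv, hK, hvK, hvf⟩ := exists_cutoff hJ hn i hc'
  obtain ⟨γ, h0, hγ⟩ := exists_integralCurve_of_compactSupport hv hK hvK p
  refine ⟨γ, h0, continuous_iff_continuousAt.2 fun t => (hγ t).continuousAt, fun t ht t' ht' => ?_⟩
  have h1 := abs_le_of_hasVel (a := t) (b := t') hn hc (fun p hp => hvf p hp.le)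
    (fun t _ => hγ t) ht t' (right_mem_Icc.2 ht')
  exact ⟨h1, hvf _ h1 ▸ hγ t'⟩

namespace IsOrbit

variable {I : Set ℝ} {γ γ' : ℝ → Y × ℝ}

theorem mono {I' : Set ℝ} (h : IsOrbit D I γ) (hI : I' ⊆ I) : IsOrbit D I' γ :=
  ⟨fun s hs => h.vel s (hI hs), fun s hs => h.mem s (hI hs)⟩

theorem shift (h : IsOrbit D I γ) (d : ℝ) : IsOrbit D {s | s + d ∈ I} fun s => γ (s + d) := by
  refine ⟨fun s hs => ?_, fun s hs => h.mem _ hs⟩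
  have := (h.vel _ hs).scomp (ψ := fun s => s + d) ((hasDerivAt_id s).add_const d)
  rwa [one_smul] at this

theorem continuousAt (h : IsOrbit D I γ) {s : ℝ} (hs : s ∈ I) : ContinuousAt γ s :=
  (h.vel s hs).continuousAt

theorem exists_bound (h : IsOrbit D I γ) {a b : ℝ} (hI : Icc a b ⊆ I) :
    ∃ c < 1 + D.δ, ∀ s ∈ Icc a b, |(γ s).2| ≤ c := by
  rcases (Icc a b).eq_empty_or_nonempty with he | hne
  · exact ⟨0, by linarith [D.δ_pos], by simp [he]⟩
  · have hc : ContinuousOn (fun s => |(γ s).2|) (Icc a b) := fun s hs =>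
      (continuous_snd.abs.continuousAt.comp (h.continuousAt (hI hs))).continuousWithinAt
    obtain ⟨x, hx, hmax⟩ := isCompact_Icc.exists_isMaxOn hne hc
    exact ⟨_, h.mem x (hI hx), fun s hs => hmax hs⟩

/-- Uniqueness of orbits. -/
theorem eqOn [CompactSpace Y] [T2Space Y] (hJ : D.IsModelJ J) (hn : 1 ≤ n) (i : Fin k)
    (ho : IsOpen I) (hI : I.OrdConnected)
    (h : IsOrbit D I γ) (h' : IsOrbit D I γ') {t₀ : ℝ} (ht₀ : t₀ ∈ I) (h0 : γ t₀ = γ' t₀) :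
    EqOn γ γ' I := by
  intro t ht
  have hex : ∀ x ∈ I, ∃ a ∈ I, ∃ b ∈ I, a < x ∧ x < b := by
    intro x hx
    obtain ⟨η, hη, hb⟩ := Metric.isOpen_iff.1 ho x hx
    exact ⟨x - η / 2, hb (by rw [Metric.mem_ball, Real.dist_eq]; rw [abs_lt]; constructor <;> linarith),
      x + η / 2, hb (by rw [Metric.mem_ball, Real.dist_eq]; rw [abs_lt]; constructor <;> linarith),
      by linarith, by linarith⟩
  obtain ⟨a, ha, b, hb, h1, h2⟩ : ∃ a ∈ I, ∃ b ∈ I, a < min t₀ t ∧ max t₀ t < b := by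
    obtain ⟨a, ha, -, -, h1, -⟩ := hex (min t₀ t) (by rcases min_choice t₀ t with h | h <;> rw [h] <;> assumption)
    obtain ⟨-, -, b, hb, -, h2⟩ := hex (max t₀ t) (by rcases max_choice t₀ t with h | h <;> rw [h] <;> assumption)
    exact ⟨a, ha, b, hb, h1, h2⟩
  have hab : Icc a b ⊆ I := hI.out ha hb
  obtain ⟨c, hc, hγ⟩ := h.exists_bound hab
  obtain ⟨c', hc', hγ'⟩ := h'.exists_bound hab
  obtain ⟨v, K, hv, hK, hvK, hvf⟩ := exists_cutoff hJ hn i (max_lt hc hc')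
  refine integralCurve_unique hv (a := a) (b := b) (t₀ := t₀)
    ⟨h1.trans_le (min_le_left _ _), (le_max_left _ _).trans_lt h2⟩ (fun s hs => ?_) (fun s hs => ?_)
    h0 ⟨h1.trans_le (min_le_right _ _), (le_max_right _ _).trans_lt h2⟩
  · have hs' := Ioo_subset_Icc_self hs
    rw [hvf _ ((hγ s hs').trans (le_max_left _ _))]
    exact h.vel s (hab hs')
  · have hs' := Ioo_subset_Icc_self hs
    rw [hvf _ ((hγ' s hs').trans (le_max_right _ _))]
    exact h'.vel s (hab hs')

theorem const {p : Y × ℝ} (hn : 1 ≤ n) (hp : p ∈ D.crit) (I : Set ℝ) : IsOrbit D I fun _ => p := by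
  have hδ := D.δ_pos
  have h1 := D.abs_crit_le hn hp
  refine ⟨fun s _ => ?_, fun s _ => by linarith [D.δ'_gt]⟩
  rw [(D.isCrit_iff_flowField_eq_zero (by linarith [D.δ'_gt])).1 hp.2]
  exact hasVel_const p s

/-- An orbit which meets a critical point is constant. -/
theorem eqOn_const [CompactSpace Y] [T2Space Y] (hJ : D.IsModelJ J) (hn : 1 ≤ n) (i : Fin k)
    (ho : IsOpen I) (hI : I.OrdConnected) (h : IsOrbit D I γ) {t : ℝ} (ht : t ∈ I)
    (hp : γ t ∈ D.crit) : ∀ s ∈ I, γ s = γ t :=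
  fun _ hs => h.eqOn hJ hn i ho hI (const hn hp I) ht rfl hs

theorem contMDiffAt (hJ : D.IsModelJ J) (hn : 1 ≤ n) (i : Fin k) (ho : IsOpen I)
    (h : IsOrbit D I γ) {s : ℝ} (hs : s ∈ I) : ContMDiffAt 𝓘₁ (IYR n) ∞ γ s := by
  refine HasVel.contMDiffAt (v := D.flowField) ?_ ?_
  · filter_upwards [(continuous_snd.abs.continuousAt (x := γ s)).eventually_lt_const (h.mem s hs)]
      with p hp
    exact contMDiffAt_flowField hJ hn i hp
  · filter_upwards [ho.mem_nhds hs] with t ht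
    exact h.vel t ht

theorem abs_le (hn : 1 ≤ n) (h : IsOrbit D I γ) {a b c : ℝ} (hI : Icc a b ⊆ I)
    (hc : 1 - D.δ' < c) (h0 : |(γ a).2| ≤ c) (hab : a ≤ b) : |(γ b).2| ≤ c :=
  abs_le_of_hasVel hn hc (fun _ _ => rfl) (fun t ht => h.vel t (hI ht)) h0 b (right_mem_Icc.2 hab)

theorem sgn_mul_le (hn : 1 ≤ n) (h : IsOrbit D I γ) {e : Bool} {a b c : ℝ} (hI : Icc a b ⊆ I)
    (hc : 1 - D.δ' < c) (h0 : sgn e * (γ a).2 ≤ c) (hab : a ≤ b) : sgn e * (γ b).2 ≤ c :=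
  sgn_mul_le_of_hasVel hn hc (fun _ _ => rfl) (fun t ht => h.vel t (hI ht)) h0 b
    (right_mem_Icc.2 hab)

theorem isTrajectory (hn : 1 ≤ n) (h : IsOrbit D I γ) {a : ℝ} (ha : Ici a ⊆ I) {c : ℝ}
    (hc : 1 - D.δ' < c) (hc' : c < 1 + D.δ) (h0 : |(γ a).2| ≤ c) :
    IsTrajectory D 1 c fun t => γ (t + a) where
  sq := by norm_num
  lt := hc'
  vel t ht := by
    rw [one_smul]
    exact (h.shift a).vel t (ha (mem_Ici.2 (by linarith)))
  mem t ht := h.abs_le hn ((Icc_subset_Ici_self).trans ha) hc h0 (by linarith)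

theorem isTrajectory_neg (h : IsOrbit D univ γ) {c : ℝ} (hc' : c < 1 + D.δ) {a : ℝ}
    (h0 : ∀ t ≤ a, |(γ t).2| ≤ c) : IsTrajectory D (-1) c fun t => γ (a - t) where
  sq := by norm_num
  lt := hc'
  vel t ht := (h.vel (a - t) (mem_univ _)).scomp (ψ := fun t => a - t)
    ((hasDerivAt_id t).const_sub a)
  mem t ht := h0 _ (by linarith)

theorem hasDerivAt_comp (h : IsOrbit D I γ) {f : Y × ℝ → ℝ} {s : ℝ} (hs : s ∈ I)
    (hf : MDifferentiableAt (IYR n) 𝓘₁ f (γ s)) :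
    HasDerivAt (fun t => f (γ t)) (md (IYR n) 𝓘₁ f (γ s) (D.flowField (γ s))) s :=
  hasVel_iff_hasDerivAt.1 ((h.vel s hs).comp (I' := 𝓘₁) (f := f) hf)

theorem hasDerivAt_tau (h : IsOrbit D I γ) {s : ℝ} (hs : s ∈ I) :
    HasDerivAt (fun t => (γ t).2) (D.flowField (γ s)).2 s :=
  hasVel_iff_hasDerivAt.1 (h.vel s hs).snd

/-- The height increases along non-constant orbits. -/
theorem strictMonoOn_height [CompactSpace Y] [T2Space Y] (hn : 1 ≤ n)
    (hI : I.OrdConnected) (h : IsOrbit D I γ) (hcrit : ∀ s ∈ I, γ s ∉ D.crit) :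
    StrictMonoOn (fun s => D.height (γ s)) I := by
  have hd : ∀ s ∈ I, HasDerivAt (fun s => D.height (γ s)) (D.ascent (γ s)) s :=
    fun s hs => h.hasDerivAt_comp hs (D.mdifferentiableAt_height _)
  refine strictMonoOn_of_deriv_pos hI.convex (fun s hs => (hd s hs).continuousAt.continuousWithinAt)
    fun s hs => ?_
  have hs' := interior_subset hs
  rw [(hd s hs').deriv]
  exact lt_of_le_of_ne (D.ascent_nonneg _)
    fun h0 => hcrit s hs' ((D.mem_crit_iff hn).2 h0.symm)

theorem continuous_cutHeight (h : IsOrbit D univ γ) : Continuous fun s => D.cutHeight (γ s) :=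
  continuous_iff_continuousAt.2 fun s =>
    (D.contMDiff_cutHeight.continuous.continuousAt).comp (h.continuousAt (mem_univ s))

theorem continuousAt_angle (hJ : D.IsModelJ J) (hn : 1 ≤ n) (i : Fin k) (h : IsOrbit D I γ) {s : ℝ}
    (hs : s ∈ I) : ContinuousAt (fun s => D.angle (γ s)) s :=
  (contMDiffAt_angle hJ hn i (h.mem s hs)).continuousAt.comp (h.continuousAt hs)

end IsOrbit

end ModelData

/-! ### Neighbourhoods of the pages -/

namespace ModelData

variable (D)

theorem c_mem_cyl (i : Fin k) {p : ℝ × ℝ} (hp : |p.1| < 1 + D.δ) :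
    D.c i p ∈ ⋃ i, D.c i '' longCyl D.δ := mem_iUnion.2 ⟨i, p, hp, rfl⟩

theorem isOpen_cyl (i : Fin k) {B : Set (ℝ × ℝ)} (hB : IsOpen B) (hBA : B ⊆ longCyl D.δ) :
    IsOpen (D.c i '' B) := (D.c_emb i).isOpen_image (isOpen_longCyl D.δ) hB hBA

theorem sgn_mul_pos_of_mem {e : Bool} {i : Fin k} {p : ℝ × ℝ} (hp : |p.1| < 1 + D.δ)
    (h : D.c i p ∈ D.U e) : 0 < sgn e * p.1 := by
  by_contra hneg
  rcases (not_lt.1 hneg).eq_or_lt with h0 | h0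
  · have hp0 : p.1 = 0 := by
      rcases mul_eq_zero.1 h0 with h1 | h1
      · cases e <;> simp [sgn] at h1
      · exact h1
    have h1 : D.c i p ∈ (D.U true : Set S) ∪ D.U false := by cases e <;> simp_all
    rw [D.U_union] at h1
    exact h1 (mem_iUnion.2 ⟨i, p, hp0, rfl⟩)
  · have h1 := D.U_cyl (!e) i p hp (by cases e <;> simp [sgn] at h0 ⊢ <;> linarith)
    have h2 := D.U_disj
    rw [Set.disjoint_left] at h2
    cases e
    · exact h2 h1 h
    · exact h2 h h1

/-- Every point of the surface lies either in one of the cylinders, or in one of the two pages. -/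
theorem cyl_or_core (z : S) :
    (∃ i p, |p.1| < 1 + D.δ ∧ D.c i p = z) ∨ ∃ e, z ∈ D.core e := by
  by_cases hz : z ∈ ⋃ i, D.c i '' longCyl D.δ
  · obtain ⟨i, p, hp, rfl⟩ := mem_iUnion.1 hz
    exact .inl ⟨i, p, hp, rfl⟩
  · have h1 : z ∈ (D.U true : Set S) ∪ D.U false := by
      rw [D.U_union]
      intro h
      obtain ⟨i, p, hp, rfl⟩ := mem_iUnion.1 h
      have hp' : p.1 = 0 := hp
      exact hz (D.c_mem_cyl i (by rw [hp', abs_zero]; linarith [D.δ_pos]))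
    rcases h1 with h1 | h1
    · exact .inr ⟨true, h1, hz⟩
    · exact .inr ⟨false, h1, hz⟩

/-- The part `|τ| > c` of the page `U e`. -/
def outer (e : Bool) (c : ℝ) : Set S := (D.U e : Set S) \ ⋃ i, D.c i '' {p | |p.1| ≤ c}

theorem mem_outer {e : Bool} {c : ℝ} {z : S} (hz : z ∈ D.outer e c) :
    z ∈ D.core e ∨ ∃ i p, max 0 c < sgn e * p.1 ∧ |p.1| < 1 + D.δ ∧ D.c i p = z := by
  rcases D.cyl_or_core z with ⟨i, p, hp, rfl⟩ | ⟨e', h⟩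
  · refine .inr ⟨i, p, max_lt (D.sgn_mul_pos_of_mem hp hz.1) ?_, hp, rfl⟩
    rw [← abs_eq_of_sgn_pos (D.sgn_mul_pos_of_mem hp hz.1).le]
    exact not_le.1 fun h => hz.2 (mem_iUnion.2 ⟨i, p, h, rfl⟩)
  · exact .inl ⟨hz.1, h.2⟩

theorem core_subset_outer (e : Bool) {c : ℝ} (hc : c < 1 + D.δ) : D.core e ⊆ D.outer e c := by
  refine sdiff_subset_sdiff_right (iUnion_mono fun i => image_mono fun p hp => ?_)
  exact lt_of_le_of_lt hp hc

theorem c_eq_imp {i i' : Fin k} {p p' : ℝ × ℝ} (hp : |p.1| < 1 + D.δ) (hp' : |p'.1| < 1 + D.δ)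
    (h : D.c i p = D.c i' p') : i = i' ∧ p.1 = p'.1 ∧ ∃ m : ℤ, p'.2 = p.2 + m := by
  have hi : i = i' := by
    by_contra hne
    exact Set.disjoint_left.1 (D.c_disj i i' hne) ⟨p, hp, rfl⟩ ⟨p', hp', h.symm⟩
  subst hi
  exact ⟨rfl, (D.c_emb i).inj p hp p' hp' h⟩

theorem c_mem_outer {e : Bool} {c : ℝ} {i : Fin k} {p : ℝ × ℝ} (hc : c < 1 + D.δ)
    (hp : |p.1| < 1 + D.δ) (h : max 0 c < sgn e * p.1) : D.c i p ∈ D.outer e c := by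
  refine ⟨D.U_cyl e i p hp ((le_max_left _ _).trans_lt h), fun h' => ?_⟩
  obtain ⟨i', p', hp', h1⟩ := mem_iUnion.1 h'
  have h2 : |p'.1| ≤ c := hp'
  rw [(D.c_eq_imp (h2.trans_lt hc) hp h1).2.1] at h2
  exact absurd (((le_max_right _ _).trans_lt h).trans_le ((sgn_mul_le_abs e _).trans h2)) (lt_irrefl _)

theorem isCompact_cyl (i : Fin k) {c : ℝ} (hc : c < 1 + D.δ) :
    IsCompact (D.c i '' {p | |p.1| ≤ c}) := by
  have h1 : D.c i '' {p | |p.1| ≤ c} = D.c i '' (Icc (-c) c ×ˢ Icc (0 : ℝ) 1) := by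
    refine Subset.antisymm ?_ (image_mono fun p hp => abs_le.2 hp.1)
    rintro _ ⟨p, hp, rfl⟩
    refine ⟨(p.1, Int.fract p.2), ⟨abs_le.1 hp, Int.fract_nonneg _, (Int.fract_lt_one _).le⟩, ?_⟩
    have := (D.c_emb i).periodic_int p.1 (Int.fract p.2) ⌊p.2⌋
    rw [Int.fract_add_floor] at this
    exact this.symm
  rw [h1]
  refine (isCompact_Icc.prod isCompact_Icc).image_of_continuousOn fun p hp => ?_
  exact (D.contMDiffAt_c i ((abs_le.2 hp.1).trans_lt hc)).continuousAt.continuousWithinAt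

theorem isOpen_outer [T2Space S] (e : Bool) {c : ℝ} (hc : c < 1 + D.δ) : IsOpen (D.outer e c) :=
  (D.U e).isOpen.sdiff (isClosed_iUnion_of_finite fun i => (D.isCompact_cyl i hc).isClosed)

theorem outer_mem_nhds [T2Space S] {e : Bool} {c : ℝ} (hc : c < 1 + D.δ) {z : S}
    (hz : z ∈ D.core e) : D.outer e c ∈ 𝓝 z :=
  (D.isOpen_outer e hc).mem_nhds (D.core_subset_outer e hc hz)

theorem compl_core (e : Bool) :
    (D.core e)ᶜ = (D.U (!e) : Set S) ∪ ⋃ i, D.c i '' longCyl D.δ := by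
  ext z
  constructor
  · intro h
    rcases D.cyl_or_core z with ⟨i, p, hp, rfl⟩ | ⟨e', h'⟩
    · exact .inr (D.c_mem_cyl i hp)
    · have : e' = !e := by cases e <;> cases e' <;> simp_all
      exact .inl (this ▸ h'.1)
  · rintro (h | h) h'
    · have h2 := D.U_disj
      rw [Set.disjoint_left] at h2
      cases e
      · exact h2 h h'.1
      · exact h2 h'.1 h
    · exact h'.2 h

theorem isClosed_core (e : Bool) : IsClosed (D.core e) := by
  rw [← isOpen_compl_iff, compl_core]
  exact (D.U _).isOpen.union
    (isOpen_iUnion fun i => D.isOpen_cyl i (isOpen_longCyl D.δ) subset_rfl)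

theorem exists_outer_subset [CompactSpace S] {e : Bool} {O : Set S} (hO : O ∈ 𝓝ˢ (D.core e)) :
    ∃ c < 1 + D.δ, D.outer e c ⊆ O := by
  obtain ⟨O', hO', h1, h2⟩ := mem_nhdsSet_iff_exists.1 hO
  let V : Iio (1 + D.δ) → Set S := fun c => (D.U (!e) : Set S) ∪ ⋃ i, D.c i '' {p | |p.1| < c}
  have : Nonempty (Iio (1 + D.δ)) := ⟨⟨0, by simpa using by linarith [D.δ_pos]⟩⟩
  obtain ⟨c, hc⟩ := (hO'.isClosed_compl.isCompact).elim_directed_cover V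
    (fun c => (D.U _).isOpen.union (isOpen_iUnion fun i => D.isOpen_cyl i
      (isOpen_lt (by fun_prop) (by fun_prop)) fun p (hp : |p.1| < c) =>
        (lt_trans hp c.2 : |p.1| < 1 + D.δ)))
    (by
      refine (compl_subset_compl.2 h1).trans ?_
      rw [compl_core]
      rintro z (hz | hz)
      · exact mem_iUnion.2 ⟨Classical.arbitrary _, .inl hz⟩
      · obtain ⟨i, p, hp, rfl⟩ := mem_iUnion.1 hz
        obtain ⟨c, hc, hc'⟩ := exists_between (show |p.1| < 1 + D.δ from hp)
        exact mem_iUnion.2 ⟨⟨c, hc'⟩, .inr (mem_iUnion.2 ⟨i, p, hc, rfl⟩)⟩)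
    (directed_of_isDirected_le fun c c' hcc => union_subset_union_right _
      (iUnion_mono fun i => image_mono fun p (hp : |p.1| < c) => lt_of_lt_of_le hp hcc))
  refine ⟨c, c.2, fun z hz => h2 ?_⟩
  by_contra hz'
  rcases hc hz' with h | h
  · have h3 := D.U_disj
    rw [Set.disjoint_left] at h3
    cases e
    · exact h3 h hz.1
    · exact h3 hz.1 h
  · obtain ⟨i, p, hp, hpz⟩ := mem_iUnion.1 h
    have hp' : |p.1| < c.1 := hp
    exact hz.2 (mem_iUnion.2 ⟨i, p, hp'.le, hpz⟩)

variable {D}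

/-- The endomorphism of `TS` induced by `J` along the slice `{y} × S`. -/
def slice (J : Y × S → (ℝ × (EY n × ES)) →L[ℝ] (ℝ × (EY n × ES))) (y : Y) (z : S) : ES →L[ℝ] ES :=
  (snd ℝ (EY n) ES).comp ((snd ℝ ℝ (EY n × ES)).comp
    ((J (y, z)).comp ((ContinuousLinearMap.inr ℝ ℝ (EY n × ES)).comp
      (ContinuousLinearMap.inr ℝ (EY n) ES))))

theorem slice_apply (y : Y) (z : S) (w : ES) : slice J y z w = (J (y, z) (0, (0, w))).2.2 := rfl

theorem smoothEnd_slice (hJ : D.IsModelJ J) (y : Y) : SmoothEnd (𝓡 2) (slice J y) := by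
  intro p
  have h1 : ContMDiffAt (𝓡 2).tangent (IYS n).tangent ∞
      (fun q : TangentBundle (𝓡 2) S => (⟨(y, q.1), ((0 : EY n), (q.2 : ES))⟩ :
        TangentBundle (IYS n) (Y × S))) p :=
    TangentBundle.contMDiffAt_prodMk (I := 𝓡 (2 * n - 1)) (I' := 𝓡 2)
      (f := fun _ => (⟨y, 0⟩ : TangentBundle (𝓡 (2 * n - 1)) Y)) (g := fun q => q)
      contMDiffAt_const contMDiffAt_id
  have h2 := hJ.contMDiffAt_apply (f := fun q : TangentBundle (𝓡 2) S => (y, q.1))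
    (v := fun q => (0, q.2)) h1
  have h3 := (contMDiffAt_tangentMap (I := IYS n) (I' := 𝓡 2) (f := fun q : Y × S => q.2)
    (p := ⟨(y, p.1), (J (y, p.1) (0, (0, p.2))).2⟩) contMDiffAt_snd).comp p h2
  refine h3.congr_of_eventuallyEq (.of_forall fun q => ?_)
  simp only [Function.comp, tangentMap]
  rw [mfderiv_snd]
  rfl

theorem cutHeight_outer {p : Y × ℝ} {e : Bool} (h : 1 + 8 * D.δ / 9 ≤ sgn e * p.2) :
    D.cutHeight p = 0 := by
  have hδ := D.δ_pos
  rw [cutHeight, (D.FG_out e p.2 (by linarith)).2, D.β_zero _ (by linarith), zero_mul]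

/-- Near the pages, `J` preserves the tangent spaces of the slices `{y} × S`. -/
theorem IsModelJ.slice_eq (hJ : D.IsModelJ J) (hn : 1 ≤ n) (y : Y) {e : Bool} {z : S}
    (hz : z ∈ D.outer e (1 + 8 * D.δ / 9)) (w : ES) :
    J (y, z) (0, (0, w)) = (0, (0, slice J y z w)) := by
  have hδ := D.δ_pos
  rcases D.mem_outer hz with hz | ⟨i, p, hp, hp', rfl⟩
  · rw [slice_apply, hJ.page e y z hz w]
  · have hp1 := (le_max_right _ _).trans_lt hp
    have h1 := hJ.key' hn i (q := ((y, p.1), p.2)) hp'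
    rw [cutHeight_outer (e := e) hp1.le, D.angle_corner (e := e) (by dsimp only; linarith),
      D.flowField_corner (e := e) (by dsimp only; linarith)] at h1
    set V := deriv (fun x => D.height (y, x)) p.1 / D.h p.1 with hV
    have hV0 : V ≠ 0 := by
      have := D.sgn_mul_flowField_neg (p := (y, p.1)) hn (e := e)
        (by dsimp only; linarith [D.δ'_gt])
      rw [D.flowField_corner (e := e) (by dsimp only; linarith)] at this
      intro h0
      simp only at this
      rw [← hV, h0, mul_zero] at this
      exact lt_irrefl _ this
    have h2 : ∀ x : EY n × ℝ, ∀ b, D.dcoord i p (x, b)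
      = (x.1, x.2 • D.dtau i p + b • D.dtheta i p) := fun x b => rfl
    have h3 : J (y, D.c i p) (0, (0, D.dtheta i p)) = (0, (0, -V • D.dtau i p)) := by
      have h4 := h1
      simp only [h2, Prod.fst_zero, Prod.snd_zero, zero_smul, one_smul, zero_add, add_zero] at h4
      refine h4.trans ?_
      simp
    have h5 : J (y, D.c i p) (0, (0, D.dtau i p)) = (0, (0, V⁻¹ • D.dtheta i p)) := by
      have h6 : ((0, (0, D.dtau i p)) : ℝ × (EY n × ES))
          = -V⁻¹ • J (y, D.c i p) (0, (0, D.dtheta i p)) := by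
        rw [h3]
        simp [smul_smul, hV0]
      rw [h6, map_smul, hJ.sq]
      simp
    obtain ⟨⟨a, b⟩, hab⟩ := ((D.c_emb i).bijective (p := p) hp').2 w
    rw [md_c] at hab
    have h6 : ((0, (0, w)) : ℝ × (EY n × ES))
        = a • (0, (0, D.dtau i p)) + b • (0, (0, D.dtheta i p)) := by
      simp [← hab]
    rw [slice_apply, h6, map_add, map_smul, map_smul, h3, h5]
    simp

theorem IsModelJ.slice_dtheta (hJ : D.IsModelJ J) (hn : 1 ≤ n) (y : Y) {e : Bool} {i : Fin k}
    {p : ℝ × ℝ} (hp : 1 - D.δ < sgn e * p.1) (hp' : |p.1| < 1 + D.δ) :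
    slice J y (D.c i p) (D.dtheta i p) = -(D.flowField (y, p.1)).2 • D.dtau i p := by
  have h1 := hJ.key' hn i (q := ((y, p.1), p.2)) hp'
  rw [D.angle_corner (e := e) hp] at h1
  have h2 := congrArg (fun x => x.2.2) h1
  simp only [coord, dcoord, Prod.fst_zero, Prod.snd_zero, zero_smul, one_smul, zero_add, add_zero,
    Prod.snd_neg] at h2
  rw [slice_apply, neg_smul, ← h2]

theorem dForm_lam_c (i : Fin k) {p : ℝ × ℝ} (hp : |p.1| < 1 + D.δ) :
    dForm (𝓡 2) D.lam (D.c i p) (D.dtau i p) (D.dtheta i p)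
      = deriv (fun x => exp (D.G x)) p.1 := by
  have h1 := dForm_pullForm (D.lam_smooth.diffFormAt (D.c i p)) (D.contMDiffAt_c i hp)
    (1, 0) (0, 1)
  rw [D.md_c, D.md_c] at h1
  simp only [one_smul, zero_smul, add_zero, zero_add] at h1
  rw [← h1]
  have h2 : pullForm 𝓘₂ (𝓡 2) (D.c i) D.lam =ᶠ[𝓝 p]
      fun x => exp (D.G x.1) • snd ℝ ℝ ℝ := by
    filter_upwards [(isOpen_longCyl D.δ).mem_nhds hp] with x hx
    ext
    · exact (congrArg _ (D.md_c i x 1 0)).trans ((D.lam_dcoord i hx 1 0).trans (by simp))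
    · exact (congrArg _ (D.md_c i x 0 1)).trans ((D.lam_dcoord i hx 0 1).trans (by simp))
  have hG : DifferentiableAt ℝ (fun x => exp (D.G x)) p.1 :=
    (D.G_smooth.differentiable (by simp) p.1).exp
  have hf : HasFDerivAt (fun x : ℝ × ℝ => x.1) (fst ℝ ℝ ℝ) p :=
    hasFDerivAt_fst
  have h3 : HasFDerivAt (fun x : ℝ × ℝ => exp (D.G x.1) • snd ℝ ℝ ℝ)
      _ p := ((hG.hasDerivAt.comp_hasFDerivAt (f := fun x : ℝ × ℝ => x.1) p hf).smul_const
        (snd ℝ ℝ ℝ))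
  rw [dForm_congr h2, dForm_vectorSpace, h3.fderiv]
  simp

/-- Near the pages, `lam ^ 2` is bounded by the metric of `d lam` and the complex structure of the
slices. As `lam(∂_θ) = e^G`, this bounds the length of `∂_θ` below. -/
theorem exists_sq_lam_le [CompactSpace S] (hJ : D.IsModelJ J) (y : Y) (e : Bool) :
    ∃ C > 0, ∀ᶠ z in 𝓝ˢ (D.core e), ∀ w,
      D.lam z w ^ 2 ≤ C * dForm (𝓡 2) D.lam z w (slice J y z w) := by
  refine (D.isClosed_core e).isCompact.induction_on (p := fun s => ∃ C > 0, ∀ᶠ z in 𝓝ˢ s, ∀ w,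
      D.lam z w ^ 2 ≤ C * dForm (𝓡 2) D.lam z w (slice J y z w)) ⟨1, one_pos, by simp⟩ ?_ ?_ ?_
  · rintro s t hst ⟨C, hC, h⟩
    exact ⟨C, hC, h.filter_mono (nhdsSet_mono hst)⟩
  · rintro s t ⟨C, hC, h⟩ ⟨C', hC', h'⟩
    refine ⟨max C C', lt_max_of_lt_left hC, ?_⟩
    rw [nhdsSet_union]
    refine eventually_sup.2 ⟨h.mono fun z hz w => ?_, h'.mono fun z hz w => ?_⟩
    · have h0 : 0 ≤ dForm (𝓡 2) D.lam z w (slice J y z w) :=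
        nonneg_of_mul_nonneg_right ((sq_nonneg _).trans (hz w)) hC
      exact (hz w).trans (mul_le_mul_of_nonneg_right (le_max_left _ _) h0)
    · have h0 : 0 ≤ dForm (𝓡 2) D.lam z w (slice J y z w) :=
        nonneg_of_mul_nonneg_right ((sq_nonneg _).trans (hz w)) hC'
      exact (hz w).trans (mul_le_mul_of_nonneg_right (le_max_right _ _) h0)
  · intro z₀ hz₀
    suffices h : ∃ C > 0, ∀ᶠ z in 𝓝 z₀, ∀ w,
        D.lam z w ^ 2 ≤ C * dForm (𝓡 2) D.lam z w (slice J y z w) by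
      obtain ⟨C, hC, h⟩ := h
      obtain ⟨O, hO, hO', hz⟩ := mem_nhds_iff.1 h
      exact ⟨O, mem_nhdsWithin_of_mem_nhds (hO'.mem_nhds hz), C, hC,
        (hO'.nhdsSet_eq).symm ▸ mem_principal.2 hO⟩
    let B := fun z => fderiv ℝ (formInChart (𝓡 2) D.lam z₀) z
    let Q := endInChart (𝓡 2) (slice J y) z₀
    have hz₀t := mem_extChartAt_target (I := 𝓡 2) z₀
    have hB : ContinuousAt B (extChartAt (𝓡 2) z₀ z₀) :=
      ((D.lam_smooth.contDiffAt_formInChart z₀ hz₀t).fderiv_right (m := 0) (by simp)).continuousAt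
    have hQ : ContinuousAt Q (extChartAt (𝓡 2) z₀ z₀) :=
      (contDiffAt_endInChart (smoothEnd_slice hJ y) hz₀t).continuousAt
    have hform : ∀ z ∈ (chartAt ES z₀).source, ∀ w,
        dForm (𝓡 2) D.lam z w (slice J y z w)
        = B (extChartAt (𝓡 2) z₀ z) (md (𝓡 2) 𝓘(ℝ, ES) (extChartAt (𝓡 2) z₀) z w)
            (Q (extChartAt (𝓡 2) z₀ z) (md (𝓡 2) 𝓘(ℝ, ES) (extChartAt (𝓡 2) z₀) z w))
          - B (extChartAt (𝓡 2) z₀ z)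
            (Q (extChartAt (𝓡 2) z₀ z) (md (𝓡 2) 𝓘(ℝ, ES) (extChartAt (𝓡 2) z₀) z w))
            (md (𝓡 2) 𝓘(ℝ, ES) (extChartAt (𝓡 2) z₀) z w) := by
      intro z hz w
      rw [dForm_inChart (I := 𝓡 2) D.lam_smooth hz, ← endInChart_apply (I := 𝓡 2) hz]
    obtain ⟨c, hc, h1⟩ := exists_mul_sq_le_of_homogeneous
      (f := fun z u => B z u (Q z u) - B z (Q z u) u) (x₀ := extChartAt (𝓡 2) z₀ z₀)
      (fun v => by
        have hfst : ContinuousAt (fun q : ES × ES => q.1) (extChartAt (𝓡 2) z₀ z₀, v) :=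
          continuousAt_fst
        have hB' := ContinuousAt.comp (x := (extChartAt (𝓡 2) z₀ z₀, v))
          (f := fun q : ES × ES => q.1) hB hfst
        have hQ' := (ContinuousAt.comp (x := (extChartAt (𝓡 2) z₀ z₀, v))
          (f := fun q : ES × ES => q.1) hQ hfst).clm_apply continuousAt_snd
        exact ((hB'.clm_apply continuousAt_snd).clm_apply hQ').sub
          ((hB'.clm_apply hQ').clm_apply continuousAt_snd))
      (fun z c v => by simp only [map_smul, smul_apply, smul_eq_mul]; ring)
      (fun v hv => by
        have h2 := hform z₀ (mem_chart_source _ _) v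
        rw [md_extChartAt_self] at h2
        simp only [ContinuousLinearMap.id_apply] at h2
        rw [← h2, slice_apply, hJ.page e y z₀ hz₀ v]
        exact D.j_tame z₀ hz₀.2 v hv)
    have hA : ContinuousAt (formInChart (𝓡 2) D.lam z₀) (extChartAt (𝓡 2) z₀ z₀) :=
      (D.lam_smooth.contDiffAt_formInChart z₀ hz₀t).continuousAt
    set N := ‖formInChart (𝓡 2) D.lam z₀ (extChartAt (𝓡 2) z₀ z₀)‖ + 1 with hN
    have hNpos : 0 < N := by positivity
    have h2 := hA.norm.eventually_lt_const (lt_add_one _)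
    refine ⟨N ^ 2 / c, by positivity, ?_⟩
    have hcont := continuousAt_extChartAt (I := 𝓡 2) z₀
    filter_upwards [hcont.eventually h1, hcont.eventually h2, chart_source_mem_nhds ES z₀]
      with z h3 h4 hz w
    have h5 := h3 (md (𝓡 2) 𝓘(ℝ, ES) (extChartAt (𝓡 2) z₀) z w)
    rw [← hform z hz w] at h5
    rw [form_eq_formInChart_comp (I := 𝓡 2) D.lam hz, div_mul_eq_mul_div, le_div_iff₀ hc]
    have h6 := (formInChart (𝓡 2) D.lam z₀ (extChartAt (𝓡 2) z₀ z)).le_opNorm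
      (md (𝓡 2) 𝓘(ℝ, ES) (extChartAt (𝓡 2) z₀) z w)
    have h7 := h6.trans (mul_le_mul_of_nonneg_right h4.le (norm_nonneg _))
    have h8 := pow_le_pow_left₀ (norm_nonneg _) h7 2
    rw [Real.norm_eq_abs, sq_abs, mul_pow] at h8
    calc _ ≤ (N ^ 2 * ‖md (𝓡 2) 𝓘(ℝ, ES) (extChartAt (𝓡 2) z₀) z w‖ ^ 2) * c :=
          mul_le_mul_of_nonneg_right h8 hc.le
      _ = N ^ 2 * (c * ‖md (𝓡 2) 𝓘(ℝ, ES) (extChartAt (𝓡 2) z₀) z w‖ ^ 2) := by ring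
      _ ≤ _ := mul_le_mul_of_nonneg_left h5 (by positivity)

/-- The speed of the flow field is bounded below near the pages, so that its orbits leave the
pages in finite time. -/
theorem exists_le_abs_flowField [CompactSpace S] (hJ : D.IsModelJ J) (hn : 1 ≤ n) (i : Fin k) (y : Y)
    (e : Bool) : ∃ η > 0, ∃ c < 1 + D.δ, ∀ τ, c < sgn e * τ → sgn e * τ < 1 + D.δ →
      η ≤ -(sgn e * (D.flowField (y, τ)).2) := by
  have hδ := D.δ_pos
  obtain ⟨C, hC, h⟩ := exists_sq_lam_le hJ y e
  obtain ⟨c, hc, hcO⟩ := D.exists_outer_subset h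
  refine ⟨exp (-D.δ) / C, by positivity, max c (1 + 8 * D.δ / 9), max_lt hc (by linarith),
    fun τ h1 h2 => ?_⟩
  have h3 := (le_max_right _ _).trans_lt h1
  have habs : |τ| < 1 + D.δ := by rwa [abs_eq_of_sgn_pos (e := e) (by linarith)]
  have h4 := hcO (D.c_mem_outer (e := e) (i := i) (p := (τ, 0)) hc habs
    (max_lt (by linarith) ((le_max_left _ _).trans_lt h1))) (D.dtheta i (τ, 0))
  rw [hJ.slice_dtheta hn y (e := e) (by dsimp only; linarith) habs, map_smul, dForm_swap,
    dForm_lam_c i habs] at h4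
  have h5 := D.lam_dcoord i (p := (τ, 0)) habs 0 1
  simp only [zero_smul, one_smul, zero_add, one_mul] at h5
  rw [h5] at h4
  have hG : ∀ᶠ x in 𝓝 τ, exp (D.G x) = exp (1 - sgn e * x) := by
    have : ∀ᶠ x in 𝓝 τ, 1 + D.δ / 3 < sgn e * x :=
      (continuous_const.mul continuous_id).continuousAt.eventually_const_lt
        (show 1 + D.δ / 3 < sgn e * τ by linarith)
    filter_upwards [this] with x hx
    rw [(D.FG_out e x hx.le).2]
  have h6 : deriv (fun x => exp (D.G x)) τ = exp (D.G τ) * -sgn e := by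
    have h7 : HasDerivAt (fun x => exp (1 - sgn e * x)) (exp (1 - sgn e * τ) * -sgn e) τ := by
      have := (((hasDerivAt_id τ).const_mul (sgn e)).const_sub 1).exp
      simpa using this
    rw [EventuallyEq.deriv_eq hG, h7.deriv, hG.self_of_nhds]
  simp only at h4
  rw [h6] at h4
  have hE := exp_pos (D.G τ)
  have h8 : exp (D.G τ) ≤ C * -(sgn e * (D.flowField (y, τ)).2) := by
    have h9 : exp (D.G τ) * exp (D.G τ)
        ≤ exp (D.G τ) * (C * -(sgn e * (D.flowField (y, τ)).2)) := by
      calc _ = exp (D.G τ) ^ 2 := by ring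
        _ ≤ _ := h4
        _ = _ := by simp only [smul_eq_mul]; ring
    exact le_of_mul_le_mul_left h9 hE
  have h10 : exp (-D.δ) ≤ exp (D.G τ) := by
    rw [(D.FG_out e τ (by linarith)).2]
    exact Real.exp_le_exp.2 (by linarith)
  rw [div_le_iff₀ hC, mul_comm]
  exact h10.trans h8

end ModelData

/-! ### Orbits which start at the pages -/

/-- An autonomous differential equation `x' = -1 / f x` on `(c, d)` with bounded `f > 0` has a solution
which starts at `x 0 = d`. -/
theorem exists_solution_from_boundary {f : ℝ → ℝ} {c d M : ℝ} (hcd : c < d)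
    (hf : ContinuousOn f (Ioo c d)) (hpos : ∀ x ∈ Ioo c d, 0 < f x)
    (hM : ∀ x ∈ Ioo c d, f x ≤ M) :
    ∃ (x : ℝ → ℝ) (T : ℝ), 0 < T ∧ Continuous x ∧ x 0 = d ∧
      ∀ s ∈ Ioo 0 T, x s ∈ Ioo c d ∧ HasDerivAt x (-(f (x s))⁻¹) s := by
  classical
  -- the solution is the inverse of `x ↦ -∫ f`; outside `(c, d)` the integrand is replaced by `1`
  let F : ℝ → ℝ := (Ioo c d).piecewise f fun _ => 1
  have hFpos : ∀ x, 0 < F x := by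
    intro x
    by_cases hx : x ∈ Ioo c d
    · rw [show F x = f x from piecewise_eq_of_mem _ _ _ hx]; exact hpos x hx
    · rw [show F x = 1 from piecewise_eq_of_notMem _ _ _ hx]; exact one_pos
  have hFM : ∀ x, F x ≤ max M 1 := by
    intro x
    by_cases hx : x ∈ Ioo c d
    · rw [show F x = f x from piecewise_eq_of_mem _ _ _ hx]; exact (hM x hx).trans (le_max_left _ _)
    · rw [show F x = 1 from piecewise_eq_of_notMem _ _ _ hx]; exact le_max_right _ _
  have hmeas : MeasureTheory.AEStronglyMeasurable F MeasureTheory.volume :=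
    MeasureTheory.AEStronglyMeasurable.piecewise measurableSet_Ioo
      (hf.aestronglyMeasurable measurableSet_Ioo) MeasureTheory.aestronglyMeasurable_const
  have hint : ∀ a b, IntervalIntegrable F MeasureTheory.volume a b := by
    intro a b
    refine (intervalIntegrable_const (c := max M 1)).mono_fun hmeas.restrict (.of_forall fun x => ?_)
    show ‖F x‖ ≤ ‖max M 1‖
    rw [Real.norm_of_nonneg (hFpos x).le, Real.norm_of_nonneg ((hFpos x).le.trans (hFM x))]
    exact hFM x
  let h : ℝ → ℝ := fun x => ∫ t in d..x, F t
  have hsub : ∀ a b, h b - h a = ∫ t in a..b, F t := fun a b =>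
    intervalIntegral.integral_interval_sub_left (hint _ _) (hint _ _)
  have hmono : StrictMono h := fun a b hab => by
    rw [← sub_pos, hsub]
    exact intervalIntegral.intervalIntegral_pos_of_pos (hint _ _) hFpos hab
  have hcont : Continuous h := intervalIntegral.continuous_primitive hint d
  have hone : ∀ a b, a ≤ b → Disjoint (Icc a b) (Ioo c d) → h b - h a = b - a := by
    intro a b hab hdis
    rw [hsub, intervalIntegral.integral_congr (g := fun _ => (1 : ℝ)) fun x hx => ?_]
    · simp
    · rw [uIcc_of_le hab] at hx
      exact piecewise_eq_of_notMem _ _ _ (Set.disjoint_left.1 hdis hx)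
  have hsurj : Surjective h := by
    refine hcont.surjective ?_ ?_
    · refine tendsto_atTop.2 fun B => ?_
      filter_upwards [eventually_ge_atTop d, eventually_ge_atTop (B + d - h d)] with x hx hx'
      have := hone d x hx (Set.disjoint_left.2 fun z hz hz' => absurd hz.1 (not_le.2 hz'.2))
      linarith
    · refine tendsto_atBot.2 fun B => ?_
      filter_upwards [eventually_le_atBot c, eventually_le_atBot (B + c - h c)] with x hx hx'
      have := hone x c hx (Set.disjoint_left.2 fun z hz hz' => absurd hz.2 (not_le.2 hz'.1))
      linarith
  let E := hmono.orderIsoOfSurjective h hsurj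
  have hE : ∀ s, h (E.symm s) = s := fun s => hmono.orderIsoOfSurjective_self_symm_apply h hsurj s
  have hE' : ∀ s, E.symm (h s) = s := fun s => hmono.orderIsoOfSurjective_symm_apply_self h hsurj s
  have hd : h d = 0 := intervalIntegral.integral_same
  refine ⟨fun s => E.symm (-s), -h c, ?_, E.symm.continuous.comp continuous_neg, ?_, fun s hs => ?_⟩
  · rw [neg_pos, ← hd]; exact hmono hcd
  · show E.symm (-0) = d
    rw [neg_zero, ← hd, hE']
  · have hx : E.symm (-s) ∈ Ioo c d := by
      constructor
      · rw [← hE' c]; exact E.symm.strictMono (by linarith [hs.2])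
      · rw [← hE' d, hd]; exact E.symm.strictMono (by linarith [hs.1])
    refine ⟨hx, ?_⟩
    have hFf : F =ᶠ[𝓝 (E.symm (-s))] f := by
      filter_upwards [Ioo_mem_nhds hx.1 hx.2] with z hz
      exact piecewise_eq_of_mem _ _ _ hz
    have hFc : ContinuousAt F (E.symm (-s)) :=
      (hf.continuousAt (Ioo_mem_nhds hx.1 hx.2)).congr hFf.symm
    have h1 : HasDerivAt h (f (E.symm (-s))) (E.symm (-s)) := by
      rw [← hFf.self_of_nhds]
      exact intervalIntegral.integral_hasDerivAt_right (hint _ _)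
        hmeas.stronglyMeasurableAtFilter hFc
    have h2 : HasDerivAt (fun s => E.symm s) (f (E.symm (-s)))⁻¹ (-s) :=
      HasDerivAt.of_local_left_inverse E.symm.continuous.continuousAt h1 (hpos _ hx).ne'
        (.of_forall hE)
    have h3 := h2.scomp s (hasDerivAt_neg s)
    simpa [Function.comp_def] using h3

namespace ModelData

/-- `γ` is, for positive times, an orbit of the flow field which starts at time `0` at the boundary
of the page over `y` (and is extended by a constant to negative times). -/
structure IsPageOrbit (D : ModelData n Y S k g) (e : Bool) (y : Y) (γ : ℝ → Y × ℝ) : Prop where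
  cont : Continuous γ
  start : ∀ s ≤ 0, γ s = (y, sgn e * (1 + D.δ))
  orbit : IsOrbit D (Ioi 0) γ

/-- Near the page only `τ` moves, by an autonomous equation which extends to the boundary in the
form of `exists_solution_from_boundary`; the solution continues as an orbit of the flow. -/
theorem exists_isPageOrbit [CompactSpace Y] [T2Space Y] [CompactSpace S] (hJ : D.IsModelJ J)
    (hn : 1 ≤ n) (i : Fin k) (e : Bool) (y : Y) : ∃ γ, IsPageOrbit D e y γ := by
  have hδ := D.δ_pos
  have hδ' := D.δ'_gt
  obtain ⟨η, hη, c₁, hc₁, hV⟩ := exists_le_abs_flowField hJ hn i y e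
  set c := max c₁ 1 with hc
  have hc' : c < 1 + D.δ := max_lt hc₁ (by linarith)
  have hc1 : 1 ≤ c := le_max_right _ _
  have hee : ∀ τ : ℝ, sgn e * (sgn e * τ) = τ := fun τ => by
    rw [← mul_assoc, sgn_mul_self, one_mul]
  have habs : ∀ τ : ℝ, 0 ≤ τ → |sgn e * τ| = τ := fun τ h => by
    rw [abs_eq_of_sgn_pos (e := e) (by rwa [hee]), hee]
  have hlow : ∀ τ ∈ Ioo c (1 + D.δ), η ≤ -(sgn e * (D.flowField (y, sgn e * τ)).2) := fun τ hτ =>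
    hV _ (by rw [hee]; exact (le_max_left _ _).trans_lt hτ.1) (by rw [hee]; exact hτ.2)
  obtain ⟨x, T, hT, hx, hx0, hxs⟩ := exists_solution_from_boundary
    (f := fun τ => (-(sgn e * (D.flowField (y, sgn e * τ)).2))⁻¹) (M := η⁻¹) hc'
    (fun τ hτ => by
      refine ContinuousAt.continuousWithinAt (ContinuousAt.inv₀ ?_ (hη.trans_le (hlow τ hτ)).ne')
      have h1 : ContinuousAt (fun p => (D.flowField p).2) (y, sgn e * τ) :=
        continuousAt_form_flowField hJ hn i
          (η := md (IYR n) 𝓘₁ (fun p : Y × ℝ => p.2)) (smoothForm_md contMDiff_snd)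
          (by rw [habs τ (by linarith [hτ.1])]; exact hτ.2) |>.congr
          (.of_forall fun p => by dsimp only; rw [md_snd]; rfl)
      have h2 : ContinuousAt (fun τ : ℝ => (y, sgn e * τ)) τ := by fun_prop
      exact ((ContinuousAt.comp (x := τ) (f := fun τ : ℝ => (y, sgn e * τ)) h1 h2).const_mul _).neg)
    (fun τ hτ => inv_pos.2 (hη.trans_le (hlow τ hτ)))
    (fun τ hτ => inv_anti₀ hη (hlow τ hτ))
  have hX : IsOrbit D (Ioo 0 T) fun s => (y, sgn e * x s) := by
    refine ⟨fun s hs => ?_, fun s hs => ?_⟩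
    · have h1 := (hasVel_const (I := 𝓡 (2 * n - 1)) y s).prodMk
        (hasVel_iff_hasDerivAt.2 ((hxs s hs).2.const_mul (sgn e)))
      have h2 : D.flowField (y, sgn e * x s) = (0, sgn e *
          -((-(sgn e * (D.flowField (y, sgn e * x s)).2))⁻¹)⁻¹) := by
        rw [inv_inv, neg_neg, hee, D.flowField_corner (e := e)]
        rw [hee]
        linarith [(hxs s hs).1.1]
      rw [h2]
      exact h1
    · rw [habs _ (by linarith [(hxs s hs).1.1])]
      exact (hxs s hs).1.2
  -- at `s₁` the solution in the corner is continued by the flow, cut off at the level of `s₀`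
  obtain ⟨s₀, hs₀, hs₀'⟩ := exists_between hT
  obtain ⟨s₁, hs₁, hs₁'⟩ := exists_between hs₀'
  have hxa : StrictAntiOn x (Ioo 0 T) := by
    refine strictAntiOn_of_deriv_neg (convex_Ioo 0 T) hx.continuousOn fun s hs => ?_
    rw [interior_Ioo] at hs
    rw [(hxs s hs).2.deriv, neg_lt_zero, inv_inv]
    exact hη.trans_le (hlow _ (hxs s hs).1)
  have hm₀ : s₀ ∈ Ioo 0 T := ⟨hs₀, hs₀'⟩
  have hm₁ : s₁ ∈ Ioo 0 T := ⟨hs₀.trans hs₁, hs₁'⟩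
  obtain ⟨Γ, hΓ0, -, hΓ⟩ := exists_flow hJ hn i (c := x s₀)
    (by linarith [(hxs s₀ hm₀).1.1, D.δ'_le]) (hxs s₀ hm₀).1.2 (y, sgn e * x s₁)
  have hΓ1 : |(Γ 0).2| < x s₀ := by
    rw [hΓ0, habs _ (by linarith [(hxs s₁ hm₁).1.1])]
    exact hxa hm₀ hm₁ hs₁
  have hΓc : ContinuousAt Γ 0 := (hΓ 0 hΓ1.le 0 le_rfl).2.continuousAt
  have hnear : ∀ᶠ t in 𝓝 (0 : ℝ), |(Γ t).2| < x s₀ :=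
    (continuous_snd.abs.continuousAt.comp hΓc).eventually_lt_const hΓ1
  obtain ⟨ζ, hζ, hball⟩ := Metric.eventually_nhds_iff.1 hnear
  have hΓo : IsOrbit D {s | s + -s₁ ∈ Ioi (-ζ)} fun s => Γ (s + -s₁) := by
    refine IsOrbit.shift ⟨fun t ht => ?_, fun t ht => ?_⟩ (-s₁)
    all_goals
      have ht' : -ζ < t := ht
      have hmin : |(Γ (min t 0)).2| < x s₀ := by
        refine hball ?_
        rw [Real.dist_eq, sub_zero, abs_of_nonpos (min_le_right _ _), neg_lt]
        exact lt_min ht' (by linarith)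
      have h1 := hΓ _ hmin.le t (min_le_left _ _)
    · exact h1.2
    · exact h1.1.trans_lt (hxs s₀ hm₀).1.2
  set a := max 0 (s₁ - ζ) with ha
  have has : a < s₁ := max_lt hm₁.1 (by linarith)
  have hag : EqOn (fun s => (y, sgn e * x s)) (fun s => Γ (s + -s₁)) (Ioo a T) := by
    refine (hX.mono fun s hs => ⟨(le_max_left _ _).trans_lt hs.1, hs.2⟩).eqOn hJ hn i isOpen_Ioo
      ordConnected_Ioo (hΓo.mono fun s hs => ?_) (t₀ := s₁) ⟨has, hs₁'⟩ ?_
    · have := (le_max_right _ _).trans_lt hs.1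
      show -ζ < s + -s₁
      linarith
    · simp [hΓ0]
  let γ : ℝ → Y × ℝ := fun s => if s ≤ s₁ then (y, sgn e * x (max s 0)) else Γ (s + -s₁)
  have hγ1 : ∀ s < T, γ s = (y, sgn e * x (max s 0)) := by
    intro s hs
    by_cases h : s ≤ s₁
    · exact if_pos h
    · have h0 : a < s := has.trans (not_le.1 h)
      rw [show γ s = Γ (s + -s₁) from if_neg h, ← show _ = Γ (s + -s₁) from hag ⟨h0, hs⟩,
        max_eq_left ((le_max_left _ _).trans h0.le)]
  have hγ2 : ∀ s > s₁, γ s = Γ (s + -s₁) := fun s hs => if_neg (not_le.2 hs)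
  have hcont1 : Continuous fun s : ℝ => (y, sgn e * x (max s 0)) := by fun_prop
  refine ⟨γ, continuous_iff_continuousAt.2 fun s => ?_, fun s hs => ?_, fun s hs => ?_, fun s hs => ?_⟩
  · rcases lt_or_ge s T with h | h
    · refine hcont1.continuousAt.congr ?_
      filter_upwards [Iio_mem_nhds h] with t ht
      exact (hγ1 t ht).symm
    · refine (hΓo.continuousAt (s := s) (show -ζ < s + -s₁ by linarith)).congr ?_
      filter_upwards [Ioi_mem_nhds (hs₁'.trans_le h)] with t ht
      exact (hγ2 t ht).symm
  · rw [hγ1 s (hs.trans_lt hT), max_eq_right hs, hx0]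
  · have hs0 : 0 < s := hs
    rcases lt_or_ge s T with h | h
    · have h1 : γ =ᶠ[𝓝 s] fun s => (y, sgn e * x s) := by
        filter_upwards [Ioo_mem_nhds hs0 h] with t ht
        rw [hγ1 t ht.2, max_eq_left ht.1.le]
      rw [h1.self_of_nhds]
      exact (hX.vel s ⟨hs0, h⟩).congr h1
    · have h1 : γ =ᶠ[𝓝 s] fun s => Γ (s + -s₁) := by
        filter_upwards [Ioi_mem_nhds (hs₁'.trans_le h)] with t ht
        exact hγ2 t ht
      rw [h1.self_of_nhds]
      exact (hΓo.vel s (show -ζ < s + -s₁ by linarith)).congr h1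
  · have hs0 : 0 < s := hs
    rcases lt_or_ge s T with h | h
    · rw [hγ1 s h, max_eq_left hs0.le]
      exact hX.mem s ⟨hs0, h⟩
    · rw [hγ2 s (hs₁'.trans_le h)]
      exact hΓo.mem s (show -ζ < s + -s₁ by linarith)

namespace IsPageOrbit

variable {e : Bool} {y : Y} {γ : ℝ → Y × ℝ} (h : IsPageOrbit D e y γ)
include h

theorem zero : γ 0 = (y, sgn e * (1 + D.δ)) := h.start 0 le_rfl

theorem sgn_mul_start : sgn e * (γ 0).2 = 1 + D.δ := by
  rw [h.zero, ← mul_assoc, sgn_mul_self, one_mul]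

theorem lt_of_le (hn : 1 ≤ n) {c s s' : ℝ} (hc : 1 - D.δ' < c) (hc' : c < 1 + D.δ) (hs : s' ≤ s)
    (hcs : c < sgn e * (γ s).2) : c < sgn e * (γ s').2 := by
  by_contra hle
  rw [not_lt] at hle
  rcases le_or_gt s' 0 with h0 | h0
  · rw [h.start s' h0, ← mul_assoc, sgn_mul_self, one_mul] at hle
    linarith
  · exact absurd (h.orbit.sgn_mul_le hn (Icc_subset_Ioi_iff hs |>.2 h0) hc hle hs) (not_le.2 hcs)

theorem fst_eq [T2Space Y] (hn : 1 ≤ n) {s : ℝ} (hs : 1 - D.δ < sgn e * (γ s).2) : (γ s).1 = y := by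
  have hδ := D.δ_pos
  rcases le_or_gt s 0 with h0 | h0
  · rw [h.start s h0]
  obtain ⟨s', hs', hss'⟩ : ∃ s' > s, 1 - D.δ < sgn e * (γ s').2 := by
    have h1 : ∀ᶠ t in 𝓝 s, 1 - D.δ < sgn e * (γ t).2 :=
      (continuous_const.mul (continuous_snd.comp h.cont)).continuousAt.eventually_const_lt hs
    exact ((eventually_mem_nhdsWithin (s := Ioi s) (a := s)).and
      (mem_nhdsWithin_of_mem_nhds h1)).exists
  have hvel : ∀ t ∈ Ioo 0 s', HasVel (𝓡 (2 * n - 1)) (fun t => (γ t).1) t 0 := by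
    intro t ht
    have h1 := (h.orbit.vel t ht.1).fst
    rwa [D.flowField_corner (e := e)
      (h.lt_of_le hn (by linarith [D.δ'_gt]) (by linarith) ht.2.le hss')] at h1
  have hconst : ∀ t ∈ Ioo 0 s', (γ t).1 = (γ s).1 := fun t ht => eq_of_hasVel_zero hvel ⟨h0, hs'⟩ ht
  have hlim : Tendsto (fun t => (γ t).1) (𝓝[>] 0) (𝓝 y) := by
    have := (continuous_fst.comp h.cont).continuousAt (x := 0)
    rw [ContinuousAt] at this
    simp only [Function.comp, h.zero] at this
    exact this.mono_left nhdsWithin_le_nhds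
  refine (tendsto_nhds_unique (hlim.congr' ?_) tendsto_const_nhds).symm
  filter_upwards [Ioo_mem_nhdsGT (h0.trans hs')] with t ht
  exact hconst t ht

theorem notMem_crit [CompactSpace Y] [T2Space Y] (hJ : D.IsModelJ J) (hn : 1 ≤ n) (i : Fin k) {s : ℝ}
    (hs : 0 < s) : γ s ∉ D.crit := by
  intro hc
  have hδ := D.δ_pos
  have h1 := h.orbit.eqOn_const hJ hn i isOpen_Ioi ordConnected_Ioi hs hc
  have h2 : Tendsto (fun t => sgn e * (γ t).2) (𝓝[>] 0) (𝓝 (1 + D.δ)) := by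
    have := (continuous_const.mul (continuous_snd.comp h.cont)).continuousAt (x := 0)
      (f := fun t => sgn e * (γ t).2)
    rw [ContinuousAt, h.sgn_mul_start] at this
    exact this.mono_left nhdsWithin_le_nhds
  have h3 : sgn e * (γ s).2 = 1 + D.δ := by
    refine (tendsto_nhds_unique (h2.congr' ?_) tendsto_const_nhds).symm
    filter_upwards [self_mem_nhdsWithin] with t ht
    rw [h1 t ht]
  have h4 := D.abs_crit_le hn hc
  linarith [sgn_mul_le_abs e (γ s).2, D.δ'_gt]

theorem isTrajectory (hn : 1 ≤ n) {a : ℝ} (ha : 0 < a) :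
    ∃ c, IsTrajectory D 1 c fun t => γ (t + a) := by
  have hδ := D.δ_pos
  exact ⟨max |(γ a).2| 1, h.orbit.isTrajectory hn (fun t ht => ha.trans_le ht)
    (lt_max_of_lt_right (by linarith [D.δ'_gt])) (max_lt (h.orbit.mem a ha) (by linarith))
    (le_max_left _ _)⟩

theorem exists_limit [CompactSpace Y] [T2Space Y] (hJ : D.IsModelJ J) (hn : 1 ≤ n) (i : Fin k) :
    ∃ p ∈ D.crit, Tendsto γ atTop (𝓝 p) := by
  obtain ⟨c, hc⟩ := h.isTrajectory hn one_pos
  obtain ⟨p, hp, hlim⟩ := hc.exists_limit hJ hn i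
  refine ⟨p, hp, (hlim.comp (tendsto_atTop_add_const_right _ (-1) tendsto_id)).congr fun t => ?_⟩
  simp

/-- Orbits from the boundaries of the pages which meet are equal. -/
theorem unique [CompactSpace Y] [T2Space Y] (hJ : D.IsModelJ J) (hn : 1 ≤ n) (i : Fin k)
    {e' : Bool} {y' : Y} {γ' : ℝ → Y × ℝ} (h' : IsPageOrbit D e' y' γ') {s s' : ℝ} (hs : 0 < s)
    (hs' : 0 < s') (heq : γ s = γ' s') : s = s' ∧ γ = γ' ∧ e = e' ∧ y = y' := by
  have key : ∀ {e e' : Bool} {y y' : Y} {γ γ' : ℝ → Y × ℝ}, IsPageOrbit D e y γ →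
      IsPageOrbit D e' y' γ' → ∀ {s s' : ℝ}, 0 < s → 0 < s' → γ s = γ' s' → s ≤ s' →
      s = s' ∧ γ 0 = γ' 0 ∧ ∀ t > 0, γ t = γ' t := by
    intro e e' y y' γ γ' h h' s s' hs hs' heq hle
    have h1 := (h'.orbit.shift (s' - s)).mono (I' := Ioi 0)
      fun t ht => by
        have : 0 < t := ht
        show 0 < t + (s' - s)
        linarith
    have h2 := h.orbit.eqOn hJ hn i isOpen_Ioi ordConnected_Ioi h1 (t₀ := s) hs (by
      rw [heq]; congr 1; ring)
    have h3 : γ 0 = γ' (s' - s) := by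
      have hl := h.cont.continuousAt (x := 0) |>.tendsto.mono_left
        (nhdsWithin_le_nhds (s := Ioi (0 : ℝ)))
      have hr : Tendsto (fun t => γ' (t + (s' - s))) (𝓝[>] 0) (𝓝 (γ' (s' - s))) := by
        have hc : Continuous fun t => γ' (t + (s' - s)) := h'.cont.comp (by fun_prop)
        have := hc.continuousAt (x := 0)
        rw [ContinuousAt, zero_add] at this
        exact this.mono_left nhdsWithin_le_nhds
      refine tendsto_nhds_unique hl (hr.congr' ?_)
      filter_upwards [self_mem_nhdsWithin] with t ht
      exact (h2 ht).symm
    have h4 : s = s' := by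
      by_contra hne
      have h5 := h'.orbit.mem (s' - s) (sub_pos.2 (lt_of_le_of_ne hle hne))
      rw [← h3] at h5
      have h6 := sgn_mul_le_abs e (γ 0).2
      rw [h.sgn_mul_start] at h6
      exact absurd (h6.trans_lt h5) (lt_irrefl _)
    subst h4
    rw [sub_self] at h3
    exact ⟨rfl, h3, fun t ht => by simpa using h2 ht⟩
  have hmain : s = s' ∧ γ 0 = γ' 0 ∧ ∀ t > 0, γ t = γ' t := by
    rcases le_total s s' with hle | hle
    · exact key h h' hs hs' heq hle
    · obtain ⟨h1, h2, h3⟩ := key h' h hs' hs heq.symm hle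
      exact ⟨h1.symm, h2.symm, fun t ht => (h3 t ht).symm⟩
  obtain ⟨h1, h2, h3⟩ := hmain
  refine ⟨h1, funext fun t => ?_, ?_⟩
  · rcases le_or_gt t 0 with ht | ht
    · rw [h.start t ht, h'.start t ht, ← h.zero, h2, h'.zero]
    · exact h3 t ht
  · rw [h.zero, h'.zero, Prod.mk.injEq] at h2
    have hpos : (1 + D.δ) ≠ 0 := by linarith [D.δ_pos]
    refine ⟨?_, h2.1⟩
    have h4 := mul_right_cancel₀ hpos h2.2
    cases e <;> cases e' <;> simp [sgn] at h4 ⊢ <;> norm_num at h4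

end IsPageOrbit

end ModelData

/-! ### Holomorphic cylinders over orbits -/

theorem contDiffOn_of_hasDerivAt {f f' : ℝ → ℝ} {I : Set ℝ} (hI : IsOpen I)
    (h : ∀ s ∈ I, HasDerivAt f (f' s) s) (hf' : ContDiffOn ℝ ∞ f' I) : ContDiffOn ℝ ∞ f I :=
  (contDiffOn_infty_iff_deriv_of_isOpen hI).2
    ⟨fun s hs => (h s hs).differentiableAt.differentiableWithinAt,
      hf'.congr fun s hs => (h s hs).deriv⟩

namespace ModelData

/-- An orbit `γ` of the flow field, lifted to `ℝ × (Y × ℝ) × ℝ` by the actions `b` and the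
angles `θ`. -/
structure IsLift (D : ModelData n Y S k g) (I : Set ℝ) (b θ : ℝ → ℝ) (γ : ℝ → Y × ℝ) : Prop where
  orbit : IsOrbit D I γ
  action : ∀ s ∈ I, HasDerivAt b (D.cutHeight (γ s)) s
  rot : ∀ s ∈ I, HasDerivAt θ (D.angle (γ s)) s

/-- The cylinder swept out by the rotations of a lifted orbit. -/
def sweep (D : ModelData n Y S k g) (i : Fin k) (b θ : ℝ → ℝ) (γ : ℝ → Y × ℝ) (p : ℝ × ℝ) :
    ℝ × (Y × S) := (b p.1, D.coord i (γ p.1, θ p.1 + p.2))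

theorem dcoord_theta_ne_zero (i : Fin k) {p : ℝ × ℝ} (hp : |p.1| < 1 + D.δ) :
    D.dcoord i p (0, 1) ≠ 0 := by
  intro h0
  have := (D.dcoord_bijective i hp).1 (h0.trans (show 0 = D.dcoord i p 0 by simp [dcoord]; rfl))
  simpa using congrArg Prod.snd this

theorem continuousAt_section_flow (hJ : D.IsModelJ J) (hn : 1 ≤ n) (i : Fin k) {q : (Y × ℝ) × ℝ}
    (hq : |q.1.2| < 1 + D.δ) :
    ContinuousAt (fun q : (Y × ℝ) × ℝ => (⟨D.coord i q, D.dcoord i (q.1.2, q.2)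
      (D.flowField q.1, D.angle q.1)⟩ : TangentBundle (IYS n) (Y × S))) q := by
  have h1 := (hJ.contMDiffAt_apply (contMDiffAt_section_coord_theta D i (-1) hq)).continuousAt
  refine h1.congr ?_
  filter_upwards [((continuous_snd.comp continuous_fst).abs.continuousAt (x := q)).eventually_lt_const
    hq] with q hq
  have h2 := hJ.key' hn i (q := q) hq
  have h3 : D.dcoord i (q.1.2, q.2) (0, -1) = -D.dcoord i (q.1.2, q.2) (0, 1) := by
    simp [dcoord]
  have h4 : J (D.coord i q) (0, D.dcoord i (q.1.2, q.2) (0, -1))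
      = (D.cutHeight q.1, D.dcoord i (q.1.2, q.2) (D.flowField q.1, D.angle q.1)) := by
    have h5 : ((0, D.dcoord i (q.1.2, q.2) (0, -1)) : ℝ × (EY n × ES))
        = -(0, D.dcoord i (q.1.2, q.2) (0, 1)) := by rw [h3]; simp
    rw [h5, map_neg, h2, neg_neg]
  rw [h4]

namespace IsLift

variable {I : Set ℝ} {b θ : ℝ → ℝ} {γ : ℝ → Y × ℝ} (h : IsLift D I b θ γ)
include h

theorem contDiffOn_action (hJ : D.IsModelJ J) (hn : 1 ≤ n) (i : Fin k) (hI : IsOpen I) :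
    ContDiffOn ℝ ∞ b I :=
  contDiffOn_of_hasDerivAt hI h.action fun _ hs =>
    ((D.contMDiff_cutHeight.contMDiffAt.comp _
      (h.orbit.contMDiffAt hJ hn i hI hs)).contDiffAt).contDiffWithinAt

theorem contDiffOn_rot (hJ : D.IsModelJ J) (hn : 1 ≤ n) (i : Fin k) (hI : IsOpen I) :
    ContDiffOn ℝ ∞ θ I :=
  contDiffOn_of_hasDerivAt hI h.rot fun s hs =>
    ((ContMDiffAt.comp s (f := γ) (contMDiffAt_angle hJ hn i (h.orbit.mem s hs))
      (h.orbit.contMDiffAt hJ hn i hI hs)).contDiffAt).contDiffWithinAt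

theorem contMDiffAt_base (hJ : D.IsModelJ J) (hn : 1 ≤ n) (i : Fin k) (hI : IsOpen I) {p : ℝ × ℝ}
    (hp : p.1 ∈ I) : ContMDiffAt 𝓘₂ (𝓘C n) ∞
      (fun p : ℝ × ℝ => (γ p.1, θ p.1 + p.2)) p := by
  have h1 : ContMDiffAt 𝓘₂ 𝓘₁ ∞ (fun p : ℝ × ℝ => p.1) p :=
    contDiff_fst.contMDiff.contMDiffAt
  have h2 : ContMDiffAt 𝓘₂ 𝓘₁ ∞ (fun p : ℝ × ℝ => θ p.1 + p.2) p :=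
    (((h.contDiffOn_rot hJ hn i hI).contDiffAt (hI.mem_nhds hp)).comp p contDiffAt_fst |>.add
      contDiffAt_snd).contMDiffAt
  exact (ContMDiffAt.comp p (f := fun p : ℝ × ℝ => p.1)
    (h.orbit.contMDiffAt hJ hn i hI hp) h1).prodMk h2

theorem contMDiffAt_sweep (hJ : D.IsModelJ J) (hn : 1 ≤ n) (i : Fin k) (hI : IsOpen I) {p : ℝ × ℝ}
    (hp : p.1 ∈ I) :
    ContMDiffAt 𝓘₂ (𝓘W n) ∞ (D.sweep i b θ γ) p := by
  have h1 : ContMDiffAt 𝓘₂ 𝓘₁ ∞ (fun p : ℝ × ℝ => b p.1) p :=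
    (((h.contDiffOn_action hJ hn i hI).contDiffAt (hI.mem_nhds hp)).comp p
      contDiffAt_fst).contMDiffAt
  exact h1.prodMk (ContMDiffAt.comp p (f := fun p : ℝ × ℝ => (γ p.1, θ p.1 + p.2))
    (D.contMDiffAt_coord i (q := (γ p.1, θ p.1 + p.2)) (h.orbit.mem _ hp))
    (h.contMDiffAt_base hJ hn i hI hp))

theorem md_base {p : ℝ × ℝ} (hp : p.1 ∈ I) (x : ℝ × ℝ) :
    MDifferentiableAt 𝓘₂ (𝓘C n)
      (fun p : ℝ × ℝ => (γ p.1, θ p.1 + p.2)) p ∧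
    md 𝓘₂ (𝓘C n) (fun p : ℝ × ℝ => (γ p.1, θ p.1 + p.2)) p x
      = (x.1 • D.flowField (γ p.1), x.1 * D.angle (γ p.1) + x.2) := by
  have hf : HasFDerivAt (fun p : ℝ × ℝ => p.1) (fst ℝ ℝ ℝ) p := hasFDerivAt_fst
  have h1 : MDifferentiableAt 𝓘₂ 𝓘₁ (fun p : ℝ × ℝ => p.1) p :=
    hf.differentiableAt.mdifferentiableAt
  have h2 : HasFDerivAt (fun p : ℝ × ℝ => θ p.1 + p.2) _ p :=
    ((h.rot _ hp).comp_hasFDerivAt (f := fun p : ℝ × ℝ => p.1) p hf).add hasFDerivAt_snd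
  have h3 := (h.orbit.vel _ hp).mdifferentiableAt
  have h4 : MDifferentiableAt 𝓘₂ (IYR n) (fun p : ℝ × ℝ => γ p.1) p :=
    MDifferentiableAt.comp p (f := fun p : ℝ × ℝ => p.1) h3 h1
  refine ⟨h4.prodMk h2.differentiableAt.mdifferentiableAt, ?_⟩
  rw [md_prodMk h4 h2.differentiableAt.mdifferentiableAt,
    md_comp (g := γ) (f := fun p : ℝ × ℝ => p.1) h3 h1, (h.orbit.vel _ hp).md_eq, md_eq_fderiv,
    md_eq_fderiv, hf.fderiv, h2.fderiv]
  refine Prod.ext ?_ ?_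
  · simp
  · simp [mul_comm]

theorem md_sweep (i : Fin k) {p : ℝ × ℝ} (hp : p.1 ∈ I) (x : ℝ × ℝ) :
    MDifferentiableAt 𝓘₂ (𝓘W n) (D.sweep i b θ γ) p ∧
    md 𝓘₂ (𝓘W n) (D.sweep i b θ γ) p x
      = (x.1 * D.cutHeight (γ p.1), D.dcoord i ((γ p.1).2, θ p.1 + p.2)
        (x.1 • D.flowField (γ p.1), x.1 * D.angle (γ p.1) + x.2)) := by
  have hf : HasFDerivAt (fun p : ℝ × ℝ => p.1) (fst ℝ ℝ ℝ) p := hasFDerivAt_fst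
  have h2 : HasFDerivAt (fun p : ℝ × ℝ => b p.1) _ p :=
    (h.action _ hp).comp_hasFDerivAt (f := fun p : ℝ × ℝ => p.1) p hf
  have h3 : MDifferentiableAt (𝓘C n) (IYS n) (D.coord i) (γ p.1, θ p.1 + p.2) :=
    (D.contMDiffAt_coord i (q := (γ p.1, θ p.1 + p.2)) (h.orbit.mem _ hp)).mdifferentiableAt
      (by simp)
  obtain ⟨h4, h5⟩ := h.md_base hp x
  have h6 : MDifferentiableAt 𝓘₂ (IYS n)
      (fun p : ℝ × ℝ => D.coord i (γ p.1, θ p.1 + p.2)) p :=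
    MDifferentiableAt.comp p (f := fun p : ℝ × ℝ => (γ p.1, θ p.1 + p.2)) h3 h4
  refine ⟨h2.differentiableAt.mdifferentiableAt.prodMk h6, ?_⟩
  have h7 : md 𝓘₂ (𝓘W n) (D.sweep i b θ γ) p = _ :=
    md_prodMk h2.differentiableAt.mdifferentiableAt h6
  rw [h7, md_comp (g := D.coord i) (f := fun p : ℝ × ℝ => (γ p.1, θ p.1 + p.2)) h3 h4,
    md_eq_fderiv, h2.fderiv]
  refine Prod.ext ?_ ?_
  · simp [mul_comm]
  · simp only [ContinuousLinearMap.prod_apply, ContinuousLinearMap.comp_apply]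
    rw [h5, D.md_coord i (q := (γ p.1, θ p.1 + p.2)) (h.orbit.mem _ hp)]

theorem md_sweep_s (i : Fin k) {p : ℝ × ℝ} (hp : p.1 ∈ I) :
    md 𝓘₂ (𝓘W n) (D.sweep i b θ γ) p (1, 0)
      = (D.cutHeight (γ p.1), D.dcoord i ((γ p.1).2, θ p.1 + p.2)
        (D.flowField (γ p.1), D.angle (γ p.1))) := by
  rw [(h.md_sweep i hp _).2]
  simp

theorem md_sweep_t (i : Fin k) {p : ℝ × ℝ} (hp : p.1 ∈ I) :
    md 𝓘₂ (𝓘W n) (D.sweep i b θ γ) p (0, 1)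
      = (0, D.dcoord i ((γ p.1).2, θ p.1 + p.2) (0, 1)) := by
  rw [(h.md_sweep i hp _).2]
  simp

/-- The swept out cylinders are `J`-holomorphic. -/
theorem hol (hJ : D.IsModelJ J) (hn : 1 ≤ n) (i : Fin k) {p : ℝ × ℝ} (hp : p.1 ∈ I) :
    J (D.sweep i b θ γ p).2 (md 𝓘₂ (𝓘W n) (D.sweep i b θ γ) p (1, 0))
      = md 𝓘₂ (𝓘W n) (D.sweep i b θ γ) p (0, 1) := by
  rw [h.md_sweep_s i hp, h.md_sweep_t i hp]
  exact hJ.key hn i (q := (γ p.1, θ p.1 + p.2)) (h.orbit.mem _ hp)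

/-- The swept out cylinders are immersed: `J` has no real eigenvectors. -/
theorem md_sweep_injective (hJ : D.IsModelJ J) (hn : 1 ≤ n) (i : Fin k) {p : ℝ × ℝ} (hp : p.1 ∈ I) :
    Injective
      (md 𝓘₂ (𝓘W n) (D.sweep i b θ γ) p) := by
  rw [injective_iff_map_eq_zero]
  rintro ⟨x, y⟩ hxy
  have h1 := h.hol hJ hn i hp
  have h2 := h.md_sweep_t i hp
  have h0 := dcoord_theta_ne_zero (D := D) i (p := ((γ p.1).2, θ p.1 + p.2)) (h.orbit.mem _ hp)
  set L := md 𝓘₂ (𝓘W n) (D.sweep i b θ γ) p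
  set Q := J (D.sweep i b θ γ p).2
  have hne : L (0, 1) ≠ 0 := by
    rw [h2]
    exact fun h => h0 (congrArg Prod.snd h)
  have h3 : x • L (1, 0) + y • L (0, 1) = 0 := by
    rw [← map_smul, ← map_smul, ← map_add, ← hxy]
    simp
  have h4 : x • L (0, 1) - y • L (1, 0) = 0 := by
    have h5 := congrArg Q h3
    have h6 : Q (L (0, 1)) = -L (1, 0) := by rw [← h1]; exact hJ.sq _ _
    rw [map_add, map_smul, map_smul, h1, h6, map_zero, smul_neg, ← sub_eq_add_neg] at h5
    exact h5
  have h7 : (x ^ 2 + y ^ 2) • L (0, 1) = 0 := by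
    have := congrArg₂ (fun u v => x • v + y • u) h3 h4
    simp only [smul_zero, add_zero] at this
    rw [← this]
    module
  have h8 := (smul_eq_zero.1 h7).resolve_right hne
  have hx : x = 0 := by nlinarith [sq_nonneg x, sq_nonneg y]
  have hy : y = 0 := by nlinarith [sq_nonneg x, sq_nonneg y]
  rw [hx, hy]
  rfl

end IsLift

/-- At a critical point `flowField` and `angle` vanish, so `∂_θ` is a multiple of the Reeb field. -/
theorem isPeriodicOrbit (hJ : D.IsModelJ J) (hn : 1 ≤ n) (i : Fin k) {p : Y × ℝ} (hp : p ∈ D.crit)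
    (θ₀ : ℝ) : IsPeriodicOrbit (IYS n) J (D.period p) (D.orbit i p θ₀) ∧
      ∀ t, D.period p • (J (D.coord i (p, t)) (1, 0)).2 = D.dcoord i (p.2, t) (0, 1) := by
  have hδ := D.δ_pos
  have hδ' := D.δ'_gt
  have hT : 0 < D.period p := exp_pos _
  have hp1 := D.abs_crit_le hn hp
  have hp2 : |p.2| < 1 + D.δ := by linarith
  have hflow : D.flowField p = 0 := (D.isCrit_iff_flowField_eq_zero (by linarith)).1 hp.2
  have hang : D.angle p = 0 := by simp [angle, hflow]
  have hreeb : ∀ t, D.period p • (J (D.coord i (p, t)) (1, 0)).2 = D.dcoord i (p.2, t) (0, 1) := by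
    intro t
    have h1 := hJ.key hn i (q := (p, t)) hp2
    rw [hflow, hang, D.cutHeight_spine (by linarith), hJ.apply_eq] at h1
    have h2 : D.dcoord i (p.2, t) ((0 : EY n × ℝ), (0 : ℝ)) = 0 := by simp [dcoord]
    rw [h2, show ((0, 0) : ℝ × (EY n × ES)) = 0 from rfl, map_zero, add_zero] at h1
    exact congrArg Prod.snd h1
  have hvel : ∀ x, HasVel (IYS n) (D.orbit i p θ₀) x
      ((D.period p)⁻¹ • D.dcoord i (p.2, x / D.period p + θ₀) (0, 1)) := by
    intro x
    have h1 : HasVel (𝓘C n) (fun x : ℝ => (p, x / D.period p + θ₀)) x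
        (0, (D.period p)⁻¹) :=
      (hasVel_const p x).prodMk (hasVel_iff_hasDerivAt.2
        (by simpa using ((hasDerivAt_id x).div_const (D.period p)).add_const θ₀))
    have h2 := HasVel.comp (γ := fun x : ℝ => (p, x / D.period p + θ₀)) (I' := IYS n) (f := D.coord i)
      ((D.contMDiffAt_coord i (q := (p, x / D.period p + θ₀)) hp2).mdifferentiableAt (by simp)) h1
    rw [D.md_coord i (q := (p, x / D.period p + θ₀)) hp2] at h2
    convert! h2 using 1
    simp [dcoord]
  refine ⟨⟨hT, fun x => (hvel x).mdifferentiableAt, fun x => ?_, fun x => ?_⟩, hreeb⟩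
  · refine (hvel x).md_one.trans ?_
    rw [← hreeb, smul_smul, inv_mul_cancel₀ hT.ne', one_smul]
    rfl
  · show (p.1, D.c i (p.2, (x + D.period p) / D.period p + θ₀)) = _
    rw [add_div, div_self hT.ne', add_right_comm, (D.c_emb i).periodic]
    rfl

/-- A swept out cylinder is asymptotic to the orbit over the limit of the swept out path. -/
theorem IsLift.asymptoticTo {I : Set ℝ} {b θ : ℝ → ℝ} {γ : ℝ → Y × ℝ} (h : IsLift D I b θ γ)
    (hJ : D.IsModelJ J) (hn : 1 ≤ n) (i : Fin k) {pos : Bool} (hI : I ∈ endFilter pos) {p : Y × ℝ}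
    (hp : p ∈ D.crit) (hγ : Tendsto γ (endFilter pos) (𝓝 p)) {θ₀ l : ℝ}
    (hθ : Tendsto θ (endFilter pos) (𝓝 θ₀))
    (hb : Tendsto (fun s => b s - D.period p * s) (endFilter pos) (𝓝 l))
    {v : ℝ × ℝ → ℝ × (Y × S)} {r : ℝ}
    (hv : ∀ q ∈ halfCyl pos r, v q = D.sweep i b θ γ q) :
    AsymptoticTo (IYS n) J pos v (D.period p) (D.orbit i p θ₀) := by
  have hδ := D.δ_pos
  have hδ' := D.δ'_gt
  have hT : 0 < D.period p := exp_pos _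
  have hp1 := D.abs_crit_le hn hp
  have hp2 : |p.2| < 1 + D.δ := by linarith
  have hflow : D.flowField p = 0 := (D.isCrit_iff_flowField_eq_zero (by linarith)).1 hp.2
  have hang : D.angle p = 0 := by simp [angle, hflow]
  have hopen : IsOpen (halfCyl pos r) := by
    cases pos
    · exact isOpen_lt continuous_fst continuous_const
    · exact isOpen_lt continuous_const continuous_fst
  have hmem : ∀ t₀ : ℝ, ∀ᶠ q : ℝ × ℝ in endFilter pos ×ˢ 𝓝 t₀, q ∈ halfCyl pos r := fun t₀ => by
    refine tendsto_fst.eventually (p := fun s => ((s, (0 : ℝ)) : ℝ × ℝ) ∈ halfCyl pos r) ?_ |>.mono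
      fun q hq => ?_
    · cases pos
      · exact eventually_lt_atBot (-r)
      · exact eventually_gt_atTop r
    · cases pos <;> exact hq
  have hmemI : ∀ t₀ : ℝ, ∀ᶠ q : ℝ × ℝ in endFilter pos ×ˢ 𝓝 t₀, q.1 ∈ I := fun t₀ =>
    tendsto_fst.eventually hI
  have hveq : ∀ q ∈ halfCyl pos r, v =ᶠ[𝓝 q] D.sweep i b θ γ := fun q hq => by
    filter_upwards [hopen.mem_nhds hq] with q' hq'
    exact hv q' hq'
  have hderiv : ∀ x : ℝ × ℝ, ∀ t₀ : ℝ, ∀ᶠ q : ℝ × ℝ in endFilter pos ×ˢ 𝓝 t₀,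
      fderiv ℝ (fun q => (v q).1) q x = x.1 * D.cutHeight (γ q.1) := by
    intro x t₀
    filter_upwards [hmem t₀, hmemI t₀] with q hq hqI
    have h1 : (fun q => (v q).1) =ᶠ[𝓝 q] fun q => b q.1 := (hveq q hq).mono fun q' hq' => by
      dsimp only; rw [hq']; rfl
    have hf : HasFDerivAt (fun p : ℝ × ℝ => p.1) (fst ℝ ℝ ℝ) q :=
      hasFDerivAt_fst
    have h2 : HasFDerivAt (fun p : ℝ × ℝ => b p.1) _ q :=
      (h.action _ hqI).comp_hasFDerivAt (f := fun p : ℝ × ℝ => p.1) q hf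
    rw [h1.fderiv_eq, h2.fderiv]
    simp [mul_comm]
  have hmd : ∀ x : ℝ × ℝ, ∀ t₀ : ℝ, ∀ᶠ q : ℝ × ℝ in endFilter pos ×ˢ 𝓝 t₀,
      (⟨(v q).2, mfderiv 𝓘₂ (IYS n) (fun q => (v q).2) q x⟩ :
        TangentBundle (IYS n) (Y × S))
      = ⟨D.coord i (γ q.1, θ q.1 + q.2), D.dcoord i ((γ q.1).2, θ q.1 + q.2)
        (x.1 • D.flowField (γ q.1), x.1 * D.angle (γ q.1) + x.2)⟩ := by
    intro x t₀
    filter_upwards [hmem t₀, hmemI t₀] with q hq hqI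
    have h1 : (fun q => (v q).2) =ᶠ[𝓝 q] fun q => D.coord i (γ q.1, θ q.1 + q.2) :=
      (hveq q hq).mono fun q' hq' => by dsimp only; rw [hq']; rfl
    obtain ⟨h4, h5⟩ := h.md_base hqI x
    have h2 : mfderiv 𝓘₂ (IYS n) (fun q => (v q).2) q x
        = D.dcoord i ((γ q.1).2, θ q.1 + q.2)
        (x.1 • D.flowField (γ q.1), x.1 * D.angle (γ q.1) + x.2) := by
      rw [h1.mfderiv_eq]
      refine (congrArg (fun L : ℝ × ℝ →L[ℝ] EY n × ES => L x) (md_comp (g := D.coord i)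
        (f := fun p : ℝ × ℝ => (γ p.1, θ p.1 + p.2))
        ((D.contMDiffAt_coord i (q := (γ q.1, θ q.1 + q.2)) (h.orbit.mem _ hqI)).mdifferentiableAt
          (by simp)) h4)).trans ?_
      rw [ContinuousLinearMap.comp_apply, h5,
        D.md_coord i (q := (γ q.1, θ q.1 + q.2)) (h.orbit.mem _ hqI)]
    rw [h2, hv q hq]
    rfl
  have hbase : ∀ t₀ : ℝ, Tendsto (fun q : ℝ × ℝ => (γ q.1, θ q.1 + q.2)) (endFilter pos ×ˢ 𝓝 t₀)
      (𝓝 (p, θ₀ + t₀)) := fun t₀ =>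
    (hγ.comp tendsto_fst).prodMk_nhds ((hθ.comp tendsto_fst).add tendsto_snd)
  have horb : ∀ t₀, D.orbit i p θ₀ (D.period p * t₀) = D.coord i (p, θ₀ + t₀) := fun t₀ => by
    rw [ModelData.orbit, mul_div_cancel_left₀ _ hT.ne', add_comm]
    rfl
  have hcut : Tendsto (fun s => D.cutHeight (γ s)) (endFilter pos) (𝓝 (D.period p)) := by
    have h1 := (D.contMDiff_cutHeight.continuous.tendsto p).comp hγ
    rw [D.cutHeight_spine (by linarith)] at h1
    exact h1
  refine ⟨⟨l, fun t₀ => ?_⟩, fun t₀ => ?_, fun t₀ => ?_, fun t₀ => ?_, fun t₀ => ?_⟩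
  · refine (hb.comp tendsto_fst).congr' ?_
    filter_upwards [hmem t₀] with q hq
    rw [hv q hq]
    rfl
  · refine (hcut.comp tendsto_fst).congr' ?_
    filter_upwards [hderiv (1, 0) t₀] with q hq
    rw [hq, one_mul]
    rfl
  · refine tendsto_const_nhds.congr' ?_
    filter_upwards [hderiv (0, 1) t₀] with q hq
    rw [hq, zero_mul]
  · have h1 := (continuousAt_section_flow hJ hn i (q := (p, θ₀ + t₀)) hp2).tendsto.comp (hbase t₀)
    rw [horb]
    have h0 : D.dcoord i (p.2, θ₀ + t₀) (D.flowField p, D.angle p) = 0 := by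
      rw [hflow, hang]; simp [dcoord]
    simp only [h0] at h1
    refine h1.congr' ?_
    filter_upwards [hmd (1, 0) t₀] with q hq
    rw [hq]
    simp
  · have h1 := (contMDiffAt_section_coord_theta D i 1
      (q := (p, θ₀ + t₀)) hp2).continuousAt.tendsto.comp (hbase t₀)
    rw [horb, (isPeriodicOrbit hJ hn i hp θ₀).2]
    refine h1.congr' ?_
    filter_upwards [hmd (0, 1) t₀] with q hq
    rw [hq]
    simp

end ModelData

/-! ### Open subsets of manifolds -/

section Opens

variable {E H M : Type*} [NormedAddCommGroup E] [NormedSpace ℝ E]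
    [TopologicalSpace H] {I : ModelWithCorners ℝ E H} [I.Boundaryless] [TopologicalSpace M]
    [ChartedSpace H M] [IsManifold I ∞ M] (U : TopologicalSpace.Opens M)

theorem md_subtype_val (z : U) : md I I (fun x : U => x.1) z = ContinuousLinearMap.id ℝ E := by
  have h1 : MDifferentiableAt I I (fun x : U => x.1) z :=
    (contMDiff_subtype_val (n := ∞) (U := U) z).mdifferentiableAt (by simp)
  rw [md_eq_fderiv_inChart h1]
  have h2 : writtenInExtChartAt I I z (fun x : U => x.1) =ᶠ[𝓝 (extChartAt I z z)] id := by
    have h3 := TopologicalSpace.Opens.chartAt_subtype_val_symm_eventuallyEq (H := H) U (x := z)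
    have h4 : ContinuousAt I.symm (extChartAt I z z) := I.continuous_symm.continuousAt
    have h5 : I.symm (extChartAt I z z) = chartAt H z.1 z.1 := by
      rw [extChartAt_coe, Function.comp_apply, I.left_inv]; rfl
    rw [← h5] at h3
    have h6 : extChartAt I z z = extChartAt I z.1 z.1 := by
      rw [extChartAt_coe, extChartAt_coe]; rfl
    filter_upwards [h4.eventually h3, h6 ▸ extChartAt_target_mem_nhds (I := I) z.1] with x hx hx'
    have h7 : ((extChartAt I z).symm x).1 = (extChartAt I z.1).symm x := by
      rw [extChartAt_coe_symm, extChartAt_coe_symm]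
      exact hx.symm
    show extChartAt I z.1 ((extChartAt I z).symm x).1 = x
    rw [h7]
    exact (extChartAt I z.1).right_inv hx'
  rw [h2.fderiv_eq, fderiv_id]

variable [Nonempty U]

open Classical in
/-- A left inverse of the inclusion of an open set. -/
def openRetract (z : M) : U := if h : z ∈ U then ⟨z, h⟩ else Classical.arbitrary U

theorem openRetract_val {z : M} (h : z ∈ U) : (openRetract U z).1 = z := by
  rw [openRetract, dif_pos h]

theorem openRetract_apply (z : U) : openRetract U z.1 = z := Subtype.ext (openRetract_val U z.2)

theorem contMDiffAt_openRetract {z : M} (h : z ∈ U) : ContMDiffAt I I ∞ (openRetract U) z := by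
  have h1 : ContMDiffAt I I ∞ (fun x : U => openRetract U x.1) ⟨z, h⟩ :=
    contMDiffAt_id.congr_of_eventuallyEq (.of_forall fun x => openRetract_apply U x)
  exact contMDiffAt_subtype_iff.1 h1

theorem md_openRetract {z : M} (h : z ∈ U) :
    md I I (openRetract U) z = ContinuousLinearMap.id ℝ E := by
  have h1 := md_comp (I := I) (I' := I) (I₂ := I) (g := openRetract U) (f := fun x : U => x.1)
    (x := ⟨z, h⟩) ((contMDiffAt_openRetract U h).mdifferentiableAt (by simp))
    ((contMDiff_subtype_val (n := ∞) (U := U) _).mdifferentiableAt (by simp))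
  rw [md_subtype_val, ContinuousLinearMap.comp_id] at h1
  rw [← h1, md_congr (g := fun x : U => x) (.of_forall fun x => openRetract_apply U x), md_id]

end Opens

/-! ### Gluing along embedded cylinders -/

open Classical in
/-- The function on `S` which is `f` in the coordinates given by the embeddings `P`, and `f₀` outside
of their images. -/
def extendAlong {κ X S : Type*} (P : κ → ℝ × ℝ → S) (A : Set (ℝ × ℝ)) (f : κ → ℝ × ℝ → X)
    (f₀ : S → X) (z : S) : X :=
  if h : ∃ q : κ × (ℝ × ℝ), q.2 ∈ A ∧ P q.1 q.2 = z then f h.choose.1 h.choose.2 else f₀ z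

theorem extendAlong_apply {κ X S : Type*} {P : κ → ℝ × ℝ → S} {A : Set (ℝ × ℝ)}
    {f : κ → ℝ × ℝ → X} {f₀ : S → X}
    (hf : ∀ j, ∀ p ∈ A, ∀ j', ∀ p' ∈ A, P j p = P j' p' → f j p = f j' p') (j : κ) {p : ℝ × ℝ}
    (hp : p ∈ A) : extendAlong P A f f₀ (P j p) = f j p := by
  have h : ∃ q : κ × (ℝ × ℝ), q.2 ∈ A ∧ P q.1 q.2 = P j p := ⟨(j, p), hp, rfl⟩
  rw [extendAlong, dif_pos h]
  exact hf _ _ h.choose_spec.1 _ _ hp h.choose_spec.2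

theorem extendAlong_of_notMem {κ X S : Type*} {P : κ → ℝ × ℝ → S} {A : Set (ℝ × ℝ)}
    {f : κ → ℝ × ℝ → X} {f₀ : S → X} {z : S} (hz : ∀ j, ∀ p ∈ A, P j p ≠ z) :
    extendAlong P A f f₀ z = f₀ z :=
  dif_neg fun ⟨q, hq, hq'⟩ => hz q.1 q.2 hq hq'

/-- The standard complex structure `∂_s ↦ ∂_t`, `∂_t ↦ -∂_s` of the plane. -/
def planeRot : ℝ × ℝ →L[ℝ] ℝ × ℝ :=
  (-snd ℝ ℝ ℝ).prod (fst ℝ ℝ ℝ)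

theorem planeRot_apply (x : ℝ × ℝ) : planeRot x = (-x.2, x.1) := rfl

namespace ModelData

/-- A holomorphic curve glued from copies (in the components `idx j` of the spine) of the cylinder
swept out by a lifted orbit, and possibly the slice `{a} × {y} × N`.  Its domain is a subset of `S`:
the cylinders are parametrized by a reparametrization `ψ` of the coordinate `τ`, and `O` is a
neighbourhood of `N` on which the curve is the slice. -/
structure LeafModel (D : ModelData n Y S k g)
    (J : Y × S → (ℝ × (EY n × ES)) →L[ℝ] (ℝ × (EY n × ES))) where
  I : Set ℝ
  isOpen_I : IsOpen I
  b : ℝ → ℝ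
  θ : ℝ → ℝ
  γ : ℝ → Y × ℝ
  lift : IsLift D I b θ γ
  inj : ∀ s ∈ I, ∀ s' ∈ I, b s = b s' → γ s = γ s' → s = s'
  κ : Type
  idx : κ → Fin k
  idx_inj : Injective idx
  ψ : ℝ → ℝ
  ψ_smooth : ContDiffOn ℝ ∞ ψ I
  ψ_deriv : ∀ s ∈ I, deriv ψ s ≠ 0
  ψ_inj : InjOn ψ I
  ψ_mem : ∀ s ∈ I, |ψ s| < 1 + D.δ
  N : Set S
  O : Set S
  y : Y
  a : ℝ
  isOpen_O : IsOpen O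
  N_sub : N ⊆ O
  N_off : ∀ z ∈ N, z ∉ ⋃ i, D.c i '' longCyl D.δ
  O_sub : ∀ z ∈ O, z ∈ N ∨ ∃ j s t, s ∈ I ∧ D.c (idx j) (ψ s, t) = z
  O_slice : ∀ z ∈ O, ∀ w, J (y, z) (0, (0, w)) = (0, (0, slice J y z w))
  O_eq : ∀ s ∈ I, ∀ j t, D.c (idx j) (ψ s, t) ∈ O → b s = a ∧ γ s = (y, ψ s) ∧ θ s = 0

namespace LeafModel

variable (L : LeafModel D J)

/-- The strip covering the cylinders. -/
def strip : Set (ℝ × ℝ) := {p | p.1 ∈ L.I}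

theorem isOpen_strip : IsOpen L.strip := L.isOpen_I.preimage continuous_fst

/-- The parametrizations of the cylinders in the domain. -/
def P (j : L.κ) (p : ℝ × ℝ) : S := D.c (L.idx j) (L.ψ p.1, p.2)

theorem contDiffAt_param {p : ℝ × ℝ} (hp : p ∈ L.strip) :
    ContDiffAt ℝ ∞ (fun p : ℝ × ℝ => (L.ψ p.1, p.2)) p :=
  ((L.ψ_smooth.contDiffAt (L.isOpen_I.mem_nhds hp)).comp p contDiffAt_fst).prodMk contDiffAt_snd

theorem md_P (j : L.κ) {p : ℝ × ℝ} (hp : p ∈ L.strip) (x : ℝ × ℝ) :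
    md 𝓘₂ (𝓡 2) (L.P j) p x
      = md 𝓘₂ (𝓡 2) (D.c (L.idx j)) (L.ψ p.1, p.2) (deriv L.ψ p.1 * x.1, x.2) := by
  have hf : HasFDerivAt (fun p : ℝ × ℝ => p.1) (fst ℝ ℝ ℝ) p := hasFDerivAt_fst
  have h1 : DifferentiableAt ℝ L.ψ p.1 :=
    (L.ψ_smooth.contDiffAt (L.isOpen_I.mem_nhds hp)).differentiableAt (by simp)
  have h2 : HasFDerivAt (fun p : ℝ × ℝ => (L.ψ p.1, p.2)) _ p :=
    (h1.hasDerivAt.comp_hasFDerivAt (f := fun p : ℝ × ℝ => p.1) p hf).prodMk hasFDerivAt_snd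
  have h3 := md_comp (g := D.c (L.idx j)) (f := fun p : ℝ × ℝ => (L.ψ p.1, p.2))
    ((D.contMDiffAt_c (L.idx j) (p := (L.ψ p.1, p.2)) (L.ψ_mem _ hp)).mdifferentiableAt (by simp))
    h2.differentiableAt.mdifferentiableAt
  refine (congrArg (fun A : ℝ × ℝ →L[ℝ] ES => A x) h3).trans ?_
  rw [ContinuousLinearMap.comp_apply, md_eq_fderiv, h2.fderiv]
  simp

theorem P_emb (j : L.κ) : IsCylEmbedding (L.P j) L.strip where
  smooth p hp := (ContMDiffAt.comp p (f := fun p : ℝ × ℝ => (L.ψ p.1, p.2))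
    (D.contMDiffAt_c (L.idx j) (p := (L.ψ p.1, p.2)) (L.ψ_mem _ hp))
    (L.contDiffAt_param hp).contMDiffAt).contMDiffWithinAt
  periodic s t := (D.c_emb _).periodic _ _
  immersion p hp := by
    rintro (x : ℝ × ℝ) (x' : ℝ × ℝ) hxx
    have h1 : md 𝓘₂ (𝓡 2) (L.P j) p x = md 𝓘₂ (𝓡 2) (L.P j) p x' := hxx
    rw [L.md_P j hp, L.md_P j hp] at h1
    have h2 := ((D.c_emb (L.idx j)).bijective (p := (L.ψ p.1, p.2)) (L.ψ_mem _ hp)).1 h1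
    rw [Prod.mk.injEq] at h2
    exact Prod.ext (mul_left_cancel₀ (L.ψ_deriv _ hp) h2.1) h2.2
  inj p hp q hq hpq := by
    obtain ⟨-, h1, h2⟩ := D.c_eq_imp (p := (L.ψ p.1, p.2)) (p' := (L.ψ q.1, q.2))
      (L.ψ_mem _ hp) (L.ψ_mem _ hq) hpq
    exact ⟨L.ψ_inj hp hq h1, h2⟩

theorem P_eq {j j' : L.κ} {p p' : ℝ × ℝ} (hp : p ∈ L.strip) (hp' : p' ∈ L.strip)
    (h : L.P j p = L.P j' p') : j = j' ∧ p.1 = p'.1 ∧ ∃ m : ℤ, p'.2 = p.2 + m := by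
  obtain ⟨h0, -⟩ := D.c_eq_imp (p := (L.ψ p.1, p.2)) (p' := (L.ψ p'.1, p'.2))
    (L.ψ_mem _ hp) (L.ψ_mem _ hp') h
  have h1 := L.idx_inj h0
  subst h1
  exact ⟨rfl, (L.P_emb j).inj p hp p' hp' h⟩

theorem P_mem_cyl (j : L.κ) {p : ℝ × ℝ} (hp : p ∈ L.strip) :
    L.P j p ∈ ⋃ i, D.c i '' longCyl D.δ := D.c_mem_cyl (p := (L.ψ p.1, p.2)) _ (L.ψ_mem _ hp)

/-- The domain of the curve. -/
def dom : Set S := L.N ∪ ⋃ j, L.P j '' L.strip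

theorem P_mem_dom (j : L.κ) {p : ℝ × ℝ} (hp : p ∈ L.strip) : L.P j p ∈ L.dom :=
  .inr (mem_iUnion.2 ⟨j, p, hp, rfl⟩)

theorem O_sub_dom : L.O ⊆ L.dom := fun z hz => by
  rcases L.O_sub z hz with h | ⟨j, s, t, hs, rfl⟩
  · exact .inl h
  · exact L.P_mem_dom j (p := (s, t)) hs

theorem mem_dom {z : S} (hz : z ∈ L.dom) : z ∈ L.O ∨ ∃ j, ∃ p ∈ L.strip, L.P j p = z := by
  rcases hz with h | h
  · exact .inl (L.N_sub h)
  · obtain ⟨j, p, hp, rfl⟩ := mem_iUnion.1 h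
    exact .inr ⟨j, p, hp, rfl⟩

theorem isOpen_dom : IsOpen L.dom := by
  have h1 : L.dom = L.O ∪ ⋃ j, L.P j '' L.strip := Subset.antisymm
    (union_subset_union_left _ L.N_sub) (union_subset L.O_sub_dom subset_union_right)
  rw [h1]
  exact L.isOpen_O.union (isOpen_iUnion fun j =>
    (L.P_emb j).isOpen_image L.isOpen_strip L.isOpen_strip subset_rfl)

/-- The curve, as a map defined on `S`. -/
def u : S → ℝ × (Y × S) :=
  extendAlong L.P L.strip (fun j => D.sweep (L.idx j) L.b L.θ L.γ) fun z => (L.a, (L.y, z))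

theorem u_P (j : L.κ) {p : ℝ × ℝ} (hp : p ∈ L.strip) :
    L.u (L.P j p) = D.sweep (L.idx j) L.b L.θ L.γ p := by
  refine extendAlong_apply (fun j p hp j' p' hp' h => ?_) j hp
  obtain ⟨rfl, h1, m, h2⟩ := L.P_eq hp hp' h
  rw [sweep, sweep, coord, coord, ← h1, h2, ← add_assoc, (D.c_emb _).periodic_int]

theorem sweep_of_mem_O {j : L.κ} {p : ℝ × ℝ} (hp : p ∈ L.strip) (h : L.P j p ∈ L.O) :
    D.sweep (L.idx j) L.b L.θ L.γ p = (L.a, (L.y, L.P j p)) := by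
  obtain ⟨h1, h2, h3⟩ := L.O_eq p.1 hp j p.2 h
  rw [sweep, coord, h1, h2, h3, zero_add]
  rfl

theorem u_N {z : S} (hz : z ∈ L.N) : L.u z = (L.a, (L.y, z)) :=
  extendAlong_of_notMem fun j _ hp h => L.N_off z hz (h ▸ L.P_mem_cyl j hp)

theorem u_O {z : S} (hz : z ∈ L.O) : L.u z = (L.a, (L.y, z)) := by
  rcases L.O_sub z hz with h | ⟨j, s, t, hs, rfl⟩
  · exact L.u_N h
  · exact (L.u_P j (p := (s, t)) hs).trans (L.sweep_of_mem_O hs hz)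

/-- The complex structure on the domain. -/
def jS : S → ES →L[ℝ] ES :=
  extendAlong L.P L.strip
    (fun j p => (md 𝓘₂ (𝓡 2) (L.P j) p).comp
      (planeRot.comp (md 𝓘₂ (𝓡 2) (L.P j) p).inverse))
    (slice J L.y)

theorem jS_P (j : L.κ) {p : ℝ × ℝ} (hp : p ∈ L.strip) (x : ℝ × ℝ) :
    L.jS (L.P j p) (md 𝓘₂ (𝓡 2) (L.P j) p x)
      = md 𝓘₂ (𝓡 2) (L.P j) p (planeRot x) := by
  rw [jS, extendAlong_apply (fun j p hp j' p' hp' h => ?_) j hp]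
  · let A := ContinuousLinearEquiv.ofBijective (md 𝓘₂ (𝓡 2) (L.P j) p)
      (LinearMap.ker_eq_bot.2 ((L.P_emb j).bijective hp).1)
      (LinearMap.range_eq_top.2 ((L.P_emb j).bijective hp).2)
    have hA : (A : ℝ × ℝ →L[ℝ] ES) = md 𝓘₂ (𝓡 2) (L.P j) p := rfl
    rw [← hA, ContinuousLinearMap.inverse_equiv]
    simp
  · obtain ⟨rfl, h1, m, h2⟩ := L.P_eq hp hp' h
    have h3 : p' = (p.1, p.2 + m) := Prod.ext h1.symm h2
    rw [h3, (L.P_emb j).md_periodic L.isOpen_strip (s := p.1) (t := p.2) hp m]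

/-- Where the curve is the slice, the cylinder coordinates are holomorphic for `slice`. -/
theorem slice_P {j : L.κ} {p : ℝ × ℝ} (hJ : D.IsModelJ J) (hn : 1 ≤ n) (hp : p ∈ L.strip)
    (h : L.P j p ∈ L.O) (x : ℝ × ℝ) :
    slice J L.y (L.P j p) (md 𝓘₂ (𝓡 2) (L.P j) p x)
      = md 𝓘₂ (𝓡 2) (L.P j) p (planeRot x) := by
  have hPs := (L.P_emb j).contMDiffAt L.isOpen_strip hp
  have h1 : D.sweep (L.idx j) L.b L.θ L.γ =ᶠ[𝓝 p] fun q => (L.a, (L.y, L.P j q)) := by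
    filter_upwards [L.isOpen_strip.mem_nhds hp,
      hPs.continuousAt.eventually (L.isOpen_O.mem_nhds h)] with q hq hq'
    exact L.sweep_of_mem_O hq hq'
  have hPd := hPs.mdifferentiableAt (by simp)
  have h2 : ∀ x, md 𝓘₂ (𝓘W n) (D.sweep (L.idx j) L.b L.θ L.γ) p x
      = (0, (0, md 𝓘₂ (𝓡 2) (L.P j) p x)) := by
    intro x
    rw [md_congr h1, md_prodMk mdifferentiableAt_const (mdifferentiableAt_const.prodMk hPd),
      md_const, md_prodMk mdifferentiableAt_const hPd, md_const]
    rfl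
  have h3 := L.lift.hol hJ hn (L.idx j) (p := p) hp
  rw [h2, h2, h1.self_of_nhds] at h3
  have h4 : slice J L.y (L.P j p) (md 𝓘₂ (𝓡 2) (L.P j) p (1, 0))
      = md 𝓘₂ (𝓡 2) (L.P j) p (0, 1) := congrArg (fun v => v.2.2) h3
  have h5 : slice J L.y (L.P j p) (md 𝓘₂ (𝓡 2) (L.P j) p (0, 1))
      = -md 𝓘₂ (𝓡 2) (L.P j) p (1, 0) := by
    have h6 := congrArg (J (L.y, L.P j p)) h3
    rw [hJ.sq, L.O_slice _ h] at h6
    simpa using (congrArg (fun v => v.2.2) h6).symm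
  have h6 : x = x.1 • (1, 0) + x.2 • (0, 1) := by simp
  have h7 : planeRot x = (-x.2) • ((1, 0) : ℝ × ℝ) + x.1 • ((0, 1) : ℝ × ℝ) := by
    simp [planeRot_apply]
  rw [h7, h6, map_add, map_add, map_smul, map_smul, map_add, map_smul, map_smul, map_smul, map_smul,
    h4, h5]
  simp only [Prod.fst_add, Prod.snd_add, Prod.smul_fst, Prod.smul_snd, smul_eq_mul, mul_one,
    mul_zero, add_zero, zero_add]
  module

theorem jS_O (hJ : D.IsModelJ J) (hn : 1 ≤ n) {z : S} (hz : z ∈ L.O) : L.jS z = slice J L.y z := by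
  rcases L.O_sub z hz with h | ⟨j, s, t, hs, rfl⟩
  · exact extendAlong_of_notMem fun j p hp h' => L.N_off z h (h' ▸ L.P_mem_cyl j hp)
  · ext1 w
    obtain ⟨x, rfl⟩ := ((L.P_emb j).bijective (p := (s, t)) hs).2 w
    exact (L.jS_P j (p := (s, t)) hs x).trans (L.slice_P hJ hn (p := (s, t)) hs hz x).symm

theorem jS_sq (hJ : D.IsModelJ J) (hn : 1 ≤ n) {z : S} (hz : z ∈ L.dom) (w : ES) :
    L.jS z (L.jS z w) = -w := by
  rcases L.mem_dom hz with h | ⟨j, p, hp, rfl⟩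
  · rw [L.jS_O hJ hn h]
    have h1 := hJ.sq (L.y, z) (0, (0, w))
    rw [L.O_slice z h, L.O_slice z h] at h1
    simpa using congrArg (fun x => x.2.2) h1
  · obtain ⟨x, rfl⟩ := ((L.P_emb j).bijective hp).2 w
    rw [L.jS_P j hp, L.jS_P j hp, ← map_neg]
    congr 1

theorem contMDiffAt_jS (hJ : D.IsModelJ J) (hn : 1 ≤ n) {q : TangentBundle (𝓡 2) S}
    (hq : q.1 ∈ L.dom) : ContMDiffAt (𝓡 2).tangent (𝓡 2).tangent ∞
      (fun q : TangentBundle (𝓡 2) S => (⟨q.1, L.jS q.1 q.2⟩ : TangentBundle (𝓡 2) S)) q := by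
  have hproj : ContinuousAt (fun q : TangentBundle (𝓡 2) S => q.1) q :=
    (FiberBundle.continuous_proj ES (TangentSpace (𝓡 2))).continuousAt
  rcases L.mem_dom hq with h | ⟨j, p, hp, hpq⟩
  · refine (smoothEnd_slice hJ L.y q).congr_of_eventuallyEq ?_
    filter_upwards [hproj.eventually (L.isOpen_O.mem_nhds h)] with x hx
    rw [L.jS_O hJ hn hx]
  · obtain ⟨G, O, hO, hpO, hG, hGO, hGp, -⟩ := (L.P_emb j).exists_local_inverse L.isOpen_strip hp
    rw [hpq] at hpO hGp
    have hG' : ContMDiffAt (𝓡 2) 𝓘₂ ∞ G q.1 := hG.contMDiffAt (hO.mem_nhds hpO)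
    have h1 := contMDiffAt_tangentMap (I := 𝓡 2) (I' := 𝓘₂) (f := G) (p := q) hG'
    have hpt : ContMDiffAt (𝓡 2).tangent 𝓘₂ ∞
        (fun x : TangentBundle (𝓡 2) S => (tangentMap (𝓡 2) 𝓘₂ G x).2) q :=
      ((Bundle.contMDiffAt_totalSpace (f := tangentMap (𝓡 2) 𝓘₂ G)).1 h1).2.congr_of_eventuallyEq
        (.of_forall fun x => by simp; rfl)
    have hbase : ContMDiffAt (𝓡 2).tangent 𝓘₂ ∞
        (fun x : TangentBundle (𝓡 2) S => G x.1) q :=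
      ContMDiffAt.comp q (f := fun x : TangentBundle (𝓡 2) S => x.1) hG'
        (Bundle.contMDiff_proj (TangentSpace (𝓡 2)) q)
    have h2 := contMDiffAt_tangentBundle_vectorSpace hbase
      ((planeRot.contDiff (n := ∞)).contMDiff.contMDiffAt.comp q hpt)
    have hPs : ContMDiffAt 𝓘₂ (𝓡 2) ∞ (L.P j) (G q.1) := by
      rw [hGp]; exact (L.P_emb j).contMDiffAt L.isOpen_strip hp
    have h3 := ContMDiffAt.comp q (contMDiffAt_tangentMap (I := 𝓘₂) (I' := 𝓡 2)
      (f := L.P j) (p := ⟨G q.1, planeRot (tangentMap (𝓡 2) 𝓘₂ G q).2⟩) hPs) h2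
    refine h3.congr_of_eventuallyEq ?_
    filter_upwards [hproj.eventually (hO.mem_nhds hpO)] with x hx
    obtain ⟨hx1, hx2⟩ := hGO x.1 hx
    have h4 : MDifferentiableAt (𝓡 2) 𝓘₂ G x.1 :=
      (hG.contMDiffAt (hO.mem_nhds hx)).mdifferentiableAt (by simp)
    have h5 : MDifferentiableAt 𝓘₂ (𝓡 2) (L.P j) (G x.1) :=
      ((L.P_emb j).contMDiffAt L.isOpen_strip hx1).mdifferentiableAt (by simp)
    have h6 := md_comp (g := L.P j) (f := G) h5 h4
    rw [md_congr (g := fun z => z) (by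
      filter_upwards [hO.mem_nhds hx] with z hz; exact (hGO z hz).2), md_id] at h6
    have h7 : ∀ w : ES, w = md 𝓘₂ (𝓡 2) (L.P j) (G x.1)
        (md (𝓡 2) 𝓘₂ G x.1 w) := fun w => by
      conv_lhs => rw [show w = ContinuousLinearMap.id ℝ ES w from rfl, h6]
      rfl
    have h8 : L.jS x.1 x.2 = md 𝓘₂ (𝓡 2) (L.P j) (G x.1)
        (planeRot (md (𝓡 2) 𝓘₂ G x.1 x.2)) := by
      have h9 := L.jS_P j hx1 (md (𝓡 2) 𝓘₂ G x.1 x.2)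
      rw [hx2] at h9
      exact (congrArg (L.jS x.1) (h7 x.2)).trans h9
    show (⟨x.1, L.jS x.1 x.2⟩ : TangentBundle (𝓡 2) S) = ⟨L.P j (G x.1), _⟩
    rw [h8, hx2]
    rfl

theorem md_u_P (j : L.κ) (hJ : D.IsModelJ J) (hn : 1 ≤ n) {p : ℝ × ℝ} (hp : p ∈ L.strip) :
    ContMDiffAt (𝓡 2) (𝓘W n) ∞ L.u (L.P j p) ∧
    ∀ x, md (𝓡 2) (𝓘W n) L.u (L.P j p) (md 𝓘₂ (𝓡 2) (L.P j) p x)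
      = md 𝓘₂ (𝓘W n) (D.sweep (L.idx j) L.b L.θ L.γ) p x := by
  obtain ⟨G, O, hO, hpO, hG, hGO, hGp, -⟩ := (L.P_emb j).exists_local_inverse L.isOpen_strip hp
  have h1 : ContMDiffAt (𝓡 2) (𝓘W n) ∞ L.u (L.P j p) := by
    have h2 : ContMDiffAt 𝓘₂ (𝓘W n) ∞
        (D.sweep (L.idx j) L.b L.θ L.γ) (G (L.P j p)) := by
      rw [hGp]; exact L.lift.contMDiffAt_sweep hJ hn _ L.isOpen_I hp
    refine (ContMDiffAt.comp (L.P j p) h2 (hG.contMDiffAt (hO.mem_nhds hpO))).congr_of_eventuallyEq ?_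
    filter_upwards [hO.mem_nhds hpO] with z hz
    rw [Function.comp, ← L.u_P j (hGO z hz).1, (hGO z hz).2]
  refine ⟨h1, fun x => ?_⟩
  have h2 := md_comp (g := L.u) (f := L.P j) (h1.mdifferentiableAt (by simp))
    (((L.P_emb j).contMDiffAt L.isOpen_strip hp).mdifferentiableAt (by simp))
  rw [md_congr (g := D.sweep (L.idx j) L.b L.θ L.γ) (by
    filter_upwards [L.isOpen_strip.mem_nhds hp] with q hq; exact L.u_P j hq)] at h2
  rw [h2]
  rfl

theorem md_u_O {z : S} (hz : z ∈ L.O) :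
    ContMDiffAt (𝓡 2) (𝓘W n) ∞ L.u z ∧
    ∀ w, md (𝓡 2) (𝓘W n) L.u z w = (0, (0, w)) := by
  have h1 : L.u =ᶠ[𝓝 z] fun z => (L.a, (L.y, z)) := by
    filter_upwards [L.isOpen_O.mem_nhds hz] with x hx
    exact L.u_O hx
  refine ⟨ContMDiffAt.congr_of_eventuallyEq
    (contMDiffAt_const.prodMk (contMDiffAt_const.prodMk contMDiffAt_id)) h1, fun w => ?_⟩
  have hid : MDifferentiableAt (𝓡 2) (𝓡 2) (fun z : S => z) z := mdifferentiableAt_id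
  rw [md_congr h1, md_prodMk mdifferentiableAt_const (mdifferentiableAt_const.prodMk hid), md_const,
    md_prodMk mdifferentiableAt_const hid, md_const, md_id]
  rfl

theorem contMDiffAt_u (hJ : D.IsModelJ J) (hn : 1 ≤ n) {z : S} (hz : z ∈ L.dom) :
    ContMDiffAt (𝓡 2) (𝓘W n) ∞ L.u z := by
  rcases L.mem_dom hz with h | ⟨j, p, hp, rfl⟩
  · exact (L.md_u_O h).1
  · exact (L.md_u_P j hJ hn hp).1

theorem u_hol (hJ : D.IsModelJ J) (hn : 1 ≤ n) {z : S} (hz : z ∈ L.dom) (w : ES) :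
    md (𝓡 2) (𝓘W n) L.u z (L.jS z w)
      = J (L.u z).2 (md (𝓡 2) (𝓘W n) L.u z w) := by
  rcases L.mem_dom hz with h | ⟨j, p, hp, rfl⟩
  · rw [(L.md_u_O h).2, (L.md_u_O h).2, L.u_O h, L.jS_O hJ hn h, L.O_slice z h]
  · obtain ⟨x, rfl⟩ := ((L.P_emb j).bijective hp).2 w
    have h1 := L.lift.hol hJ hn (L.idx j) (p := p) hp
    rw [L.jS_P j hp, (L.md_u_P j hJ hn hp).2, (L.md_u_P j hJ hn hp).2, L.u_P j hp]
    set A := md 𝓘₂ (𝓘W n) (D.sweep (L.idx j) L.b L.θ L.γ) p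
    set Q := J (D.sweep (L.idx j) L.b L.θ L.γ p).2
    have h2 : Q (A (0, 1)) = -A (1, 0) := by rw [← h1]; exact hJ.sq _ _
    have h6 : x = x.1 • (1, 0) + x.2 • (0, 1) := by simp
    have h7 : planeRot x = (-x.2) • ((1, 0) : ℝ × ℝ) + x.1 • ((0, 1) : ℝ × ℝ) := by
      simp [planeRot_apply]
    have h8 : A x = x.1 • A (1, 0) + x.2 • A (0, 1) := by
      rw [← map_smul, ← map_smul, ← map_add, ← h6]
    rw [h8, h7, map_add, map_smul, map_smul, map_add, map_smul, map_smul, h1, h2]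
    module

theorem u_injOn : InjOn L.u L.dom := by
  have hmix : ∀ z ∈ L.N, ∀ j, ∀ p ∈ L.strip, L.u z ≠ L.u (L.P j p) := by
    intro z hz j p hp h
    rw [L.u_N hz, L.u_P j hp] at h
    have h1 : z = D.c (L.idx j) ((L.γ p.1).2, L.θ p.1 + p.2) := congrArg (fun w => w.2.2) h
    exact L.N_off z hz (h1 ▸ D.c_mem_cyl _ (L.lift.orbit.mem _ hp))
  rintro z (hz | hz) z' (hz' | hz') h
  · rw [L.u_N hz, L.u_N hz'] at h
    exact congrArg (fun w => w.2.2) h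
  · obtain ⟨j, p, hp, rfl⟩ := mem_iUnion.1 hz'
    exact absurd h (hmix z hz j p hp)
  · obtain ⟨j, p, hp, rfl⟩ := mem_iUnion.1 hz
    exact absurd h.symm (hmix z' hz' j p hp)
  · obtain ⟨j, p, hp, rfl⟩ := mem_iUnion.1 hz
    obtain ⟨j', p', hp', rfl⟩ := mem_iUnion.1 hz'
    rw [L.u_P j hp, L.u_P j' hp'] at h
    have h1 : L.b p.1 = L.b p'.1 := congrArg Prod.fst h
    have h2 : (L.γ p.1).1 = (L.γ p'.1).1 := congrArg (fun w => w.2.1) h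
    have h3 : D.c (L.idx j) ((L.γ p.1).2, L.θ p.1 + p.2)
        = D.c (L.idx j') ((L.γ p'.1).2, L.θ p'.1 + p'.2) := congrArg (fun w => w.2.2) h
    obtain ⟨h4, h5, m, h6⟩ := D.c_eq_imp (p := ((L.γ p.1).2, L.θ p.1 + p.2))
      (p' := ((L.γ p'.1).2, L.θ p'.1 + p'.2)) (L.lift.orbit.mem _ hp) (L.lift.orbit.mem _ hp') h3
    have h7 := L.idx_inj h4
    subst h7
    have h8 : p.1 = p'.1 := L.inj _ hp _ hp' h1 (Prod.ext h2 h5)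
    have h9 : p'.2 = p.2 + m := by
      have h10 : L.θ p'.1 + p'.2 = L.θ p.1 + p.2 + m := h6
      rw [h8] at h10
      linarith
    have h10 : p' = (p.1, p.2 + m) := Prod.ext h8.symm h9
    rw [h10, (L.P_emb j).periodic_int]

theorem md_u_injective (hJ : D.IsModelJ J) (hn : 1 ≤ n) {z : S} (hz : z ∈ L.dom) :
    Injective (md (𝓡 2) (𝓘W n) L.u z) := by
  rcases L.mem_dom hz with h | ⟨j, p, hp, rfl⟩
  · intro w w' hw
    rw [(L.md_u_O h).2, (L.md_u_O h).2] at hw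
    exact congrArg (fun v => v.2.2) hw
  · intro w w' hw
    obtain ⟨x, rfl⟩ := ((L.P_emb j).bijective hp).2 w
    obtain ⟨x', rfl⟩ := ((L.P_emb j).bijective hp).2 w'
    rw [(L.md_u_P j hJ hn hp).2, (L.md_u_P j hJ hn hp).2] at hw
    rw [L.lift.md_sweep_injective hJ hn _ hp hw]

end LeafModel

end ModelData

/-! ### The punctured curves -/

section Opens

variable {E H M : Type*} [NormedAddCommGroup E] [NormedSpace ℝ E]
  [TopologicalSpace H] {I : ModelWithCorners ℝ E H} [I.Boundaryless] [TopologicalSpace M]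
  [ChartedSpace H M] [IsManifold I ∞ M] (U : TopologicalSpace.Opens M)
  {E' H' M' : Type*} [NormedAddCommGroup E'] [NormedSpace ℝ E']
  [TopologicalSpace H'] {I' : ModelWithCorners ℝ E' H'} [TopologicalSpace M']
  [ChartedSpace H' M']

theorem md_comp_subtype_val {f : M → M'} {z : U} (hf : MDifferentiableAt I I' f z.1) :
    md I I' (fun x : U => f x.1) z = md I I' f z.1 := by
  rw [md_comp (g := f) (f := fun x : U => x.1) hf
    ((contMDiff_subtype_val (n := ∞) (U := U) z).mdifferentiableAt (by simp)), md_subtype_val,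
    ContinuousLinearMap.comp_id]

theorem md_openRetract_comp [IsManifold I' ∞ M'] [Nonempty U] {f : M' → M} {x : M'} (hf : MDifferentiableAt I' I f x)
    (hx : f x ∈ U) : md I' I (fun y => openRetract U (f y)) x = md I' I f x := by
  rw [md_comp (g := openRetract U) (f := f)
    ((contMDiffAt_openRetract U hx).mdifferentiableAt (by simp)) hf, md_openRetract U hx,
    ContinuousLinearMap.id_comp]

/-- The restriction of an endomorphism field to an open set. -/
theorem smoothEnd_opens {j : M → E →L[ℝ] E}
    (hj : ∀ q : TangentBundle I M, q.1 ∈ U → ContMDiffAt I.tangent I.tangent ∞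
      (fun q : TangentBundle I M => (⟨q.1, j q.1 q.2⟩ : TangentBundle I M)) q) :
    SmoothEnd I (fun z : U => j z.1) := by
  intro q
  have : Nonempty U := ⟨q.1⟩
  have h1 := contMDiffAt_tangentMap (I := I) (I' := I) (f := fun x : U => x.1) (p := q)
    (contMDiff_subtype_val (n := ∞) (U := U) _)
  have h2 := ContMDiffAt.comp q (f := tangentMap I I (fun x : U => x.1))
    (hj (tangentMap I I (fun x : U => x.1) q) q.1.2) h1
  have h3 := ContMDiffAt.comp q (contMDiffAt_tangentMap (I := I) (I' := I) (f := openRetract U)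
    (p := ⟨q.1.1, j q.1.1 (tangentMap I I (fun x : U => x.1) q).2⟩)
    (contMDiffAt_openRetract U q.1.2)) h2
  refine h3.congr_of_eventuallyEq (.of_forall fun x => ?_)
  have h4 : ∀ w : E, md I I (fun x : U => x.1) x.1 w = w := fun w => by
    rw [md_subtype_val]; rfl
  have h5 : ∀ w : E, md I I (openRetract U) x.1.1 w = w := fun w => by
    rw [md_openRetract U x.1.2]; rfl
  have h6 : (j x.1.1 x.2 : E)
      = md I I (openRetract U) x.1.1 (j x.1.1 (md I I (fun x : U => x.1) x.1 x.2)) :=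
    ((h5 _).trans (congrArg (j x.1.1) (h4 x.2))).symm
  exact congrArg₂ (fun (a : U) (w : E) => (⟨a, w⟩ : TangentBundle I U))
    (openRetract_apply U x.1).symm h6

end Opens

theorem PuncturedCurve.isSimple_of_injective {E H M : Type*} [NormedAddCommGroup E]
    [NormedSpace ℝ E] [TopologicalSpace H] {I : ModelWithCorners ℝ E H} [TopologicalSpace M]
    [ChartedSpace H M] [IsManifold I ∞ M] {J : M → (ℝ × E) →L[ℝ] (ℝ × E)} {C : PuncturedCurve I J}
    (h : Injective C.u) : C.IsSimple := fun C' f _ _ hf z z' hz =>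
  h (by rw [hf z, hf z', hz])

theorem isOpen_halfCyl (pos : Bool) (r : ℝ) : IsOpen (halfCyl pos r) := by
  cases pos
  · exact isOpen_lt continuous_fst continuous_const
  · exact isOpen_lt continuous_const continuous_fst

namespace ModelData

open Classical in
/-- The tangent planes of the foliation: over the cylinders they are spanned by `∂_θ` and `J ∂_θ`, and
over the pages by the tangent spaces of the slices. -/
def planeField (D : ModelData n Y S k g) (J : Y × S → (ℝ × (EY n × ES)) →L[ℝ] (ℝ × (EY n × ES)))
    (w : ℝ × (Y × S)) : Submodule ℝ (ℝ × (EY n × ES)) :=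
  if h : ∃ q : Fin k × (ℝ × ℝ), |q.2.1| < 1 + D.δ ∧ D.c q.1 q.2 = w.2.2 then
    Submodule.span ℝ {((0, (0, D.dtheta h.choose.1 h.choose.2)) : ℝ × (EY n × ES)),
      J w.2 (0, (0, D.dtheta h.choose.1 h.choose.2))}
  else LinearMap.range ((LinearMap.inr ℝ ℝ (EY n × ES)).comp (LinearMap.inr ℝ (EY n) ES))

theorem planeField_c (i : Fin k) {p : ℝ × ℝ} (hp : |p.1| < 1 + D.δ) (a : ℝ) (y : Y) :
    D.planeField J (a, (y, D.c i p)) = Submodule.span ℝ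
      {((0, (0, D.dtheta i p)) : ℝ × (EY n × ES)), J (y, D.c i p) (0, (0, D.dtheta i p))} := by
  have h : ∃ q : Fin k × (ℝ × ℝ), |q.2.1| < 1 + D.δ ∧ D.c q.1 q.2 = D.c i p := ⟨(i, p), hp, rfl⟩
  have h1 : D.dtheta h.choose.1 h.choose.2 = D.dtheta i p := by
    obtain ⟨h2, h3⟩ := h.choose_spec
    obtain ⟨h4, h5, m, h6⟩ := D.c_eq_imp hp h2 h3.symm
    rw [← h4, show h.choose.2 = (p.1, p.2 + m) from Prod.ext h5.symm h6]
    exact congrArg (fun L : ℝ × ℝ →L[ℝ] ES => L (0, 1))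
      ((D.c_emb i).md_periodic (isOpen_longCyl D.δ) (s := p.1) (t := p.2) hp m)
  rw [planeField, dif_pos h, h1]

/-- Where `J` preserves the tangent spaces of the slices, these are the planes. -/
theorem planeField_of_slice (hJ : D.IsModelJ J) {a : ℝ} {y : Y} {z : S}
    (hz : ∀ w, J (y, z) (0, (0, w)) = (0, (0, slice J y z w))) :
    D.planeField J (a, (y, z))
      = LinearMap.range ((LinearMap.inr ℝ ℝ (EY n × ES)).comp (LinearMap.inr ℝ (EY n) ES)) ∧
    ∀ w : ES, w ≠ 0 → Submodule.span ℝ {((0, (0, w)) : ℝ × (EY n × ES)), J (y, z) (0, (0, w))}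
      = LinearMap.range ((LinearMap.inr ℝ ℝ (EY n × ES)).comp (LinearMap.inr ℝ (EY n) ES)) := by
  have key : ∀ w : ES, w ≠ 0 → Submodule.span ℝ
      {((0, (0, w)) : ℝ × (EY n × ES)), J (y, z) (0, (0, w))}
      = LinearMap.range ((LinearMap.inr ℝ ℝ (EY n × ES)).comp (LinearMap.inr ℝ (EY n) ES)) := by
    intro w hw
    have hsq : slice J y z (slice J y z w) = -w := by
      have h1 := hJ.sq (y, z) (0, (0, w))
      rw [hz, hz] at h1
      simpa using congrArg (fun x => x.2.2) h1
    have hli : LinearIndependent ℝ ![w, slice J y z w] := by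
      rw [LinearIndependent.pair_iff]
      intro s t hst
      have h1 : s • slice J y z w - t • w = 0 := by
        have := congrArg (slice J y z) hst
        rw [map_add, map_smul, map_smul, hsq, map_zero, smul_neg, ← sub_eq_add_neg] at this
        exact this
      have h2 : (s ^ 2 + t ^ 2) • w = 0 := by
        have := congrArg₂ (fun u v => s • u - t • v) hst h1
        simp only [smul_zero, sub_zero] at this
        rw [← this]
        module
      have h3 := (smul_eq_zero.1 h2).resolve_right hw
      exact ⟨by nlinarith [sq_nonneg s, sq_nonneg t], by nlinarith [sq_nonneg s, sq_nonneg t]⟩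
    have htop : Submodule.span ℝ {w, slice J y z w} = ⊤ := by
      have h1 := hli.span_eq_top_of_card_eq_finrank' (by simp)
      rwa [Matrix.range_cons, Matrix.range_cons, Matrix.range_empty, union_empty,
        singleton_union] at h1
    rw [LinearMap.range_eq_map, ← htop, Submodule.map_span, image_pair, hz]
    rfl
  refine ⟨?_, key⟩
  by_cases h : ∃ q : Fin k × (ℝ × ℝ), |q.2.1| < 1 + D.δ ∧ D.c q.1 q.2 = z
  · obtain ⟨q, hq, rfl⟩ := h
    rw [planeField_c q.1 hq]
    refine key _ fun h0 => ?_
    refine dcoord_theta_ne_zero (D := D) q.1 hq ?_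
    show (_, _) = (_, _)
    simp [h0]
  · exact dif_neg h

namespace LeafModel

variable (L : LeafModel D J)

theorem md_u_mem_planeField (hJ : D.IsModelJ J) (hn : 1 ≤ n) {z : S} (hz : z ∈ L.dom) (w : ES) :
    md (𝓡 2) (𝓘W n) L.u z w ∈ D.planeField J (L.u z) := by
  rcases L.mem_dom hz with h | ⟨j, p, hp, rfl⟩
  · rw [(L.md_u_O h).2, L.u_O h, (planeField_of_slice hJ (L.O_slice z h)).1]
    exact ⟨w, rfl⟩
  · obtain ⟨x, rfl⟩ := ((L.P_emb j).bijective hp).2 w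
    rw [(L.md_u_P j hJ hn hp).2, L.u_P j hp]
    have h1 := L.lift.hol hJ hn (L.idx j) (p := p) hp
    have h2 := L.lift.md_sweep_t (L.idx j) (p := p) hp
    have h3 : D.planeField J (D.sweep (L.idx j) L.b L.θ L.γ p) = _ :=
      planeField_c (J := J) (L.idx j) (p := ((L.γ p.1).2, L.θ p.1 + p.2)) (L.lift.orbit.mem _ hp)
        (L.b p.1) (L.γ p.1).1
    have h4 : (D.dcoord (L.idx j) ((L.γ p.1).2, L.θ p.1 + p.2) ((0 : EY n × ℝ), (1 : ℝ)))
        = (0, D.dtheta (L.idx j) ((L.γ p.1).2, L.θ p.1 + p.2)) := by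
      simp [dcoord]
    rw [h4] at h2
    rw [h3, ← h2]
    set A := md 𝓘₂ (𝓘W n) (D.sweep (L.idx j) L.b L.θ L.γ) p
    have h5 : J ((L.γ p.1).1, D.c (L.idx j) ((L.γ p.1).2, L.θ p.1 + p.2)) (A (0, 1))
        = -A (1, 0) := by
      rw [← h1]; exact hJ.sq _ _
    rw [h5]
    have h6 : A x = (-x.1) • -A (1, 0) + x.2 • A (0, 1) := by
      rw [smul_neg, neg_smul, neg_neg, ← map_smul, ← map_smul, ← map_add]
      simp
    rw [h6]
    exact Submodule.add_mem _ (Submodule.smul_mem _ _ (Submodule.subset_span (by simp)))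
      (Submodule.smul_mem _ _ (Submodule.subset_span (by simp)))

/-- The punctures of a curve: the cylinders (or half-cylinders) in the domain which run into the
spine, where they are asymptotic to periodic orbits. -/
structure Punctures where
  ι : Type
  fin : Finite ι
  pos : ι → Bool
  comp : ι → L.κ
  sub : ∀ i, halfCyl (pos i) 0 ⊆ L.strip
  ne : ∀ i i', i ≠ i' → comp i = comp i' → pos i ≠ pos i'
  K : Set S
  isCompact_K : IsCompact K
  K_sub : K ⊆ L.dom
  cover : ∀ z ∈ L.dom, z ∉ K → ∃ i, ∃ p ∈ halfCyl (pos i) 1, L.P (comp i) p = z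
  conn : IsConnected L.dom
  T : ι → ℝ
  orb : ι → ℝ → Y × S
  periodic : ∀ i, IsPeriodicOrbit (IYS n) J (T i) (orb i)
  asymp : ∀ i, ∀ v : ℝ × ℝ → ℝ × (Y × S),
    (∀ p ∈ halfCyl (pos i) 0, v p = D.sweep (L.idx (comp i)) L.b L.θ L.γ p) →
    AsymptoticTo (IYS n) J (pos i) v (T i) (orb i)

/-- The domain, as an open set. -/
def domO : TopologicalSpace.Opens S := ⟨L.dom, L.isOpen_dom⟩

variable {L}

theorem Punctures.u_retract (Q : Punctures L) [Nonempty L.domO] (i : Q.ι) {p : ℝ × ℝ}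
    (hp : p ∈ halfCyl (Q.pos i) 0) :
    L.u (openRetract L.domO (L.P (Q.comp i) p)).1
      = D.sweep (L.idx (Q.comp i)) L.b L.θ L.γ p := by
  rw [openRetract_val L.domO (L.P_mem_dom _ (Q.sub i hp)), L.u_P _ (Q.sub i hp)]

theorem isCylEmbedding_openRetract [Nonempty L.domO] (j : L.κ) {A : Set (ℝ × ℝ)}
    (hA : A ⊆ L.strip) : IsCylEmbedding (fun p => openRetract L.domO (L.P j p)) A where
  smooth p hp := (ContMDiffAt.comp p (f := L.P j)
    (contMDiffAt_openRetract (I := 𝓡 2) L.domO (L.P_mem_dom j (hA hp)))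
    ((L.P_emb j).contMDiffAt L.isOpen_strip (hA hp))).contMDiffWithinAt
  periodic s t := by rw [(L.P_emb j).periodic]
  immersion p hp := by
    have h1 := md_openRetract_comp (I := 𝓡 2) (I' := 𝓘₂) L.domO (f := L.P j)
      (((L.P_emb j).contMDiffAt L.isOpen_strip (hA hp)).mdifferentiableAt (by simp))
      (L.P_mem_dom j (hA hp))
    show Injective
      (md 𝓘₂ (𝓡 2) (fun p => openRetract L.domO (L.P j p)) p)
    rw [h1]
    exact (L.P_emb j).immersion p (hA hp)
  inj p hp q hq hpq := by
    have h1 := congrArg Subtype.val hpq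
    rw [openRetract_val L.domO (L.P_mem_dom j (hA hp)),
      openRetract_val L.domO (L.P_mem_dom j (hA hq))] at h1
    exact (L.P_emb j).inj p (hA hp) q (hA hq) h1

theorem isHolCyl_openRetract [Nonempty L.domO] (j : L.κ) {A : Set (ℝ × ℝ)}
    (hA : A ⊆ L.strip) :
    IsHolCyl (fun z : L.domO => L.jS z.1) (fun p => openRetract L.domO (L.P j p)) A := by
  intro p hp
  have h1 := md_openRetract_comp (I := 𝓡 2) (I' := 𝓘₂) L.domO (f := L.P j)
    (((L.P_emb j).contMDiffAt L.isOpen_strip (hA hp)).mdifferentiableAt (by simp))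
    (L.P_mem_dom j (hA hp))
  show L.jS (openRetract L.domO (L.P j p)).1
    (md 𝓘₂ (𝓡 2) (fun p => openRetract L.domO (L.P j p)) p (1, 0))
    = md 𝓘₂ (𝓡 2) (fun p => openRetract L.domO (L.P j p)) p (0, 1)
  rw [h1, openRetract_val L.domO (L.P_mem_dom j (hA hp)), L.jS_P j (hA hp), planeRot_apply]
  simp

theorem md_u_domO (hJ : D.IsModelJ J) (hn : 1 ≤ n) (z : L.domO) :
    md (𝓡 2) (𝓘W n) (fun z : L.domO => L.u z.1) z
      = md (𝓡 2) (𝓘W n) L.u z.1 :=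
  md_comp_subtype_val L.domO ((L.contMDiffAt_u hJ hn z.2).mdifferentiableAt (by simp))

/-- The punctured curve defined by a model. -/
def curve [T2Space S] (hJ : D.IsModelJ J) (hn : 1 ≤ n) (Q : Punctures L) :
    PuncturedCurve (IYS n) J :=
  have : ConnectedSpace L.domO := isConnected_iff_connectedSpace.1 Q.conn
  { S := L.domO
    j := fun z => L.jS z.1
    j_smooth := smoothEnd_opens (I := 𝓡 2) L.domO
      fun _ hq => L.contMDiffAt_jS hJ hn hq
    j_sq := fun z v => L.jS_sq hJ hn z.2 v
    ι := Q.ι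
    fin := Q.fin
    pos := Q.pos
    φ := fun i p => openRetract L.domO (L.P (Q.comp i) p)
    φ_emb := fun i => isCylEmbedding_openRetract (Q.comp i) (Q.sub i)
    φ_hol := fun i => isHolCyl_openRetract (Q.comp i) (Q.sub i)
    φ_disj := fun i i' hii => by
      rw [Set.disjoint_left]
      rintro _ ⟨p, hp, rfl⟩ ⟨p', hp', h⟩
      have h1 := congrArg Subtype.val h
      rw [openRetract_val L.domO (L.P_mem_dom _ (Q.sub i hp)),
        openRetract_val L.domO (L.P_mem_dom _ (Q.sub i' hp'))] at h1
      obtain ⟨h2, h3, -⟩ := L.P_eq (Q.sub i' hp') (Q.sub i hp) h1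
      have h4 := Q.ne i i' hii h2.symm
      simp only [halfCyl, mem_ofPred_eq] at hp hp'
      rw [h3] at hp'
      revert hp hp' h4
      cases Q.pos i <;> cases Q.pos i' <;> simp <;> intro h5 <;> linarith
    compact := by
      have h1 : IsCompact ((fun z : L.domO => z.1) ⁻¹' Q.K) :=
        Topology.IsInducing.subtypeVal.isCompact_preimage' Q.isCompact_K
          (fun z hz => ⟨⟨z, Q.K_sub hz⟩, rfl⟩)
      refine h1.of_isClosed_subset ?_ fun z hz => ?_
      · rw [isClosed_compl_iff]
        refine isOpen_iUnion fun i => ?_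
        refine (isCylEmbedding_openRetract (Q.comp i) (Q.sub i)).isOpen_image (isOpen_halfCyl _ _)
          (isOpen_halfCyl _ _) fun p hp => ?_
        revert hp
        cases Q.pos i <;> simp [halfCyl] <;> intro hp <;> linarith
      · by_contra hK
        obtain ⟨i, p, hp, hpz⟩ := Q.cover z.1 z.2 hK
        refine hz (mem_iUnion.2 ⟨i, p, hp, ?_⟩)
        show openRetract L.domO (L.P (Q.comp i) p) = z
        rw [hpz, openRetract_apply]
    u := fun z => L.u z.1
    u_smooth := fun z => contMDiffAt_subtype_iff.2 (L.contMDiffAt_u hJ hn z.2)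
    u_hol := fun z v => by
      have h1 := md_u_domO hJ hn z
      have h2 := L.u_hol hJ hn z.2 v
      rw [← h1] at h2
      exact h2
    asymptotic := fun i => ⟨Q.T i, Q.orb i, Q.periodic i,
      Q.asymp i _ fun p hp => Q.u_retract i hp⟩ }

theorem curve_u_retract
    [Nonempty L.domO] (j : L.κ) {p : ℝ × ℝ} (hp : p ∈ L.strip) :
    L.u (openRetract L.domO (L.P j p)).1 = D.sweep (L.idx j) L.b L.θ L.γ p := by
  rw [openRetract_val L.domO (L.P_mem_dom _ hp), L.u_P _ hp]

theorem curve_parametrizes [T2Space S] (hJ : D.IsModelJ J) (hn : 1 ≤ n) (Q : Punctures L) :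
    (curve hJ hn Q).Parametrizes (L.u '' L.dom) := by
  have hinj : Injective (curve hJ hn Q).u := fun z z' h =>
    Subtype.ext (L.u_injOn z.2 z'.2 h)
  refine ⟨PuncturedCurve.isSimple_of_injective hinj, hinj, fun z => ?_, ?_⟩
  · have h1 := md_u_domO hJ hn z
    show Injective (md (𝓡 2) (𝓘W n) (fun z : L.domO => L.u z.1) z)
    rw [h1]
    exact L.md_u_injective hJ hn z.2
  · ext w
    constructor
    · rintro ⟨z, rfl⟩
      exact ⟨z.1, z.2, rfl⟩
    · rintro ⟨z, hz, rfl⟩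
      exact ⟨⟨z, hz⟩, rfl⟩

theorem curve_tangent [T2Space S] (hJ : D.IsModelJ J) (hn : 1 ≤ n) (Q : Punctures L)
    (z : (curve hJ hn Q).S) (v : ES) :
    md (𝓡 2) (𝓘W n) (curve hJ hn Q).u z v
      ∈ D.planeField J ((curve hJ hn Q).u z) := by
  have h1 := L.md_u_mem_planeField hJ hn z.2 v
  rw [← md_u_domO hJ hn z] at h1
  exact h1

end LeafModel

end ModelData

/-! ### Energy -/

open MeasureTheory

/-- A fundamental domain of the cylinder over `I`. -/
def unitStrip (I : Set ℝ) : Set (ℝ × ℝ) := I ×ˢ Ico 0 1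

theorem lintegral_unitStrip_le {I : Set ℝ} {f : ℝ → ℝ≥0∞} :
    ∫⁻ p in unitStrip I, f p.1 ≤ ∫⁻ s in I, f s := by
  rw [unitStrip, Measure.volume_eq_prod, ← Measure.prod_restrict]
  refine (lintegral_prod_le _).trans ?_
  simp

/-- The integral of the derivative of a bounded monotone function. -/
theorem lintegral_deriv_le {I : Set ℝ} (hI : IsOpen I) (hc : Convex ℝ I) {f f' : ℝ → ℝ} {a b : ℝ}
    (hf : ∀ s ∈ I, HasDerivAt f (f' s) s) (hf' : ∀ s ∈ I, 0 ≤ f' s) (hb : ∀ s ∈ I, f s ∈ Icc a b) :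
    ∫⁻ s in I, ENNReal.ofReal (f' s) ≤ ENNReal.ofReal (b - a) := by
  have hm : MonotoneOn f I := by
    refine monotoneOn_of_deriv_nonneg hc (fun s hs => (hf s hs).continuousAt.continuousWithinAt)
      (fun s hs => (hf s (interior_subset hs)).differentiableAt.differentiableWithinAt)
      fun s hs => ?_
    rw [(hf s (interior_subset hs)).deriv]
    exact hf' s (interior_subset hs)
  rw [lintegral_deriv_eq_volume_image_of_monotoneOn hI.measurableSet
    (fun s hs => (hf s hs).hasDerivWithinAt) hm, ← Real.volume_Icc]
  exact measure_mono (image_subset_iff.2 hb)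

section General

variable {E H M : Type*} [NormedAddCommGroup E] [NormedSpace ℝ E] [TopologicalSpace H]
  {I : ModelWithCorners ℝ E H} [TopologicalSpace M] [ChartedSpace H M] [IsManifold I ∞ M]
  {J : M → (ℝ × E) →L[ℝ] (ℝ × E)}

/-- The integral over a finite cover bounds the energy. -/
theorem PuncturedCurve.energy_le_sum (C : PuncturedCurve I J) {om : ℝ × M → ℝ × E → ℝ × E → ℝ}
    {ι : Type*} [Fintype ι] (ψ : ι → ℝ × ℝ → C.S) (A O : ι → Set (ℝ × ℝ))
    (hA : ∀ i, MeasurableSet (A i)) (hO : ∀ i, IsOpen (O i)) (hAO : ∀ i, A i ⊆ O i)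
    (hψ : ∀ i, ContMDiffOn 𝓘₂ (𝓡 2) 1 (ψ i) (O i))
    (hcov : ∀ z, ∃ i, z ∈ ψ i '' A i) {B : ι → ℝ≥0∞}
    (hB : ∀ i, ∫⁻ p in A i, ENNReal.ofReal |om (C.u (ψ i p))
      (md 𝓘₂ ((𝓘₁).prod I) (fun q => C.u (ψ i q)) p (1, 0))
      (md 𝓘₂ ((𝓘₁).prod I) (fun q => C.u (ψ i q)) p (0, 1))| ≤ B i) :
    C.energy om ≤ ∑ i, B i := by
  classical
  obtain ⟨f, hf⟩ : ∃ f : ι → ℕ, Injective f :=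
    ⟨fun i => (Fintype.equivFin ι i : ℕ), fun i i' h =>
      (Fintype.equivFin ι).injective (Fin.ext h)⟩
  have : Nonempty C.S := inferInstance
  let c : ℕ → ℝ × ℝ → C.S := fun _ _ => Classical.arbitrary C.S
  have hψ' : ∀ i, extend f ψ c (f i) = ψ i := hf.extend_apply _ _
  have hA' : ∀ i, extend f A (fun _ => ∅) (f i) = A i := hf.extend_apply _ _
  have hA0 : ∀ m, (¬∃ i, f i = m) → extend f A (fun _ => ∅) m = ∅ := fun m hm =>
    Function.extend_apply' _ _ _ hm
  refine (iInf₂_le_of_le (extend f ψ c) (extend f A fun _ => ∅)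
    (iInf_le_of_le ⟨fun m => ?_, fun m => ?_, ?_⟩ ?_))
  · by_cases hm : ∃ i, f i = m
    · obtain ⟨i, rfl⟩ := hm
      rw [hA']; exact hA i
    · rw [hA0 m hm]; exact MeasurableSet.empty
  · by_cases hm : ∃ i, f i = m
    · obtain ⟨i, rfl⟩ := hm
      rw [hA', hψ']
      exact ⟨O i, hO i, hAO i, hψ i⟩
    · rw [hA0 m hm]
      exact ⟨∅, isOpen_empty, subset_rfl, fun p hp => hp.elim⟩
  · refine eq_univ_of_forall fun z => ?_
    obtain ⟨i, hi⟩ := hcov z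
    refine mem_iUnion.2 ⟨f i, ?_⟩
    rw [hA', hψ']
    exact hi
  · rw [← hf.tsum_eq (f := fun m => ∫⁻ p in extend f A (fun _ => ∅) m, ENNReal.ofReal
      |om (C.u (extend f ψ c m p))
        (mfderiv 𝓘₂ ((𝓘₁).prod I) (fun q => C.u (extend f ψ c m q)) p
          ((1, 0) : ℝ × ℝ))
        (mfderiv 𝓘₂ ((𝓘₁).prod I) (fun q => C.u (extend f ψ c m q)) p
          ((0, 1) : ℝ × ℝ))|), tsum_fintype]
    · refine Finset.sum_le_sum fun i _ => ?_
      rw [hA', hψ']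
      exact hB i
    · intro m hm
      by_contra h
      refine hm ?_
      show ∫⁻ p in _, _ = 0
      exact setLIntegral_measure_zero _ _
        ((congrArg volume (hA0 m fun ⟨i, hi⟩ => h ⟨i, hi⟩)).trans measure_empty)

/-- A smooth 2-form on a compact surface has finite integrals over the pieces of a finite atlas. -/
theorem exists_finite_cover_lintegral {S : Type*} [TopologicalSpace S] [ChartedSpace ES S]
    [IsManifold (𝓡 2) ∞ S] [CompactSpace S] {lam : S → ES →L[ℝ] ℝ} (hlam : SmoothForm (𝓡 2) lam) :
    ∃ (T : Finset S) (K : S → Set (ℝ × ℝ)) (ψ : S → ℝ × ℝ → S) (O : S → Set (ℝ × ℝ)) (B : ℝ≥0),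
      (∀ x, IsClosed (K x) ∧ IsOpen (O x) ∧ K x ⊆ O x) ∧
      (∀ x, ContMDiffOn 𝓘₂ (𝓡 2) ∞ (ψ x) (O x)) ∧
      (∀ z, ∃ x ∈ T, z ∈ ψ x '' K x) ∧
      ∀ x ∈ T, ∫⁻ p in K x, ENNReal.ofReal |dForm (𝓡 2) lam (ψ x p)
        (md 𝓘₂ (𝓡 2) (ψ x) p (1, 0)) (md 𝓘₂ (𝓡 2) (ψ x) p (0, 1))| ≤ B := by
  let A : (ℝ × ℝ) ≃L[ℝ] ES := ContinuousLinearEquiv.ofFinrankEq (by simp)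
  let O : S → Set (ℝ × ℝ) := fun x => A ⁻¹' (extChartAt (𝓡 2) x).target
  let ψ : S → ℝ × ℝ → S := fun x p => (extChartAt (𝓡 2) x).symm (A p)
  have hO : ∀ x, IsOpen (O x) := fun x => (isOpen_extChartAt_target x).preimage A.continuous
  have hψ : ∀ x, ∀ p ∈ O x, ContMDiffAt 𝓘₂ (𝓡 2) ∞ (ψ x) p := fun x p hp =>
    ContMDiffAt.comp p (f := A) (contMDiffAt_extChartAt_symm hp) A.contDiff.contMDiff.contMDiffAt
  have hK : ∀ x, ∃ K, IsCompact K ∧ K ⊆ O x ∧ ψ x '' K ∈ 𝓝 x := by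
    intro x
    have h0 : A.symm (extChartAt (𝓡 2) x x) ∈ O x := by
      show A (A.symm (extChartAt (𝓡 2) x x)) ∈ (extChartAt (𝓡 2) x).target
      rw [A.apply_symm_apply]
      exact mem_extChartAt_target x
    obtain ⟨K, hK, h1, h2⟩ := exists_compact_subset (hO x) h0
    refine ⟨K, hK, h2, ?_⟩
    have h3 : (fun z => A.symm (extChartAt (𝓡 2) x z)) ⁻¹' K ∈ 𝓝 x :=
      (A.symm.continuous.continuousAt.comp (continuousAt_extChartAt x)).preimage_mem_nhds
        (mem_interior_iff_mem_nhds.1 h1)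
    filter_upwards [h3, extChartAt_source_mem_nhds (I := 𝓡 2) x] with z hz hz'
    refine ⟨_, hz, ?_⟩
    show (extChartAt (𝓡 2) x).symm (A (A.symm _)) = z
    rw [A.apply_symm_apply, (extChartAt (𝓡 2) x).left_inv hz']
  choose K hKc hKO hKn using hK
  obtain ⟨T, -, hT⟩ := isCompact_univ.elim_nhds_subcover (fun x => ψ x '' K x) fun x _ => hKn x
  have hfin : ∀ x, ∫⁻ p in K x, ENNReal.ofReal |dForm (𝓡 2) lam (ψ x p)
        (md 𝓘₂ (𝓡 2) (ψ x) p (1, 0)) (md 𝓘₂ (𝓡 2) (ψ x) p (0, 1))| < ⊤ := by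
    intro x
    let N : ES → ES →L[ℝ] ES →L[ℝ] ℝ := fderiv ℝ (formInChart (𝓡 2) lam x)
    have hN : ContinuousOn N (extChartAt (𝓡 2) x).target :=
      (hlam.contDiffOn_formInChart x).continuousOn_fderiv_of_isOpen (isOpen_extChartAt_target x)
        (by simp)
    have hf : ContinuousOn (fun p => N (A p) (A (1, 0)) (A (0, 1)) - N (A p) (A (0, 1)) (A (1, 0)))
        (K x) := by
      have h1 : ContinuousOn (fun p => N (A p)) (K x) :=
        hN.comp A.continuous.continuousOn (hKO x)
      exact ((h1.clm_apply continuousOn_const).clm_apply continuousOn_const).sub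
        ((h1.clm_apply continuousOn_const).clm_apply continuousOn_const)
    obtain ⟨b, hb⟩ := (hKc x).exists_bound_of_continuousOn hf
    refine (setLIntegral_mono (g := fun _ => ENNReal.ofReal b) measurable_const fun p hp => ?_).trans_lt
      (by rw [setLIntegral_const]; exact ENNReal.mul_lt_top ENNReal.ofReal_lt_top (hKc x).measure_lt_top)
    refine ENNReal.ofReal_le_ofReal (le_trans (le_of_eq ?_) (hb p hp))
    rw [Real.norm_eq_abs]
    congr 1
    have hp' : A p ∈ (extChartAt (𝓡 2) x).target := hKO x hp
    have hq : ψ x p ∈ (chartAt ES x).source := by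
      have := (extChartAt (𝓡 2) x).map_target hp'
      rwa [extChartAt_source] at this
    have hr : extChartAt (𝓡 2) x (ψ x p) = A p := (extChartAt (𝓡 2) x).right_inv hp'
    have hm : ∀ v, md (𝓡 2) 𝓘(ℝ, ES) (extChartAt (𝓡 2) x) (ψ x p)
        (md 𝓘₂ (𝓡 2) (ψ x) p v) = A v := by
      intro v
      have h1 := md_comp (I := 𝓘₂) (I' := 𝓡 2) (I₂ := 𝓘(ℝ, ES))
        (g := extChartAt (𝓡 2) x) (f := ψ x) (x := p) (mdifferentiableAt_extChartAt hq)
        ((hψ x p hp').mdifferentiableAt (by simp))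
      rw [← ContinuousLinearMap.comp_apply, ← h1]
      have h2 : (fun q => extChartAt (𝓡 2) x (ψ x q)) =ᶠ[𝓝 p] A := by
        filter_upwards [(hO x).mem_nhds hp'] with q hq
        exact (extChartAt (𝓡 2) x).right_inv hq
      rw [md_congr h2, md_eq_fderiv, A.fderiv]
      rfl
    rw [dForm_inChart hlam hq, hm, hm, hr]
  refine ⟨T, K, ψ, O, ∑ x ∈ T, (∫⁻ p in K x, ENNReal.ofReal |dForm (𝓡 2) lam (ψ x p)
        (md 𝓘₂ (𝓡 2) (ψ x) p (1, 0)) (md 𝓘₂ (𝓡 2) (ψ x) p (0, 1))|).toNNReal,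
    fun x => ⟨(hKc x).isClosed, hO x, hKO x⟩, fun x p hp => (hψ x p hp).contMDiffWithinAt, fun z => ?_,
    fun x hx => ?_⟩
  · obtain ⟨x, hx, hz⟩ := mem_iUnion₂.1 (hT (mem_univ z))
    exact ⟨x, hx, hz⟩
  · refine (ENNReal.coe_toNNReal (hfin x).ne).symm.le.trans (ENNReal.coe_le_coe.2 ?_)
    exact Finset.single_le_sum (f := fun x => (∫⁻ p in K x, ENNReal.ofReal |dForm (𝓡 2) lam (ψ x p)
        (md 𝓘₂ (𝓡 2) (ψ x) p (1, 0)) (md 𝓘₂ (𝓡 2) (ψ x) p (0, 1))|).toNNReal)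
      (fun _ _ => zero_le) hx

end General

namespace ModelData

/-- The derivative of `cutHeight` in the direction of `flowField`. -/
def cutAscent (D : ModelData n Y S k g) (p : Y × ℝ) : ℝ :=
  md (IYR n) 𝓘₁ D.cutHeight p (D.flowField p)

theorem cutAscent_nonneg (hn : 1 ≤ n) (p : Y × ℝ) : 0 ≤ D.cutAscent p := by
  have hδ := D.δ_pos
  have hδ' := D.δ'_gt
  by_cases h : |p.2| < 1 - D.δ / 3
  · have h1 : D.cutHeight =ᶠ[𝓝 p] D.height := by
      filter_upwards [continuous_snd.abs.continuousAt.eventually_lt_const h] with q hq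
      rw [D.cutHeight_spine hq.le, D.height_spine hq.le]
    rw [cutAscent, md_congr h1]
    exact D.ascent_nonneg p
  · obtain ⟨e, he⟩ := exists_sgn p.2
    have h0 : 1 - D.δ / 3 ≤ sgn e * p.2 := he ▸ not_lt.1 h
    have hβ : HasDerivAt (fun τ => D.β (D.G τ)) (deriv D.β (D.G p.2) * deriv D.G p.2) p.2 :=
      (D.β_smooth.differentiable (by simp) _).hasDerivAt.comp p.2
        (D.G_smooth.differentiable (by simp) _).hasDerivAt
    have hs : HasMFDerivAt (IYR n) 𝓘₁ (fun q : Y × ℝ => q.2) p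
        (snd ℝ (EY n) ℝ) := hasMFDerivAt_snd p
    have h2 : HasMFDerivAt (IYR n) 𝓘₁ (fun q : Y × ℝ => D.β (D.G q.2)) p _ :=
      HasMFDerivAt.comp p (f := fun q : Y × ℝ => q.2) hβ.hasFDerivAt.hasMFDerivAt hs
    have h3 := h2.mul (D.mdifferentiableAt_height p).hasMFDerivAt
    have h4 : md (IYR n) 𝓘₁ D.cutHeight p = _ := h3.mfderiv
    have h5 : D.cutAscent p = D.β (D.G p.2) * D.ascent p
        + D.height p * ((deriv D.β (D.G p.2) * deriv D.G p.2) * (D.flowField p).2) := by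
      rw [cutAscent, h4]
      show D.β (D.G p.2) * D.ascent p + D.height p *
        ((D.flowField p).2 * (deriv D.β (D.G p.2) * deriv D.G p.2)) = _
      ring
    have h6 := D.sgn_mul_flowField_neg (p := p) hn (e := e) (by linarith)
    have h7 := D.sgn_mul_deriv_G_nonpos (e := e) (τ := p.2) (by linarith [D.δ_lt])
    have h8 : (sgn e * deriv D.G p.2) * (sgn e * (D.flowField p).2)
        = deriv D.G p.2 * (D.flowField p).2 := by
      rw [mul_mul_mul_comm, sgn_mul_self, one_mul]
    rw [h5, mul_assoc, ← h8]
    exact add_nonneg (mul_nonneg (D.β_nonneg _) (D.ascent_nonneg p)) (mul_nonneg (D.height_pos p).le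
      (mul_nonneg (D.β_mono _) (mul_nonneg_of_nonpos_of_nonpos h7 h6.le)))

theorem cutHeight_nonneg (p : Y × ℝ) : 0 ≤ D.cutHeight p :=
  mul_nonneg (D.β_nonneg _) (D.height_pos p).le

theorem cutHeight_le (p : Y × ℝ) : D.cutHeight p ≤ D.height p :=
  mul_le_of_le_one_left (D.height_pos p).le (D.β_le_one _)

theorem exists_height_le [CompactSpace Y] (D : ModelData n Y S k g) :
    ∃ M : ℝ≥0, ∀ p : Y × ℝ, |p.2| < 1 + D.δ → D.height p ≤ M := by
  obtain ⟨M, hM⟩ := (isCompact_strip (Y := Y) (1 + D.δ)).exists_bound_of_continuousOn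
    D.contMDiff_height.continuous.continuousOn
  refine ⟨M.toNNReal, fun p hp => ?_⟩
  exact (le_abs_self _).trans ((hM p hp.le).trans (Real.le_coe_toNNReal M))

namespace IsLift

variable {I : Set ℝ} {b θ : ℝ → ℝ} {γ : ℝ → Y × ℝ} (h : IsLift D I b θ γ)
include h

/-- The integrand of the `Ω`-energy of a swept out cylinder is the derivative of the height. -/
theorem om_sweep (i : Fin k) {p : ℝ × ℝ} (hp : p.1 ∈ I) :
    D.Om (D.sweep i b θ γ p).2
      (md 𝓘₂ (𝓘W n) (D.sweep i b θ γ) p (1, 0)).2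
      (md 𝓘₂ (𝓘W n) (D.sweep i b θ γ) p (0, 1)).2
      = D.ascent (γ p.1) := by
  rw [h.md_sweep_s i hp, h.md_sweep_t i hp]
  have h1 := D.Om_coord i (q := (γ p.1, θ p.1 + p.2)) (h.orbit.mem _ hp)
    (D.flowField (γ p.1), D.angle (γ p.1)) (0, 1)
  refine h1.trans ?_
  simp [ascent]

theorem dLam_sweep (i : Fin k) {p : ℝ × ℝ} (hp : p.1 ∈ I) :
    dForm (IYS n) D.Lam (D.sweep i b θ γ p).2
      (md 𝓘₂ (𝓘W n) (D.sweep i b θ γ) p (1, 0)).2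
      (md 𝓘₂ (𝓘W n) (D.sweep i b θ γ) p (0, 1)).2
      = D.cutAscent (γ p.1) := by
  rw [h.md_sweep_s i hp, h.md_sweep_t i hp]
  have h1 := D.dLam_coord i (q := (γ p.1, θ p.1 + p.2)) (h.orbit.mem _ hp)
    (D.flowField (γ p.1), D.angle (γ p.1)) (0, 1)
  refine h1.trans ?_
  simp [cutAscent]

theorem sympForm_sweep (i : Fin k) (ph : ℝ → ℝ) {p : ℝ × ℝ} (hp : p.1 ∈ I) :
    sympForm (IYS n) D.Lam D.Om ph (D.sweep i b θ γ p)
      (md 𝓘₂ (𝓘W n) (D.sweep i b θ γ) p (1, 0))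
      (md 𝓘₂ (𝓘W n) (D.sweep i b θ γ) p (0, 1))
      = deriv ph (b p.1) * (D.cutHeight (γ p.1) * D.cutHeight (γ p.1))
        + ph (b p.1) * D.cutAscent (γ p.1) + D.ascent (γ p.1) := by
  rw [sympForm, h.om_sweep i hp, h.dLam_sweep i hp, h.md_sweep_s i hp, h.md_sweep_t i hp]
  have h1 := D.Lam_coord i (q := (γ p.1, θ p.1 + p.2)) (h.orbit.mem _ hp) (0, 1)
  have h2 : D.Lam (D.sweep i b θ γ p).2 (D.dcoord i ((γ p.1).2, θ p.1 + p.2) (0, 1))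
      = D.cutHeight (γ p.1) := by
    refine h1.trans ?_
    simp [cylForm]
  dsimp only
  rw [h2, zero_mul, sub_zero]
  rfl

theorem lintegral_ascent_le (hI : IsOpen I) (hc : Convex ℝ I) {M : ℝ≥0}
    (hM : ∀ p : Y × ℝ, |p.2| < 1 + D.δ → D.height p ≤ M) :
    ∫⁻ s in I, ENNReal.ofReal (D.ascent (γ s)) ≤ M := by
  have h1 := lintegral_deriv_le hI hc (a := 0) (b := M) (f' := fun s => D.ascent (γ s))
    (fun s hs => h.orbit.hasDerivAt_comp hs (D.mdifferentiableAt_height _))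
    (fun s _ => D.ascent_nonneg (γ s))
    fun s hs => ⟨(D.height_pos _).le, hM _ (h.orbit.mem s hs)⟩
  simpa using h1

theorem lintegral_cutAscent_le (hn : 1 ≤ n) (hI : IsOpen I) (hc : Convex ℝ I) {M : ℝ≥0}
    (hM : ∀ p : Y × ℝ, |p.2| < 1 + D.δ → D.height p ≤ M) :
    ∫⁻ s in I, ENNReal.ofReal (D.cutAscent (γ s)) ≤ M := by
  have h1 := lintegral_deriv_le hI hc (a := 0) (b := M) (f' := fun s => D.cutAscent (γ s))
    (fun s hs => h.orbit.hasDerivAt_comp hs (D.mdifferentiableAt_cutHeight _))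
    (fun s _ => cutAscent_nonneg hn (γ s))
    fun s hs => ⟨cutHeight_nonneg _, (cutHeight_le _).trans (hM _ (h.orbit.mem s hs))⟩
  simpa using h1

theorem lintegral_profile_le (hI : IsOpen I) (hc : Convex ℝ I) {e₀ : ℝ≥0} {ph : ℝ → ℝ}
    (hph : IsProfile e₀ ph) :
    ∫⁻ s in I, ENNReal.ofReal (deriv ph (b s) * D.cutHeight (γ s)) ≤ 2 * e₀ := by
  have h1 := lintegral_deriv_le hI hc (a := -e₀) (b := e₀) (f := fun s => ph (b s))
    (fun s hs => ((hph.1.differentiable (by simp) (b s)).hasDerivAt).comp s (h.action s hs))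
    (fun s _ => mul_nonneg (hph.2.2 _).le (cutHeight_nonneg _))
    fun s hs => ⟨(hph.2.1 _).1.le, (hph.2.1 _).2.le⟩
  refine h1.trans (le_of_eq ?_)
  rw [sub_neg_eq_add, ← two_mul, ENNReal.ofReal_mul (by norm_num)]
  simp

end IsLift


theorem lt_tau_of_mem_outer {e : Bool} {c : ℝ} (hc : c < 1 + D.δ) {z : S} (hz : z ∈ D.outer e c) :
    max 0 c < sgn e * D.tau z := by
  have hδ := D.δ_pos
  rcases D.mem_outer hz with h | ⟨i, p, hp, hp', rfl⟩
  · have h1 : ¬∃ τ : ℝ, |τ| < 1 + D.δ ∧ ∃ (i : Fin k) (θ : ℝ), D.c i (τ, θ) = z := by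
      rintro ⟨τ, hτ, i, θ, rfl⟩
      exact h.2 (D.c_mem_cyl (p := (τ, θ)) i hτ)
    rw [tau, dif_neg h1]
    have h2 := D.U_disj
    rw [Set.disjoint_left] at h2
    cases e
    · rw [if_neg (show ¬z ∈ D.U true from fun h3 => h2 h3 h.1)]
      simp only [sgn]
      norm_num
      constructor <;> linarith
    · rw [if_pos (show z ∈ D.U true from h.1)]
      simp only [sgn]
      norm_num
      constructor <;> linarith
  · rwa [D.tau_c i hp']

theorem forms_outer {e : Bool} (y : Y) {z : S} (hz : z ∈ D.outer e (1 + 8 * D.δ / 9)) :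
    D.Lam (y, z) = D.K • (D.al (sgn e) y).comp (fst ℝ (EY n) ES) ∧
    D.primitive (y, z) = D.K • (D.al (sgn e) y).comp (fst ℝ (EY n) ES)
      + (D.lam z).comp (snd ℝ (EY n) ES) := by
  have hδ := D.δ_pos
  have h1 := (le_max_right _ _).trans_lt (D.lt_tau_of_mem_outer (by linarith) hz)
  obtain ⟨h2, h3⟩ := D.FG_out e (D.tau z) (by linarith)
  have h4 : D.β (D.G (D.tau z)) = 0 := D.β_zero _ (by rw [h3]; linarith)
  have h5 : D.r z = sgn e := h2
  have h6 : D.σ (sgn e) = D.K := D.σ_out _ (abs_sgn e).ge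
  constructor
  · simp [Lam, h5, h6, h4, D.H_end]
  · simp [primitive, h5, h6, D.H_end]

/-- On the tangent spaces of the pages, `dΛ` vanishes and `Ω` is the area form `d lam`. -/
theorem dForms_core [T2Space S] {e : Bool} (y : Y) {z : S} (hz : z ∈ D.core e) (w w' : ES) :
    dForm (IYS n) D.Lam (y, z) (0, w) (0, w') = 0 ∧
    D.Om (y, z) (0, w) (0, w') = dForm (𝓡 2) D.lam z w w' := by
  have hδ := D.δ_pos
  have hc : 1 + 8 * D.δ / 9 < 1 + D.δ := by linarith
  have hO : (fun q : Y × S => q.2) ⁻¹' D.outer e (1 + 8 * D.δ / 9) ∈ 𝓝 (y, z) :=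
    continuous_snd.continuousAt.preimage_mem_nhds (D.outer_mem_nhds hc hz)
  have hz' := D.core_subset_outer e hc hz
  have hι : ContMDiffAt (𝓡 2) (IYS n) ∞ (fun x : S => (y, x)) z :=
    contMDiffAt_const.prodMk contMDiffAt_id
  have hmd : ∀ (x : S) (v : ES), md (𝓡 2) (IYS n) (fun x : S => (y, x)) x v = (0, v) := by
    intro x v
    have h1 : md (𝓡 2) (IYS n) (fun x : S => (y, x)) x
        = (md (𝓡 2) (𝓡 (2 * n - 1)) (fun _ : S => y) x).prod (md (𝓡 2) (𝓡 2) (fun x : S => x) x) :=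
      md_prodMk mdifferentiableAt_const mdifferentiableAt_id
    rw [h1, md_id, md_const]
    rfl
  have hA : DiffFormAt (IYS n) (fun q : Y × S =>
      D.K • (D.al (sgn e) q.1).comp (fst ℝ (EY n) ES)) (y, z) := by
    have h1 := (D.diffFormAt_al (sgn e) y).pullForm (f := fun q : Y × S => q.1) (x := (y, z))
      (I := IYS n) contMDiffAt_fst
    refine (DiffFormAt.smul (f := fun _ => D.K) h1 mdifferentiableAt_const).congr
      (.of_forall fun q => ?_)
    dsimp only
    rw [pullForm, md_fst]
  have hB : DiffFormAt (IYS n) (fun q : Y × S =>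
      (D.lam q.2).comp (snd ℝ (EY n) ES)) (y, z) := by
    have h1 := (D.lam_smooth.diffFormAt z).pullForm (f := fun q : Y × S => q.2) (x := (y, z))
      (I := IYS n) contMDiffAt_snd
    refine h1.congr (.of_forall fun q => ?_)
    rw [pullForm, md_snd]
  have hL : DiffFormAt (IYS n) D.Lam (y, z) := hA.congr (by
    filter_upwards [hO] with q hq
    exact (forms_outer q.1 hq).1.symm)
  have hP : DiffFormAt (IYS n) D.primitive (y, z) := (hA.add hB).congr (by
    filter_upwards [hO] with q hq
    exact (forms_outer q.1 hq).2.symm)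
  have hL' : pullForm (𝓡 2) (IYS n) (fun x : S => (y, x)) D.Lam =ᶠ[𝓝 z] fun _ => 0 := by
    filter_upwards [D.outer_mem_nhds hc hz] with x hx
    ext1 v
    refine (congrArg (D.Lam (y, x)) (hmd x v)).trans ?_
    rw [(forms_outer y hx).1]
    simp
  have hP' : pullForm (𝓡 2) (IYS n) (fun x : S => (y, x)) D.primitive =ᶠ[𝓝 z] D.lam := by
    filter_upwards [D.outer_mem_nhds hc hz] with x hx
    ext1 v
    refine (congrArg (D.primitive (y, x)) (hmd x v)).trans ?_
    rw [(forms_outer y hx).2]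
    simp
  have h1 := dForm_pullForm (f := fun x : S => (y, x)) hL hι w w'
  have h2 := dForm_pullForm (f := fun x : S => (y, x)) hP hι w w'
  rw [hmd, hmd, dForm_congr hL'] at h1
  rw [hmd, hmd, dForm_congr hP'] at h2
  refine ⟨h1.symm.trans ?_, h2.symm⟩
  have h3 : formInChart (𝓡 2) (fun _ : S => (0 : ES →L[ℝ] ℝ)) z = fun _ => 0 := by
    ext x v; simp [formInChart_eq]
  rw [dForm_apply, h3]
  simp

theorem sympForm_core [T2Space S] {e : Bool} {y : Y} {z : S} (hz : z ∈ D.core e) (a : ℝ)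
    (ph : ℝ → ℝ) (w w' : ES) :
    sympForm (IYS n) D.Lam D.Om ph (a, (y, z)) (0, (0, w)) (0, (0, w'))
      = dForm (𝓡 2) D.lam z w w' := by
  have h1 := dForms_core (D := D) y hz w w'
  rw [sympForm]
  dsimp only
  rw [h1.1, h1.2]
  ring

namespace LeafModel

variable {L : LeafModel D J}

/-- The derivative of the curve in the coordinates of a cylinder. -/
theorem md_curve_P [Nonempty L.domO] (j : L.κ) {p : ℝ × ℝ} (hp : p ∈ L.strip) :
    L.u (openRetract L.domO (L.P j p)).1 = D.sweep (L.idx j) L.b L.θ L.γ p ∧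
    md 𝓘₂ (𝓘W n) (fun q => L.u (openRetract L.domO (L.P j q)).1) p
      = md 𝓘₂ (𝓘W n) (D.sweep (L.idx j) L.b L.θ L.γ) p := by
  have h1 : (fun q => L.u (openRetract L.domO (L.P j q)).1)
      =ᶠ[𝓝 p] D.sweep (L.idx j) L.b L.θ L.γ := by
    filter_upwards [L.isOpen_strip.mem_nhds hp] with q hq
    exact curve_u_retract j hq
  exact ⟨h1.self_of_nhds, md_congr h1⟩

/-- The derivative of the curve over the page. -/
theorem md_curve_O [Nonempty L.domO] {ψ : ℝ × ℝ → S} {p : ℝ × ℝ}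
    (hψ : ContMDiffAt 𝓘₂ (𝓡 2) ∞ ψ p) (hp : ψ p ∈ L.O) :
    L.u (openRetract L.domO (ψ p)).1 = (L.a, (L.y, ψ p)) ∧
    ∀ x, md 𝓘₂ (𝓘W n) (fun q => L.u (openRetract L.domO (ψ q)).1) p x
      = (0, (0, md 𝓘₂ (𝓡 2) ψ p x)) := by
  have h1 : (fun q => L.u (openRetract L.domO (ψ q)).1) =ᶠ[𝓝 p] fun q => (L.a, (L.y, ψ q)) := by
    filter_upwards [hψ.continuousAt.eventually (L.isOpen_O.mem_nhds hp)] with q hq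
    rw [openRetract_val L.domO (L.O_sub_dom hq), L.u_O hq]
  have h2 := hψ.mdifferentiableAt (by simp)
  refine ⟨h1.self_of_nhds, fun x => ?_⟩
  rw [md_congr h1, md_prodMk mdifferentiableAt_const (mdifferentiableAt_const.prodMk h2), md_const,
    md_prodMk mdifferentiableAt_const h2, md_const]
  rfl

/-- The energy of a curve is estimated separately on the cylinders and on the page. -/
theorem energy_curve_le [T2Space S] [CompactSpace S] (hJ : D.IsModelJ J)
    (hn : 1 ≤ n) :
    ∃ B₀ : ℝ≥0, ∀ (L : LeafModel D J) (Q : Punctures L), IsClosed L.N →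
      ∀ {om : ℝ × (Y × S) → ℝ × (EY n × ES) → ℝ × (EY n × ES) → ℝ},
      (∀ z ∈ L.N, ∀ w w', om (L.a, (L.y, z)) (0, (0, w)) (0, (0, w')) = dForm (𝓡 2) D.lam z w w') →
      ∀ {f : ℝ → ℝ≥0∞} {B₁ : ℝ≥0},
      (∀ j, ∀ p ∈ L.strip, ENNReal.ofReal |om (D.sweep (L.idx j) L.b L.θ L.γ p)
        (md 𝓘₂ (𝓘W n) (D.sweep (L.idx j) L.b L.θ L.γ) p (1, 0))
        (md 𝓘₂ (𝓘W n) (D.sweep (L.idx j) L.b L.θ L.γ) p (0, 1))|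
          ≤ f p.1) →
      ∫⁻ s in L.I, f s ≤ B₁ →
      (curve hJ hn Q).energy om ≤ k * B₁ + B₀ := by
  classical
  obtain ⟨T, K, ψ, O, B, hK, hψ, hcov, hB⟩ := exists_finite_cover_lintegral D.lam_smooth
  refine ⟨T.card * B, fun L Q hN om hom f B₁ hf hfB => ?_⟩
  have hne : Nonempty L.domO := by
    obtain ⟨z, hz⟩ := Q.conn.nonempty
    exact ⟨⟨z, hz⟩⟩
  have : Finite L.κ := Finite.of_injective _ L.idx_inj
  have : Fintype L.κ := Fintype.ofFinite _
  have hcard : Fintype.card L.κ ≤ k := by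
    simpa using Fintype.card_le_of_injective _ L.idx_inj
  -- the domain is covered by the cylinders and by the atlas of `S`, restricted to the page
  let Ψ : L.κ ⊕ T → ℝ × ℝ → L.domO := Sum.elim (fun j p => openRetract L.domO (L.P j p))
    fun x p => openRetract L.domO (ψ x p)
  let A : L.κ ⊕ T → Set (ℝ × ℝ) := Sum.elim (fun _ => unitStrip L.I) fun x => K x ∩ ψ x ⁻¹' L.N
  let O' : L.κ ⊕ T → Set (ℝ × ℝ) := Sum.elim (fun _ => L.strip) fun x => O x ∩ ψ x ⁻¹' L.O
  have hψx : ∀ x, ∀ p ∈ O x, ContMDiffAt 𝓘₂ (𝓡 2) ∞ (ψ x) p := fun x p hp =>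
    (hψ x).contMDiffAt ((hK x).2.1.mem_nhds hp)
  refine ((curve hJ hn Q).energy_le_sum Ψ A O' ?_ ?_ ?_ ?_ ?_
    (B := Sum.elim (fun _ => (B₁ : ℝ≥0∞)) fun _ => B) ?_).trans ?_
  · rintro (j | x)
    · exact L.isOpen_I.measurableSet.prod measurableSet_Ico
    · exact (((hψ x).continuousOn.mono (hK x).2.2).preimage_isClosed_of_isClosed (hK x).1
        hN).measurableSet
  · rintro (j | x)
    · exact L.isOpen_strip
    · exact (hψ x).continuousOn.isOpen_inter_preimage (hK x).2.1 L.isOpen_O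
  · rintro (j | x)
    · exact fun p hp => hp.1
    · exact inter_subset_inter (hK x).2.2 (preimage_mono L.N_sub)
  · rintro (j | x)
    · exact (isCylEmbedding_openRetract j subset_rfl).smooth.of_le (by simp)
    · intro p hp
      exact ((ContMDiffAt.comp p (f := ψ x) (contMDiffAt_openRetract (I := 𝓡 2) L.domO
        (L.O_sub_dom hp.2)) (hψx x p hp.1)).of_le (by simp)).contMDiffWithinAt
  · rintro ⟨z, hz⟩
    rcases hz with hz | hz
    · obtain ⟨x, hx, p, hp, rfl⟩ := hcov z
      exact ⟨.inr ⟨x, hx⟩, p, ⟨hp, hz⟩, openRetract_apply L.domO ⟨ψ x p, _⟩⟩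
    · obtain ⟨j, p, hp, rfl⟩ := mem_iUnion.1 hz
      refine ⟨.inl j, (p.1, Int.fract p.2), ⟨hp, Int.fract_nonneg _, Int.fract_lt_one _⟩, ?_⟩
      have h1 := (L.P_emb j).periodic_int p.1 (Int.fract p.2) ⌊p.2⌋
      rw [Int.fract_add_floor] at h1
      show openRetract L.domO (L.P j (p.1, Int.fract p.2)) = _
      rw [← h1]
      exact openRetract_apply L.domO ⟨L.P j p, _⟩
  · rintro (j | x)
    · refine (setLIntegral_mono' (L.isOpen_I.measurableSet.prod measurableSet_Ico)
        (fun p hp => ?_)).trans ((lintegral_unitStrip_le (f := f)).trans hfB)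
      obtain ⟨h1, h2⟩ := L.md_curve_P j (p := p) hp.1
      refine le_trans (le_of_eq ?_) (hf j p hp.1)
      rw [← h1, ← h2]
      rfl
    · have hm : MeasurableSet (K x ∩ ψ x ⁻¹' L.N) :=
        (((hψ x).continuousOn.mono (hK x).2.2).preimage_isClosed_of_isClosed (hK x).1
          hN).measurableSet
      refine (setLIntegral_mono' hm (fun p hp => ?_)).trans
        ((lintegral_mono_set inter_subset_left).trans (hB x x.2))
      obtain ⟨h1, h2⟩ := L.md_curve_O (hψx x p ((hK x).2.2 hp.1)) (L.N_sub hp.2)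
      refine le_of_eq ?_
      rw [← hom _ hp.2, ← h1, ← h2, ← h2]
      rfl
  · rw [Fintype.sum_sum_type]
    simp only [Sum.elim_inl, Sum.elim_inr, Finset.sum_const, Finset.card_univ, nsmul_eq_mul,
      Fintype.card_coe]
    push_cast
    gcongr

/-- The energies of all curves have a common bound. -/
theorem exists_energy_bound [T2Space S] [CompactSpace S] [CompactSpace Y] (hJ : D.IsModelJ J)
    (hn : 1 ≤ n) (e₀ : ℝ≥0) : ∃ B : ℝ≥0, ∀ (L : LeafModel D J) (Q : Punctures L), IsClosed L.N →
      Convex ℝ L.I →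
      (curve hJ hn Q).energy (fun w v v' => D.Om w.2 v.2 v'.2) ≤ B ∧
      ∀ ph, IsProfile e₀ ph →
        (curve hJ hn Q).energy (sympForm (IYS n) D.Lam D.Om ph) ≤ B := by
  obtain ⟨B₀, hB₀⟩ := energy_curve_le hJ hn
  obtain ⟨M, hM⟩ := D.exists_height_le
  refine ⟨k * (2 * e₀ * M + e₀ * M + M) + B₀, fun L Q hN hI => ?_⟩
  have hcore : ∀ z ∈ L.N, ∃ e, z ∈ D.core e := fun z hz => by
    rcases D.cyl_or_core z with ⟨i, p, hp, rfl⟩ | h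
    · exact absurd (D.c_mem_cyl i hp) (L.N_off _ hz)
    · exact h
  have h1 := L.lift.lintegral_ascent_le L.isOpen_I hI hM
  have h2 := L.lift.lintegral_cutAscent_le hn L.isOpen_I hI hM
  have hmeas : ∀ {f f' : ℝ → ℝ}, (∀ s ∈ L.I, HasDerivAt f (f' s) s) →
      AEMeasurable (fun s => ENNReal.ofReal (f' s)) (volume.restrict L.I) := fun {f f'} hf =>
    ((measurable_deriv f).ennreal_ofReal.aemeasurable).congr
      ((ae_restrict_mem L.isOpen_I.measurableSet).mono fun s hs => by
      dsimp only; rw [(hf s hs).deriv])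
  have hm1 := hmeas (f' := fun s => D.ascent (L.γ s)) fun s hs =>
    L.lift.orbit.hasDerivAt_comp hs (D.mdifferentiableAt_height _)
  have hm2 := hmeas (f' := fun s => D.cutAscent (L.γ s)) fun s hs =>
    L.lift.orbit.hasDerivAt_comp hs (D.mdifferentiableAt_cutHeight _)
  constructor
  · refine (hB₀ L Q hN (f := fun s => ENNReal.ofReal (D.ascent (L.γ s))) (B₁ := M)
      (fun z hz w w' => ?_) (fun j p hp => ?_) h1).trans ?_
    · obtain ⟨e, he⟩ := hcore z hz
      exact (dForms_core L.y he w w').2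
    · rw [L.lift.om_sweep _ hp, abs_of_nonneg (D.ascent_nonneg _)]
    · push_cast
      gcongr
      exact le_add_self
  · intro ph hph
    have h3 := L.lift.lintegral_profile_le L.isOpen_I hI hph
    have hm3 := hmeas (f' := fun s => deriv ph (L.b s) * D.cutHeight (L.γ s)) fun s hs =>
      ((hph.1.differentiable (by simp) (L.b s)).hasDerivAt).comp s (L.lift.action s hs)
    refine (hB₀ L Q hN (f := fun s =>
      ENNReal.ofReal (deriv ph (L.b s) * D.cutHeight (L.γ s)) * M
        + e₀ * ENNReal.ofReal (D.cutAscent (L.γ s)) + ENNReal.ofReal (D.ascent (L.γ s)))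
      (B₁ := 2 * e₀ * M + e₀ * M + M) (fun z hz w w' => ?_) (fun j p hp => ?_) ?_).trans ?_
    · obtain ⟨e, he⟩ := hcore z hz
      exact sympForm_core he _ _ _ _
    · rw [L.lift.sympForm_sweep _ ph hp]
      have hc := cutHeight_nonneg (D := D) (L.γ p.1)
      have hc' := (cutHeight_le (D := D) (L.γ p.1)).trans (hM _ (L.lift.orbit.mem _ hp))
      have hd := hph.2.2 (L.b p.1)
      have ha := cutAscent_nonneg (D := D) hn (L.γ p.1)
      have hb := D.ascent_nonneg (L.γ p.1)
      have he := abs_lt.2 (hph.2.1 (L.b p.1))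
      have h4 : |deriv ph (L.b p.1) * (D.cutHeight (L.γ p.1) * D.cutHeight (L.γ p.1))
        + ph (L.b p.1) * D.cutAscent (L.γ p.1) + D.ascent (L.γ p.1)|
        ≤ deriv ph (L.b p.1) * D.cutHeight (L.γ p.1) * M + e₀ * D.cutAscent (L.γ p.1)
          + D.ascent (L.γ p.1) := by
        refine (abs_add_three _ _ _).trans ?_
        rw [abs_of_nonneg hb, abs_mul (ph _), abs_of_nonneg ha, ← mul_assoc,
          abs_of_nonneg (mul_nonneg (mul_nonneg hd.le hc) hc)]
        have := mul_nonneg hd.le hc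
        gcongr
      refine (ENNReal.ofReal_le_ofReal h4).trans ?_
      refine ENNReal.ofReal_add_le.trans (add_le_add (ENNReal.ofReal_add_le.trans ?_) le_rfl)
      rw [ENNReal.ofReal_mul (mul_nonneg hd.le hc), ENNReal.ofReal_mul (p := (e₀ : ℝ)) e₀.2]
      simp
    · rw [lintegral_add_left' (by fun_prop), lintegral_add_left' (by fun_prop),
        lintegral_mul_const'' _ hm3, lintegral_const_mul'' _ hm2]
      push_cast
      gcongr
    · push_cast
      exact le_rfl

end LeafModel

end ModelData

/-! ### The cylindrical leaves -/

namespace ModelData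

/-- The model of a cylindrical leaf, with domain an annulus in the `i`-th cylinder. -/
def cylModel (J : Y × S → (ℝ × (EY n × ES)) →L[ℝ] (ℝ × (EY n × ES))) (i : Fin k) {b θ : ℝ → ℝ}
    {γ : ℝ → Y × ℝ} (h : IsLift D univ b θ γ) (hinj : ∀ s s', b s = b s' → γ s = γ s' → s = s') :
    LeafModel D J where
  I := univ
  isOpen_I := isOpen_univ
  b := b
  θ := θ
  γ := γ
  lift := h
  inj s _ s' _ := hinj s s'
  κ := Unit
  idx _ := i
  idx_inj _ _ _ := rfl
  ψ s := Real.arctan s / 2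
  ψ_smooth := (Real.contDiff_arctan.div_const 2).contDiffOn
  ψ_deriv s _ := by
    rw [((Real.hasDerivAt_arctan s).div_const 2).deriv]
    positivity
  ψ_inj s _ s' _ hs := Real.arctan_injective (by simpa using hs)
  ψ_mem s _ := by
    have h1 := Real.arctan_lt_pi_div_two s
    have h2 := Real.neg_pi_div_two_lt_arctan s
    have h3 := Real.pi_le_four
    have := D.δ_pos
    rw [abs_lt]
    constructor <;> linarith
  N := ∅
  O := ∅
  y := (γ 0).1
  a := 0
  isOpen_O := isOpen_empty
  N_sub := subset_rfl
  N_off _ hz := hz.elim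
  O_sub _ hz := hz.elim
  O_slice _ hz := hz.elim
  O_eq _ _ _ _ hz := hz.elim

section

variable {i : Fin k} {b θ : ℝ → ℝ} {γ : ℝ → Y × ℝ} {h : IsLift D univ b θ γ}
  {hinj : ∀ s s', b s = b s' → γ s = γ s' → s = s'}

theorem cylModel_dom : (cylModel J i h hinj).dom = range ((cylModel J i h hinj).P ()) := by
  ext z
  constructor
  · rintro (hz | hz)
    · exact hz.elim
    · obtain ⟨j, p, -, rfl⟩ := mem_iUnion.1 hz
      exact ⟨p, rfl⟩
  · rintro ⟨p, rfl⟩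
    exact (cylModel J i h hinj).P_mem_dom () (mem_univ _)

theorem cylModel_image : (cylModel J i h hinj).u '' (cylModel J i h hinj).dom
    = range (D.sweep i b θ γ) := by
  rw [cylModel_dom, ← range_comp]
  exact congrArg range (funext fun p => (cylModel J i h hinj).u_P () (mem_univ _))

theorem cylModel_continuous : Continuous ((cylModel J i h hinj).P ()) :=
  continuous_iff_continuousAt.2 fun _ =>
    (((cylModel J i h hinj).P_emb ()).contMDiffAt (cylModel J i h hinj).isOpen_strip
      (mem_univ _)).continuousAt

/-- The two punctures of a cylindrical leaf. -/
def cylPunctures (hJ : D.IsModelJ J) (hn : 1 ≤ n) (p : Bool → Y × ℝ) (hp : ∀ e, p e ∈ D.crit)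
    (θ₀ : Bool → ℝ) (hγ : ∀ e, Tendsto γ (endFilter e) (𝓝 (p e)))
    (hθ : ∀ e, Tendsto θ (endFilter e) (𝓝 (θ₀ e)))
    (hb : ∀ e, ∃ l, Tendsto (fun s => b s - D.period (p e) * s) (endFilter e) (𝓝 l)) :
    (cylModel J i h hinj).Punctures where
  ι := Bool
  fin := inferInstance
  pos e := e
  comp _ := ()
  sub _ _ _ := mem_univ _
  ne _ _ hne _ := hne
  K := (cylModel J i h hinj).P () '' (Icc (-1) 1 ×ˢ Icc (0 : ℝ) 1)
  isCompact_K := (isCompact_Icc.prod isCompact_Icc).image cylModel_continuous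
  K_sub := by
    rw [cylModel_dom]
    exact image_subset_range _ _
  cover z hz hK := by
    rw [cylModel_dom] at hz
    obtain ⟨p, rfl⟩ := hz
    by_cases hp : p.1 ∈ Icc (-1 : ℝ) 1
    · refine absurd ⟨(p.1, Int.fract p.2), ⟨hp, Int.fract_nonneg _, (Int.fract_lt_one _).le⟩, ?_⟩ hK
      have h1 := ((cylModel J i h hinj).P_emb ()).periodic_int p.1 (Int.fract p.2) ⌊p.2⌋
      rw [Int.fract_add_floor] at h1
      exact h1.symm
    · rw [mem_Icc, not_and_or, not_le, not_le] at hp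
      rcases hp with hp | hp
      · exact ⟨false, p, hp, rfl⟩
      · exact ⟨true, p, hp, rfl⟩
  conn := by
    rw [cylModel_dom]
    exact isConnected_range cylModel_continuous
  T e := D.period (p e)
  orb e := D.orbit i (p e) (θ₀ e)
  periodic e := (isPeriodicOrbit hJ hn i (hp e) (θ₀ e)).1
  asymp e v hv := by
    obtain ⟨l, hl⟩ := hb e
    exact h.asymptoticTo hJ hn i univ_mem (hp e) (hγ e) (hθ e) hl hv

theorem cylModel_isCylinder [T2Space S] (hJ : D.IsModelJ J) (hn : 1 ≤ n) (p : Bool → Y × ℝ)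
    (hp : ∀ e, p e ∈ D.crit) (θ₀ : Bool → ℝ) (hγ : ∀ e, Tendsto γ (endFilter e) (𝓝 (p e)))
    (hθ : ∀ e, Tendsto θ (endFilter e) (𝓝 (θ₀ e)))
    (hb : ∀ e, ∃ l, Tendsto (fun s => b s - D.period (p e) * s) (endFilter e) (𝓝 l)) :
    (LeafModel.curve hJ hn (cylPunctures (i := i) (h := h) (hinj := hinj) hJ hn p hp θ₀ hγ hθ
      hb)).IsCylinder (D.sweep i b θ γ) (D.period (p false)) (D.orbit i (p false) (θ₀ false))
      (D.period (p true)) (D.orbit i (p true) (θ₀ true)) := by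
  let Q := cylPunctures (i := i) (h := h) (hinj := hinj) hJ hn p hp θ₀ hγ hθ hb
  let L := cylModel J i h hinj
  have hne : Nonempty L.domO := (LeafModel.curve hJ hn Q).conn.toNonempty
  have hasymp : ∀ e : Q.ι, (LeafModel.curve hJ hn Q).AsymptoticAt e (Q.T e) (Q.orb e) := fun e =>
    ⟨Q.periodic e, Q.asymp e _ fun q hq => Q.u_retract e hq⟩
  refine ⟨fun q => openRetract L.domO (L.P () q), true, false,
    LeafModel.isCylEmbedding_openRetract () fun _ _ => mem_univ _,
    LeafModel.isHolCyl_openRetract () fun _ _ => mem_univ _, ?_,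
    fun q => LeafModel.curve_u_retract () (mem_univ _), ?_, rfl, rfl, fun _ _ => rfl, fun _ _ => rfl,
    hasymp true, hasymp false⟩
  · rintro ⟨z, hz⟩
    have hz' : z ∈ L.dom := hz
    rw [cylModel_dom] at hz'
    obtain ⟨q, rfl⟩ := hz'
    exact ⟨q, openRetract_apply L.domO ⟨L.P () q, hz⟩⟩
  · rintro (_ | _)
    · exact .inr rfl
    · exact .inl rfl

end

/-- The leaf property shared by all leaves: the image of a curve tangent to the plane field, with
bounded energy. -/
def IsGoodCurve (D : ModelData n Y S k g) (e₀ B : ℝ≥0) (C : PuncturedCurve (IYS n) J)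
    (L : Set (ℝ × (Y × S))) : Prop :=
  C.Parametrizes L ∧
  (∀ (z : C.S) (v : ES), md (𝓡 2) (𝓘W n) C.u z v ∈ D.planeField J (C.u z)) ∧
  C.energy (fun w v v' => D.Om w.2 v.2 v'.2) ≤ B ∧
  ∀ ph, IsProfile e₀ ph → C.energy (sympForm (IYS n) D.Lam D.Om ph) ≤ B

/-- A bound of the energies of the curves given by models. -/
def IsEnergyBound [T2Space S] (hJ : D.IsModelJ J) (hn : 1 ≤ n) (e₀ B : ℝ≥0) : Prop :=
  ∀ (L : LeafModel D J) (Q : L.Punctures), IsClosed L.N → Convex ℝ L.I →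
    (LeafModel.curve hJ hn Q).energy (fun w v v' => D.Om w.2 v.2 v'.2) ≤ B ∧
    ∀ ph, IsProfile e₀ ph →
      (LeafModel.curve hJ hn Q).energy (sympForm (IYS n) D.Lam D.Om ph) ≤ B

theorem IsEnergyBound.isGoodCurve [T2Space S] {hJ : D.IsModelJ J} {hn : 1 ≤ n} {e₀ B : ℝ≥0}
    (hB : IsEnergyBound hJ hn e₀ B) {L : LeafModel D J} (Q : L.Punctures) (hN : IsClosed L.N)
    (hI : Convex ℝ L.I) : IsGoodCurve D e₀ B (LeafModel.curve hJ hn Q) (L.u '' L.dom) :=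
  ⟨LeafModel.curve_parametrizes hJ hn Q, LeafModel.curve_tangent hJ hn Q, hB L Q hN hI⟩

/-- The trivial cylinder over the critical point `p`. -/
def trivialSet (D : ModelData n Y S k g) (i : Fin k) (p : Y × ℝ) : Set (ℝ × (Y × S)) :=
  range (D.sweep i (fun s => D.period p * s) (fun _ => 0) fun _ => p)

theorem isLift_const (hn : 1 ≤ n) {p : Y × ℝ} (hp : p ∈ D.crit) :
    IsLift D univ (fun s => D.period p * s) (fun _ => 0) fun _ => p := by
  have hδ := D.δ_pos
  have h1 := D.abs_crit_le hn hp
  have h2 := D.δ'_gt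
  refine ⟨IsOrbit.const hn hp univ, fun s _ => ?_, fun s _ => ?_⟩
  · rw [D.cutHeight_spine (by linarith)]
    simpa [period] using (hasDerivAt_id s).const_mul (D.period p)
  · have h0 := (D.isCrit_iff_flowField_eq_zero (by linarith)).1 hp.2
    have h3 : D.angle p = 0 := by simp [angle, h0]
    rw [h3]
    exact hasDerivAt_const s _

theorem exists_trivial_leaf [T2Space S] {hJ : D.IsModelJ J} {hn : 1 ≤ n} {e₀ B : ℝ≥0}
    (hB : IsEnergyBound hJ hn e₀ B) (i : Fin k) {p : Y × ℝ} (hp : p ∈ D.crit) :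
    D.IsTrivialLeaf J i p (D.trivialSet i p) ∧
      ∃ C : PuncturedCurve (IYS n) J, IsGoodCurve D e₀ B C (D.trivialSet i p) := by
  have hT : 0 < D.period p := exp_pos _
  have hlift := isLift_const (D := D) hn hp
  have hinj : ∀ s s', D.period p * s = D.period p * s' → p = p → s = s' := fun s s' h _ =>
    mul_left_cancel₀ hT.ne' h
  have hb : ∀ e : Bool, ∃ l, Tendsto (fun s => D.period p * s - D.period p * s) (endFilter e) (𝓝 l) :=
    fun e => ⟨0, by simpa using tendsto_const_nhds⟩
  let Q := cylPunctures (J := J) (i := i) (h := hlift) (hinj := hinj) hJ hn (fun _ => p)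
    (fun _ => hp) (fun _ => 0) (fun _ => tendsto_const_nhds) (fun _ => tendsto_const_nhds) hb
  have hgood := hB.isGoodCurve Q isClosed_empty convex_univ
  rw [cylModel_image] at hgood
  refine ⟨⟨LeafModel.curve hJ hn Q, hgood.1, ?_⟩, _, hgood⟩
  have h1 := cylModel_isCylinder (J := J) (i := i) (h := hlift) (hinj := hinj) hJ hn (fun _ => p)
    (fun _ => hp) (fun _ => 0) (fun _ => tendsto_const_nhds) (fun _ => tendsto_const_nhds) hb
  have h2 : D.sweep i (fun s => D.period p * s) (fun _ => 0) (fun _ => p)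
      = fun q => (D.period p * q.1, (p.1, D.c i (p.2, q.2))) := by
    funext q
    simp [sweep, coord]
  rw [h2] at h1
  exact h1

theorem IsFlowLine.isOrbit {γ : ℝ → Y × ℝ} (h : D.IsFlowLine γ) : IsOrbit D univ γ := by
  have hδ := D.δ_pos
  refine ⟨fun s _ => ?_, fun s _ => by linarith [(h s).2.2.1]⟩
  obtain ⟨h1, h2, h3, -⟩ := h s
  have h4 := h2.unique (D := D) (by linarith) (D.flowField_spine h3)
  rw [← h4]
  exact MDifferentiableAt.hasVel h1

theorem isFlowLine_of_isOrbit {γ : ℝ → Y × ℝ} (h : IsOrbit D univ γ)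
    (h' : ∀ s, |(γ s).2| ≤ 1 - D.δ) (hc : ∀ s, γ s ∉ D.crit) : D.IsFlowLine γ := fun s => by
  refine ⟨(h.vel s (mem_univ s)).mdifferentiableAt, ?_, h' s, hc s⟩
  have h1 : velocity n γ s = D.flowField (γ s) := (h.vel s (mem_univ s)).md_one
  rw [h1]
  exact D.flowField_spine (h' s)

/-- The equations of flow line cylinders hold along lifted orbits in the spine. -/
theorem IsLift.flowEqs {I : Set ℝ} {b θ : ℝ → ℝ} {γ : ℝ → Y × ℝ} (h : IsLift D I b θ γ) {s : ℝ}
    (hs : s ∈ I) (hs' : |(γ s).2| ≤ 1 - D.δ) : D.FlowEqs b γ θ s := by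
  have hδ := D.δ_pos
  have h1 : velocity n γ s = D.flowField (γ s) := (h.orbit.vel s hs).md_one
  refine ⟨(h.orbit.vel s hs).mdifferentiableAt, ?_, ?_, ?_⟩
  · rw [h1]
    exact D.flowField_spine hs'
  · rw [← D.cutHeight_spine (by linarith)]
    exact h.action s hs
  · rw [h1]
    exact h.rot s hs

/-- Orbits on the whole line lift, with prescribed initial values. -/
theorem IsOrbit.exists_lift {γ : ℝ → Y × ℝ} (h : IsOrbit D univ γ) (hJ : D.IsModelJ J) (hn : 1 ≤ n)
    (i : Fin k) (a₀ : ℝ) : ∃ b θ, IsLift D univ b θ γ ∧ b 0 = a₀ ∧ θ 0 = 0 := by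
  have h1 := h.continuous_cutHeight
  have h2 : Continuous fun s => D.angle (γ s) := continuous_iff_continuousAt.2 fun s =>
    h.continuousAt_angle hJ hn i (mem_univ s)
  refine ⟨fun s => a₀ + ∫ x in (0 : ℝ)..s, D.cutHeight (γ x), fun s => ∫ x in (0 : ℝ)..s, D.angle (γ x),
    ⟨h, fun s _ => ?_, fun s _ => ?_⟩, by simp, by simp⟩
  · exact (h1.integral_hasStrictDerivAt 0 s).hasDerivAt.const_add a₀
  · exact (h2.integral_hasStrictDerivAt 0 s).hasDerivAt

/-- The set swept out by a lifted flow line of the gradient in the `i`-th component of the spine. -/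
def IsFlowSet (D : ModelData n Y S k g) (i : Fin k) (γ : ℝ → Y × ℝ) (a₀ : ℝ)
    (L : Set (ℝ × (Y × S))) : Prop :=
  ∃ b θ, IsLift D univ b θ γ ∧ b 0 = a₀ ∧ θ 0 = 0 ∧ L = range (D.sweep i b θ γ)

/-- A lifted orbit in the spine converges at both ends. -/
theorem IsLift.exists_limits [CompactSpace Y] [T2Space Y] {b θ : ℝ → ℝ} {γ : ℝ → Y × ℝ}
    (h : IsLift D univ b θ γ) (hJ : D.IsModelJ J) (hn : 1 ≤ n) (i : Fin k)
    (hc : ∀ s, |(γ s).2| ≤ 1 - D.δ) (e : Bool) : ∃ p ∈ D.crit, ∃ θ₀ l,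
      Tendsto γ (endFilter e) (𝓝 p) ∧ Tendsto θ (endFilter e) (𝓝 θ₀) ∧
      Tendsto (fun s => b s - D.period p * s) (endFilter e) (𝓝 l) := by
  have hδ := D.δ_pos
  have hδ' := D.δ'_gt
  cases e
  · have htr := h.orbit.isTrajectory_neg (c := 1 - D.δ) (a := 0) (by linarith) fun t _ => hc t
    simp only [zero_sub] at htr
    obtain ⟨p, hp, hlim⟩ := htr.exists_limit hJ hn i
    have hneg : ∀ {f f' : ℝ → ℝ}, (∀ s, HasDerivAt f (f' s) s) → ∀ t : ℝ,
        HasDerivAt (fun s => f (-s)) (-1 * f' (-t)) t := fun hf t => by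
      simpa [Function.comp_def] using (hf (-t)).scomp t (hasDerivAt_neg t)
    obtain ⟨θ₀, hθ⟩ := htr.exists_limit_angle hJ hn i
      (.of_forall (hneg fun s => h.rot s (mem_univ s)))
    obtain ⟨l, hl⟩ := htr.exists_limit_action hJ hn i hp hlim
      (.of_forall (hneg fun s => h.action s (mem_univ s)))
    refine ⟨p, hp, θ₀, l, ?_, ?_, ?_⟩
    · exact (hlim.comp tendsto_neg_atBot_atTop).congr fun t => by simp
    · exact (hθ.comp tendsto_neg_atBot_atTop).congr fun t => by simp
    · exact (hl.comp tendsto_neg_atBot_atTop).congr fun t => by simp; ring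
  · have htr := h.orbit.isTrajectory (c := 1 - D.δ) (a := 0) hn (subset_univ _) (by linarith)
      (by linarith) (hc 0)
    simp only [add_zero] at htr
    obtain ⟨p, hp, hlim⟩ := htr.exists_limit hJ hn i
    obtain ⟨θ₀, hθ⟩ := htr.exists_limit_angle hJ hn i (θ := θ)
      (.of_forall fun s => by simpa using h.rot s (mem_univ s))
    obtain ⟨l, hl⟩ := htr.exists_limit_action hJ hn i hp hlim (b := b)
      (.of_forall fun s => by simpa using h.action s (mem_univ s))
    exact ⟨p, hp, θ₀, l, hlim, hθ, hl.congr fun t => by simp⟩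

theorem exists_flow_leaf [CompactSpace Y] [T2Space Y] [T2Space S] {hJ : D.IsModelJ J} {hn : 1 ≤ n}
    {e₀ B : ℝ≥0} (hB : IsEnergyBound hJ hn e₀ B) {i : Fin k} {γ : ℝ → Y × ℝ} {a₀ : ℝ}
    (hγ : D.IsFlowLine γ) {L : Set (ℝ × (Y × S))} (hL : D.IsFlowSet i γ a₀ L) :
    D.IsFlowLeaf J i γ a₀ L ∧ ∃ C : PuncturedCurve (IYS n) J, IsGoodCurve D e₀ B C L := by
  have hδ := D.δ_pos
  obtain ⟨b, θ, hlift, hb0, hθ0, rfl⟩ := hL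
  have hc : ∀ s, |(γ s).2| ≤ 1 - D.δ := fun s => (hγ s).2.2.1
  choose p hp θ₀ l h1 h2 h3 using hlift.exists_limits hJ hn i hc
  have hmono : StrictMono b := by
    refine strictMono_of_deriv_pos fun s => ?_
    rw [(hlift.action s (mem_univ s)).deriv, D.cutHeight_spine (by linarith [hc s])]
    exact exp_pos _
  have hinj : ∀ s s', b s = b s' → γ s = γ s' → s = s' := fun s s' h _ => hmono.injective h
  have h3' : ∀ e, ∃ l, Tendsto (fun s => b s - D.period (p e) * s) (endFilter e) (𝓝 l) :=
    fun e => ⟨l e, h3 e⟩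
  let Q := cylPunctures (J := J) (i := i) (h := hlift) (hinj := hinj) hJ hn p hp θ₀ h1 h2 h3'
  have hgood := hB.isGoodCurve Q isClosed_empty convex_univ
  rw [cylModel_image] at hgood
  have hcyl := cylModel_isCylinder (J := J) (i := i) (h := hlift) (hinj := hinj) hJ hn p hp θ₀ h1 h2
    h3'
  refine ⟨⟨LeafModel.curve hJ hn Q, b, θ, p false, p true, θ₀ false, θ₀ true, hgood.1,
    fun s => hlift.flowEqs (mem_univ s) (hc s), hb0, hθ0, ?_, ?_, hp false, hp true, h1 false, h1 true,
    hcyl⟩, _, hgood⟩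
  · have h4 := (h3 true).add_atTop (tendsto_id.const_mul_atTop (exp_pos (D.ε * D.H (p true))))
    refine h4.congr fun s => ?_
    simp [period]
  · have h4 := (h3 false).add_atBot
      (tendsto_id.const_mul_atBot (exp_pos (D.ε * D.H (p false))))
    refine h4.congr fun s => ?_
    simp [period]

end ModelData

/-! ### The page-like leaves -/

namespace ModelData

namespace IsPageOrbit

variable {e : Bool} {y : Y} {γ : ℝ → Y × ℝ} (h : IsPageOrbit D e y γ)
include h

theorem continuous_tau : Continuous fun s => sgn e * (γ s).2 :=
  continuous_const.mul (continuous_snd.comp h.cont)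

/-- The coordinate `±τ` of the orbit, deformed so that it decreases to `0`: a parametrization of the
part of the cylinders which belongs to the page. -/
theorem exists_reparam [CompactSpace Y] [T2Space Y] (hJ : D.IsModelJ J) (hn : 1 ≤ n) (i : Fin k) :
    ∃ (ψ : ℝ → ℝ) (s₀ : ℝ), 0 < s₀ ∧ (∀ s ≤ s₀, ψ s = sgn e * (γ s).2) ∧
      ContDiffOn ℝ ∞ ψ (Ioi 0) ∧ (∀ s > 0, deriv ψ s < 0) ∧ StrictAntiOn ψ (Ici 0) ∧
      ψ '' Ioi 0 = Ioo 0 (1 + D.δ) := by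
  have hδ := D.δ_pos
  have hδ1 := D.δ_lt
  have hδ' := D.δ'_gt
  have hc := h.continuous_tau
  obtain ⟨s₀, hs₀, hs₀'⟩ : ∃ s₀ > 0, 1 - D.δ < sgn e * (γ (2 * s₀)).2 := by
    have h1 : ∀ᶠ s in 𝓝 (0 : ℝ), 1 - D.δ < sgn e * (γ (2 * s)).2 := by
      have h2 : ContinuousAt (fun s => sgn e * (γ (2 * s)).2) 0 :=
        (hc.comp (continuous_const.mul continuous_id)).continuousAt
      refine h2.eventually_const_lt ?_
      show 1 - D.δ < sgn e * (γ (2 * 0)).2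
      rw [mul_zero, h.sgn_mul_start]
      linarith
    obtain ⟨s, hs, hs'⟩ := ((eventually_mem_nhdsWithin (s := Ioi (0 : ℝ)) (a := 0)).and
      (mem_nhdsWithin_of_mem_nhds h1)).exists
    exact ⟨s, hs, hs'⟩
  have htau : ∀ s ≤ 2 * s₀, 1 - D.δ < sgn e * (γ s).2 := fun s hs =>
    h.lt_of_le hn (by linarith) (by linarith) hs hs₀'
  have htau' : ∀ s > 0, sgn e * (γ s).2 < 1 + D.δ := fun s hs =>
    (sgn_mul_le_abs e _).trans_lt (h.orbit.mem s hs)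
  -- `ψ` interpolates between `±τ`, before `s₀`, and `(1 - δ) e^{-s}`, after `2 s₀`
  let ρ : ℝ → ℝ := fun s => Real.smoothTransition (2 - s / s₀)
  have hρ : ContDiff ℝ ∞ ρ := Real.smoothTransition.contDiff.comp
    (contDiff_const.sub (contDiff_id.div_const s₀))
  have hρ0 : ∀ s, 2 * s₀ ≤ s → ρ s = 0 := fun s hs => Real.smoothTransition.zero_of_nonpos (by
    rw [sub_nonpos, le_div_iff₀ hs₀]; exact hs)
  have hρ1 : ∀ s ≤ s₀, ρ s = 1 := fun s hs => Real.smoothTransition.one_of_one_le (by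
    have : s / s₀ ≤ 1 := (div_le_one hs₀).2 hs
    linarith)
  have hρn : ∀ s, 0 ≤ ρ s := fun s => Real.smoothTransition.nonneg _
  have hρl : ∀ s, ρ s ≤ 1 := fun s => Real.smoothTransition.le_one _
  have hρd : ∀ s, deriv ρ s ≤ 0 := fun s => by
    have hanti : Antitone ρ := fun a b hab => Real.smoothTransition.monotone (by gcongr)
    exact hanti.deriv_nonpos
  let E : ℝ → ℝ := fun s => (1 - D.δ) * exp (-s)
  have hE : ∀ s, HasDerivAt E (-E s) s := fun s => by
    have := ((hasDerivAt_id s).neg.exp).const_mul (1 - D.δ)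
    simpa [E] using this
  have hE0 : ∀ s, 0 < E s := fun s => mul_pos (by linarith) (exp_pos _)
  have hE1 : ∀ s ≥ 0, E s ≤ 1 - D.δ := fun s hs => by
    have : exp (-s) ≤ 1 := Real.exp_le_one_iff.2 (by linarith)
    exact mul_le_of_le_one_right (by linarith) this
  let T : ℝ → ℝ := fun s => sgn e * (γ s).2
  let ψ : ℝ → ℝ := fun s => T s * ρ s + (1 - ρ s) * E s
  have hψ1 : ∀ s ≤ s₀, ψ s = T s := fun s hs => by simp [ψ, hρ1 s hs]
  have hψ0 : ∀ s, 2 * s₀ ≤ s → ψ s = E s := fun s hs => by simp [ψ, hρ0 s hs]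
  have hT : ∀ s > 0, HasDerivAt T (sgn e * (D.flowField (γ s)).2) s := fun s hs =>
    (h.orbit.hasDerivAt_tau hs).const_mul _
  have hψd : ∀ s > 0, HasDerivAt ψ (sgn e * (D.flowField (γ s)).2 * ρ s + T s * deriv ρ s
      + (-deriv ρ s * E s + (1 - ρ s) * -E s)) s := fun s hs => by
    have h1 := (hρ.differentiable (by simp) s).hasDerivAt
    exact ((hT s hs).mul h1).add ((h1.const_sub 1).mul (hE s))
  have hψneg : ∀ s > 0, sgn e * (D.flowField (γ s)).2 * ρ s + T s * deriv ρ s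
      + (-deriv ρ s * E s + (1 - ρ s) * -E s) < 0 := by
    intro s hs
    have hs2 : deriv ρ s * (T s - E s) ≤ 0 ∧ ρ s * (sgn e * (D.flowField (γ s)).2) ≤ 0 ∧
        (ρ s = 1 → ρ s * (sgn e * (D.flowField (γ s)).2) < 0) := by
      rcases le_or_gt s (2 * s₀) with h1 | h1
      · have h2 := htau s h1
        have h3 := D.sgn_mul_flowField_neg (p := γ s) hn (e := e) (by linarith)
        refine ⟨mul_nonpos_of_nonpos_of_nonneg (hρd s) ?_,
          mul_nonpos_of_nonneg_of_nonpos (hρn s) h3.le, fun h4 => by rwa [h4, one_mul]⟩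
        have := hE1 s hs.le
        show 0 ≤ sgn e * (γ s).2 - E s
        linarith
      · have h2 : ρ =ᶠ[𝓝 s] fun _ => 0 := by
          filter_upwards [lt_mem_nhds h1] with t ht
          exact hρ0 t ht.le
        rw [h2.deriv_eq, h2.self_of_nhds]
        simp
    obtain ⟨h1, h2, h3⟩ := hs2
    have h4 := hE0 s
    rcases (hρl s).eq_or_lt with h5 | h5
    · have := h3 h5
      rw [h5] at this ⊢
      linarith
    · nlinarith [mul_pos (sub_pos.2 h5) h4]
  have hψc : Continuous ψ := (hc.mul hρ.continuous).add
    ((continuous_const.sub hρ.continuous).mul (continuous_const.mul (by fun_prop)))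
  have hanti : StrictAntiOn ψ (Ici 0) := by
    refine strictAntiOn_of_deriv_neg (convex_Ici 0) hψc.continuousOn fun s hs => ?_
    rw [interior_Ici] at hs
    rw [(hψd s hs).deriv]
    exact hψneg s hs
  have hψ00 : ψ 0 = 1 + D.δ := by rw [hψ1 0 hs₀.le]; exact h.sgn_mul_start
  have hψpos : ∀ s, 0 ≤ s → 0 < ψ s := by
    intro s hs
    refine lt_of_lt_of_le ?_ (hanti.antitoneOn hs (le_max_right _ _ |>.trans' hs : 0 ≤ max (2 * s₀) s)
      (le_max_right _ _))
    rw [hψ0 _ (le_max_left _ _)]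
    exact hE0 _
  refine ⟨ψ, s₀, hs₀, hψ1, ?_, fun s hs => (hψd s hs).deriv ▸ hψneg s hs, hanti, ?_⟩
  · have h1 : ContDiffOn ℝ ∞ T (Ioi 0) := fun s hs => by
      have h2 := ContMDiffAt.comp s (f := γ) (contMDiffAt_snd (I := 𝓡 (2 * n - 1)) (J := 𝓘₁))
        (h.orbit.contMDiffAt hJ hn i isOpen_Ioi hs)
      exact (contDiffAt_const.mul h2.contDiffAt).contDiffWithinAt
    exact (h1.mul hρ.contDiffOn).add ((contDiffOn_const.sub hρ.contDiffOn).mul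
      (contDiff_const.mul (contDiff_id.neg.exp)).contDiffOn)
  · ext v
    constructor
    · rintro ⟨s, hs, rfl⟩
      have h1 := hanti (mem_Ici.2 le_rfl) (mem_Ici.2 (le_of_lt hs)) hs
      rw [hψ00] at h1
      exact ⟨hψpos s (le_of_lt hs), h1⟩
    · rintro ⟨h1, h2⟩
      have h3 : Tendsto E atTop (𝓝 0) := by
        simpa [E] using (Real.tendsto_exp_atBot.comp tendsto_neg_atTop_atBot).const_mul (1 - D.δ)
      obtain ⟨s, hs, hs'⟩ := ((h3.eventually_lt_const h1).and
        ((eventually_ge_atTop (2 * s₀)))).exists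
      rw [← hψ0 s hs'] at hs
      have hs0 : 0 ≤ s := by linarith
      obtain ⟨x, hx, rfl⟩ := intermediate_value_Icc' hs0 hψc.continuousOn
        ⟨hs.le, hψ00.symm ▸ h2.le⟩
      refine ⟨x, lt_of_le_of_ne hx.1 fun h0 => ?_, rfl⟩
      rw [← h0, hψ00] at h2
      exact lt_irrefl _ h2

theorem cutHeight_eq_zero (hn : 1 ≤ n) {s : ℝ} (hs : 1 + 8 * D.δ / 9 < sgn e * (γ s).2) :
    ∀ s' ≤ s, D.cutHeight (γ s') = 0 := fun s' hs' => by
  have hδ := D.δ_pos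
  exact cutHeight_outer (e := e)
    (h.lt_of_le hn (by linarith [D.δ'_gt, D.δ_lt]) (by linarith) hs' hs).le

theorem angle_eq_zero (hn : 1 ≤ n) {s : ℝ} (hs : 1 - D.δ < sgn e * (γ s).2) :
    ∀ s' ≤ s, D.angle (γ s') = 0 := fun s' hs' => by
  have hδ := D.δ_pos
  exact D.angle_corner (e := e) (h.lt_of_le hn (by linarith [D.δ'_gt]) (by linarith) hs' hs)

end IsPageOrbit

/-- The action along an orbit from the page at level `a`. -/
def pageAction (D : ModelData n Y S k g) (γ : ℝ → Y × ℝ) (a s : ℝ) : ℝ :=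
  a + ∫ x in (0 : ℝ)..s, D.cutHeight (γ x)

/-- The rotation along an orbit from the page. -/
def pageAngle (D : ModelData n Y S k g) (γ : ℝ → Y × ℝ) (s : ℝ) : ℝ :=
  ∫ x in (0 : ℝ)..s, D.angle (γ x)

namespace IsPageOrbit

variable {e : Bool} {y : Y} {γ : ℝ → Y × ℝ} (h : IsPageOrbit D e y γ)
include h

theorem hasDerivAt_action (a s : ℝ) : HasDerivAt (D.pageAction γ a) (D.cutHeight (γ s)) s :=
  ((D.contMDiff_cutHeight.continuous.comp h.cont).integral_hasStrictDerivAt 0 s).hasDerivAt.const_add a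

theorem continuous_angle (hJ : D.IsModelJ J) (hn : 1 ≤ n) (i : Fin k) :
    Continuous fun s => D.angle (γ s) := by
  have hδ := D.δ_pos
  refine continuous_iff_continuousAt.2 fun s => ?_
  by_cases hs : 1 - D.δ < sgn e * (γ s).2
  · have h1 : (fun s => D.angle (γ s)) =ᶠ[𝓝 s] fun _ => 0 := by
      filter_upwards [h.continuous_tau.continuousAt.eventually_const_lt hs] with t ht
      exact D.angle_corner ht
    exact continuousAt_const.congr h1.symm
  · refine h.orbit.continuousAt_angle hJ hn i (show 0 < s from lt_of_not_ge fun h0 => hs ?_)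
    rw [h.start s h0, ← mul_assoc, sgn_mul_self, one_mul]
    linarith

theorem isLift (hJ : D.IsModelJ J) (hn : 1 ≤ n) (i : Fin k) (a : ℝ) :
    IsLift D (Ioi 0) (D.pageAction γ a) (D.pageAngle γ) γ :=
  ⟨h.orbit, fun s _ => h.hasDerivAt_action a s, fun s _ =>
    ((h.continuous_angle hJ hn i).integral_hasStrictDerivAt 0 s).hasDerivAt⟩

theorem action_eq (hn : 1 ≤ n) (a : ℝ) {s : ℝ} (hs : 1 + 8 * D.δ / 9 < sgn e * (γ s).2)
    (hs0 : 0 ≤ s) : D.pageAction γ a s = a := by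
  rw [pageAction, intervalIntegral.integral_congr (g := fun _ => 0) fun x hx => ?_]
  · simp
  · rw [uIcc_of_le hs0] at hx
    exact h.cutHeight_eq_zero hn hs x hx.2

theorem pageAngle_eq (hn : 1 ≤ n) {s : ℝ} (hs : 1 - D.δ < sgn e * (γ s).2)
    (hs0 : 0 ≤ s) : D.pageAngle γ s = 0 := by
  rw [pageAngle, intervalIntegral.integral_congr (g := fun _ => 0) fun x hx => ?_]
  · simp
  · rw [uIcc_of_le hs0] at hx
    exact h.angle_eq_zero hn hs x hx.2

end IsPageOrbit

/-- The page over `y` at level `a`, continued by the orbit `γ` in all cylinders. -/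
def pageSet (D : ModelData n Y S k g) (e : Bool) (y : Y) (γ : ℝ → Y × ℝ) (a : ℝ) :
    Set (ℝ × (Y × S)) :=
  {w | w.1 = a ∧ w.2.1 = y ∧ w.2.2 ∈ D.core e} ∪
    ⋃ i, D.sweep i (D.pageAction γ a) (D.pageAngle γ) γ '' {p | 0 < p.1}

/-- The page over `y` at level `a`: the slice over the core, and a copy of the cylinder over `γ` in
each component of the spine. -/
theorem exists_page_model [CompactSpace Y] [T2Space Y] [CompactSpace S] [T2Space S]
    (hJ : D.IsModelJ J) (hn : 1 ≤ n) (i : Fin k) {e : Bool} {y : Y} {γ : ℝ → Y × ℝ}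
    (h : IsPageOrbit D e y γ) (a : ℝ) :
    ∃ (L : LeafModel D J) (Q : L.Punctures) (pt : Fin k ≃ Q.ι), IsClosed L.N ∧ Convex ℝ L.I ∧
      L.u '' L.dom = D.pageSet e y γ a ∧ L.domO = D.U e ∧
      L.u '' (L.dom \ ⋃ i, L.P (Q.comp (pt i)) '' halfCyl true 0)
        = {w | w.1 = a ∧ w.2.1 = y ∧ w.2.2 ∈ D.core e} ∧
      ∀ i, Q.pos (pt i) = true ∧ L.idx (Q.comp (pt i)) = i ∧ L.b = D.pageAction γ a ∧
        L.θ = D.pageAngle γ ∧ L.γ = γ ∧ ∃ p ∈ D.crit, Tendsto γ atTop (𝓝 p) ∧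
          Q.T (pt i) = D.period p ∧ ∃ θ₀, Q.orb (pt i) = D.orbit i p θ₀ := by
  have hδ := D.δ_pos
  obtain ⟨ψ, s₀, hs₀, hψ, hψs, hψd, hψa, hψi⟩ := h.exists_reparam hJ hn i
  have hlift := h.isLift hJ hn i a
  have hmem : ∀ s > 0, ψ s ∈ Ioo 0 (1 + D.δ) := fun s hs => hψi ▸ mem_image_of_mem ψ hs
  have hsgn : ∀ x : ℝ, sgn e * (sgn e * x) = x := fun x => by
    rw [← mul_assoc, sgn_mul_self, one_mul]
  have habs : ∀ x : ℝ, 0 ≤ x → |sgn e * x| = x := fun x hx => by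
    rw [abs_mul, abs_sgn, one_mul, abs_of_nonneg hx]
  have hsurj : ∀ x : ℝ, 0 < sgn e * x → |x| < 1 + D.δ → ∃ s > 0, sgn e * ψ s = x := by
    intro x hx hx'
    have h1 : sgn e * x ∈ ψ '' Ioi 0 := hψi.symm ▸ ⟨hx, (sgn_mul_le_abs e x).trans_lt hx'⟩
    obtain ⟨s, hs, hs'⟩ := h1
    exact ⟨s, hs, by rw [hs', hsgn]⟩
  have hs₀m := hmem s₀ hs₀
  -- beyond the level `c` the curve is still the slice
  set c := max (1 + 8 * D.δ / 9) (ψ s₀) with hc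
  have hc1 : c < 1 + D.δ := max_lt (by linarith) hs₀m.2
  have hcO : D.outer e c ⊆ D.outer e (1 + 8 * D.δ / 9) :=
    sdiff_subset_sdiff_right (iUnion_mono fun i => image_mono fun p (hp : |p.1| ≤ 1 + 8 * D.δ / 9) =>
      (hp.trans (le_max_left _ _) : |p.1| ≤ c))
  let L : LeafModel D J :=
    { I := Ioi 0
      isOpen_I := isOpen_Ioi
      b := D.pageAction γ a
      θ := D.pageAngle γ
      γ := γ
      lift := hlift
      inj := fun s hs s' hs' _ hγ =>
        (h.orbit.strictMonoOn_height hn ordConnected_Ioi fun s hs => h.notMem_crit hJ hn i hs).injOn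
          hs hs' (congrArg D.height hγ)
      κ := Fin k
      idx := id
      idx_inj := Function.injective_id
      ψ := fun s => sgn e * ψ s
      ψ_smooth := contDiffOn_const.mul hψs
      ψ_deriv := fun s hs => by
        rw [deriv_const_mul_field]
        refine mul_ne_zero ?_ (hψd s hs).ne
        cases e <;> simp [sgn]
      ψ_inj := fun s hs s' hs' hss => hψa.injOn (mem_Ici.2 (le_of_lt hs)) (mem_Ici.2 (le_of_lt hs')) (by
        have := congrArg (sgn e * ·) hss
        simpa only [hsgn] using this)
      ψ_mem := fun s hs => by
        rw [habs _ (hmem s hs).1.le]; exact (hmem s hs).2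
      N := D.core e
      O := D.outer e c
      y := y
      a := a
      isOpen_O := D.isOpen_outer e hc1
      N_sub := D.core_subset_outer e hc1
      N_off := fun z hz => hz.2
      O_sub := fun z hz => by
        rcases D.mem_outer hz with hz | ⟨j, p, hp, hp', rfl⟩
        · exact .inl hz
        · obtain ⟨s, hs, hs'⟩ := hsurj p.1 ((le_max_left _ _).trans_lt hp) hp'
          exact .inr ⟨j, s, p.2, hs, by dsimp only [id]; rw [hs']⟩
      O_slice := fun z hz w => hJ.slice_eq hn y (hcO hz) w
      O_eq := fun s hs j t hz => by
        have hs' : |sgn e * ψ s| < 1 + D.δ := by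
          rw [habs _ (hmem s hs).1.le]; exact (hmem s hs).2
        have h1 : c < ψ s := by
          rcases D.mem_outer hz with hz | ⟨j', p, hp, hp', hpz⟩
          · exact absurd (D.c_mem_cyl (p := (sgn e * ψ s, t)) j hs') hz.2
          · have h2 := (D.c_eq_imp (p' := (sgn e * ψ s, t)) hp' hs' hpz).2.1
            rw [h2, hsgn] at hp
            exact (le_max_right _ _).trans_lt hp
        have h2 : s ≤ s₀ := by
          by_contra hlt
          exact absurd (hψa (mem_Ici.2 hs₀.le) (mem_Ici.2 (le_of_lt hs)) (not_le.1 hlt))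
            (not_lt.2 ((le_max_right _ _).trans h1.le))
        have h3 := (le_max_left _ _).trans_lt h1
        have h4 := hψ s h2
        rw [h4] at h3
        refine ⟨h.action_eq hn a h3 (le_of_lt hs), Prod.ext (h.fst_eq hn (by linarith)) ?_,
          h.pageAngle_eq hn (by linarith) (le_of_lt hs)⟩
        rw [h4, hsgn] }
  have hLP : ∀ j p, L.P j p = D.c j (sgn e * ψ p.1, p.2) := fun _ _ => rfl
  have hdom : L.dom = D.U e := by
    ext z
    constructor
    · rintro (hz | hz)
      · exact hz.1
      · obtain ⟨j, p, hp, rfl⟩ := mem_iUnion.1 hz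
        refine D.U_cyl e j _ (L.ψ_mem p.1 hp) ?_
        show 0 < sgn e * (sgn e * ψ p.1)
        rw [hsgn]
        exact (hmem p.1 hp).1
    · intro hz
      rcases D.cyl_or_core z with ⟨j, p, hp, rfl⟩ | ⟨e', he'⟩
      · obtain ⟨s, hs, hs'⟩ := hsurj p.1 (D.sgn_mul_pos_of_mem hp hz) hp
        exact .inr (mem_iUnion.2 ⟨j, (s, p.2), hs, by rw [hLP]; dsimp only; rw [hs']⟩)
      · exact .inl ⟨hz, he'.2⟩
  have hdisj : Disjoint (D.U e : Set S) (D.U (!e)) := by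
    cases e
    · exact D.U_disj.symm
    · exact D.U_disj
  have hconn : IsConnected L.dom := by
    have hp : PathConnectedSpace (D.U e) := by
      cases e
      · exact D.genus_neg.1
      · exact D.genus_pos.1
    rw [hdom]
    exact isConnected_iff_connectedSpace.2 (inferInstance : ConnectedSpace (D.U e))
  obtain ⟨p, hp, hlim⟩ := h.exists_limit hJ hn i
  obtain ⟨c', htr⟩ := h.isTrajectory hn one_pos
  have hlim1 : Tendsto (fun t => γ (t + 1)) atTop (𝓝 p) :=
    hlim.comp (tendsto_atTop_add_const_right _ 1 tendsto_id)
  obtain ⟨θ₀, hθ₀⟩ := htr.exists_limit_angle hJ hn i (θ := fun t => D.pageAngle γ (t + 1)) (by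
    filter_upwards [eventually_ge_atTop 0] with t ht
    rw [one_mul]
    exact (hlift.rot (t + 1) (by show 0 < t + 1; linarith)).comp_add_const t 1)
  obtain ⟨l, hl⟩ := htr.exists_limit_action hJ hn i hp hlim1
    (b := fun t => D.pageAction γ a (t + 1)) (by
    filter_upwards with t
    rw [one_mul]
    exact (h.hasDerivAt_action a (t + 1)).comp_add_const t 1)
  have hθ₀' : Tendsto (D.pageAngle γ) atTop (𝓝 θ₀) :=
    (hθ₀.comp (tendsto_atTop_add_const_right _ (-1) tendsto_id)).congr fun t => by simp
  have hl' : Tendsto (fun s => D.pageAction γ a s - D.period p * s) atTop (𝓝 (l - D.period p)) := by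
    refine ((hl.comp (tendsto_atTop_add_const_right _ (-1) tendsto_id)).sub_const
      (D.period p)).congr fun t => ?_
    simp
    ring
  let Q : L.Punctures :=
    { ι := Fin k
      fin := inferInstance
      pos := fun _ => true
      comp := fun j => j
      sub := fun _ q hq => hq
      ne := fun i i' hne heq => absurd heq hne
      K := ((D.U (!e) : Set S) ∪ ⋃ j, D.c j '' {p | |p.1| < 1 + D.δ ∧ sgn e * p.1 < ψ 1})ᶜ
      isCompact_K := by
        refine IsClosed.isCompact (isClosed_compl_iff.2 ((D.U _).isOpen.union
          (isOpen_iUnion fun j => D.isOpen_cyl j ?_ fun p hp => hp.1)))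
        exact (isOpen_lt (f := fun p : ℝ × ℝ => |p.1|) (by fun_prop) continuous_const).inter
          (isOpen_lt (f := fun p : ℝ × ℝ => sgn e * p.1) (by fun_prop) continuous_const)
      K_sub := fun z hz => by
        rw [hdom]
        rw [mem_compl_iff, mem_union, not_or] at hz
        rcases D.cyl_or_core z with ⟨j, p, hp, rfl⟩ | ⟨e', he'⟩
        · refine D.U_cyl e j p hp ((hmem 1 one_pos).1.trans_le (not_lt.1 fun hlt => hz.2 ?_))
          exact mem_iUnion.2 ⟨j, p, ⟨hp, hlt⟩, rfl⟩
        · rcases Bool.eq_or_eq_not e' e with rfl | rfl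
          · exact he'.1
          · exact absurd he'.1 hz.1
      cover := fun z hz hzK => by
        rw [hdom] at hz
        rw [mem_compl_iff, not_not] at hzK
        rcases hzK with hzK | hzK
        · exact absurd hzK (disjoint_left.1 hdisj hz)
        · obtain ⟨j, p, ⟨hp, hp'⟩, rfl⟩ := mem_iUnion.1 hzK
          obtain ⟨s, hs, hs'⟩ := hsurj p.1 (D.sgn_mul_pos_of_mem hp hz) hp
          refine ⟨j, (s, p.2), ?_, by rw [hLP]; dsimp only; rw [hs']⟩
          rw [← hs', hsgn] at hp'
          exact (hψa.lt_iff_gt (mem_Ici.2 (le_of_lt hs)) (mem_Ici.2 zero_le_one)).1 hp'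
      conn := hconn
      T := fun _ => D.period p
      orb := fun j => D.orbit j p θ₀
      periodic := fun j => (isPeriodicOrbit hJ hn j hp θ₀).1
      asymp := fun j v hv => hlift.asymptoticTo hJ hn j (pos := true) (Ioi_mem_atTop 0) hp hlim hθ₀'
        hl' hv }
  have hN : L.u '' D.core e = {w | w.1 = a ∧ w.2.1 = y ∧ w.2.2 ∈ D.core e} := by
    ext w
    constructor
    · rintro ⟨z, hz, rfl⟩
      rw [L.u_N hz]
      exact ⟨rfl, rfl, hz⟩
    · rintro ⟨h1, h2, h3⟩
      exact ⟨w.2.2, h3, (L.u_N h3).trans (Prod.ext h1.symm (Prod.ext h2.symm rfl))⟩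
  refine ⟨L, Q, Equiv.refl _, D.isClosed_core e, convex_Ioi 0, ?_, ?_, ?_, fun j =>
    ⟨rfl, rfl, rfl, rfl, rfl, p, hp, hlim, rfl, θ₀, rfl⟩⟩
  · rw [pageSet, ← hN, LeafModel.dom, image_union, image_iUnion]
    congr 1
    refine iUnion_congr fun j => ?_
    rw [← image_comp]
    exact image_congr fun q hq => L.u_P j hq
  · exact TopologicalSpace.Opens.ext hdom
  · rw [← hN]
    congr 1
    ext z
    constructor
    · rintro ⟨hz | hz, hz'⟩
      · exact hz
      · obtain ⟨j, q, hq, rfl⟩ := mem_iUnion.1 hz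
        exact (hz' (mem_iUnion.2 ⟨j, q, hq, rfl⟩)).elim
    · intro hz
      refine ⟨.inl hz, fun hz' => ?_⟩
      obtain ⟨j, q, hq, rfl⟩ := mem_iUnion.1 hz'
      exact hz.2 (L.P_mem_cyl j hq)

theorem exists_page_leaf [CompactSpace Y] [T2Space Y] [CompactSpace S] [T2Space S]
    {hJ : D.IsModelJ J} {hn : 1 ≤ n} {e₀ B : ℝ≥0} (hB : IsEnergyBound hJ hn e₀ B) (i : Fin k)
    {e : Bool} {y : Y} {γ : ℝ → Y × ℝ} (h : IsPageOrbit D e y γ) (a : ℝ) :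
    D.IsPageLeaf J e y a (D.pageSet e y γ a) ∧
      ∃ C : PuncturedCurve (IYS n) J, IsGoodCurve D e₀ B C (D.pageSet e y γ a) := by
  have hδ := D.δ_pos
  have hδ' := D.δ'_gt
  obtain ⟨L, Q, pt, hN, hI, himg, hdom, hcore, hpt⟩ := exists_page_model hJ hn i h a
  have hgood := hB.isGoodCurve Q hN hI
  rw [himg] at hgood
  have hne : Nonempty L.domO := (LeafModel.curve hJ hn Q).conn.toNonempty
  refine ⟨⟨LeafModel.curve hJ hn Q, pt, hgood.1, ?_, ?_, fun j => ?_⟩, _, hgood⟩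
  · show HasGenus L.domO k _
    rw [hdom]
    cases e
    · exact D.genus_neg
    · exact D.genus_pos
  · rw [← hcore]
    ext w
    constructor
    · rintro ⟨z, hz, rfl⟩
      refine ⟨z.1, ⟨z.2, fun hz' => hz ?_⟩, rfl⟩
      obtain ⟨j, q, hq, hqz⟩ := mem_iUnion.1 hz'
      refine mem_iUnion.2 ⟨pt j, q, ?_, ?_⟩
      · show q ∈ halfCyl (Q.pos (pt j)) 0
        rw [(hpt j).1]
        exact hq
      · show openRetract L.domO (L.P (Q.comp (pt j)) q) = z
        rw [hqz]
        exact openRetract_apply L.domO z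
    · rintro ⟨z, ⟨hz, hz'⟩, rfl⟩
      refine ⟨⟨z, hz⟩, fun h1 => hz' ?_, rfl⟩
      obtain ⟨j, q, hq, hqz⟩ := mem_iUnion.1 h1
      obtain ⟨j, rfl⟩ := pt.surjective j
      have hq' : q ∈ halfCyl (Q.pos (pt j)) 0 := hq
      refine mem_iUnion.2 ⟨j, q, ?_, ?_⟩
      · rw [(hpt j).1] at hq'
        exact hq'
      · have h2 := congrArg Subtype.val hqz
        exact (openRetract_val L.domO (L.P_mem_dom _ (Q.sub _ hq'))).symm.trans h2
  · obtain ⟨hpos, hidx, hb, hθ, hγ, p, hp, hlim, hT, θ₀, horb⟩ := hpt j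
    have hlift := h.isLift hJ hn i a
    have hgt : ∀ s > 0, ∀ e', 1 - D.δ < sgn e' * (γ s).2 → D.flowField (γ s)
      = (0, deriv (fun τ => exp (D.Gε (γ s).1 τ)) (γ s).2 / D.h (γ s).2) :=
      fun s _ e' hs => D.flowField_corner (e := e') hs
    refine ⟨hpos, D.pageAction γ a, D.pageAngle γ, γ, p, θ₀, fun s t hs => ?_, h.orbit.mem, ?_, ?_,
      fun s hs hs' => ?_, fun s hs hs' => hlift.flowEqs hs hs', ?_, hp, hlim, ?_⟩
    · have hq : (s, t) ∈ halfCyl (Q.pos (pt j)) 0 := by rw [hpos]; exact hs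
      refine (Q.u_retract (pt j) hq).trans ?_
      rw [hidx, hb, hθ, hγ]
      rfl
    · have h1 := (continuous_snd.comp h.cont).tendsto 0
      simp only [Function.comp_def, h.zero] at h1
      exact h1.mono_left nhdsWithin_le_nhds
    · have h1 := (h.hasDerivAt_action a 0).continuousAt.tendsto
      rw [show D.pageAction γ a 0 = a by simp [pageAction]] at h1
      exact h1.mono_left nhdsWithin_le_nhds
    · have h1 := h.fst_eq hn hs'
      have h2 := hgt s hs e hs'
      rw [h1] at h2
      refine ⟨h1, h.pageAngle_eq hn hs' hs.le, ?_, ?_⟩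
      · rw [← h1]
        exact h.hasDerivAt_action a s
      · have h3 := h.orbit.hasDerivAt_tau hs
        rw [h2] at h3
        exact h3
    · have h1 := D.abs_crit_le hn hp
      exact ((continuous_snd.tendsto p).comp hlim).abs.eventually_lt_const
        (show |p.2| < 1 - D.δ by linarith)
    · have h1 : (LeafModel.curve hJ hn Q).AsymptoticAt (pt j) (Q.T (pt j)) (Q.orb (pt j)) :=
        ⟨Q.periodic _, Q.asymp _ _ fun q hq => Q.u_retract _ hq⟩
      rw [hT, horb] at h1
      exact h1

end ModelData

/-! ### The leaves form a partition -/

namespace ModelData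

/-- The leaves, with the orbit `orb e y` from the page over `y`. -/
def leaves (D : ModelData n Y S k g) (orb : Bool → Y → ℝ → Y × ℝ) : Set (Set (ℝ × (Y × S))) :=
  {L | (∃ i, ∃ p ∈ D.crit, L = D.trivialSet i p) ∨
    (∃ i γ a₀, D.IsFlowLine γ ∧ D.IsFlowSet i γ a₀ L) ∨ ∃ e y a, L = D.pageSet e y (orb e y) a}

/-- The leaves which are swept out by orbits in the spine. -/
def IsCylinderSet (D : ModelData n Y S k g) (L : Set (ℝ × (Y × S))) : Prop :=
  ∃ i b θ γ, IsLift D univ b θ γ ∧ (∀ s, |(γ s).2| ≤ 1 - D.δ) ∧ L = range (D.sweep i b θ γ)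

theorem mem_leaves (hn : 1 ≤ n) {orb : Bool → Y → ℝ → Y × ℝ} {L : Set (ℝ × (Y × S))}
    (hL : L ∈ D.leaves orb) : D.IsCylinderSet L ∨ ∃ e y a, L = D.pageSet e y (orb e y) a := by
  rcases hL with ⟨i, p, hp, rfl⟩ | ⟨i, γ, a₀, hγ, b, θ, h, -, -, rfl⟩ | h
  · exact .inl ⟨i, _, _, _, isLift_const hn hp,
      fun _ => (D.abs_crit_le hn hp).trans (by linarith [D.δ'_gt]), rfl⟩
  · exact .inl ⟨i, b, θ, γ, h, fun s => (hγ s).2.2.1, rfl⟩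
  · exact .inr h

theorem mem_range_sweep {i i' : Fin k} {b θ : ℝ → ℝ} {γ : ℝ → Y × ℝ} {a : ℝ} {y : Y} {p : ℝ × ℝ}
    (hγ : ∀ s, |(γ s).2| < 1 + D.δ) (hp : |p.1| < 1 + D.δ)
    (h : (a, (y, D.c i' p)) ∈ range (D.sweep i b θ γ)) :
    i = i' ∧ ∃ s t, b s = a ∧ γ s = (y, p.1) ∧ p.2 = θ s + t := by
  obtain ⟨q, hq⟩ := h
  simp only [sweep, coord, Prod.mk.injEq] at hq
  obtain ⟨h1, h2, h3⟩ := hq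
  obtain ⟨h4, h5, m, h6⟩ := D.c_eq_imp (p := ((γ q.1).2, θ q.1 + q.2)) (hγ q.1) hp h3
  exact ⟨h4, q.1, q.2 + m, h1, Prod.ext h2 h5, by rw [h6]; ring⟩

theorem notMem_core {e : Bool} {i : Fin k} {p : ℝ × ℝ} (hp : |p.1| < 1 + D.δ) :
    D.c i p ∉ D.core e := fun h => h.2 (D.c_mem_cyl i hp)

theorem mem_pageSet_c {e : Bool} {y y' : Y} {γ : ℝ → Y × ℝ} (h : IsPageOrbit D e y γ) {a a' : ℝ}
    {i : Fin k} {p : ℝ × ℝ} (hp : |p.1| < 1 + D.δ) :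
    (a', (y', D.c i p)) ∈ D.pageSet e y γ a ↔
      ∃ s > 0, D.pageAction γ a s = a' ∧ γ s = (y', p.1) := by
  constructor
  · rintro (h1 | h1)
    · exact absurd h1.2.2 (notMem_core hp)
    · obtain ⟨i', q, hq, hq'⟩ := mem_iUnion.1 h1
      simp only [sweep, coord, Prod.mk.injEq] at hq'
      obtain ⟨h2, h3, h4⟩ := hq'
      obtain ⟨-, h5, -⟩ :=
        D.c_eq_imp (p := ((γ q.1).2, D.pageAngle γ q.1 + q.2)) (h.orbit.mem q.1 hq) hp h4
      exact ⟨q.1, hq, h2, Prod.ext h3 h5⟩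
  · rintro ⟨s, hs, h1, h2⟩
    refine .inr (mem_iUnion.2 ⟨i, (s, p.2 - D.pageAngle γ s), hs, ?_⟩)
    simp only [sweep, coord, h1, h2, add_sub_cancel]

theorem mem_pageSet_core {e e' : Bool} {y y' : Y} {γ : ℝ → Y × ℝ} (h : IsPageOrbit D e y γ)
    {a a' : ℝ} {z : S} (hz : z ∈ D.core e') :
    (a', (y', z)) ∈ D.pageSet e y γ a ↔ a' = a ∧ y' = y ∧ e' = e := by
  constructor
  · rintro (h1 | h1)
    · refine ⟨h1.1, h1.2.1, ?_⟩
      have h2 : z ∈ D.core e := h1.2.2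
      have hd := disjoint_left.1 D.U_disj
      cases e <;> cases e' <;> first | rfl | exact absurd h2.1 (hd hz.1) | exact absurd hz.1 (hd h2.1)
    · obtain ⟨i', q, hq, hq'⟩ := mem_iUnion.1 h1
      have h2 : D.c i' ((γ q.1).2, D.pageAngle γ q.1 + q.2) = z := congrArg (fun w => w.2.2) hq'
      exact absurd (h2 ▸ hz) (notMem_core (p := ((γ q.1).2, D.pageAngle γ q.1 + q.2))
        (h.orbit.mem q.1 hq))
  · rintro ⟨rfl, rfl, rfl⟩
    exact .inl ⟨rfl, rfl, hz⟩

/-- Two cylinders swept out by orbits in the spine which meet are equal. -/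
theorem IsCylinderSet.eq_of_mem [CompactSpace Y] [T2Space Y] (hJ : D.IsModelJ J) (hn : 1 ≤ n)
    {L L' : Set (ℝ × (Y × S))} (h : D.IsCylinderSet L) (h' : D.IsCylinderSet L')
    {w : ℝ × (Y × S)} (hw : w ∈ L) (hw' : w ∈ L') : L = L' := by
  have key : ∀ {L L' : Set (ℝ × (Y × S))}, D.IsCylinderSet L → D.IsCylinderSet L' → w ∈ L →
      w ∈ L' → L ⊆ L' := by
    have hδ := D.δ_pos
    rintro _ _ ⟨i, b, θ, γ, h, hc, rfl⟩ ⟨i', b', θ', γ', h', hc', rfl⟩ ⟨p, rfl⟩ hw'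
    have hlt : ∀ s, |(γ s).2| < 1 + D.δ := fun s => by linarith [hc s]
    obtain ⟨rfl, s', t', h1, h2, -⟩ := mem_range_sweep (fun s => by linarith [hc' s]) (hlt p.1) hw'
    have horb := h.orbit.eqOn hJ hn i' isOpen_univ ordConnected_univ
      (h'.orbit.shift (s' - p.1)) (mem_univ p.1) (by rw [add_sub_cancel, h2])
    have hconst : ∀ {f f' u : ℝ → ℝ}, (∀ s, HasDerivAt f (u s) s) → (∀ s, HasDerivAt f' (u s) s) →
        ∀ s, f s - f' s = f p.1 - f' p.1 := fun hf hf' s =>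
      is_const_of_deriv_eq_zero (fun x => ((hf x).sub (hf' x)).differentiableAt)
        (fun x => by rw [((hf x).sub (hf' x)).deriv, sub_self]) s p.1
    have hshift : ∀ {f' : ℝ → ℝ} {u : Y × ℝ → ℝ}, (∀ s, HasDerivAt f' (u (γ' s)) s) →
        ∀ s, HasDerivAt (fun x => f' (x + (s' - p.1))) (u (γ s)) s := fun hf s => by
      rw [horb (mem_univ s)]
      exact (hf (s + (s' - p.1))).comp_add_const s (s' - p.1)
    have hb := hconst (fun s => h.action s (mem_univ s))
      (hshift (u := D.cutHeight) fun s => h'.action s (mem_univ s))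
    have hθ := hconst (fun s => h.rot s (mem_univ s))
      (hshift (u := D.angle) fun s => h'.rot s (mem_univ s))
    rintro _ ⟨q, rfl⟩
    refine ⟨(q.1 + (s' - p.1), q.2 + (θ p.1 - θ' s')), ?_⟩
    have hb' := hb q.1
    have hθ' := hθ q.1
    rw [add_sub_cancel] at hb' hθ'
    have hq : γ' (q.1 + (s' - p.1)) = γ q.1 := (horb (mem_univ q.1)).symm
    simp only [sweep]
    rw [hq]
    refine Prod.ext ?_ ?_
    · dsimp only
      linarith
    · dsimp only
      congr 2
      linarith
  exact Subset.antisymm (key h h' hw hw') (key h' h hw' hw)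

/-- Orbits from the pages do not meet orbits which stay in the spine. -/
theorem IsPageOrbit.ne_of_abs_le [CompactSpace Y] [T2Space Y] (hJ : D.IsModelJ J) (hn : 1 ≤ n)
    (i : Fin k) {e : Bool} {y : Y} {γ γ' : ℝ → Y × ℝ} (h : IsPageOrbit D e y γ)
    (h' : IsOrbit D univ γ') (hc : ∀ s, |(γ' s).2| ≤ 1 - D.δ) {s s' : ℝ} (hs : 0 < s) :
    γ s ≠ γ' s' := by
  intro heq
  have hδ := D.δ_pos
  have h1 := h.orbit.eqOn hJ hn i isOpen_Ioi ordConnected_Ioi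
    ((h'.shift (s' - s)).mono (subset_univ _)) hs (by rw [add_sub_cancel, heq])
  have h2 : Tendsto (fun t => sgn e * (γ t).2) (𝓝[>] 0) (𝓝 (1 + D.δ)) := by
    have h3 := h.continuous_tau.tendsto 0
    rw [h.sgn_mul_start] at h3
    exact h3.mono_left nhdsWithin_le_nhds
  have h4 : 1 + D.δ ≤ 1 - D.δ := by
    refine le_of_tendsto h2 ?_
    filter_upwards [self_mem_nhdsWithin] with t ht
    rw [h1 ht]
    exact (sgn_mul_le_abs e _).trans (hc _)
  linarith

theorem IsPageOrbit.exists_eq_of_corner [CompactSpace Y] [T2Space Y] (hJ : D.IsModelJ J)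
    (hn : 1 ≤ n) (i : Fin k) {e : Bool} {y : Y} {γ : ℝ → Y × ℝ} (h : IsPageOrbit D e y γ) {τ : ℝ}
    (hτ : 1 - D.δ < sgn e * τ) (hτ' : |τ| < 1 + D.δ) : ∃ s > 0, γ s = (y, τ) := by
  have hδ' := D.δ'_gt
  obtain ⟨p, hp, hlim⟩ := h.exists_limit hJ hn i
  have h1 : sgn e * p.2 < sgn e * τ :=
    ((sgn_mul_le_abs e _).trans (D.abs_crit_le hn hp)).trans_lt (by linarith)
  have h2 : ∀ᶠ s in atTop, sgn e * (γ s).2 < sgn e * τ :=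
    (((continuous_snd.tendsto p).comp hlim).const_mul (sgn e)).eventually_lt_const h1
  obtain ⟨s₁, h3, h4⟩ := (h2.and (eventually_ge_atTop 0)).exists
  have h5 : sgn e * τ < 1 + D.δ := (sgn_mul_le_abs e _).trans_lt hτ'
  obtain ⟨s, hs, hs'⟩ := intermediate_value_Icc' h4 h.continuous_tau.continuousOn
    (show sgn e * τ ∈ Icc (sgn e * (γ s₁).2) (sgn e * (γ 0).2) from
      ⟨h3.le, by rw [h.sgn_mul_start]; exact h5.le⟩)
  have hs' : sgn e * (γ s).2 = sgn e * τ := hs'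
  refine ⟨s, lt_of_le_of_ne hs.1 fun h0 => ?_, Prod.ext (h.fst_eq hn (hs' ▸ hτ)) ?_⟩
  · rw [← h0, h.sgn_mul_start] at hs'
    linarith
  · have h6 := congrArg (sgn e * ·) hs'
    simpa only [← mul_assoc, sgn_mul_self, one_mul] using h6

/-- A point of the spine which is not critical lies on a flow line in the spine or, if its backward
orbit leaves the spine, on the orbit from some page. -/
theorem exists_flowLine_or_page [CompactSpace Y] [T2Space Y] (hJ : D.IsModelJ J) (hn : 1 ≤ n)
    (i : Fin k) {orb : Bool → Y → ℝ → Y × ℝ} (horb : ∀ e y, IsPageOrbit D e y (orb e y))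
    {q : Y × ℝ} (hq : |q.2| ≤ 1 - D.δ) (hq' : q ∉ D.crit) :
    (∃ γ, D.IsFlowLine γ ∧ γ 0 = q) ∨ ∃ e y, ∃ s > 0, orb e y s = q := by
  have hδ := D.δ_pos
  have hδ' := D.δ'_gt
  obtain ⟨γ, h0, hc, hγ⟩ := exists_flow hJ hn i (c := 1) (by linarith) (by linarith) q
  by_cases hall : ∀ t, |(γ t).2| ≤ 1 - D.δ
  · have horbit : IsOrbit D univ γ := ⟨fun t _ => (hγ t (by linarith [hall t]) t le_rfl).2,
      fun t _ => by linarith [hall t]⟩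
    refine .inl ⟨γ, isFlowLine_of_isOrbit horbit hall fun s hs => hq' ?_, h0⟩
    rw [← h0, horbit.eqOn_const hJ hn i isOpen_univ ordConnected_univ (mem_univ s) hs 0 (mem_univ 0)]
    exact hs
  · push Not at hall
    obtain ⟨t₁, ht₁⟩ := hall
    have h0' : |(γ 0).2| ≤ 1 - D.δ := h0 ▸ hq
    have hneg : t₁ < 0 := by
      by_contra hpos
      have h1 : IsOrbit D (Ici 0) γ := ⟨fun t ht => (hγ 0 (by linarith) t ht).2,
        fun t ht => by linarith [(hγ 0 (by linarith) t ht).1]⟩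
      exact absurd (h1.abs_le hn (Icc_subset_Ici_self) (by linarith) h0' (not_lt.1 hpos))
        (not_le.2 ht₁)
    -- a time at which the orbit is in the corner, where `γ` still follows the flow
    have hcont : Continuous fun t => |(γ t).2| := (continuous_snd.comp hc).abs
    obtain ⟨t₂, ht₂, hm⟩ := intermediate_value_Icc' hneg.le hcont.continuousOn
      (show min |(γ t₁).2| (1 - D.δ / 2) ∈ Icc |(γ 0).2| |(γ t₁).2| from
        ⟨le_min (by linarith) (by linarith), min_le_left _ _⟩)
    have hm : |(γ t₂).2| = min |(γ t₁).2| (1 - D.δ / 2) := hm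
    have hm1 : 1 - D.δ < |(γ t₂).2| := hm ▸ lt_min ht₁ (by linarith)
    have hm2 : |(γ t₂).2| < 1 := hm ▸ (min_le_right _ _).trans_lt (by linarith)
    obtain ⟨t₃, ht₃, ht₃'⟩ := ((eventually_mem_nhdsWithin (s := Iio t₂) (a := t₂)).and
      (mem_nhdsWithin_of_mem_nhds (hcont.continuousAt.eventually_lt_const hm2))).exists
    have ht₃ : t₃ < t₂ := ht₃
    have h1 : IsOrbit D (Ioi t₃) γ := ⟨fun t ht => (hγ t₃ (le_of_lt ht₃') t (le_of_lt ht)).2,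
      fun t ht => by linarith [(hγ t₃ (le_of_lt ht₃') t (le_of_lt ht)).1]⟩
    obtain ⟨e, he⟩ := exists_sgn (γ t₂).2
    obtain ⟨s, hs, hs'⟩ := (horb e (γ t₂).1).exists_eq_of_corner hJ hn i (he ▸ hm1) (by linarith)
    have h2 : IsOrbit D (Ioi (max 0 (s - t₂ + t₃))) fun x => γ (x + (t₂ - s)) :=
      (h1.shift (t₂ - s)).mono fun x hx => by
        have hx' : s - t₂ + t₃ < x := (le_max_right _ _).trans_lt hx
        show t₃ < x + (t₂ - s)
        linarith
    have hmax : max 0 (s - t₂ + t₃) < s := max_lt hs (by linarith)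
    have h3 := ((horb e (γ t₂).1).orbit.mono (Ioi_subset_Ioi (le_max_left _ _))).eqOn hJ hn i
      isOpen_Ioi ordConnected_Ioi h2 hmax (by rw [add_sub_cancel, hs'])
    have hle : s ≤ s - t₂ := by linarith [ht₂.2]
    refine .inr ⟨e, (γ t₂).1, s - t₂, hs.trans_le hle, ?_⟩
    rw [h3 (hmax.trans_le hle), ← h0]
    show γ (s - t₂ + (t₂ - s)) = γ 0
    rw [show s - t₂ + (t₂ - s) = 0 by ring]

/-- The leaves cover the symplectization. -/
theorem exists_mem_leaves [CompactSpace Y] [T2Space Y] (hJ : D.IsModelJ J) (hn : 1 ≤ n)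
    {orb : Bool → Y → ℝ → Y × ℝ} (horb : ∀ e y, IsPageOrbit D e y (orb e y)) (w : ℝ × (Y × S)) :
    ∃ L ∈ D.leaves orb, w ∈ L := by
  obtain ⟨a, y, z⟩ := w
  rcases D.cyl_or_core z with ⟨i, p, hp, rfl⟩ | ⟨e, he⟩
  · have hpage : (∃ e y', ∃ s > 0, orb e y' s = (y, p.1)) →
        ∃ L ∈ D.leaves orb, (a, (y, D.c i p)) ∈ L := by
      rintro ⟨e, y', s, hs, h1⟩
      refine ⟨_, .inr (.inr ⟨e, y', a - D.pageAction (orb e y') 0 s, rfl⟩),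
        (mem_pageSet_c (horb e y') hp).2 ⟨s, hs, ?_, h1⟩⟩
      simp only [pageAction]
      ring
    by_cases hcrit : (y, p.1) ∈ D.crit
    · refine ⟨_, .inl ⟨i, _, hcrit, rfl⟩, (a / D.period (y, p.1), p.2), ?_⟩
      have hT : D.period (y, p.1) ≠ 0 := (exp_pos _).ne'
      simp only [sweep, coord, zero_add, mul_div_cancel₀ a hT]
    · rcases le_or_gt |p.1| (1 - D.δ) with hc | hc
      · rcases exists_flowLine_or_page hJ hn i horb (q := (y, p.1)) hc hcrit with ⟨γ, hγ, h0⟩ | h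
        · obtain ⟨b, θ, h1, h2, h3⟩ := hγ.isOrbit.exists_lift hJ hn i a
          refine ⟨_, .inr (.inl ⟨i, γ, a, hγ, b, θ, h1, h2, h3, rfl⟩), (0, p.2), ?_⟩
          simp only [sweep, coord, h0, h2, h3, zero_add]
        · exact hpage h
      · obtain ⟨e, he⟩ := exists_sgn p.1
        obtain ⟨s, hs, h⟩ := (horb e y).exists_eq_of_corner hJ hn i (he ▸ hc) hp
        exact hpage ⟨e, y, s, hs, h⟩
  · exact ⟨_, .inr (.inr ⟨e, y, a, rfl⟩), (mem_pageSet_core (horb e y) he).2 ⟨rfl, rfl, rfl⟩⟩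

/-- Leaves which meet are equal. -/
theorem eq_of_mem_leaves [CompactSpace Y] [T2Space Y] (hJ : D.IsModelJ J) (hn : 1 ≤ n)
    {orb : Bool → Y → ℝ → Y × ℝ} (horb : ∀ e y, IsPageOrbit D e y (orb e y))
    {L L' : Set (ℝ × (Y × S))} (hL : L ∈ D.leaves orb) (hL' : L' ∈ D.leaves orb)
    {w : ℝ × (Y × S)} (hw : w ∈ L) (hw' : w ∈ L') : L = L' := by
  have hδ := D.δ_pos
  have hne : ∀ {L : Set (ℝ × (Y × S))} {e y a}, D.IsCylinderSet L → w ∈ L →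
      w ∉ D.pageSet e y (orb e y) a := by
    rintro _ e y a ⟨i, b, θ, γ, h, hc, rfl⟩ ⟨q, rfl⟩ h2
    obtain ⟨s, hs, -, h3⟩ := (mem_pageSet_c (horb e y) (p := ((γ q.1).2, θ q.1 + q.2))
      (by linarith [hc q.1])).1 h2
    exact (horb e y).ne_of_abs_le hJ hn i h.orbit hc hs h3
  rcases mem_leaves hn hL with h | ⟨e, y, a, rfl⟩ <;>
    rcases mem_leaves hn hL' with h' | ⟨e', y', a', rfl⟩
  · exact h.eq_of_mem hJ hn h' hw hw'
  · exact absurd hw' (hne h hw)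
  · exact absurd hw (hne h' hw')
  · obtain ⟨x, y₀, z⟩ := w
    rcases D.cyl_or_core z with ⟨i, p, hp, rfl⟩ | ⟨e₀, hz⟩
    · obtain ⟨s, hs, h1, h2⟩ := (mem_pageSet_c (horb e y) hp).1 hw
      obtain ⟨s', hs', h1', h2'⟩ := (mem_pageSet_c (horb e' y') hp).1 hw'
      obtain ⟨rfl, -, rfl, rfl⟩ := (horb e y).unique hJ hn i (horb e' y') hs hs' (h2.trans h2'.symm)
      obtain rfl : a = a' := by
        simp only [pageAction] at h1 h1'
        linarith
      rfl
    · obtain ⟨rfl, rfl, rfl⟩ := (mem_pageSet_core (horb e y) hz).1 hw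
      obtain ⟨rfl, rfl, rfl⟩ := (mem_pageSet_core (horb e' y') hz).1 hw'
      rfl

theorem isPartition_leaves [CompactSpace Y] [T2Space Y] (hJ : D.IsModelJ J) (hn : 1 ≤ n) (i : Fin k)
    {orb : Bool → Y → ℝ → Y × ℝ} (horb : ∀ e y, IsPageOrbit D e y (orb e y)) :
    Setoid.IsPartition (D.leaves orb) := by
  refine ⟨fun h => ?_, fun w => ?_⟩
  · rcases mem_leaves hn h with ⟨i, b, θ, γ, -, -, h1⟩ | ⟨e, y, a, h1⟩
    · exact (range_nonempty _).ne_empty h1.symm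
    · have h2 : (D.pageAction (orb e y) a 1, ((orb e y 1).1, D.c i ((orb e y 1).2, 0)))
          ∈ D.pageSet e y (orb e y) a :=
        (mem_pageSet_c (horb e y) (p := ((orb e y 1).2, 0))
          ((horb e y).orbit.mem 1 (mem_Ioi.2 one_pos))).2 ⟨1, one_pos, rfl, rfl⟩
      rw [← h1] at h2
      exact h2
  · obtain ⟨L, hL, hw⟩ := exists_mem_leaves hJ hn horb w
    exact ⟨L, ⟨hL, hw⟩, fun L' h => eq_of_mem_leaves hJ hn horb h.1 hL h.2 hw⟩

theorem image_translate_range_sweep (i : Fin k) (b θ : ℝ → ℝ) (γ : ℝ → Y × ℝ) (c : ℝ) :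
    (fun w : ℝ × (Y × S) => (w.1 + c, w.2)) '' range (D.sweep i b θ γ)
      = range (D.sweep i (fun s => b s + c) θ γ) := by
  rw [← range_comp]
  rfl

theorem translate_mem_leaves {orb : Bool → Y → ℝ → Y × ℝ} {L : Set (ℝ × (Y × S))}
    (hL : L ∈ D.leaves orb) (c : ℝ) :
    (fun w : ℝ × (Y × S) => (w.1 + c, w.2)) '' L ∈ D.leaves orb := by
  rcases hL with ⟨i, p, hp, rfl⟩ | ⟨i, γ, a₀, hγ, b, θ, h, h1, h2, rfl⟩ | ⟨e, y, a, rfl⟩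
  · refine .inl ⟨i, p, hp, ?_⟩
    have hT : D.period p ≠ 0 := (exp_pos _).ne'
    rw [trivialSet, image_translate_range_sweep]
    refine Subset.antisymm ?_ ?_
    · rintro _ ⟨q, rfl⟩
      exact ⟨(q.1 + c / D.period p, q.2), Prod.ext (by simp only [sweep]; field_simp) rfl⟩
    · rintro _ ⟨q, rfl⟩
      exact ⟨(q.1 - c / D.period p, q.2), Prod.ext (by simp only [sweep]; field_simp; ring) rfl⟩
  · rw [image_translate_range_sweep]
    exact .inr (.inl ⟨i, γ, a₀ + c, hγ, _, θ,
      ⟨h.orbit, fun s hs => (h.action s hs).add_const c, h.rot⟩, by rw [h1], h2, rfl⟩)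
  · refine .inr (.inr ⟨e, y, a + c, ?_⟩)
    rw [pageSet, image_union, image_iUnion, pageSet]
    congr 1
    · ext w
      constructor
      · rintro ⟨w, ⟨rfl, h2, h3⟩, rfl⟩
        exact ⟨rfl, h2, h3⟩
      · rintro ⟨h1, h2, h3⟩
        exact ⟨(a, w.2), ⟨rfl, h2, h3⟩, Prod.ext h1.symm rfl⟩
    · refine iUnion_congr fun i => ?_
      rw [← image_comp]
      refine image_congr fun q _ => Prod.ext ?_ rfl
      simp only [Function.comp_apply, sweep, pageAction]
      ring

/-! ### The plane field of the leaves -/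

theorem contMDiffOn_section_inr {X : Y × S → EY n × ES} {O : Set (Y × S)}
    (hX : ∀ m ∈ O, ContMDiffAt (IYS n) (IYS n).tangent ∞
      (fun m => (⟨m, X m⟩ : TangentBundle (IYS n) (Y × S))) m) :
    ContMDiffOn (𝓘W n) (𝓘W n).tangent ∞
      (fun q => (⟨q, (0, X q.2)⟩ : TangentBundle (𝓘W n) (ℝ × (Y × S))))
      (univ ×ˢ O) := by
  intro q hq
  have h1 : ContMDiffAt (𝓘W n) (IYS n).tangent ∞
      (fun q : ℝ × (Y × S) => (⟨q.2, X q.2⟩ : TangentBundle (IYS n) (Y × S))) q :=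
    ContMDiffAt.comp q (f := fun q : ℝ × (Y × S) => q.2) (hX q.2 hq.2) contMDiffAt_snd
  have h2 : ContMDiffAt (𝓘W n) (𝓘₁).tangent ∞
      (fun q : ℝ × (Y × S) => (⟨q.1, 0⟩ : TangentBundle 𝓘₁ ℝ)) q :=
    contMDiffAt_zeroSection_comp (I := 𝓘₁) contMDiffAt_fst
  exact (TangentBundle.contMDiffAt_prodMk (I := 𝓘₁) (I' := IYS n) h2 h1).contMDiffWithinAt

/-- The tangent bundle of a surface has a nowhere vanishing local section. -/
theorem exists_local_section (z : S) : ∃ (V : S → ES) (O : Set S), IsOpen O ∧ z ∈ O ∧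
    ∀ x ∈ O, V x ≠ 0 ∧
      ContMDiffAt (𝓡 2) (𝓡 2).tangent ∞ (fun x => (⟨x, V x⟩ : TangentBundle (𝓡 2) S)) x := by
  let t := trivializationAt ES (TangentSpace (𝓡 2) (M := S)) z
  obtain ⟨v, hv⟩ := exists_ne (0 : ES)
  refine ⟨fun x => t.symm x v, t.baseSet, t.open_baseSet,
    FiberBundle.mem_baseSet_trivializationAt' z, fun x hx => ⟨fun h => hv ?_, ?_⟩⟩
  · have h1 := t.linearMapAt_symmₗ (R := ℝ) hx v
    rw [t.coe_symmₗ hx, show t.symm x v = 0 from h] at h1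
    exact h1.symm.trans (map_zero _)
  · have h1 : ContMDiffAt ((𝓡 2).prod 𝓘(ℝ, ES)) (𝓡 2).tangent ∞ t.toOpenPartialHomeomorph.symm (x, v) :=
      (t.contMDiffOn_symm).contMDiffAt
        (t.open_target.mem_nhds (t.mem_target.2 hx))
    have h2 := ContMDiffAt.comp x (f := fun x : S => (x, v)) h1
      (contMDiffAt_id.prodMk contMDiffAt_const)
    refine h2.congr_of_eventuallyEq ?_
    filter_upwards [t.open_baseSet.mem_nhds hx] with x' hx'
    exact t.mk_symm hx' v

/-- The plane field of the leaves is smooth: it is spanned by a local vector field `X` and `J X`,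
where `X` is tangent to `S`. -/
theorem exists_frame_planeField [T2Space S] (hJ : D.IsModelJ J) (hn : 1 ≤ n) (w : ℝ × (Y × S)) :
    ∃ (O : Set (ℝ × (Y × S))) (X : ℝ × (Y × S) → ℝ × (EY n × ES)), IsOpen O ∧ w ∈ O ∧
      ContMDiffOn (𝓘W n) (𝓘W n).tangent ∞
        (fun q => (⟨q, X q⟩ : TangentBundle (𝓘W n) (ℝ × (Y × S)))) O ∧
      ∀ q ∈ O, X q ≠ 0 ∧ D.planeField J q = Submodule.span ℝ {X q, J q.2 (X q)} := by
  have hδ := D.δ_pos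
  obtain ⟨a, y, z⟩ := w
  rcases D.cyl_or_core z with ⟨i, p, hp, rfl⟩ | ⟨e, hz⟩
  · obtain ⟨G, O, hO, hw, hG, hGO, -, -⟩ := D.exists_local_inverse_coord i (q := ((y, p.1), p.2)) hp
    refine ⟨univ ×ˢ O, fun q => (0, D.dcoord i ((G q.2).1.2, (G q.2).2) (0, 1)), isOpen_univ.prod hO,
      ⟨mem_univ _, hw⟩, contMDiffOn_section_inr
        (X := fun m => D.dcoord i ((G m).1.2, (G m).2) (0, 1)) fun m hm => ?_, fun q hq => ?_⟩
    · refine (ContMDiffAt.comp m (f := G) (contMDiffAt_section_coord_theta D i 1 (hGO m hm).1)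
        (hG.contMDiffAt (hO.mem_nhds hm))).congr_of_eventuallyEq ?_
      filter_upwards [hO.mem_nhds hm] with m' hm'
      have h1 := (hGO m' hm').2
      exact congrArg (fun x => (⟨x, D.dcoord i ((G m').1.2, (G m').2) (0, 1)⟩ :
        TangentBundle (IYS n) (Y × S))) h1.symm
    · obtain ⟨h1, h2⟩ := hGO q.2 hq.2
      refine ⟨fun h => dcoord_theta_ne_zero (D := D) i (p := ((G q.2).1.2, (G q.2).2)) h1
        (congrArg Prod.snd h), ?_⟩
      have h3 := planeField_c (J := J) i (p := ((G q.2).1.2, (G q.2).2)) h1 q.1 (G q.2).1.1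
      have h4 : D.dcoord i ((G q.2).1.2, (G q.2).2) ((0 : EY n × ℝ), (1 : ℝ))
          = (0, D.dtheta i ((G q.2).1.2, (G q.2).2)) := by simp [dcoord]
      have h5 : ((G q.2).1.1, D.c i ((G q.2).1.2, (G q.2).2)) = q.2 := h2
      rw [h5] at h3
      dsimp only
      rw [h4]
      exact h3
  · obtain ⟨V, O, hO, hzO, hV⟩ := exists_local_section z
    have hc : 1 + 8 * D.δ / 9 < 1 + D.δ := by linarith
    refine ⟨univ ×ˢ (univ ×ˢ (O ∩ D.outer e (1 + 8 * D.δ / 9))), fun q => (0, (0, V q.2.2)),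
      isOpen_univ.prod (isOpen_univ.prod (hO.inter (D.isOpen_outer e hc))),
      ⟨mem_univ _, mem_univ _, hzO, D.core_subset_outer e hc hz⟩,
      contMDiffOn_section_inr (X := fun m => (0, V m.2)) fun m hm => ?_, fun q hq => ⟨fun h => ?_, ?_⟩⟩
    · have h1 : ContMDiffAt (IYS n) (𝓡 2).tangent ∞
          (fun m : Y × S => (⟨m.2, V m.2⟩ : TangentBundle (𝓡 2) S)) m :=
        ContMDiffAt.comp m (f := fun m : Y × S => m.2) (hV m.2 hm.2.1).2 contMDiffAt_snd
      have h2 : ContMDiffAt (IYS n) (𝓡 (2 * n - 1)).tangent ∞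
          (fun m : Y × S => (⟨m.1, 0⟩ : TangentBundle (𝓡 (2 * n - 1)) Y)) m :=
        contMDiffAt_zeroSection_comp (I := 𝓡 (2 * n - 1)) contMDiffAt_fst
      exact TangentBundle.contMDiffAt_prodMk (I := 𝓡 (2 * n - 1)) (I' := 𝓡 2) h2 h1
    · exact (hV q.2.2 hq.2.2.1).1 (congrArg (fun x => x.2.2) h)
    · have h1 := planeField_of_slice hJ (a := q.1) (y := q.2.1) (hJ.slice_eq hn q.2.1 hq.2.2.2)
      exact h1.1.trans (h1.2 _ (hV q.2.2 hq.2.2.1).1).symm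

end ModelData

end SpinalFoliation

end

open SpinalFoliation.ModelData in
theorem mainTheorem8 {n k g : ℕ} (hn : 1 ≤ n) (hk : 1 ≤ k) (hg : k ≤ g) {Y S : Type}
    [TopologicalSpace Y] [ChartedSpace (SpinalFoliation.EY n) Y]
    [IsManifold (𝓡 (2 * n - 1)) ∞ Y] [CompactSpace Y] [T2Space Y]
    [TopologicalSpace S] [ChartedSpace SpinalFoliation.ES S]
    [IsManifold (𝓡 2) ∞ S] [CompactSpace S] [T2Space S]
    (D : SpinalFoliation.ModelData n Y S k g)
    (J : Y × S → (ℝ × (SpinalFoliation.EY n × SpinalFoliation.ES)) →L[ℝ]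
      (ℝ × (SpinalFoliation.EY n × SpinalFoliation.ES)))
    (hJ : D.IsModelJ J)
    (e₀ : ℝ) (he₀ : 0 < e₀)
    (hsymp : SpinalFoliation.IsSymplectization (SpinalFoliation.IYS n) D.Lam D.Om e₀) :
    ∃ leaves : Set (Set (ℝ × (Y × S))),
      SpinalFoliation.IsFiniteEnergyFoliation (I := SpinalFoliation.IYS n) D.Lam D.Om e₀ J leaves ∧
      (∀ L ∈ leaves,
        (∃ i, ∃ p ∈ D.crit, D.IsTrivialLeaf J i p L) ∨
        (∃ i γ a₀, D.IsFlowLine γ ∧ D.IsFlowLeaf J i γ a₀ L) ∨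
        (∃ e y a, D.IsPageLeaf J e y a L)) ∧
      (∀ i, ∀ p ∈ D.crit, ∃ L ∈ leaves, D.IsTrivialLeaf J i p L) ∧
      (∀ i γ a₀, D.IsFlowLine γ → ∃ L ∈ leaves, D.IsFlowLeaf J i γ a₀ L) ∧
      (∀ e y a, ∃ L ∈ leaves, D.IsPageLeaf J e y a L) := by
  lift e₀ to ℝ≥0 using he₀.le
  let i₀ : Fin k := ⟨0, hk⟩
  obtain ⟨B, hB⟩ := LeafModel.exists_energy_bound hJ hn e₀
  replace hB : IsEnergyBound hJ hn e₀ B := hB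
  choose orb horb using fun e y => exists_isPageOrbit hJ hn i₀ e y
  have hflow : ∀ i γ a₀, D.IsFlowLine γ → ∃ L, D.IsFlowSet i γ a₀ L := fun i γ a₀ hγ =>
    have ⟨b, θ, h1, h2, h3⟩ := hγ.isOrbit.exists_lift hJ hn i a₀
    ⟨_, b, θ, h1, h2, h3, rfl⟩
  refine ⟨D.leaves orb, ⟨isPartition_leaves hJ hn i₀ horb,
    fun L hL c => translate_mem_leaves hL c,
    D.planeField J, B, exists_frame_planeField hJ hn, ?_⟩, ?_,
    fun i p hp => ⟨_, .inl ⟨i, p, hp, rfl⟩,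
      (exists_trivial_leaf hB i hp).1⟩,
    fun i γ a₀ hγ => ?_,
    fun e y a => ⟨_, .inr (.inr ⟨e, y, a, rfl⟩),
      (exists_page_leaf hB i₀ (horb e y) a).1⟩⟩
  · rintro L (⟨i, p, hp, rfl⟩ | ⟨i, γ, a₀, hγ, hL⟩ | ⟨e, y, a, rfl⟩)
    · exact (exists_trivial_leaf hB i hp).2
    · exact (exists_flow_leaf hB hγ hL).2
    · exact (exists_page_leaf hB i₀ (horb e y) a).2
  · rintro L (⟨i, p, hp, rfl⟩ | ⟨i, γ, a₀, hγ, hL⟩ | ⟨e, y, a, rfl⟩)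
    · exact .inl ⟨i, p, hp, (exists_trivial_leaf hB i hp).1⟩
    · exact .inr (.inl ⟨i, γ, a₀, hγ, (exists_flow_leaf hB hγ hL).1⟩)
    · exact .inr (.inr ⟨e, y, a,
        (exists_page_leaf hB i₀ (horb e y) a).1⟩)
  · obtain ⟨L, hL⟩ := hflow i γ a₀ hγ
    exact ⟨L, .inr (.inl ⟨i, γ, a₀, hγ, hL⟩),
      (exists_flow_leaf hB hγ hL).1⟩
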